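/- **Setting.** Let $A\in\mathbb R^{p\times p}$, $B\in\mathbb R^{p\times q}$, let $\Sigma_0\in\mathbb R^{p\times p}$ be positive semidefinite and $D>0$. Consider the Gaussian AR(1) source $x_{t+1}=Ax_t+Bw_t$, $t\ge 0$, where $x_0\sim N(0,\Sigma_0)$ is independent of the i.i.d. sequence $w_t\sim N(0,I_q)$. Assume that $A$ is stable (all its eigenvalues have modulus less than $1$) or that $(A,B)$ is stabilizable ($A+BK$ is stable for some matrix $K$). Rates are in bits per source vector. *Nonanticipative rate distortion function.* $R^{\mathrm{na}}(D)=\lim_{n}R^{\mathrm{na}}_{0,n}(D)$ (read as the lower limit if the limit is not known to exist), where $R^{\mathrm{na}}_{0,n}(D)$ is the infimum of $\frac1{n+1}I(x^n;y^n)$ over all causal test channels $\{P(dy_t\mid y^{t-1},x^t)\}_{t\le n}$ with $\frac1{n+1}\sum_{t=0}^n\mathbb E\|x_t-y_t\|_2^2\le D$. *Operational zero-delay rate.* A zero-delay code consists of prefix-free sets $\mathcal Z_t$ of binary words, encoding policies $P(dz_t\mid z^{t-1},x^t)$ with $z_t\in\mathcal Z_t$, and decoding policies $P(dy_t\mid y^{t-1},z^t)$.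 With $l_t$ the length of $z_t$, $R^{\mathrm{op}}_{\mathrm{zd}}(D)$ is the infimum of $\limsup_n\frac1{n+1}\sum_{t=0}^n\mathbb E\,l_t$ over all zero-delay codes with $\limsup_n\frac1{n+1}\sum_{t=0}^n\mathbb E\|x_t-y_t\|_2^2\le D$. *Stationary feedback realization.* It is given by a matrix $\Pi'$ with $\operatorname{tr}\Pi'\le D$ (the steady-state error covariance), $\Pi=A\Pi'A^{T}+BB^{T}$, and an invertible matrix $E$ with $E\Pi'E^{T}=\operatorname{diag}(\delta_i)$, $E\Pi E^{T}=\operatorname{diag}(\lambda_i)$, where $0\le\delta_i\le\lambda_i$ and $\delta_i=0$ only if $\lambda_i=0$. Its information rate is $\frac12\sum_{i:\lambda_i>0}\log_2(\lambda_i/\delta_i)$ (that is, $\frac12\log_2(|\Pi|/|\Pi'|)$ if $\Pi'$ is nonsingular); it is called optimal if this rate does not exceed (hence attains) $R^{\mathrm{na}}(D)$. *Dithered scheme.* Given a realization and step sizes $\Delta_1,\dots,\Delta_p>0$, put $V_i=\Delta_i^2/12$, $H_i=1-\delta_i/\lambda_i$, $\Theta_i=\sqrt{H_i\delta_i/V_i}$,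 $\Phi_i=\Theta_i^{-1}H_i$ (with $\Theta_i=\Phi_i=0$ if $\delta_i=\lambda_i$). Let $r_{t,i}$ be dither variables that are independent of the source and of each other, with $r_{t,i}$ uniform on $(-\Delta_i/2,\Delta_i/2)$. With $\hat x_{0|-1}=0$ and $\hat x_{t|t-1}=Ay_{t-1}$ for $t\ge1$, put $$k_t=x_t-\hat x_{t|t-1},\quad \alpha_t=\Phi Ek_t,\quad \tilde\beta_{t,i}=Q_{\Delta_i}(\alpha_{t,i}+r_{t,i}),\quad \beta_t=\tilde\beta_t-r_t,\quad y_t=\hat x_{t|t-1}+E^{-1}\Theta\beta_t,$$ where $Q_\Delta(u)$ is the multiple of $\Delta$ nearest to $u$. **Theorem 1 (Upper bound).** Under these assumptions $$R^{\mathrm{op}}_{\mathrm{zd}}(D)\le R^{\mathrm{na}}(D)+\frac p2\log_2\Big(\frac{\pi e}{6}\Big)+1 .$$ Moreover, an optimal stationary feedback realization exists, and for every optimal one and all step sizes $\Delta_i>0$ the dithered scheme satisfies $\limsup_n\frac1{n+1}\sum_{t=0}^n\mathbb E\|x_t-y_t\|_2^2\le D$, and when, for each $t$ separately, $\tilde\beta_t$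 is encoded by a suitable Shannon code for its conditional distribution given $r_t$ (a prefix code with lengths $\lceil-\log_2P(\tilde\beta_t=b\mid r_t)\rceil$), the codeword lengths satisfy $$\limsup_n\frac1{n+1}\sum_{t=0}^n\mathbb E\,l_t\le R^{\mathrm{na}}(D)+\frac p2\log_2\Big(\frac{\pi e}{6}\Big)+1 .$$ -/

import Mathlib

open MeasureTheory ProbabilityTheory Filter Matrix
open scoped ENNReal Matrix

noncomputable section

namespace ZeroDelay

/-- Real column vectors of length `p`. -/
abbrev Vec (p : ℕ) : Type := Fin p → ℝ

/-- Finite binary words. -/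
abbrev Word : Type := List Bool

instance instMeasurableSpaceWord : MeasurableSpace (List Bool) := ⊤

/-- Squared Euclidean distance `‖x - y‖₂²`, as an extended nonnegative real. -/
def sqErr {p : ℕ} (x y : Vec p) : ℝ≥0∞ := ENNReal.ofReal (∑ i, (x i - y i) ^ 2)

/-- `limsup_n (1/(n+1)) ∑_{t ≤ n} a t`. -/
def limsupAvg (a : ℕ → ℝ≥0∞) : ℝ≥0∞ :=
  limsup (fun n : ℕ => (∑ t ∈ Finset.range (n + 1), a t) / ((n : ℝ≥0∞) + 1)) atTop

lemma measurable_snoc {α : Type*} [MeasurableSpace α] (t : ℕ) :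
    Measurable (fun a : (Fin t → α) × α => (Fin.snoc a.1 a.2 : Fin (t + 1) → α)) := by
  refine measurable_pi_lambda _ fun i => ?_
  refine Fin.lastCases ?_ (fun j => ?_) i
  · simpa using measurable_snd
  · simp only [Fin.snoc_castSucc]
    exact (measurable_pi_apply j).comp measurable_fst

/-! ### The source -/

/-- All (complex) eigenvalues of `A` have modulus less than one. -/
def IsStable {p : ℕ} (A : Matrix (Fin p) (Fin p) ℝ) : Prop :=
  ∀ μ ∈ spectrum ℂ (A.map (algebraMap ℝ ℂ)), ‖μ‖ < 1

/-- Some static state feedback makes the closed loop `A + B K` stable. -/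
def IsStabilizable {p q : ℕ} (A : Matrix (Fin p) (Fin p) ℝ) (B : Matrix (Fin p) (Fin q) ℝ) :
    Prop :=
  ∃ K : Matrix (Fin q) (Fin p) ℝ, IsStable (A + B * K)

/-- The solution of `x (t+1) = A x t + B w t`, `x 0 = x0`. -/
def sourcePath {p q : ℕ} (A : Matrix (Fin p) (Fin p) ℝ) (B : Matrix (Fin p) (Fin q) ℝ)
    (x0 : Vec p) (w : ℕ → Vec q) : ℕ → Vec p
  | 0 => x0
  | t + 1 => A *ᵥ sourcePath A B x0 w t + B *ᵥ w t

/-- The law of `(x_t)_{t ≥ 0}`, with `x_0 ~ N(0, S0)` independent of the i.i.d. `N(0, I)`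
sequence `(w_t)`. -/
def sourceLaw {p q : ℕ} (A : Matrix (Fin p) (Fin p) ℝ) (B : Matrix (Fin p) (Fin q) ℝ)
    (S0 : Matrix (Fin p) (Fin p) ℝ) : Measure (ℕ → Vec p) :=
  (((multivariateGaussian 0 S0).map WithLp.ofLp).prod
    (Measure.infinitePi fun _ : ℕ => Measure.pi fun _ : Fin q => gaussianReal 0 1)).map
      fun ω => sourcePath A B ω.1 ω.2

lemma measurable_sourcePath {p q : ℕ} (A : Matrix (Fin p) (Fin p) ℝ)
    (B : Matrix (Fin p) (Fin q) ℝ) :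
    Measurable fun ω : Vec p × (ℕ → Vec q) => sourcePath A B ω.1 ω.2 := by
  refine measurable_pi_lambda _ fun t => ?_
  induction t with
  | zero => exact measurable_fst
  | succ t ih =>
    simp only [sourcePath]
    refine Measurable.add ?_ ?_
    · exact (Continuous.matrix_mulVec continuous_const continuous_id).measurable.comp ih
    · exact (Continuous.matrix_mulVec continuous_const continuous_id).measurable.comp
        ((measurable_pi_apply t).comp measurable_snd)

instance instIsProbabilityMeasureSourceLaw {p q : ℕ} (A : Matrix (Fin p) (Fin p) ℝ)
    (B : Matrix (Fin p) (Fin q) ℝ) (S0 : Matrix (Fin p) (Fin p) ℝ) :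
    IsProbabilityMeasure (sourceLaw A B S0) := by
  have : IsProbabilityMeasure
      ((multivariateGaussian (0 : EuclideanSpace ℝ (Fin p)) S0).map WithLp.ofLp) :=
    Measure.isProbabilityMeasure_map (by fun_prop)
  exact Measure.isProbabilityMeasure_map (measurable_sourcePath A B).aemeasurable

/-! ### The nonanticipative rate distortion function -/

/-- A sequence of causal reproduction distributions `P(dy_t | y^{t-1}, x^t)`. -/
structure TestChannel (p : ℕ) where
  kernel : (t : ℕ) → Kernel ((Fin t → Vec p) × (Fin (t + 1) → Vec p)) (Vec p)
  markov : ∀ t, IsMarkovKernel (kernel t)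

namespace TestChannel

variable {p : ℕ} (κ : TestChannel p)

instance (t : ℕ) : IsMarkovKernel (κ.kernel t) := κ.markov t

/-- The causally conditioned law of `(y_0, …, y_{t-1})` given the source path: the product of
the kernels `P(dy_s | y^{s-1}, x^s)`, `s < t`. -/
def causal : (t : ℕ) → Kernel (ℕ → Vec p) (Fin t → Vec p)
  | 0 => Kernel.const _ (Measure.dirac Fin.elim0)
  | t + 1 =>
    ((causal t) ⊗ₖ ((κ.kernel t).comap
      (fun a : (ℕ → Vec p) × (Fin t → Vec p) => (a.2, fun i : Fin (t + 1) => a.1 i))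
      (by fun_prop))).map (fun a => (Fin.snoc a.1 a.2 : Fin (t + 1) → Vec p))

instance (t : ℕ) : IsMarkovKernel (κ.causal t) := by
  induction t with
  | zero => unfold causal; infer_instance
  | succ t ih => unfold causal; exact Kernel.IsMarkovKernel.map _ (measurable_snoc t)

/-- The joint law of `((x_0, …, x_n), (y_0, …, y_n))` when the source has law `src`. -/
def jointLaw (src : Measure (ℕ → Vec p)) (n : ℕ) :
    Measure ((Fin (n + 1) → Vec p) × (Fin (n + 1) → Vec p)) :=
  (src ⊗ₘ κ.causal (n + 1)).map fun a => (fun i : Fin (n + 1) => a.1 i, a.2)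

/-- The mutual information `I(x^n; y^n)`, in bits. -/
def mutualInfo (src : Measure (ℕ → Vec p)) (n : ℕ) : ℝ≥0∞ :=
  InformationTheory.klDiv (κ.jointLaw src n)
    ((κ.jointLaw src n).fst.prod (κ.jointLaw src n).snd) / ENNReal.ofReal (Real.log 2)

/-- `(1/(n+1)) E ∑_{t ≤ n} ‖x_t - y_t‖²`. -/
def avgDistortion (src : Measure (ℕ → Vec p)) (n : ℕ) : ℝ≥0∞ :=
  (∫⁻ a, ∑ t, sqErr (a.1 t) (a.2 t) ∂(κ.jointLaw src n)) / ((n : ℝ≥0∞) + 1)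

end TestChannel

/-- The finite-time nonanticipative rate distortion function. -/
def finiteNRDF {p : ℕ} (src : Measure (ℕ → Vec p)) (n : ℕ) (D : ℝ) : ℝ≥0∞ :=
  ⨅ (κ : TestChannel p) (_ : κ.avgDistortion src n ≤ ENNReal.ofReal D),
    κ.mutualInfo src n / ((n : ℝ≥0∞) + 1)

/-- The nonanticipative rate distortion function: the limit of the finite-time ones. It is
written as a lower limit, which is the limit whenever that exists. -/
def nrdf {p : ℕ} (src : Measure (ℕ → Vec p)) (D : ℝ) : ℝ≥0∞ :=
  liminf (fun n => finiteNRDF src n D) atTop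

/-! ### Zero-delay codes -/

/-- No word of `C` is a proper prefix of another one. -/
def IsPrefixFree (C : Set Word) : Prop := ∀ a ∈ C, ∀ b ∈ C, a <+: b → a = b

/-- A zero-delay code: instantaneous codebooks, encoding policies `P(dz_t | z^{t-1}, x^t)` with
values in the codebook of time `t`, and decoding policies `P(dy_t | y^{t-1}, z^t)`. -/
structure ZeroDelayCode (p : ℕ) where
  codebook : ℕ → Set Word
  prefixFree : ∀ t, IsPrefixFree (codebook t)
  enc : (t : ℕ) → Kernel ((Fin t → Word) × (Fin (t + 1) → Vec p)) Word
  dec : (t : ℕ) → Kernel ((Fin t → Vec p) × (Fin (t + 1) → Word)) (Vec p)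
  enc_markov : ∀ t, IsMarkovKernel (enc t)
  dec_markov : ∀ t, IsMarkovKernel (dec t)
  enc_mem : ∀ t h, enc t h (codebook t)ᶜ = 0

namespace ZeroDelayCode

variable {p : ℕ} (c : ZeroDelayCode p)

instance (t : ℕ) : IsMarkovKernel (c.enc t) := c.enc_markov t

instance (t : ℕ) : IsMarkovKernel (c.dec t) := c.dec_markov t

/-- The law of `(z_t, y_t)` given the source path and `(z^{t-1}, y^{t-1})`. -/
def stepKernel (t : ℕ) :
    Kernel ((ℕ → Vec p) × ((Fin t → Word) × (Fin t → Vec p))) (Word × Vec p) :=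
  ((c.enc t).comap
    (fun a : (ℕ → Vec p) × ((Fin t → Word) × (Fin t → Vec p)) =>
      (a.2.1, fun i : Fin (t + 1) => a.1 i)) (by fun_prop)) ⊗ₖ
  ((c.dec t).comap
    (fun a : ((ℕ → Vec p) × ((Fin t → Word) × (Fin t → Vec p))) × Word =>
      (a.1.2.2, (Fin.snoc a.1.2.1 a.2 : Fin (t + 1) → Word)))
    (Measurable.prodMk (by fun_prop)
      ((measurable_snoc t).comp (Measurable.prodMk (by fun_prop) measurable_snd))))

instance (t : ℕ) : IsMarkovKernel (c.stepKernel t) := by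
  unfold stepKernel; infer_instance

/-- The law of `(z_0, …, z_{t-1})` and `(y_0, …, y_{t-1})` given the source path. -/
def hist : (t : ℕ) → Kernel (ℕ → Vec p) ((Fin t → Word) × (Fin t → Vec p))
  | 0 => Kernel.const _ (Measure.dirac (Fin.elim0, Fin.elim0))
  | t + 1 =>
    ((hist t) ⊗ₖ (c.stepKernel t)).map
      (fun a => ((Fin.snoc a.1.1 a.2.1 : Fin (t + 1) → Word),
        (Fin.snoc a.1.2 a.2.2 : Fin (t + 1) → Vec p)))

instance (t : ℕ) : IsMarkovKernel (c.hist t) := by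
  induction t with
  | zero => unfold hist; infer_instance
  | succ t ih =>
    unfold hist
    refine Kernel.IsMarkovKernel.map _ (Measurable.prodMk ?_ ?_)
    · exact (measurable_snoc t).comp (Measurable.prodMk (by fun_prop) (by fun_prop))
    · exact (measurable_snoc t).comp (Measurable.prodMk (by fun_prop) (by fun_prop))

/-- The expected codeword length `E l_t`. -/
def expLength (src : Measure (ℕ → Vec p)) (t : ℕ) : ℝ≥0∞ :=
  ∫⁻ a, ((a.2.1 (Fin.last t)).length : ℝ≥0∞) ∂(src ⊗ₘ c.hist (t + 1))

/-- The expected squared error `E ‖x_t - y_t‖²`. -/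
def expDistortion (src : Measure (ℕ → Vec p)) (t : ℕ) : ℝ≥0∞ :=
  ∫⁻ a, sqErr (a.1 t) (a.2.2 (Fin.last t)) ∂(src ⊗ₘ c.hist (t + 1))

end ZeroDelayCode

/-- The optimal performance theoretically attainable by zero-delay codes, in bits per source
vector. -/
def opta {p : ℕ} (src : Measure (ℕ → Vec p)) (D : ℝ) : ℝ≥0∞ :=
  ⨅ (c : ZeroDelayCode p) (_ : limsupAvg (c.expDistortion src) ≤ ENNReal.ofReal D),
    limsupAvg (c.expLength src)

/-! ### The stationary feedback realization -/

/-- The matrices of an asymptotically stationary feedback realization with distortion at most `D`.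
`post` is the steady-state error covariance after the update and `A * post * Aᵀ + B * Bᵀ` the one
before it; the invertible matrix `E` brings them to the diagonal forms `diag δ` and `diag lam`. -/
structure Realization {p q : ℕ} (A : Matrix (Fin p) (Fin p) ℝ) (B : Matrix (Fin p) (Fin q) ℝ)
    (D : ℝ) where
  post : Matrix (Fin p) (Fin p) ℝ
  E : Matrix (Fin p) (Fin p) ℝ
  δ : Vec p
  lam : Vec p
  isUnit_E : IsUnit E.det
  post_eq : E * post * Eᵀ = Matrix.diagonal δ
  prior_eq : E * (A * post * Aᵀ + B * Bᵀ) * Eᵀ = Matrix.diagonal lam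
  δ_nonneg : ∀ i, 0 ≤ δ i
  δ_le_lam : ∀ i, δ i ≤ lam i
  lam_eq_zero : ∀ i, δ i = 0 → lam i = 0
  trace_le : post.trace ≤ D

/-- The uniform quantizer with step `s`, as the index of the output level: the output is
`s * quantIndex s u`, the multiple of `s` nearest to `u`. -/
def quantIndex (s u : ℝ) : ℤ := round (u / s)

namespace Realization

variable {p q : ℕ} {A : Matrix (Fin p) (Fin p) ℝ} {B : Matrix (Fin p) (Fin q) ℝ} {D : ℝ}
  (R : Realization A B D)

/-- The steady-state information rate `(1/2) log₂ (|A Π' Aᵀ + B Bᵀ| / |Π'|)` of the realization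
over Gaussian channels, in bits; coordinates in which both variances vanish contribute `0`. -/
def rate : ℝ := ∑ i, (1 / 2) * Real.logb 2 (R.lam i / R.δ i)

/-- The realization is one of an optimal test channel: its information rate attains the
nonanticipative rate distortion function (it cannot be smaller). -/
def IsOptimal (S0 : Matrix (Fin p) (Fin p) ℝ) : Prop :=
  ENNReal.ofReal R.rate ≤ nrdf (sourceLaw A B S0) D

/-- The diagonal of the scaling `H = I - diag (δ / λ)`. -/
def H (i : Fin p) : ℝ := 1 - R.δ i / R.lam i

/-- The diagonal of the decoder scaling `Θ = √(H δ V⁻¹)`, where the channel noise variance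
`V = Δ² / 12` is the one of the dithered quantizer with step `Δ`. -/
def Θ (Δ : Vec p) (i : Fin p) : ℝ := Real.sqrt (R.H i * R.δ i * (Δ i ^ 2 / 12)⁻¹)

/-- The diagonal of the encoder scaling `Φ = Θ⁻¹ H`. In a coordinate where `δ = λ`, both `Θ` and
`Φ` vanish: nothing is transmitted there. -/
def Φ (Δ : Vec p) (i : Fin p) : ℝ := (R.Θ Δ i)⁻¹ * R.H i

/-- The quantizer input `α_t = Φ E k_t`, as a function of the prediction error `k_t`. -/
def quantInput (Δ k : Vec p) : Vec p := fun i => R.Φ Δ i * (R.E *ᵥ k) i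

/-- The indices of the quantizer output `β̃_t = Q_Δ (α_t + r_t)`, for the prediction error `k` and
the dither value `r`. -/
def index (Δ k r : Vec p) : Fin p → ℤ := fun i => quantIndex (Δ i) (R.quantInput Δ k i + r i)

/-- The decoder output `β_t = β̃_t - r_t` after the dither has been subtracted. -/
def β (Δ k r : Vec p) : Vec p := fun i => Δ i * (R.index Δ k r i : ℝ) - r i

/-- The reconstructed innovation `E⁻¹ Θ β_t`. -/
def innov (Δ k r : Vec p) : Vec p := R.E⁻¹ *ᵥ fun i => R.Θ Δ i * R.β Δ k r i

/-- The Kalman prediction `x̂_{t|t-1}` along a source path `x` and a dither path `r`: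
`x̂_{0|-1} = 0` and `x̂_{t+1|t} = A y_t`, where `y_t = x̂_{t|t}`. -/
def pred (Δ : Vec p) (x r : ℕ → Vec p) : ℕ → Vec p
  | 0 => 0
  | t + 1 => A *ᵥ (pred Δ x r t + R.innov Δ (x t - pred Δ x r t) (r t))

/-- The reproduction `y_t`. -/
def recon (Δ : Vec p) (x r : ℕ → Vec p) (t : ℕ) : Vec p :=
  R.pred Δ x r t + R.innov Δ (x t - R.pred Δ x r t) (r t)

/-- The indices of the quantizer output `β̃_t` along a source path and a dither path. -/
def output (Δ : Vec p) (x r : ℕ → Vec p) (t : ℕ) : Fin p → ℤ :=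
  R.index Δ (x t - R.pred Δ x r t) (r t)

end Realization

/-- The uniform distribution on `(-s/2, s/2)`: the law of `s * u` for `u` uniform on
`(-1/2, 1/2)`. -/
def ditherMarginal (s : ℝ) : Measure ℝ :=
  ((volume : Measure ℝ).restrict (Set.Ioo (-1 / 2) (1 / 2))).map fun u => s * u

instance instIsProbabilityMeasureDitherMarginal (s : ℝ) :
    IsProbabilityMeasure (ditherMarginal s) := by
  have : IsProbabilityMeasure
      ((volume : Measure ℝ).restrict (Set.Ioo (-1 / 2 : ℝ) (1 / 2))) :=
    ⟨by rw [Measure.restrict_apply_univ, Real.volume_Ioo]; norm_num⟩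
  exact Measure.isProbabilityMeasure_map (by fun_prop)

/-- The law of the dither: independent over time and components, with component `i` uniform on
`(-Δ i / 2, Δ i / 2)`. -/
def ditherLaw {p : ℕ} (Δ : Vec p) : Measure (ℕ → Vec p) :=
  Measure.infinitePi fun _ : ℕ => Measure.pi fun i : Fin p => ditherMarginal (Δ i)

instance instIsProbabilityMeasureDitherLaw {p : ℕ} (Δ : Vec p) :
    IsProbabilityMeasure (ditherLaw Δ) := by
  unfold ditherLaw; infer_instance

/-- The joint law of the source and the dither, which are independent. -/
def schemeLaw {p q : ℕ} (A : Matrix (Fin p) (Fin p) ℝ) (B : Matrix (Fin p) (Fin q) ℝ)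
    (S0 : Matrix (Fin p) (Fin p) ℝ) (Δ : Vec p) : Measure ((ℕ → Vec p) × (ℕ → Vec p)) :=
  (sourceLaw A B S0).prod (ditherLaw Δ)

instance instIsProbabilityMeasureSchemeLaw {p q : ℕ} (A : Matrix (Fin p) (Fin p) ℝ)
    (B : Matrix (Fin p) (Fin q) ℝ) (S0 : Matrix (Fin p) (Fin p) ℝ) (Δ : Vec p) :
    IsProbabilityMeasure (schemeLaw A B S0 Δ) := by
  unfold schemeLaw; infer_instance

/-- `code` is a Shannon code for symbols whose conditional distribution given the side
information `r` is `κ r`: for each `r` the symbols of positive probability get codewords, none a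
prefix of another, and the length is `⌈-log₂ (κ r {b})⌉`. -/
structure IsShannonCode {R S : Type*} [MeasurableSpace R] [MeasurableSpace S]
    (κ : Kernel R S) (code : R → S → Word) : Prop where
  measurable : Measurable fun a : R × S => code a.1 a.2
  prefixFree : ∀ r b b', κ r {b} ≠ 0 → κ r {b'} ≠ 0 → code r b <+: code r b' → b = b'
  length_eq : ∀ r b, κ r {b} ≠ 0 →
    (code r b).length = ⌈-Real.logb 2 ((κ r).real {b})⌉₊

namespace Realization

variable {p q : ℕ} {A : Matrix (Fin p) (Fin p) ℝ} {B : Matrix (Fin p) (Fin q) ℝ} {D : ℝ}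
  (R : Realization A B D)

/-- The expected squared error `E ‖x_t - y_t‖²` of the dithered scheme. -/
def expDistortion (S0 : Matrix (Fin p) (Fin p) ℝ) (Δ : Vec p) (t : ℕ) : ℝ≥0∞ :=
  ∫⁻ ω, sqErr (ω.1 t) (R.recon Δ ω.1 ω.2 t) ∂(schemeLaw A B S0 Δ)

/-- The conditional distribution of the quantizer output at time `t` given the dither at
time `t`. -/
def outputGivenDither (S0 : Matrix (Fin p) (Fin p) ℝ) (Δ : Vec p) (t : ℕ) :
    Kernel (Vec p) (Fin p → ℤ) :=
  condDistrib (fun ω => R.output Δ ω.1 ω.2 t) (fun ω => ω.2 t) (schemeLaw A B S0 Δ)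

/-- The expected codeword length at time `t`, when the quantizer output `b` is encoded as
`code r b` given the dither value `r`. -/
def expLength (S0 : Matrix (Fin p) (Fin p) ℝ) (Δ : Vec p) (t : ℕ)
    (code : Vec p → (Fin p → ℤ) → Word) : ℝ≥0∞ :=
  ∫⁻ ω, ((code (ω.2 t) (R.output Δ ω.1 ω.2 t)).length : ℝ≥0∞) ∂(schemeLaw A B S0 Δ)

end Realization

end ZeroDelay

end

noncomputable section

namespace ZeroDelay

/-! The proof has three ingredients: the second-moment behaviour of the dithered loop, the removal
of the dither, and a converse that produces an optimal realization.

The loop. Whatever its input, the error of a subtractively dithered quantizer has mean zero and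
variance `Δ²/12`, and the errors of different coordinates are uncorrelated. With the scalings `Θ`,
`Φ` the prediction error therefore follows a linear recursion whose second moments are those of the
realization over Gaussian channels, and `Π` is a fixed point of the moment recursion
(`steady_state`). The closed loop is stable by a Popov–Belevitch–Hautus argument
(`isStable_closedLoop`). Pairing the recursion with a solution of the dual Lyapunov equation bounds
the sum of any quadratic cost over `n` steps by `n` times its steady value plus a constant
(`sum_trace_le_of_lyapunov`); convergence of the covariances is never needed. The distortion is such
a cost, with steady value `tr Π'`. So, in effect, is the codeword length: a Shannon code loses at
most one bit against the logarithmic loss of any reference mass function whose total mass is at most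
one on average over the dither (`lintegral_length_le`). Sampling a Gaussian density of variance
`(Δ²/12) λ/δ` on the dithered grid gives such a reference, its loss is quadratic, and the steady
value is at most `½ log₂(λ/δ) + ½ log₂(πe/6)` per coordinate.

Removing the dither. A zero-delay code has no randomness shared by encoder and decoder, so one
dither path has to be frozen. Given the path, quantization errors are no longer centred or
uncorrelated with the state, but the deviations are orthogonal increments as functions of source and
dither. Their averages vanish almost surely along squares, hence the cost bounds hold on almost
every path (`ae_eventually_sum_cost_le`). The reference is then normalized separately at each time,
and the strong law makes this free on average (`opta_le`).

The converse. It suffices to find one covariance `P` with `tr P ≤ D`, `P ≤ APAᵀ + BBᵀ` and `½ log₂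
(|APAᵀ + BBᵀ| / |P|)` at most the nonanticipative rate distortion function; simultaneous
diagonalization then gives a realization. After restriction to the part of the state space reached
by the noise (`exists_controllable_part`), take nearly optimal test channels with growing horizon.
Their mutual information is bounded below through the variational formula
(`ofReal_integral_le_klDiv`), tested with the information density of a linear Gaussian model `M`.
This density has exponential moment one under the product law (`lintegral_exp_infoDens`), and its
mean under the joint law depends only on the error covariances of a linear filter run on the
reproductions. As the mean is affine in them, only their time average matters, and a limit point `P`
satisfies `modelRate A B M P ≤ L` for every `M` (`exists_limit_cov`). This forces `P` to be positive
definite (`posDef_of_modelRate_le`), and the choice `M = P` finishes. -/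

/-! ### Resampling a coordinate -/

/-- An i.i.d. sequence is invariant under resampling one coordinate. -/
lemma measurePreserving_update {X : Type*} [MeasurableSpace X] (γ : Measure X)
    [IsProbabilityMeasure γ] (t : ℕ) :
    MeasurePreserving (fun a : (ℕ → X) × X => Function.update a.1 t a.2)
      ((Measure.infinitePi fun _ : ℕ => γ).prod γ) (Measure.infinitePi fun _ : ℕ => γ) := by
  have hm : Measurable (fun a : (ℕ → X) × X => Function.update a.1 t a.2) := by
    refine measurable_pi_lambda _ fun i => ?_
    by_cases h : i = t
    · subst h; simpa using measurable_snd
    · simp only [Function.update_of_ne h]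
      exact (measurable_pi_apply i).comp measurable_fst
  refine ⟨hm, Measure.eq_infinitePi _ fun s T hT => ?_⟩
  rw [Measure.map_apply hm (MeasurableSet.pi (Finset.countable_toSet s) fun i _ => hT i)]
  by_cases ht : t ∈ s
  · have : (fun a : (ℕ → X) × X => Function.update a.1 t a.2) ⁻¹' (s : Set ℕ).pi T
        = ((s.erase t : Finset ℕ) : Set ℕ).pi T ×ˢ T t := by
      ext a
      simp only [Set.mem_preimage, Set.mem_pi, Finset.mem_coe, Set.mem_prod, Finset.mem_erase]
      constructor
      · intro h
        refine ⟨fun i hi => ?_, by simpa using h t ht⟩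
        simpa [Function.update_of_ne hi.1] using h i hi.2
      · rintro ⟨h1, h2⟩ i hi
        by_cases hit : i = t
        · subst hit; simpa using h2
        · simpa [Function.update_of_ne hit] using h1 i ⟨hit, hi⟩
    rw [this, Measure.prod_prod, Measure.infinitePi_pi _ fun i _ => hT i,
      Finset.prod_erase_mul _ _ ht]
  · have : (fun a : (ℕ → X) × X => Function.update a.1 t a.2) ⁻¹' (s : Set ℕ).pi T
        = (s : Set ℕ).pi T ×ˢ Set.univ := by
      ext a
      simp only [Set.mem_preimage, Set.mem_pi, Finset.mem_coe, Set.mem_prod, Set.mem_univ, and_true]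
      refine forall₂_congr fun i hi => ?_
      have hit : i ≠ t := fun h => ht (by rw [← h]; exact hi)
      rw [Function.update_of_ne hit]
    rw [this, Measure.prod_prod, Measure.infinitePi_pi _ fun i _ => hT i]
    simp

section Resample

variable {Ω Ω' X α β : Type*} [MeasurableSpace Ω] [MeasurableSpace Ω'] [MeasurableSpace X]
  [MeasurableSpace α] [MeasurableSpace β]

/-- Resampling takes the place of conditioning on the past: `H` does not notice the resampled
coordinate and `W` returns exactly the new value, so the pair has the law of an independent pair. -/
lemma map_prodMk_of_resample {μ : Measure Ω} [IsProbabilityMeasure μ] {γ : Measure X}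
    [IsProbabilityMeasure γ] {R : Ω × X → Ω} (hR : MeasurePreserving R (μ.prod γ) μ)
    {H : Ω → α} {W : Ω → X} (hH : Measurable H) (hW : Measurable W)
    (hHR : ∀ ω x, H (R (ω, x)) = H ω) (hWR : ∀ ω x, W (R (ω, x)) = x) :
    μ.map (fun ω => (H ω, W ω)) = (μ.map H).prod γ := by
  conv_lhs => rw [← hR.map_eq]
  rw [Measure.map_map (hH.prodMk hW) hR.measurable]
  have : (fun ω => (H ω, W ω)) ∘ R = Prod.map H id := by
    ext ⟨ω, x⟩ <;> simp [hHR, hWR]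
  rw [this, ← Measure.map_prod_map _ _ hH measurable_id, Measure.map_id]

lemma map_of_resample {μ : Measure Ω} [IsProbabilityMeasure μ] {γ : Measure X}
    [IsProbabilityMeasure γ] {R : Ω × X → Ω} (hR : MeasurePreserving R (μ.prod γ) μ)
    {W : Ω → X} (hW : Measurable W) (hWR : ∀ ω x, W (R (ω, x)) = x) : μ.map W = γ := by
  conv_lhs => rw [← hR.map_eq]
  rw [Measure.map_map hW hR.measurable]
  have : W ∘ R = Prod.snd := by ext ⟨ω, x⟩; simp [hWR]
  rw [this]
  exact measurePreserving_snd.map_eq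

lemma indepFun_of_resample {μ : Measure Ω} [IsProbabilityMeasure μ] {γ : Measure X}
    [IsProbabilityMeasure γ] {R : Ω × X → Ω} (hR : MeasurePreserving R (μ.prod γ) μ)
    {H : Ω → α} {W : Ω → X} (hH : Measurable H) (hW : Measurable W)
    (hHR : ∀ ω x, H (R (ω, x)) = H ω) (hWR : ∀ ω x, W (R (ω, x)) = x) :
    IndepFun H W μ := by
  rw [indepFun_iff_map_prod_eq_prod_map_map hH.aemeasurable hW.aemeasurable,
    map_prodMk_of_resample hR hH hW hHR hWR, map_of_resample hR hW hWR]

lemma lintegral_of_resample {μ : Measure Ω} [IsProbabilityMeasure μ] {γ : Measure X}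
    [IsProbabilityMeasure γ] {R : Ω × X → Ω} (hR : MeasurePreserving R (μ.prod γ) μ)
    {H : Ω → α} {W : Ω → X} (hH : Measurable H) (hW : Measurable W)
    (hHR : ∀ ω x, H (R (ω, x)) = H ω) (hWR : ∀ ω x, W (R (ω, x)) = x)
    {f : α → X → ℝ≥0∞} (hf : Measurable (Function.uncurry f)) :
    ∫⁻ ω, f (H ω) (W ω) ∂μ = ∫⁻ ω, ∫⁻ x, f (H ω) x ∂γ ∂μ := by
  have h1 : ∫⁻ ω, f (H ω) (W ω) ∂μ
      = ∫⁻ a, Function.uncurry f a ∂(μ.map fun ω => (H ω, W ω)) := by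
    rw [lintegral_map hf (hH.prodMk hW)]; rfl
  rw [h1, map_prodMk_of_resample hR hH hW hHR hWR, lintegral_prod _ hf.aemeasurable,
    lintegral_map _ hH]
  · rfl
  · exact hf.lintegral_prod_right'

lemma integral_of_resample {μ : Measure Ω} [IsProbabilityMeasure μ] {γ : Measure X}
    [IsProbabilityMeasure γ] {R : Ω × X → Ω} (hR : MeasurePreserving R (μ.prod γ) μ)
    {H : Ω → α} {W : Ω → X} (hH : Measurable H) (hW : Measurable W)
    (hHR : ∀ ω x, H (R (ω, x)) = H ω) (hWR : ∀ ω x, W (R (ω, x)) = x)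
    {f : α → X → ℝ} (hf : Measurable (Function.uncurry f))
    (hi : Integrable (fun ω => f (H ω) (W ω)) μ) :
    ∫ ω, f (H ω) (W ω) ∂μ = ∫ ω, ∫ x, f (H ω) x ∂γ ∂μ := by
  have h1 : ∫ ω, f (H ω) (W ω) ∂μ
      = ∫ a, Function.uncurry f a ∂(μ.map fun ω => (H ω, W ω)) := by
    rw [integral_map (hH.prodMk hW).aemeasurable hf.aestronglyMeasurable]; rfl
  have h2 : Integrable (Function.uncurry f) (μ.map fun ω => (H ω, W ω)) := by
    rw [integrable_map_measure hf.aestronglyMeasurable (hH.prodMk hW).aemeasurable]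
    exact hi
  rw [map_prodMk_of_resample hR hH hW hHR hWR] at h2
  rw [h1, map_prodMk_of_resample hR hH hW hHR hWR, integral_prod _ h2, integral_map hH.aemeasurable]
  · rfl
  · exact (hf.stronglyMeasurable.integral_prod_right').aestronglyMeasurable

/-- Resampling commutes with a kernel that does not see the resampled coordinate. -/
lemma resample_compProd {μ : Measure Ω} [IsProbabilityMeasure μ] {γ : Measure X}
    [IsProbabilityMeasure γ] {R : Ω × X → Ω} (hR : MeasurePreserving R (μ.prod γ) μ)
    (K : Kernel Ω β) [IsMarkovKernel K] (hK : ∀ ω x, K (R (ω, x)) = K ω) :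
    MeasurePreserving (fun a : (Ω × β) × X => (R (a.1.1, a.2), a.1.2))
      ((μ ⊗ₘ K).prod γ) (μ ⊗ₘ K) := by
  have hm : Measurable (fun a : (Ω × β) × X => (R (a.1.1, a.2), a.1.2)) :=
    (hR.measurable.comp (by fun_prop)).prodMk (by fun_prop)
  refine ⟨hm, Measure.ext_of_lintegral _ fun f hf => ?_⟩
  have hfm : Measurable fun a : (Ω × β) × X => f (R (a.1.1, a.2), a.1.2) := hf.comp hm
  rw [lintegral_map hf hm, lintegral_prod _ hfm.aemeasurable,
    Measure.lintegral_compProd hfm.lintegral_prod_right', Measure.lintegral_compProd hf]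
  -- The kernel output and the fresh value are independent given `ω`, so they can be integrated in
  -- either order; afterwards `K ω` may be rewritten as `K (R (ω, x))` and the invariance of `μ`
  -- applies.
  have h1 : ∀ ω, ∫⁻ y, ∫⁻ x, f (R (ω, x), y) ∂γ ∂(K ω) = ∫⁻ x, ∫⁻ y, f (R (ω, x), y) ∂(K ω) ∂γ := by
    intro ω
    refine lintegral_lintegral_swap ?_
    exact (hf.comp ((hR.measurable.comp (by fun_prop)).prodMk (by fun_prop))).aemeasurable
  simp_rw [h1]
  have hg : Measurable fun ω => ∫⁻ y, f (ω, y) ∂(K ω) := hf.lintegral_kernel_prod_right'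
  have hgR : Measurable fun a => ∫⁻ y, f (R a, y) ∂(K (R a)) := hg.comp hR.measurable
  conv_rhs => rw [← hR.map_eq, lintegral_map hg hR.measurable]
  rw [lintegral_prod _ hgR.aemeasurable]
  simp only [hK]

lemma resample_prod_left {μ : Measure Ω} [IsProbabilityMeasure μ]
    {ν : Measure Ω'} [IsProbabilityMeasure ν] {γ : Measure X}
    [IsProbabilityMeasure γ] {R : Ω × X → Ω} (hR : MeasurePreserving R (μ.prod γ) μ) :
    MeasurePreserving (fun a : (Ω × Ω') × X => (R (a.1.1, a.2), a.1.2))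
      ((μ.prod ν).prod γ) (μ.prod ν) := by
  have := resample_compProd hR (Kernel.const Ω ν) (fun _ _ => rfl)
  rwa [Measure.compProd_const] at this

lemma resample_prod_right {μ : Measure Ω} [IsProbabilityMeasure μ]
    {ν : Measure Ω'} [IsProbabilityMeasure ν] {γ : Measure X}
    [IsProbabilityMeasure γ] {R : Ω' × X → Ω'} (hR : MeasurePreserving R (ν.prod γ) ν) :
    MeasurePreserving (fun a : (Ω × Ω') × X => (a.1.1, R (a.1.2, a.2)))
      ((μ.prod ν).prod γ) (μ.prod ν) :=
  ((MeasurePreserving.id μ).prod hR).comp (measurePreserving_prodAssoc μ ν γ)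

end Resample

/-! ### Second moments of random vectors -/

section Moments

variable {Ω : Type*} [MeasurableSpace Ω] {ι κ η : Type*}

/-- All components are square integrable. -/
def SqInt (μ : Measure Ω) (u : Ω → ι → ℝ) : Prop := ∀ i, MemLp (fun ω => u ω i) 2 μ

/-- The matrix `E u vᵀ`. -/
def crossMoment (μ : Measure Ω) (u : Ω → ι → ℝ) (v : Ω → κ → ℝ) : Matrix ι κ ℝ :=
  Matrix.of fun i j => ∫ ω, u ω i * v ω j ∂μ

variable {μ : Measure Ω} {u u' : Ω → ι → ℝ} {v : Ω → κ → ℝ}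

lemma SqInt.integrable_mul (hu : SqInt μ u) (hv : SqInt μ v) (i : ι) (j : κ) :
    Integrable (fun ω => u ω i * v ω j) μ := (hu i).integrable_mul (hv j)

lemma SqInt.add (hu : SqInt μ u) (hu' : SqInt μ u') : SqInt μ (fun ω => u ω + u' ω) :=
  fun i => (hu i).add (hu' i)

lemma SqInt.sub (hu : SqInt μ u) (hu' : SqInt μ u') : SqInt μ (fun ω => u ω - u' ω) :=
  fun i => (hu i).sub (hu' i)

lemma SqInt.mulVec [Fintype ι] (C : Matrix η ι ℝ) (hu : SqInt μ u) :
    SqInt μ (fun ω => C *ᵥ u ω) := fun i => by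
  simp only [Matrix.mulVec, dotProduct]
  exact memLp_finsetSum _ fun j _ => (hu j).const_mul _

lemma SqInt.of_bound [IsFiniteMeasure μ] (hm : Measurable u) (c : ℝ) (h : ∀ ω i, |u ω i| ≤ c) :
    SqInt μ u := fun i =>
  MemLp.of_bound ((measurable_pi_apply i).comp hm).aestronglyMeasurable c
    (ae_of_all _ fun ω => h ω i)

lemma crossMoment_transpose : (crossMoment μ u v)ᵀ = crossMoment μ v u := by
  ext i j; simp [crossMoment, mul_comm]

lemma crossMoment_add_left (hu : SqInt μ u) (hu' : SqInt μ u') (hv : SqInt μ v) :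
    crossMoment μ (fun ω => u ω + u' ω) v = crossMoment μ u v + crossMoment μ u' v := by
  ext i j
  simp only [crossMoment, Matrix.of_apply, Matrix.add_apply, Pi.add_apply, add_mul]
  exact integral_add (hu.integrable_mul hv i j) (hu'.integrable_mul hv i j)

lemma crossMoment_add_right (hu : SqInt μ u) (hu' : SqInt μ u') (hv : SqInt μ v) :
    crossMoment μ v (fun ω => u ω + u' ω) = crossMoment μ v u + crossMoment μ v u' := by
  rw [← crossMoment_transpose, crossMoment_add_left hu hu' hv, Matrix.transpose_add,
    crossMoment_transpose, crossMoment_transpose]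

lemma crossMoment_sub_left (hu : SqInt μ u) (hu' : SqInt μ u') (hv : SqInt μ v) :
    crossMoment μ (fun ω => u ω - u' ω) v = crossMoment μ u v - crossMoment μ u' v := by
  ext i j
  simp only [crossMoment, Matrix.of_apply, Matrix.sub_apply, Pi.sub_apply, sub_mul]
  exact integral_sub (hu.integrable_mul hv i j) (hu'.integrable_mul hv i j)

lemma crossMoment_mulVec_left [Fintype ι] (C : Matrix η ι ℝ) (hu : SqInt μ u) (hv : SqInt μ v) :
    crossMoment μ (fun ω => C *ᵥ u ω) v = C * crossMoment μ u v := by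
  ext i j
  simp only [crossMoment, Matrix.of_apply, Matrix.mul_apply, Matrix.mulVec, dotProduct,
    Finset.sum_mul, mul_assoc]
  rw [integral_finsetSum _ fun k _ => (hu.integrable_mul hv k j).const_mul _]
  simp only [integral_const_mul]

lemma crossMoment_mulVec_right [Fintype ι] (C : Matrix η ι ℝ) (hu : SqInt μ u) (hv : SqInt μ v) :
    crossMoment μ v (fun ω => C *ᵥ u ω) = crossMoment μ v u * Cᵀ := by
  rw [← crossMoment_transpose, crossMoment_mulVec_left C hu hv, Matrix.transpose_mul,
    crossMoment_transpose]

lemma SqInt.integrable_quad [Fintype ι] (hu : SqInt μ u) (M : Matrix ι ι ℝ) :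
    Integrable (fun ω => u ω ⬝ᵥ M *ᵥ u ω) μ := by
  simp only [dotProduct, Matrix.mulVec, Finset.mul_sum]
  refine integrable_finsetSum _ fun i _ => integrable_finsetSum _ fun j _ => ?_
  have := (hu.integrable_mul hu i j).const_mul (M i j)
  refine this.congr (ae_of_all _ fun ω => ?_)
  ring

lemma integral_quad [Fintype ι] (hu : SqInt μ u) (M : Matrix ι ι ℝ) :
    ∫ ω, u ω ⬝ᵥ M *ᵥ u ω ∂μ = (M * crossMoment μ u u).trace := by
  simp only [dotProduct, Matrix.mulVec, Finset.mul_sum, Matrix.trace, Matrix.diag,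
    Matrix.mul_apply, crossMoment, Matrix.of_apply]
  have hi : ∀ i j, Integrable (fun ω => u ω i * (M i j * u ω j)) μ := fun i j => by
    refine ((hu.integrable_mul hu i j).const_mul (M i j)).congr (ae_of_all _ fun ω => ?_)
    ring
  rw [integral_finsetSum _ fun i _ => integrable_finsetSum _ fun j _ => hi i j]
  refine Finset.sum_congr rfl fun i _ => ?_
  rw [integral_finsetSum _ fun j _ => hi i j]
  refine Finset.sum_congr rfl fun j _ => ?_
  rw [← integral_const_mul]
  congr 1; ext ω; ring

lemma posSemidef_crossMoment [Fintype ι] (hu : SqInt μ u) : (crossMoment μ u u).PosSemidef := by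
  classical
  refine Matrix.PosSemidef.of_dotProduct_mulVec_nonneg ?_ fun x => ?_
  · rw [Matrix.IsHermitian, Matrix.conjTranspose_eq_transpose_of_trivial, crossMoment_transpose]
  -- The form at `x` is the mean of `(u ⬝ᵥ x)²`, the quadratic form of the rank-one matrix `x xᵀ` at
  -- `u`.
  · have h : x ⬝ᵥ crossMoment μ u u *ᵥ x = ∫ ω, u ω ⬝ᵥ vecMulVec x x *ᵥ u ω ∂μ := by
      rw [integral_quad hu, Matrix.trace_mul_comm, Matrix.mul_vecMulVec, Matrix.trace_vecMulVec,
        dotProduct_comm]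
    simp only [star_trivial]
    rw [h]
    refine integral_nonneg fun ω => ?_
    simp only [Matrix.vecMulVec_mulVec, Pi.zero_apply]
    rw [dotProduct_smul, dotProduct_comm x (u ω)]
    simpa using mul_self_nonneg (u ω ⬝ᵥ x)

lemma trace_crossMoment [Fintype ι] (hu : SqInt μ u) :
    (crossMoment μ u u).trace = ∫ ω, ∑ i, u ω i ^ 2 ∂μ := by
  simp only [Matrix.trace, Matrix.diag, crossMoment, Matrix.of_apply, ← sq]
  rw [integral_finsetSum _ fun i _ => (hu i).integrable_sq]

lemma crossMoment_eq_zero_of_indepFun [Fintype κ] (h : IndepFun u v μ)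
    (hu : SqInt μ u) (hv : SqInt μ v)
    (h0 : ∀ j, ∫ ω, v ω j ∂μ = 0) : crossMoment μ u v = 0 := by
  ext i j
  have : IndepFun (fun ω => u ω i) (fun ω => v ω j) μ :=
    h.comp (measurable_pi_apply i) (measurable_pi_apply j)
  have h2 := this.integral_mul_eq_mul_integral (hu i).aestronglyMeasurable (hv j).aestronglyMeasurable
  simp only [Pi.mul_apply] at h2
  simp [crossMoment, h2, h0]

lemma SqInt.lintegral_sum_sq [Fintype ι] (hu : SqInt μ u) :
    ∫⁻ ω, ENNReal.ofReal (∑ i, u ω i ^ 2) ∂μ = ENNReal.ofReal (crossMoment μ u u).trace := by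
  rw [trace_crossMoment hu, ofReal_integral_eq_lintegral_ofReal]
  · exact integrable_finsetSum _ fun i _ => (hu i).integrable_sq
  · exact ae_of_all _ fun ω => Finset.sum_nonneg fun i _ => sq_nonneg _

lemma SqInt.of_lintegral [Fintype ι] (hm : Measurable u)
    (h : ∫⁻ ω, ENNReal.ofReal (∑ i, u ω i ^ 2) ∂μ ≠ ∞) : SqInt μ u := by
  intro i
  have hmi : Measurable fun ω => u ω i := (measurable_pi_apply i).comp hm
  rw [memLp_two_iff_integrable_sq hmi.aestronglyMeasurable]
  refine ⟨(hmi.pow_const 2).aestronglyMeasurable, ?_⟩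
  refine lt_of_le_of_lt (lintegral_mono fun ω => ?_) (lt_top_iff_ne_top.2 h)
  rw [Real.enorm_of_nonneg (sq_nonneg _)]
  exact ENNReal.ofReal_le_ofReal
    (Finset.single_le_sum (f := fun i => u ω i ^ 2) (fun i _ => sq_nonneg _) (Finset.mem_univ i))

end Moments

/-! ### Stability -/

section Lyapunov

attribute [local instance] Matrix.frobeniusNormedRing Matrix.frobeniusNormedAlgebra

/-- Powers of a stable matrix decay geometrically. -/
lemma IsStable.exists_pow_le {p : ℕ} {L : Matrix (Fin p) (Fin p) ℝ} (hL : IsStable L) :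
    ∃ r : ℝ, 0 ≤ r ∧ r < 1 ∧ ∀ᶠ n : ℕ in atTop, ‖L ^ n‖ ≤ r ^ n := by
  rcases Nat.eq_zero_or_pos p with rfl | hp
  · refine ⟨0, le_rfl, one_pos, Eventually.of_forall fun n => ?_⟩
    rw [Subsingleton.elim (L ^ n) 0, norm_zero]
    positivity
  have : Nonempty (Fin p) := ⟨⟨0, hp⟩⟩
  set Lc : Matrix (Fin p) (Fin p) ℂ := L.map (algebraMap ℝ ℂ) with hLc
  have : CompleteSpace (Matrix (Fin p) (Fin p) ℂ) := FiniteDimensional.complete ℂ _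
  -- Gelfand's formula over `ℂ`: any `r` strictly between the spectral radius and one eventually
  -- dominates `‖Lⁿ‖^(1/n)`. The Frobenius norm is unchanged by the passage from `ℝ` to `ℂ`, which
  -- carries the bound back.
  have h1 : spectralRadius ℂ Lc < (1 : NNReal) :=
    spectrum.spectralRadius_lt_of_forall_lt Lc fun z hz => by
      have := hL z hz
      exact_mod_cast this
  obtain ⟨r, hr1, hr2⟩ := ENNReal.lt_iff_exists_nnreal_btwn.1 h1
  refine ⟨r, r.2, by exact_mod_cast hr2, ?_⟩
  have h2 := (spectrum.pow_nnnorm_pow_one_div_tendsto_nhds_spectralRadius Lc).eventually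
    (gt_mem_nhds hr1)
  filter_upwards [h2, eventually_gt_atTop 0] with n hn hn0
  have h3 : ((‖Lc ^ n‖₊ : ℝ≥0∞)) ≤ (r : ℝ≥0∞) ^ n := by
    have := ENNReal.rpow_le_rpow hn.le (Nat.cast_nonneg (α := ℝ) n)
    rwa [← ENNReal.rpow_mul, one_div_mul_cancel (by positivity), ENNReal.rpow_one,
      ENNReal.rpow_natCast] at this
  have h4 : ‖Lc ^ n‖ ≤ (r : ℝ) ^ n := by exact_mod_cast h3
  have h5 : Lc ^ n = (L ^ n).map (algebraMap ℝ ℂ) := by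
    rw [hLc, ← RingHom.mapMatrix_apply, ← RingHom.mapMatrix_apply, map_pow]
  rw [h5] at h4
  rwa [Matrix.frobenius_norm_map_eq] at h4
  intro a; simp

/-- The discrete Lyapunov equation of a stable matrix has a positive semidefinite solution. -/
lemma IsStable.exists_lyapunov {p : ℕ} {L : Matrix (Fin p) (Fin p) ℝ} (hL : IsStable L)
    {M : Matrix (Fin p) (Fin p) ℝ} (hM : M.PosSemidef) :
    ∃ N : Matrix (Fin p) (Fin p) ℝ, N.PosSemidef ∧ N - Lᵀ * N * L = M := by
  obtain ⟨r, hr0, hr1, hr⟩ := hL.exists_pow_le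
  have : CompleteSpace (Matrix (Fin p) (Fin p) ℝ) := FiniteDimensional.complete ℝ _
  -- The solution is the sum of this series; removing its first term is the same as conjugating by
  -- `L`, which is the equation.
  set a : ℕ → Matrix (Fin p) (Fin p) ℝ := fun n => (L ^ n)ᵀ * M * L ^ n with ha
  have hsum : Summable a := by
    have hg : Summable fun n : ℕ => ‖M‖ * (r ^ 2) ^ n :=
      (summable_geometric_of_lt_one (by positivity) (by nlinarith)).mul_left _
    refine Summable.of_norm_bounded_eventually_nat hg ?_
    filter_upwards [hr] with n hn
    have h2 : ‖(L ^ n)ᵀ‖ ≤ r ^ n := by rwa [Matrix.frobenius_norm_transpose]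
    calc ‖a n‖ ≤ ‖(L ^ n)ᵀ‖ * ‖M‖ * ‖L ^ n‖ :=
          (norm_mul_le _ _).trans (mul_le_mul_of_nonneg_right (norm_mul_le _ _) (norm_nonneg _))
      _ ≤ r ^ n * ‖M‖ * r ^ n := by gcongr
      _ = ‖M‖ * (r ^ 2) ^ n := by rw [← pow_mul, mul_comm 2 n, pow_mul]; ring
  have hcont : ∀ φ : Matrix (Fin p) (Fin p) ℝ →ₗ[ℝ] ℝ, HasSum (fun n => φ (a n)) (φ (∑' n, a n)) :=
    fun φ => hsum.hasSum.map φ.toAddMonoidHom (LinearMap.continuous_of_finiteDimensional φ)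
  have hpsd : ∀ n, (a n).PosSemidef := fun n => by
    have := hM.conjTranspose_mul_mul_same (L ^ n)
    rwa [Matrix.conjTranspose_eq_transpose_of_trivial] at this
  refine ⟨∑' n, a n, Matrix.PosSemidef.of_dotProduct_mulVec_nonneg ?_ fun x => ?_, ?_⟩
  · ext i j
    rw [Matrix.conjTranspose_apply, star_trivial]
    let φ : Fin p → Fin p → (Matrix (Fin p) (Fin p) ℝ →ₗ[ℝ] ℝ) := fun i j =>
      { toFun := fun X => X i j, map_add' := fun _ _ => rfl, map_smul' := fun _ _ => rfl }
    have h1 := hcont (φ i j)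
    have h2 := hcont (φ j i)
    have e : (fun n => φ j i (a n)) = fun n => φ i j (a n) := by
      ext n
      have := (hpsd n).isHermitian.apply i j
      rw [star_trivial] at this
      exact this
    rw [e] at h2
    exact h2.unique h1
  · let φ : Matrix (Fin p) (Fin p) ℝ →ₗ[ℝ] ℝ :=
      { toFun := fun X => star x ⬝ᵥ X *ᵥ x
        map_add' := fun X Y => by simp [Matrix.add_mulVec, dotProduct_add]
        map_smul' := fun c X => by simp [Matrix.smul_mulVec, dotProduct_smul] }
    exact (hcont φ).nonneg fun n => (hpsd n).dotProduct_mulVec_nonneg x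
  · have h0 : ∑' n, a n = a 0 + ∑' n, a (n + 1) := hsum.tsum_eq_zero_add
    have h1 : ∑' n, a (n + 1) = Lᵀ * (∑' n, a n) * L := by
      have h2 : HasSum (fun n => Lᵀ * a n * L) (Lᵀ * (∑' n, a n) * L) :=
        (hsum.hasSum.mul_left Lᵀ).mul_right L
      rw [← h2.tsum_eq]
      congr 1; ext1 n
      simp only [ha, pow_succ, Matrix.transpose_mul, Matrix.mul_assoc]
    rw [← h1, h0, add_sub_cancel_right]
    simp [ha]

end Lyapunov

/-- A matrix is unstable iff it has a left eigenpair with modulus at least one, here split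
into real and imaginary parts. -/
lemma not_isStable_iff {p : ℕ} {L : Matrix (Fin p) (Fin p) ℝ} :
    ¬ IsStable L ↔ ∃ (s τ : ℝ) (a b : Fin p → ℝ), 1 ≤ s ^ 2 + τ ^ 2 ∧ (a ≠ 0 ∨ b ≠ 0) ∧
      Lᵀ *ᵥ a = s • a - τ • b ∧ Lᵀ *ᵥ b = τ • a + s • b := by
  have key : ∀ μ : ℂ, μ ∈ spectrum ℂ (L.map (algebraMap ℝ ℂ)) ↔ ∃ u : Fin p → ℂ, u ≠ 0 ∧
      u ᵥ* L.map (algebraMap ℝ ℂ) = μ • u := by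
    intro μ
    rw [spectrum.mem_iff, Matrix.isUnit_iff_isUnit_det, isUnit_iff_ne_zero, not_not,
      ← Matrix.exists_vecMul_eq_zero_iff]
    refine exists_congr fun u => and_congr_right fun _ => ?_
    rw [Matrix.vecMul_sub, sub_eq_zero, Matrix.algebraMap_eq_diagonal, eq_comm]
    have : u ᵥ* diagonal (algebraMap ℂ (Fin p → ℂ) μ) = μ • u := by
      ext i; simp [Matrix.vecMul_diagonal, mul_comm]
    rw [this]
  -- Since `L` is real, the complex eigenvector equation splits into equations for the real and
  -- imaginary parts of `u`.
  have hre : ∀ (u : Fin p → ℂ) (μ : ℂ), u ᵥ* L.map (algebraMap ℝ ℂ) = μ • u ↔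
      (Lᵀ *ᵥ (fun i => (u i).re) = μ.re • (fun i => (u i).re) - μ.im • (fun i => (u i).im) ∧
       Lᵀ *ᵥ (fun i => (u i).im) = μ.im • (fun i => (u i).re) + μ.re • (fun i => (u i).im)) := by
    intro u μ
    rw [funext_iff, funext_iff, funext_iff, ← forall_and]
    refine forall_congr' fun i => ?_
    rw [Complex.ext_iff]
    simp only [Matrix.vecMul, Matrix.mulVec, dotProduct, Matrix.map_apply, Matrix.transpose_apply,
      Complex.re_sum, Complex.im_sum, Complex.mul_re, Complex.mul_im, Pi.smul_apply, smul_eq_mul,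
      Pi.sub_apply, Pi.add_apply, Complex.coe_algebraMap, Complex.ofReal_re, Complex.ofReal_im,
      mul_zero, sub_zero, zero_add]
    simp only [mul_comm (L _ _)]
    refine and_congr Iff.rfl ⟨fun h => by rw [h]; ring, fun h => by rw [h]; ring⟩
  constructor
  · intro h
    simp only [IsStable, not_forall, not_lt] at h
    obtain ⟨μ, hμ, h1⟩ := h
    obtain ⟨u, hu, hu2⟩ := (key μ).1 hμ
    obtain ⟨e1, e2⟩ := (hre u μ).1 hu2
    refine ⟨μ.re, μ.im, _, _, ?_, ?_, e1, e2⟩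
    · have h2 : ‖μ‖ ^ 2 = μ.re ^ 2 + μ.im ^ 2 := by
        rw [← Complex.normSq_eq_norm_sq, Complex.normSq_apply]; ring
      rw [← h2]; nlinarith
    · by_contra hc
      push Not at hc
      refine hu (funext fun i => Complex.ext ?_ ?_)
      · exact congrFun hc.1 i
      · exact congrFun hc.2 i
  · rintro ⟨s, τ, a, b, h1, h2, e1, e2⟩ hst
    have hmem : (⟨s, τ⟩ : ℂ) ∈ spectrum ℂ (L.map (algebraMap ℝ ℂ)) := by
      refine (key _).2 ⟨fun i => ⟨a i, b i⟩, ?_, (hre _ _).2 ⟨e1, e2⟩⟩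
      intro h0
      rcases h2 with h2 | h2
      · exact h2 (funext fun i => congrArg Complex.re (congrFun h0 i))
      · exact h2 (funext fun i => congrArg Complex.im (congrFun h0 i))
    have h3 := hst _ hmem
    have h4 : ‖(⟨s, τ⟩ : ℂ)‖ ^ 2 = s ^ 2 + τ ^ 2 := by
      rw [← Complex.normSq_eq_norm_sq, Complex.normSq_apply]; ring
    nlinarith [norm_nonneg (⟨s, τ⟩ : ℂ)]

lemma IsStable.isStabilizable {p q : ℕ} {A : Matrix (Fin p) (Fin p) ℝ}
    {B : Matrix (Fin p) (Fin q) ℝ} (h : IsStable A) : IsStabilizable A B :=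
  ⟨0, by simpa using h⟩

/-! ### The closed loop of a realization and its stability -/

namespace Realization

variable {p q : ℕ} {A : Matrix (Fin p) (Fin p) ℝ} {B : Matrix (Fin p) (Fin q) ℝ} {D : ℝ}
  (R : Realization A B D)

/-- The end-to-end gain `ΘΦ` of the quantized channel in each coordinate. -/
def gain (i : Fin p) : ℝ := if R.lam i = 0 then 0 else R.H i

/-- The steady-state covariance of the prediction error. -/
def prior : Matrix (Fin p) (Fin p) ℝ := A * R.post * Aᵀ + B * Bᵀ

/-- The map from the prediction error to the filtering error. -/
def filt : Matrix (Fin p) (Fin p) ℝ := 1 - R.E⁻¹ * diagonal R.gain * R.E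

lemma lam_nonneg (i : Fin p) : 0 ≤ R.lam i := (R.δ_nonneg i).trans (R.δ_le_lam i)

lemma H_nonneg (i : Fin p) : 0 ≤ R.H i := by
  have := div_le_one_of_le₀ (R.δ_le_lam i) (R.lam_nonneg i)
  unfold H; linarith

lemma gain_nonneg (i : Fin p) : 0 ≤ R.gain i := by
  unfold gain; split_ifs
  · exact le_rfl
  · exact R.H_nonneg i

/-- For `h = 1 - δ/λ` the two terms are `δ²/λ` and `δ - δ²/λ`: the posterior variance consists of
attenuated prior variance and of channel noise with variance `hδ`. In a degenerate coordinate
everything is zero. -/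
lemma gain_eq (i : Fin p) : (1 - R.gain i) ^ 2 * R.lam i + R.gain i * R.δ i = R.δ i := by
  unfold gain H
  split_ifs with h
  · have : R.δ i = 0 := le_antisymm (h ▸ R.δ_le_lam i) (R.δ_nonneg i)
    simp [h, this]
  · field_simp; ring

/-- Absence of channel noise means absence of transmission, because `δ` vanishes only together with
`λ`. The stability proof needs exactly this: a noiseless nonzero gain would be invisible in the
covariance equation. -/
lemma gain_eq_zero (i : Fin p) (h : R.gain i * R.δ i = 0) : R.gain i = 0 := by
  rcases mul_eq_zero.1 h with h | h
  · exact h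
  · simp [gain, R.lam_eq_zero i h]

lemma E_inv_mul : R.E⁻¹ * R.E = 1 := Matrix.nonsing_inv_mul _ R.isUnit_E

lemma E_mul_inv : R.E * R.E⁻¹ = 1 := Matrix.mul_nonsing_inv _ R.isUnit_E

lemma eq_of_conj {X Y : Matrix (Fin p) (Fin p) ℝ} (h : R.E * X * R.Eᵀ = R.E * Y * R.Eᵀ) : X = Y := by
  have hT : R.Eᵀ * (R.E⁻¹)ᵀ = 1 := by rw [← Matrix.transpose_mul, R.E_inv_mul, transpose_one]
  have : ∀ Z, Z = R.E⁻¹ * (R.E * Z * R.Eᵀ) * (R.E⁻¹)ᵀ := fun Z => by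
    calc Z = (R.E⁻¹ * R.E) * Z * (R.Eᵀ * (R.E⁻¹)ᵀ) := by simp [R.E_inv_mul, hT]
      _ = _ := by simp only [Matrix.mul_assoc]
  rw [this X, this Y, h]

lemma E_mul_filt : R.E * R.filt = diagonal (fun i => 1 - R.gain i) * R.E := by
  have h : diagonal (fun i => 1 - R.gain i) = (1 : Matrix (Fin p) (Fin p) ℝ) - diagonal R.gain := by
    rw [← diagonal_one, diagonal_sub]
  rw [filt, Matrix.mul_sub, h, Matrix.sub_mul, ← Matrix.mul_assoc, ← Matrix.mul_assoc, R.E_mul_inv]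
  simp

/-- Conjugation by `E` makes every matrix diagonal and reduces the claim to `gain_eq` in each
coordinate. -/
lemma post_eq_filt : R.post = R.filt * R.prior * R.filtᵀ
    + R.E⁻¹ * diagonal (fun i => R.gain i * R.δ i) * (R.E⁻¹)ᵀ := by
  have hT : (R.E⁻¹)ᵀ * R.Eᵀ = 1 := by rw [← Matrix.transpose_mul, R.E_mul_inv, transpose_one]
  apply R.eq_of_conj
  have h1 : R.E * (R.filt * R.prior * R.filtᵀ) * R.Eᵀ
      = diagonal (fun i => (1 - R.gain i) ^ 2 * R.lam i) := by
    calc _ = (R.E * R.filt) * R.prior * (R.E * R.filt)ᵀ := by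
          simp only [Matrix.transpose_mul, Matrix.mul_assoc]
      _ = diagonal (fun i => 1 - R.gain i) * (R.E * R.prior * R.Eᵀ)
            * diagonal (fun i => 1 - R.gain i) := by
          rw [E_mul_filt]; simp only [Matrix.transpose_mul, Matrix.mul_assoc, diagonal_transpose]
      _ = _ := by
          rw [prior, R.prior_eq, diagonal_mul_diagonal, diagonal_mul_diagonal]
          congr 1; ext i; ring
  have h2 : R.E * (R.E⁻¹ * diagonal (fun i => R.gain i * R.δ i) * (R.E⁻¹)ᵀ) * R.Eᵀ
      = diagonal (fun i => R.gain i * R.δ i) := by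
    calc _ = (R.E * R.E⁻¹) * diagonal (fun i => R.gain i * R.δ i) * ((R.E⁻¹)ᵀ * R.Eᵀ) := by
          simp only [Matrix.mul_assoc]
      _ = _ := by rw [R.E_mul_inv, hT]; simp
  rw [Matrix.mul_add, Matrix.add_mul, h1, h2, R.post_eq, diagonal_add]
  congr 1; ext i; rw [R.gain_eq i]

/-- The stationary covariance equation of the closed loop, with channel noise and process noise as
inputs. It drives both the stability proof and the estimates of time averages. -/
lemma prior_eq_closedLoop : R.prior = (A * R.filt) * R.prior * (A * R.filt)ᵀ
    + ((A * R.E⁻¹) * diagonal (fun i => R.gain i * R.δ i) * (A * R.E⁻¹)ᵀ + B * Bᵀ) := by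
  conv_lhs => rw [prior, R.post_eq_filt]
  simp only [Matrix.transpose_mul, Matrix.mul_add, Matrix.add_mul, Matrix.mul_assoc, add_assoc]

lemma posSemidef_post : R.post.PosSemidef := by
  have h := (Matrix.PosSemidef.diagonal (n := Fin p) (d := R.δ) R.δ_nonneg)
  have h2 := h.mul_mul_conjTranspose_same R.E⁻¹
  rw [← R.post_eq, Matrix.conjTranspose_eq_transpose_of_trivial] at h2
  have hT : R.Eᵀ * (R.E⁻¹)ᵀ = 1 := by rw [← Matrix.transpose_mul, R.E_inv_mul, transpose_one]
  have h3 : R.E⁻¹ * (R.E * R.post * R.Eᵀ) * (R.E⁻¹)ᵀ = R.post := by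
    calc _ = (R.E⁻¹ * R.E) * R.post * (R.Eᵀ * (R.E⁻¹)ᵀ) := by simp only [Matrix.mul_assoc]
      _ = _ := by rw [R.E_inv_mul, hT]; simp
  rwa [h3] at h2

lemma posSemidef_prior : R.prior.PosSemidef := by
  have h1 := R.posSemidef_post.mul_mul_conjTranspose_same A
  have h2 := Matrix.posSemidef_self_mul_conjTranspose B
  rw [Matrix.conjTranspose_eq_transpose_of_trivial] at h1 h2
  exact h1.add h2

lemma quad_conj {m n : ℕ} (C : Matrix (Fin m) (Fin n) ℝ) (S : Matrix (Fin n) (Fin n) ℝ)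
    (a : Fin m → ℝ) : a ⬝ᵥ (C * S * Cᵀ) *ᵥ a = (Cᵀ *ᵥ a) ⬝ᵥ S *ᵥ (Cᵀ *ᵥ a) := by
  rw [← Matrix.mulVec_mulVec, ← Matrix.mulVec_mulVec, Matrix.dotProduct_mulVec,
    ← Matrix.mulVec_transpose]

/-- Multiplying `a + ib` by `s + iτ` multiplies its Hermitian form by `s² + τ²`; in real terms, the
cross terms cancel. -/
lemma dotProduct_smul_sub_add (S : Matrix (Fin p) (Fin p) ℝ) (s τ : ℝ) (a b : Fin p → ℝ) :
    (s • a - τ • b) ⬝ᵥ S *ᵥ (s • a - τ • b) + (τ • a + s • b) ⬝ᵥ S *ᵥ (τ • a + s • b)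
      = (s ^ 2 + τ ^ 2) * (a ⬝ᵥ S *ᵥ a + b ⬝ᵥ S *ᵥ b) := by
  simp only [Matrix.mulVec_add, Matrix.mulVec_sub, Matrix.mulVec_smul, dotProduct_add,
    dotProduct_sub, add_dotProduct, sub_dotProduct, dotProduct_smul, smul_dotProduct, smul_eq_mul]
  ring

/-- The closed loop of every realization is stable (Popov–Belevitch–Hautus argument). -/
theorem isStable_closedLoop (hAB : IsStabilizable A B) : IsStable (A * R.filt) := by
  by_contra hns
  obtain ⟨s, τ, a, b, h1, h2, e1, e2⟩ := not_isStable_iff.1 hns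
  set d : Fin p → ℝ := fun i => R.gain i * R.δ i with hd
  have hd0 : ∀ i, 0 ≤ d i := fun i => mul_nonneg (R.gain_nonneg i) (R.δ_nonneg i)
  -- The stationary equation tested on `c`: the form of `prior` at the image of `c`, plus two
  -- nonnegative noise terms.
  have hquad : ∀ c : Fin p → ℝ, c ⬝ᵥ R.prior *ᵥ c
      = ((A * R.filt)ᵀ *ᵥ c) ⬝ᵥ R.prior *ᵥ ((A * R.filt)ᵀ *ᵥ c)
        + (∑ i, d i * (((A * R.E⁻¹)ᵀ *ᵥ c) i) ^ 2 + (Bᵀ *ᵥ c) ⬝ᵥ (Bᵀ *ᵥ c)) := by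
    intro c
    conv_lhs => rw [R.prior_eq_closedLoop]
    rw [Matrix.add_mulVec, Matrix.add_mulVec, dotProduct_add, dotProduct_add, quad_conj, quad_conj]
    congr 2
    · simp only [dotProduct, Matrix.mulVec_diagonal]
      exact Finset.sum_congr rfl fun i _ => by ring
    · rw [← Matrix.mulVec_mulVec, Matrix.dotProduct_mulVec, ← Matrix.mulVec_transpose]
  have hp := fun c => R.posSemidef_prior.dotProduct_mulVec_nonneg c
  simp only [star_trivial] at hp
  have hB0 : ∀ c : Fin p → ℝ, 0 ≤ (Bᵀ *ᵥ c) ⬝ᵥ (Bᵀ *ᵥ c) := fun c =>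
    Finset.sum_nonneg fun i _ => mul_self_nonneg _
  have hS0 : ∀ c : Fin p → ℝ, 0 ≤ ∑ i, d i * (((A * R.E⁻¹)ᵀ *ᵥ c) i) ^ 2 := fun c =>
    Finset.sum_nonneg fun i _ => mul_nonneg (hd0 i) (sq_nonneg _)
  have hab := dotProduct_smul_sub_add R.prior s τ a b
  have ha := hquad a
  have hb := hquad b
  rw [e1] at ha
  rw [e2] at hb
  -- A direction in which neither noise acts sees neither the measurement update nor any feedback
  -- through `B`, so the transposes of the filter loop and of `A + B K` agree on it.
  have hz : ∀ c : Fin p → ℝ, ∑ i, d i * (((A * R.E⁻¹)ᵀ *ᵥ c) i) ^ 2 = 0 →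
      (Bᵀ *ᵥ c) ⬝ᵥ (Bᵀ *ᵥ c) = 0 → ∀ K : Matrix (Fin q) (Fin p) ℝ,
      (A + B * K)ᵀ *ᵥ c = (A * R.filt)ᵀ *ᵥ c := by
    intro c hc1 hc2 K
    have hBc : Bᵀ *ᵥ c = 0 := by
      simpa using dotProduct_self_eq_zero.1 hc2
    have hG : diagonal R.gain *ᵥ ((A * R.E⁻¹)ᵀ *ᵥ c) = 0 := by
      ext i
      rw [Matrix.mulVec_diagonal]
      have := (Finset.sum_eq_zero_iff_of_nonneg fun i _ =>
        mul_nonneg (hd0 i) (sq_nonneg (((A * R.E⁻¹)ᵀ *ᵥ c) i))).1 hc1 i (Finset.mem_univ i)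
      rcases mul_eq_zero.1 this with h | h
      · simp [R.gain_eq_zero i h]
      · rw [(pow_eq_zero_iff two_ne_zero).1 h, mul_zero]; rfl
    have hT : (A * R.filt)ᵀ = Aᵀ - R.Eᵀ * (diagonal R.gain * (A * R.E⁻¹)ᵀ) := by
      simp only [filt, Matrix.mul_sub, Matrix.mul_one, Matrix.transpose_sub, Matrix.transpose_mul,
        diagonal_transpose, Matrix.mul_assoc]
    rw [hT, Matrix.sub_mulVec, ← Matrix.mulVec_mulVec, ← Matrix.mulVec_mulVec, hG,
      Matrix.mulVec_zero, sub_zero, Matrix.transpose_add, Matrix.add_mulVec, Matrix.transpose_mul,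
      ← Matrix.mulVec_mulVec, hBc, Matrix.mulVec_zero, add_zero]
  -- Adding the equations for `a` and `b` gives `f = (s² + τ²) f + noise` for the total form `f ≥
  -- 0`. As `s² + τ² ≥ 1`, all noise terms vanish, and `(s, τ, a, b)` becomes an unstable eigenpair
  -- of `A + B K`, contradicting stabilizability.
  have hnn : 0 ≤ (s ^ 2 + τ ^ 2 - 1) * (a ⬝ᵥ R.prior *ᵥ a + b ⬝ᵥ R.prior *ᵥ b) :=
    mul_nonneg (by linarith) (add_nonneg (hp a) (hp b))
  have := hS0 a; have := hS0 b; have := hB0 a; have := hB0 b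
  have za := hz a (by linarith) (by linarith)
  have zb := hz b (by linarith) (by linarith)
  obtain ⟨K, hK⟩ := hAB
  exact not_isStable_iff.2 ⟨s, τ, a, b, h1, h2, (za K).trans e1, (zb K).trans e2⟩ hK

end Realization

/-! ### The error of the dithered quantizer -/

lemma measurable_round_real : Measurable (fun x : ℝ => (round x : ℤ)) := by
  have : (fun x : ℝ => (round x : ℤ)) = fun x => ⌊x + 1 / 2⌋ := by
    ext x; exact round_eq x
  rw [this]; fun_prop

lemma periodic_round_sub : Function.Periodic (fun s : ℝ => (round s : ℝ) - s) 1 := fun s => by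
  simp only [round_add_one]; push_cast; ring

lemma integral_ditherMarginal (s : ℝ) {f : ℝ → ℝ} (hf : Measurable f) :
    ∫ r, f r ∂(ditherMarginal s) = ∫ u in (-1 / 2 : ℝ)..(1 / 2), f (s * u) := by
  rw [ditherMarginal, integral_map (by fun_prop) hf.aestronglyMeasurable,
    intervalIntegral.integral_of_le (by norm_num), integral_Ioc_eq_integral_Ioo]

/-- The rounding error has period one, so a shift does not change its integral over a period, and
around zero it is `-s`. This is the effect of dithering: the moments of the error do not depend on
the input. Only the first two moments are used later, never the full independence of error and
input. -/
lemma integral_periodic_pow (n : ℕ) (u : ℝ) :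
    ∫ s in (-1 / 2 : ℝ)..(1 / 2), ((round (u + s) : ℝ) - (u + s)) ^ n
      = ∫ s in (-1 / 2 : ℝ)..(1 / 2), (-s) ^ n := by
  have hp : Function.Periodic (fun s : ℝ => ((round s : ℝ) - s) ^ n) 1 := fun s => by
    simp only [periodic_round_sub s]
  rw [intervalIntegral.integral_comp_add_left (fun s : ℝ => ((round s : ℝ) - s) ^ n) u]
  have h := hp.intervalIntegral_add_eq (u + -1 / 2) (-1 / 2)
  rw [show u + -1 / 2 + 1 = u + 1 / 2 by ring, show (-1 / 2 : ℝ) + 1 = 1 / 2 by norm_num] at h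
  rw [h, intervalIntegral.integral_of_le (by norm_num), intervalIntegral.integral_of_le (by norm_num),
    integral_Ioc_eq_integral_Ioo, integral_Ioc_eq_integral_Ioo]
  refine setIntegral_congr_fun measurableSet_Ioo fun s hs => ?_
  have : round s = 0 := round_eq_zero_iff.2 ⟨by have := hs.1; linarith, by have := hs.2; linarith⟩
  simp [this]

/-- The error of the subtractively dithered quantizer. -/
def quantErr (s α r : ℝ) : ℝ := s * (quantIndex s (α + r) : ℝ) - r - α

lemma measurable_quantErr {α : Type*} [MeasurableSpace α] (s : ℝ) {f g : α → ℝ}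
    (hf : Measurable f) (hg : Measurable g) : Measurable (fun a => quantErr s (f a) (g a)) := by
  unfold quantErr quantIndex
  have : Measurable (fun a : α => ((round ((f a + g a) / s) : ℤ) : ℝ)) :=
    (measurable_from_top (f := fun z : ℤ => (z : ℝ))).comp
      (measurable_round_real.comp ((hf.add hg).div_const s))
  exact ((this.const_mul s).sub hg).sub hf

lemma abs_quantErr_le {s : ℝ} (hs : 0 < s) (α r : ℝ) : |quantErr s α r| ≤ s / 2 := by
  have h : quantErr s α r = -(s * ((α + r) / s - round ((α + r) / s))) := by
    unfold quantErr quantIndex; field_simp; ring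
  rw [h, abs_neg, abs_mul, abs_of_pos hs]
  nlinarith [abs_sub_round ((α + r) / s)]

lemma integral_quantErr_pow {s : ℝ} (hs : 0 < s) (α : ℝ) (n : ℕ) :
    ∫ r, quantErr s α r ^ n ∂(ditherMarginal s)
      = s ^ n * ∫ u in (-1 / 2 : ℝ)..(1 / 2), (-u) ^ n := by
  have hm : Measurable fun r => quantErr s α r ^ n :=
    (measurable_quantErr s measurable_const measurable_id).pow_const n
  rw [integral_ditherMarginal s hm, ← integral_periodic_pow n (α / s),
    ← intervalIntegral.integral_const_mul]
  refine intervalIntegral.integral_congr fun u _ => ?_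
  have h : quantErr s α (s * u) = s * ((round (α / s + u) : ℝ) - (α / s + u)) := by
    unfold quantErr quantIndex
    rw [add_div, mul_div_cancel_left₀ _ hs.ne']
    field_simp
    ring
  simp only [h, mul_pow]

lemma integral_quantErr {s : ℝ} (hs : 0 < s) (α : ℝ) :
    ∫ r, quantErr s α r ∂(ditherMarginal s) = 0 := by
  have h := integral_quantErr_pow hs α 1
  simp only [pow_one] at h
  rw [h, intervalIntegral.integral_neg, integral_id]; norm_num

lemma integral_quantErr_sq {s : ℝ} (hs : 0 < s) (α : ℝ) :
    ∫ r, quantErr s α r ^ 2 ∂(ditherMarginal s) = s ^ 2 / 12 := by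
  rw [integral_quantErr_pow hs α 2]
  simp only [neg_sq, integral_pow]; norm_num; ring

/-- The law of the dither at one time. -/
def ditherStep {p : ℕ} (Δ : Vec p) : Measure (Vec p) := Measure.pi fun i => ditherMarginal (Δ i)

instance {p : ℕ} (Δ : Vec p) : IsProbabilityMeasure (ditherStep Δ) := by
  unfold ditherStep; infer_instance

/-! ### The initial state and the process noise -/

lemma gaussian_memLp {p : ℕ} (S0 : Matrix (Fin p) (Fin p) ℝ) :
    SqInt ((multivariateGaussian (0 : EuclideanSpace ℝ (Fin p)) S0).map WithLp.ofLp)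
      (fun x : Vec p => x) := fun i => by
  have h : MemLp (id : EuclideanSpace ℝ (Fin p) → _) 2
      (multivariateGaussian (0 : EuclideanSpace ℝ (Fin p)) S0) :=
    IsGaussian.memLp_id _ 2 (by simp)
  have h2 := (EuclideanSpace.proj i : EuclideanSpace ℝ (Fin p) →L[ℝ] ℝ).comp_memLp' h
  refine (memLp_map_measure_iff (measurable_pi_apply i).aestronglyMeasurable (by fun_prop)).2 ?_
  exact h2

instance {p : ℕ} (S0 : Matrix (Fin p) (Fin p) ℝ) : IsProbabilityMeasure
    ((multivariateGaussian (0 : EuclideanSpace ℝ (Fin p)) S0).map WithLp.ofLp) :=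
  Measure.isProbabilityMeasure_map (by fun_prop)

/-- The law of the standard Gaussian noise at one time. -/
def noiseStep (q : ℕ) : Measure (Vec q) := Measure.pi fun _ : Fin q => gaussianReal 0 1

instance (q : ℕ) : IsProbabilityMeasure (noiseStep q) := by unfold noiseStep; infer_instance

lemma sqInt_noiseStep (q : ℕ) : SqInt (noiseStep q) (fun w => w) := fun i => by
  have h : MemLp (id : ℝ → ℝ) 2 (gaussianReal 0 1) := memLp_id_gaussianReal' 2 (by simp)
  exact h.comp_measurePreserving (measurePreserving_eval (fun _ : Fin q => gaussianReal 0 1) i)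

lemma integral_noiseStep (q : ℕ) (i : Fin q) : ∫ w, w i ∂(noiseStep q) = 0 := by
  have h := (measurePreserving_eval (fun _ : Fin q => gaussianReal 0 1) i)
  have h2 : ∫ x, x ∂((noiseStep q).map (Function.eval i)) = ∫ w, w i ∂(noiseStep q) :=
    integral_map (measurable_pi_apply i).aemeasurable (by fun_prop)
  rw [← h2, noiseStep, h.map_eq, integral_id_gaussianReal]

lemma crossMoment_noiseStep (q : ℕ) :
    crossMoment (noiseStep q) (fun w => w) (fun w => w) = 1 := by
  ext i j
  simp only [crossMoment, Matrix.of_apply]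
  by_cases hij : i = j
  · subst hij
    have h := (measurePreserving_eval (fun _ : Fin q => gaussianReal 0 1) i)
    have h2 : ∫ x, x * x ∂((noiseStep q).map (Function.eval i)) = ∫ w, w i * w i ∂(noiseStep q) :=
      integral_map (measurable_pi_apply i).aemeasurable (by fun_prop)
    rw [← h2, noiseStep, h.map_eq, Matrix.one_apply_eq]
    have hv := variance_id_gaussianReal (μ := 0) (v := 1)
    rw [variance_eq_integral (by fun_prop)] at hv
    simp only [id, integral_id_gaussianReal, sub_zero] at hv
    simpa [sq] using hv
  · rw [Matrix.one_apply_ne hij]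
    have hI : iIndepFun (fun (i : Fin q) (w : Vec q) => w i) (noiseStep q) :=
      iIndepFun_pi (X := fun _ => id) (fun _ => by fun_prop)
    have h2 := (hI.indepFun hij).integral_mul_eq_mul_integral
      (measurable_pi_apply i).aestronglyMeasurable (measurable_pi_apply j).aestronglyMeasurable
    simp only [Pi.mul_apply] at h2
    rw [h2, integral_noiseStep, zero_mul]

/-- The joint law of the initial state and the process noise. -/
def driveLaw {p : ℕ} (q : ℕ) (S0 : Matrix (Fin p) (Fin p) ℝ) : Measure (Vec p × (ℕ → Vec q)) :=
  ((multivariateGaussian 0 S0).map WithLp.ofLp).prod (Measure.infinitePi fun _ : ℕ => noiseStep q)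

instance {p : ℕ} (q : ℕ) (S0 : Matrix (Fin p) (Fin p) ℝ) :
    IsProbabilityMeasure (driveLaw q S0) := by unfold driveLaw; infer_instance

lemma sourceLaw_eq_map {p q : ℕ} (A : Matrix (Fin p) (Fin p) ℝ) (B : Matrix (Fin p) (Fin q) ℝ)
    (S0 : Matrix (Fin p) (Fin p) ℝ) :
    sourceLaw A B S0 = (driveLaw q S0).map fun ω => sourcePath A B ω.1 ω.2 := rfl

lemma sqInt_initial {p : ℕ} (q : ℕ) (S0 : Matrix (Fin p) (Fin p) ℝ) :
    SqInt (driveLaw q S0) (fun ω => ω.1) := fun i => by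
  have h : MemLp (fun x : Vec p => x i) 2
      ((multivariateGaussian (0 : EuclideanSpace ℝ (Fin p)) S0).map WithLp.ofLp) :=
    gaussian_memLp S0 i
  exact h.comp_measurePreserving (g := fun x : Vec p => x i) measurePreserving_fst

lemma resample_noise {p : ℕ} (q : ℕ) (S0 : Matrix (Fin p) (Fin p) ℝ) (t : ℕ) :
    MeasurePreserving
      (fun a : (Vec p × (ℕ → Vec q)) × Vec q => (a.1.1, Function.update a.1.2 t a.2))
      ((driveLaw q S0).prod (noiseStep q)) (driveLaw q S0) :=
  resample_prod_right (measurePreserving_update (noiseStep q) t)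

lemma sourcePath_congr {p q : ℕ} (A : Matrix (Fin p) (Fin p) ℝ) (B : Matrix (Fin p) (Fin q) ℝ)
    (x0 : Vec p) {w w' : ℕ → Vec q} {t : ℕ} (h : ∀ s < t, w s = w' s) :
    sourcePath A B x0 w t = sourcePath A B x0 w' t := by
  induction t with
  | zero => rfl
  | succ t ih =>
    simp only [sourcePath]
    rw [ih fun s hs => h s (hs.trans (Nat.lt_succ_self t)), h t (Nat.lt_succ_self t)]

lemma sourcePath_update {p q : ℕ} (A : Matrix (Fin p) (Fin p) ℝ) (B : Matrix (Fin p) (Fin q) ℝ)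
    (x0 : Vec p) (w : ℕ → Vec q) {t s : ℕ} (hs : s ≤ t) (w' : Vec q) :
    sourcePath A B x0 (Function.update w t w') s = sourcePath A B x0 w s :=
  sourcePath_congr A B x0 fun i hi => Function.update_of_ne (by omega) _ _

/-! ### The error recursion of the scheme -/

namespace Realization

variable {p q : ℕ} {A : Matrix (Fin p) (Fin p) ℝ} {B : Matrix (Fin p) (Fin q) ℝ} {D : ℝ}
  (R : Realization A B D) (Δ : Vec p)

/-- The quantization error, for the prediction error `k` and the dither value `r`. -/
def qerr (k r : Vec p) : Vec p := fun i => quantErr (Δ i) (R.quantInput Δ k i) (r i)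

lemma β_eq (k r : Vec p) (i : Fin p) : R.β Δ k r i = R.quantInput Δ k i + R.qerr Δ k r i := by
  unfold β qerr quantErr index; ring

variable {Δ}

/-- Where `λ = 0`, division by zero makes `H` equal to one, which is why `gain` differs from `H`
there; but then `δ = 0`, so `Θ` and the product vanish. Elsewhere `Θ = 0` forces `H δ = 0`, hence
zero gain. -/
lemma Θ_mul_Φ (hΔ : ∀ i, 0 < Δ i) (i : Fin p) : R.Θ Δ i * R.Φ Δ i = R.gain i := by
  have hV : 0 < (Δ i ^ 2 / 12)⁻¹ := by have := hΔ i; positivity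
  by_cases h : R.Θ Δ i = 0
  · rw [h, zero_mul]
    have h0 : R.H i * R.δ i = 0 := by
      rw [Θ, Real.sqrt_eq_zero (mul_nonneg (mul_nonneg (R.H_nonneg i) (R.δ_nonneg i)) hV.le)] at h
      exact (mul_eq_zero.1 h).resolve_right hV.ne'
    symm
    apply R.gain_eq_zero
    unfold gain; split_ifs
    · simp
    · exact h0
  · rw [Φ, ← mul_assoc, mul_inv_cancel₀ h, one_mul, gain, if_neg]
    intro hl
    apply h
    have : R.δ i = 0 := le_antisymm (hl ▸ R.δ_le_lam i) (R.δ_nonneg i)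
    simp [Θ, this]

/-- This is what `Θ` is designed for: scaled by it, quantization noise of variance `Δ²/12` acquires
the variance of the Gaussian channel noise, for every step size. -/
lemma Θ_sq_mul (hΔ : ∀ i, 0 < Δ i) (i : Fin p) :
    R.Θ Δ i ^ 2 * (Δ i ^ 2 / 12) = R.gain i * R.δ i := by
  have hV : 0 < Δ i ^ 2 / 12 := by have := hΔ i; positivity
  rw [Θ, Real.sq_sqrt (mul_nonneg (mul_nonneg (R.H_nonneg i) (R.δ_nonneg i)) (inv_nonneg.2 hV.le)),
    mul_assoc, inv_mul_cancel₀ hV.ne', mul_one, gain]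
  split_ifs with h
  · have : R.δ i = 0 := le_antisymm (h ▸ R.δ_le_lam i) (R.δ_nonneg i)
    simp [this]
  · rfl

/-- Written in terms of the quantization error, the quantized update is exactly linear; all
nonlinearity sits in `qerr`. -/
lemma sub_innov (hΔ : ∀ i, 0 < Δ i) (k r : Vec p) :
    k - R.innov Δ k r = R.filt *ᵥ k + (-(R.E⁻¹ * diagonal (R.Θ Δ))) *ᵥ R.qerr Δ k r := by
  have h : (fun i => R.Θ Δ i * R.β Δ k r i)
      = diagonal R.gain *ᵥ (R.E *ᵥ k) + diagonal (R.Θ Δ) *ᵥ R.qerr Δ k r := by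
    ext i
    rw [Pi.add_apply, mulVec_diagonal, mulVec_diagonal, R.β_eq, quantInput, mul_add, ← mul_assoc,
      R.Θ_mul_Φ hΔ]
  rw [innov, h, filt, Matrix.mulVec_add, Matrix.sub_mulVec, Matrix.one_mulVec, Matrix.neg_mulVec,
    ← Matrix.mulVec_mulVec, ← Matrix.mulVec_mulVec, ← Matrix.mulVec_mulVec]
  abel

variable (Δ)

lemma pred_congr {x x' r r' : ℕ → Vec p} {t : ℕ} (hx : ∀ s < t, x s = x' s)
    (hr : ∀ s < t, r s = r' s) : R.pred Δ x r t = R.pred Δ x' r' t := by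
  induction t with
  | zero => rfl
  | succ t ih =>
    have h1 := ih (fun s hs => hx s (hs.trans (Nat.lt_succ_self t)))
      (fun s hs => hr s (hs.trans (Nat.lt_succ_self t)))
    simp only [pred]
    rw [h1, hx t (Nat.lt_succ_self t), hr t (Nat.lt_succ_self t)]

lemma measurable_quantInput : Measurable (R.quantInput Δ) := by
  unfold quantInput
  refine measurable_pi_lambda _ fun i => ?_
  have : Measurable fun k : Vec p => (R.E *ᵥ k) i :=
    (measurable_pi_apply i).comp (Continuous.matrix_mulVec continuous_const continuous_id).measurable
  exact this.const_mul _

lemma measurable_index {α : Type*} [MeasurableSpace α] {f g : α → Vec p}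
    (hf : Measurable f) (hg : Measurable g) : Measurable fun a => R.index Δ (f a) (g a) := by
  refine measurable_pi_lambda _ fun i => ?_
  unfold index quantIndex
  have h : Measurable fun a => R.quantInput Δ (f a) i :=
    (measurable_pi_apply i).comp ((R.measurable_quantInput Δ).comp hf)
  exact measurable_round_real.comp
    ((h.add ((measurable_pi_apply i).comp hg)).div_const _)

lemma measurable_qerr {α : Type*} [MeasurableSpace α] {f g : α → Vec p}
    (hf : Measurable f) (hg : Measurable g) : Measurable fun a => R.qerr Δ (f a) (g a) := by
  refine measurable_pi_lambda _ fun i => ?_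
  have h : Measurable fun a => R.quantInput Δ (f a) i :=
    (measurable_pi_apply i).comp ((R.measurable_quantInput Δ).comp hf)
  exact measurable_quantErr (Δ i) h ((measurable_pi_apply i).comp hg)

lemma measurable_mulVec {m n : ℕ} (C : Matrix (Fin m) (Fin n) ℝ) {α : Type*} [MeasurableSpace α]
    {f : α → Fin n → ℝ} (hf : Measurable f) : Measurable fun a => C *ᵥ f a :=
  (Continuous.matrix_mulVec continuous_const continuous_id).measurable.comp hf

lemma measurable_innov {α : Type*} [MeasurableSpace α] {f g : α → Vec p}
    (hf : Measurable f) (hg : Measurable g) : Measurable fun a => R.innov Δ (f a) (g a) := by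
  unfold innov
  refine measurable_mulVec _ (measurable_pi_lambda _ fun i => ?_)
  simp only [R.β_eq]
  have h1 : Measurable fun a => R.quantInput Δ (f a) i :=
    (measurable_pi_apply i).comp ((R.measurable_quantInput Δ).comp hf)
  have h2 : Measurable fun a => R.qerr Δ (f a) (g a) i :=
    measurable_quantErr (Δ i) h1 ((measurable_pi_apply i).comp hg)
  exact (h1.add h2).const_mul _

lemma measurable_pred (t : ℕ) :
    Measurable (fun a : (ℕ → Vec p) × (ℕ → Vec p) => R.pred Δ a.1 a.2 t) := by
  induction t with
  | zero => exact measurable_const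
  | succ t ih =>
    simp only [pred]
    have h1 : Measurable fun a : (ℕ → Vec p) × (ℕ → Vec p) => a.1 t - R.pred Δ a.1 a.2 t :=
      Measurable.sub (by fun_prop) ih
    have h2 : Measurable fun a : (ℕ → Vec p) × (ℕ → Vec p) => a.2 t := by fun_prop
    exact measurable_mulVec A (ih.add (R.measurable_innov Δ h1 h2))

/-- The prediction error, as a function of the initial state, the noise and the dither. -/
def predErr (t : ℕ) (a : (Vec p × (ℕ → Vec q)) × (ℕ → Vec p)) : Vec p :=
  sourcePath A B a.1.1 a.1.2 t - R.pred Δ (sourcePath A B a.1.1 a.1.2) a.2 t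

lemma measurable_predErr (t : ℕ) : Measurable (R.predErr Δ t) := by
  have h : Measurable fun a : (Vec p × (ℕ → Vec q)) × (ℕ → Vec p) => sourcePath A B a.1.1 a.1.2 :=
    (measurable_sourcePath A B).comp measurable_fst
  exact ((measurable_pi_apply t).comp h).sub
    ((R.measurable_pred Δ t).comp (h.prodMk measurable_snd))

variable {Δ} in
lemma predErr_succ (hΔ : ∀ i, 0 < Δ i) (t : ℕ) (a : (Vec p × (ℕ → Vec q)) × (ℕ → Vec p)) :
    R.predErr Δ (t + 1) a = (A * R.filt) *ᵥ R.predErr Δ t a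
      + (-(A * R.E⁻¹ * diagonal (R.Θ Δ))) *ᵥ R.qerr Δ (R.predErr Δ t a) (a.2 t)
      + B *ᵥ a.1.2 t := by
  have h := R.sub_innov hΔ (R.predErr Δ t a) (a.2 t)
  have h2 : R.predErr Δ (t + 1) a
      = A *ᵥ (R.predErr Δ t a - R.innov Δ (R.predErr Δ t a) (a.2 t)) + B *ᵥ a.1.2 t := by
    simp only [predErr, sourcePath, pred, Matrix.mulVec_sub, Matrix.mulVec_add]
    abel
  rw [h2, h, Matrix.mulVec_add, Matrix.mulVec_mulVec, Matrix.mulVec_mulVec, Matrix.mul_neg,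
    Matrix.mul_assoc]

lemma predErr_update_noise {t s : ℕ} (hts : t ≤ s)
    (a : (Vec p × (ℕ → Vec q)) × (ℕ → Vec p)) (w : Vec q) :
    R.predErr Δ t ((a.1.1, Function.update a.1.2 s w), a.2) = R.predErr Δ t a := by
  unfold predErr
  rw [sourcePath_update A B _ _ hts]
  congr 1
  exact R.pred_congr Δ (fun i hi => sourcePath_update A B _ _ (by omega) _) fun _ _ => rfl

lemma predErr_update_dither {t s : ℕ} (hts : t ≤ s)
    (a : (Vec p × (ℕ → Vec q)) × (ℕ → Vec p)) (r : Vec p) :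
    R.predErr Δ t (a.1, Function.update a.2 s r) = R.predErr Δ t a := by
  unfold predErr
  congr 1
  exact R.pred_congr Δ (fun _ _ => rfl) fun i hi => Function.update_of_ne (by omega) _ _

variable {Δ}

lemma abs_qerr_le (hΔ : ∀ i, 0 < Δ i) (k r : Vec p) (i : Fin p) :
    |R.qerr Δ k r i| ≤ Δ i / 2 := abs_quantErr_le (hΔ i) _ _

lemma integral_qerr (hΔ : ∀ i, 0 < Δ i) (k : Vec p) (i : Fin p) :
    ∫ r, R.qerr Δ k r i ∂(ditherStep Δ) = 0 := by
  have h := measurePreserving_eval (fun i => ditherMarginal (Δ i)) i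
  rw [← integral_quantErr (hΔ i) (R.quantInput Δ k i), ← h.map_eq, integral_map]
  · rfl
  · exact h.measurable.aemeasurable
  · exact (measurable_quantErr (Δ i) measurable_const measurable_id).aestronglyMeasurable

/-- For a frozen prediction error, each component of the quantization error depends on its own
dither component only, so different components are independent and centred. -/
lemma integral_qerr_mul (hΔ : ∀ i, 0 < Δ i) (k : Vec p) (i j : Fin p) :
    ∫ r, R.qerr Δ k r i * R.qerr Δ k r j ∂(ditherStep Δ)
      = diagonal (fun i => Δ i ^ 2 / 12) i j := by
  have hm : ∀ i, Measurable fun r : ℝ => quantErr (Δ i) (R.quantInput Δ k i) r := fun i =>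
    measurable_quantErr (Δ i) measurable_const measurable_id
  by_cases hij : i = j
  · subst hij
    have h := measurePreserving_eval (fun i => ditherMarginal (Δ i)) i
    rw [diagonal_apply_eq, ← integral_quantErr_sq (hΔ i) (R.quantInput Δ k i), ← h.map_eq,
      integral_map]
    · simp only [← sq]; rfl
    · exact h.measurable.aemeasurable
    · exact ((hm i).pow_const 2).aestronglyMeasurable
  · rw [diagonal_apply_ne _ hij]
    have hI : iIndepFun (fun (i : Fin p) (r : Vec p) => quantErr (Δ i) (R.quantInput Δ k i) (r i))
        (ditherStep Δ) := iIndepFun_pi fun i => (hm i).aemeasurable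
    have h2 := (hI.indepFun hij).integral_mul_eq_mul_integral
      ((hm i).comp (measurable_pi_apply i)).aestronglyMeasurable
      ((hm j).comp (measurable_pi_apply j)).aestronglyMeasurable
    have h3 := R.integral_qerr hΔ k i
    simp only [Pi.mul_apply] at h2
    unfold qerr at h3 ⊢
    rw [h2, h3, zero_mul]

end Realization

/-! ### Second moments of linear recursions -/

section Moments

variable {Ω Ω' : Type*} [MeasurableSpace Ω] [MeasurableSpace Ω'] {ι κ η : Type*} {μ : Measure Ω}

lemma crossMoment_map {f : Ω → Ω'} (hf : Measurable f) {u : Ω' → ι → ℝ} {v : Ω' → κ → ℝ}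
    (hu : Measurable u) (hv : Measurable v) :
    crossMoment (μ.map f) u v = crossMoment μ (fun ω => u (f ω)) (fun ω => v (f ω)) := by
  ext i j
  simp only [crossMoment, Matrix.of_apply]
  exact integral_map hf.aemeasurable (((measurable_pi_apply i).comp hu).mul
    ((measurable_pi_apply j).comp hv)).aestronglyMeasurable

lemma sqInt_map {f : Ω → Ω'} (hf : Measurable f) {u : Ω' → ι → ℝ} (hu : Measurable u) :
    SqInt (μ.map f) u ↔ SqInt μ (fun ω => u (f ω)) :=
  forall_congr' fun i => memLp_map_measure_iff
    ((measurable_pi_apply i).comp hu).aestronglyMeasurable hf.aemeasurable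

/-- The second moment matrix of `C k + H v`. -/
lemma crossMoment_lin [Fintype ι] [Fintype κ] {k : Ω → ι → ℝ} {v : Ω → κ → ℝ}
    (hk : SqInt μ k) (hv : SqInt μ v) (C : Matrix η ι ℝ) (H : Matrix η κ ℝ) :
    crossMoment μ (fun ω => C *ᵥ k ω + H *ᵥ v ω) (fun ω => C *ᵥ k ω + H *ᵥ v ω)
      = C * crossMoment μ k k * Cᵀ + C * crossMoment μ k v * Hᵀ
        + (H * (crossMoment μ k v)ᵀ * Cᵀ + H * crossMoment μ v v * Hᵀ) := by
  have hC := hk.mulVec C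
  have hH := hv.mulVec H
  rw [crossMoment_add_left hC hH (hC.add hH), crossMoment_add_right hC hH hC,
    crossMoment_add_right hC hH hH, crossMoment_mulVec_left C hk hC, crossMoment_mulVec_left C hk hH,
    crossMoment_mulVec_left H hv hC, crossMoment_mulVec_left H hv hH,
    crossMoment_mulVec_right C hk hk, crossMoment_mulVec_right H hv hk,
    crossMoment_mulVec_right C hk hv, crossMoment_mulVec_right H hv hv, crossMoment_transpose]
  simp only [Matrix.mul_assoc]

/-- The second moment matrix after one step of a linear system driven by fresh noise. -/
lemma crossMoment_step [Fintype ι] [Fintype κ] [Fintype η] [DecidableEq η] {k : Ω → ι → ℝ}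
    {v : Ω → κ → ℝ} {w : Ω → η → ℝ} (hk : SqInt μ k) (hv : SqInt μ v) (hw : SqInt μ w)
    (hkw : crossMoment μ k w = 0) (hvw : crossMoment μ v w = 0) (hww : crossMoment μ w w = 1)
    (L : Matrix ι ι ℝ) (G : Matrix ι κ ℝ) (B : Matrix ι η ℝ) :
    crossMoment μ (fun ω => L *ᵥ k ω + G *ᵥ v ω + B *ᵥ w ω)
        (fun ω => L *ᵥ k ω + G *ᵥ v ω + B *ᵥ w ω)
      = L * crossMoment μ k k * Lᵀ + L * crossMoment μ k v * Gᵀ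
        + (G * (crossMoment μ k v)ᵀ * Lᵀ + G * crossMoment μ v v * Gᵀ) + B * Bᵀ := by
  have hu := (hk.mulVec L).add (hv.mulVec G)
  have hB := hw.mulVec B
  have h0 : crossMoment μ (fun ω => L *ᵥ k ω + G *ᵥ v ω) (fun ω => B *ᵥ w ω) = 0 := by
    rw [crossMoment_mulVec_right B hw hu, crossMoment_add_left (hk.mulVec L) (hv.mulVec G) hw,
      crossMoment_mulVec_left L hk hw, crossMoment_mulVec_left G hv hw, hkw, hvw]
    simp
  have h0' : crossMoment μ (fun ω => B *ᵥ w ω) (fun ω => L *ᵥ k ω + G *ᵥ v ω) = 0 := by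
    rw [← crossMoment_transpose, h0, Matrix.transpose_zero]
  rw [crossMoment_add_left hu hB (hu.add hB), crossMoment_add_right hu hB hu,
    crossMoment_add_right hu hB hB, h0, h0', crossMoment_mulVec_left B hw hB, crossMoment_mulVec_right B hw hw, hww,
    crossMoment_lin hk hv]
  simp [Matrix.mul_assoc]

open scoped MatrixOrder in
lemma exists_posSemidef_sqrt [Fintype ι] [DecidableEq ι] {S : Matrix ι ι ℝ} (hS : S.PosSemidef) :
    ∃ C : Matrix ι ι ℝ, C.PosSemidef ∧ Cᵀ = C ∧ C * C = S := by
  have h := (CFC.sqrt_nonneg S).posSemidef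
  refine ⟨CFC.sqrt S, h, ?_, CFC.sqrt_mul_sqrt_self S hS.nonneg⟩
  have := h.isHermitian.eq
  rwa [Matrix.conjTranspose_eq_transpose_of_trivial] at this

lemma trace_mul_nonneg [Fintype ι] [DecidableEq ι] {M N : Matrix ι ι ℝ}
    (hM : M.PosSemidef) (hN : N.PosSemidef) : 0 ≤ (M * N).trace := by
  obtain ⟨C, -, hC, rfl⟩ := exists_posSemidef_sqrt hN
  rw [← Matrix.mul_assoc, Matrix.trace_mul_comm, ← Matrix.mul_assoc]
  have h := (hM.mul_mul_conjTranspose_same C).trace_nonneg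
  rwa [Matrix.conjTranspose_eq_transpose_of_trivial, hC] at h

/-- Time averages of a perturbed Lyapunov recursion. -/
lemma sum_trace_le_of_lyapunov [Fintype ι] [DecidableEq ι] {L M N P X : Matrix ι ι ℝ}
    (hN : N.PosSemidef) (hNM : N - Lᵀ * N * L = M) (hP : P = L * P * Lᵀ + X)
    {Q Z : ℕ → Matrix ι ι ℝ} (hQ : ∀ t, (Q t).PosSemidef)
    (hstep : ∀ t, Q (t + 1) = L * Q t * Lᵀ + X + Z t) (n : ℕ) :
    ∑ t ∈ Finset.range n, (M * Q t).trace
      ≤ (N * Q 0).trace + n * (M * P).trace + (N * ∑ t ∈ Finset.range n, Z t).trace := by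
  -- By duality of the trace, the Lyapunov equation for `N` says that one step of the recursion
  -- lowers the potential `tr (N Y)` by the cost `tr (M Y)`.
  have hconj : ∀ Y : Matrix ι ι ℝ, (N * (L * Y * Lᵀ)).trace = (N * Y).trace - (M * Y).trace := by
    intro Y
    have h : (N * (L * Y * Lᵀ)).trace = (Lᵀ * N * L * Y).trace := by
      rw [show N * (L * Y * Lᵀ) = (N * L * Y) * Lᵀ by simp only [Matrix.mul_assoc],
        Matrix.trace_mul_comm]
      simp only [Matrix.mul_assoc]
    rw [h, ← hNM, Matrix.sub_mul, Matrix.trace_sub]; ring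
  -- Applied to the fixed point `P`, the same identity shows that the input `X` raises the potential
  -- by exactly the steady cost.
  have hX : (N * X).trace = (M * P).trace := by
    have h1 := hconj P
    have h2 : X = P - L * P * Lᵀ := by rw [eq_sub_iff_add_eq, add_comm]; exact hP.symm
    rw [h2, Matrix.mul_sub, Matrix.trace_sub, h1]; ring
  have key : ∀ n, ∑ t ∈ Finset.range n, (M * Q t).trace + (N * Q n).trace
      = (N * Q 0).trace + n * (M * P).trace + (N * ∑ t ∈ Finset.range n, Z t).trace := by
    intro n
    induction n with
    | zero => simp
    | succ n ih =>
      rw [Finset.sum_range_succ, Finset.sum_range_succ, hstep n, Matrix.mul_add, Matrix.mul_add,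
        Matrix.mul_add, Matrix.trace_add, Matrix.trace_add, Matrix.trace_add, hconj, hX]
      push_cast
      linarith
  -- The terminal potential is nonnegative and can be dropped.
  have := trace_mul_nonneg hN (hQ n)
  linarith [key n]

end Moments

/-! ### Error covariances of the dithered scheme -/

namespace Realization

variable {p q : ℕ} {A : Matrix (Fin p) (Fin p) ℝ} {B : Matrix (Fin p) (Fin q) ℝ} {D : ℝ}
  (R : Realization A B D) {Δ : Vec p}

/-- The joint law of initial state, noise and dither. -/
def driveDitherLaw (q : ℕ) (S0 : Matrix (Fin p) (Fin p) ℝ) (Δ : Vec p) :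
    Measure ((Vec p × (ℕ → Vec q)) × (ℕ → Vec p)) :=
  (driveLaw q S0).prod (ditherLaw Δ)

instance (S0 : Matrix (Fin p) (Fin p) ℝ) (Δ : Vec p) :
    IsProbabilityMeasure (driveDitherLaw q S0 Δ) := by unfold driveDitherLaw; infer_instance

/-- The quantization error at time `t`. -/
def qerrAt (Δ : Vec p) (t : ℕ) (a : (Vec p × (ℕ → Vec q)) × (ℕ → Vec p)) : Vec p :=
  R.qerr Δ (R.predErr Δ t a) (a.2 t)

lemma measurable_qerrAt (t : ℕ) : Measurable (R.qerrAt Δ t) := by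
  have h : Measurable fun a : (Vec p × (ℕ → Vec q)) × (ℕ → Vec p) => a.2 t := by fun_prop
  exact R.measurable_qerr Δ (R.measurable_predErr Δ t) h

section General

variable {Ω : Type*} [MeasurableSpace Ω] {μ : Measure Ω} [IsProbabilityMeasure μ]
  {φ : Ω → (Vec p × (ℕ → Vec q)) × (ℕ → Vec p)}

/-- The map `φ` lets one statement serve both for the joint law of source and dither and for the
source alone with a fixed dither path. -/
lemma sqInt_qerrAt (hΔ : ∀ i, 0 < Δ i) (hφ : Measurable φ) (t : ℕ) :
    SqInt μ (fun ω => R.qerrAt Δ t (φ ω)) := by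
  refine SqInt.of_bound ((R.measurable_qerrAt t).comp hφ) (∑ i, Δ i / 2) fun ω i => ?_
  refine (R.abs_qerr_le hΔ _ _ i).trans ?_
  exact Finset.single_le_sum (f := fun i => Δ i / 2) (fun i _ => by have := hΔ i; positivity)
    (Finset.mem_univ i)

lemma sqInt_predErr (hΔ : ∀ i, 0 < Δ i) (hφ : Measurable φ) (h0 : SqInt μ fun ω => (φ ω).1.1)
    (hw : ∀ t, SqInt μ fun ω => (φ ω).1.2 t) (t : ℕ) :
    SqInt μ (fun ω => R.predErr Δ t (φ ω)) := by
  induction t with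
  | zero => simpa [predErr, sourcePath, pred] using h0
  | succ t ih =>
    simp only [R.predErr_succ hΔ]
    exact ((ih.mulVec _).add ((R.sqInt_qerrAt hΔ hφ t).mulVec _)).add ((hw t).mulVec _)

end General

lemma sqInt_noise (S0 : Matrix (Fin p) (Fin p) ℝ) (t : ℕ) :
    SqInt (driveLaw q S0) (fun ω => ω.2 t) := by
  have h := map_of_resample (resample_noise q S0 t) (W := fun ω => ω.2 t) (by fun_prop)
    (fun ω x => by simp)
  have h2 := sqInt_noiseStep q
  rw [← h, sqInt_map (by fun_prop) measurable_id'] at h2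
  exact h2

lemma sqInt_initial' (S0 : Matrix (Fin p) (Fin p) ℝ) (Δ : Vec p) :
    SqInt (driveDitherLaw q S0 Δ) (fun a => a.1.1) := fun i =>
  (sqInt_initial q S0 i).comp_measurePreserving
    (measurePreserving_fst (μ := driveLaw q S0) (ν := ditherLaw Δ))

lemma sqInt_noise' (S0 : Matrix (Fin p) (Fin p) ℝ) (Δ : Vec p) (t : ℕ) :
    SqInt (driveDitherLaw q S0 Δ) (fun a => a.1.2 t) := fun i =>
  (sqInt_noise S0 t i).comp_measurePreserving
    (measurePreserving_fst (μ := driveLaw q S0) (ν := ditherLaw Δ))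

lemma sqInt_predErr_joint (hΔ : ∀ i, 0 < Δ i) (S0 : Matrix (Fin p) (Fin p) ℝ) (t : ℕ) :
    SqInt (driveDitherLaw q S0 Δ) (R.predErr Δ t) :=
  R.sqInt_predErr hΔ measurable_id (sqInt_initial' S0 Δ) (sqInt_noise' S0 Δ) t

lemma sqInt_predErr_path (hΔ : ∀ i, 0 < Δ i) (S0 : Matrix (Fin p) (Fin p) ℝ) (r : ℕ → Vec p)
    (t : ℕ) : SqInt (driveLaw q S0) (fun ω => R.predErr Δ t (ω, r)) :=
  R.sqInt_predErr hΔ (by fun_prop) (sqInt_initial q S0) (sqInt_noise S0) t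

lemma sqInt_qerrAt_joint (hΔ : ∀ i, 0 < Δ i) (S0 : Matrix (Fin p) (Fin p) ℝ) (t : ℕ) :
    SqInt (driveDitherLaw q S0 Δ) (R.qerrAt Δ t) :=
  R.sqInt_qerrAt hΔ measurable_id t

lemma sqInt_qerrAt_path (hΔ : ∀ i, 0 < Δ i) (S0 : Matrix (Fin p) (Fin p) ℝ) (r : ℕ → Vec p)
    (t : ℕ) : SqInt (driveLaw q S0) (fun ω => R.qerrAt Δ t (ω, r)) :=
  R.sqInt_qerrAt hΔ (by fun_prop) t

lemma resample_noise_joint (S0 : Matrix (Fin p) (Fin p) ℝ) (Δ : Vec p) (t : ℕ) :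
    MeasurePreserving (fun b : ((Vec p × (ℕ → Vec q)) × (ℕ → Vec p)) × Vec q =>
        ((b.1.1.1, Function.update b.1.1.2 t b.2), b.1.2))
      ((driveDitherLaw q S0 Δ).prod (noiseStep q)) (driveDitherLaw q S0 Δ) :=
  resample_prod_left (resample_noise q S0 t)

lemma resample_dither_joint (S0 : Matrix (Fin p) (Fin p) ℝ) (Δ : Vec p) (t : ℕ) :
    MeasurePreserving (fun b : ((Vec p × (ℕ → Vec q)) × (ℕ → Vec p)) × Vec p =>
        (b.1.1, Function.update b.1.2 t b.2))
      ((driveDitherLaw q S0 Δ).prod (ditherStep Δ)) (driveDitherLaw q S0 Δ) :=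
  resample_prod_right (measurePreserving_update (ditherStep Δ) t)

lemma crossMoment_noise (S0 : Matrix (Fin p) (Fin p) ℝ) (t : ℕ) :
    crossMoment (driveLaw q S0) (fun ω => ω.2 t) (fun ω => ω.2 t) = 1 := by
  have h := map_of_resample (resample_noise q S0 t) (W := fun ω => ω.2 t) (by fun_prop)
    (fun ω x => by simp)
  rw [← crossMoment_noiseStep, ← h, crossMoment_map (by fun_prop) measurable_id' measurable_id']

lemma integral_noise (S0 : Matrix (Fin p) (Fin p) ℝ) (t : ℕ) (j : Fin q) :
    ∫ ω, ω.2 t j ∂(driveLaw q S0) = 0 := by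
  have h := map_of_resample (resample_noise q S0 t) (W := fun ω => ω.2 t) (by fun_prop)
    (fun ω x => by simp)
  have h2 : ∫ w, w j ∂((driveLaw q S0).map fun ω => ω.2 t) = ∫ ω, ω.2 t j ∂(driveLaw q S0) :=
    integral_map (by fun_prop) (measurable_pi_apply j).aestronglyMeasurable
  rw [← h2, h, integral_noiseStep]

lemma crossMoment_noise_eq_zero {η : Type*} (S0 : Matrix (Fin p) (Fin p) ℝ) (t : ℕ)
    {u : Vec p × (ℕ → Vec q) → η → ℝ} (hum : Measurable u) (hu : SqInt (driveLaw q S0) u)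
    (h : ∀ ω w, u (ω.1, Function.update ω.2 t w) = u ω) :
    crossMoment (driveLaw q S0) u (fun ω => ω.2 t) = 0 :=
  crossMoment_eq_zero_of_indepFun
    (indepFun_of_resample (resample_noise q S0 t) (W := fun ω => ω.2 t) hum (by fun_prop)
      (fun ω w => h ω w) (fun ω x => by simp)) hu (sqInt_noise S0 t) (integral_noise S0 t)

/-- The error covariance recursion along a fixed dither path. -/
lemma crossMoment_predErr_path (hΔ : ∀ i, 0 < Δ i) (S0 : Matrix (Fin p) (Fin p) ℝ)
    (r : ℕ → Vec p) (t : ℕ) :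
    let Q := crossMoment (driveLaw q S0) (fun ω => R.predErr Δ t (ω, r))
      (fun ω => R.predErr Δ t (ω, r))
    let C := crossMoment (driveLaw q S0) (fun ω => R.predErr Δ t (ω, r))
      (fun ω => R.qerrAt Δ t (ω, r))
    let S := crossMoment (driveLaw q S0) (fun ω => R.qerrAt Δ t (ω, r))
      (fun ω => R.qerrAt Δ t (ω, r))
    let L := A * R.filt
    let G := -(A * R.E⁻¹ * diagonal (R.Θ Δ))
    crossMoment (driveLaw q S0) (fun ω => R.predErr Δ (t + 1) (ω, r))
      (fun ω => R.predErr Δ (t + 1) (ω, r))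
      = L * Q * Lᵀ + L * C * Gᵀ + (G * Cᵀ * Lᵀ + G * S * Gᵀ) + B * Bᵀ := by
  intro Q C S L G
  simp only [R.predErr_succ hΔ]
  -- Only the process noise is fresh here. With the dither frozen, the quantization error is a
  -- function of the prediction error, so `C` need not vanish and `S` need not be `diag (Δ²/12)`.
  refine crossMoment_step (R.sqInt_predErr_path hΔ S0 r t) (R.sqInt_qerrAt_path hΔ S0 r t)
    (sqInt_noise S0 t) ?_ ?_ (crossMoment_noise S0 t) _ _ _
  · refine crossMoment_noise_eq_zero S0 t ((R.measurable_predErr Δ t).comp (by fun_prop))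
      (R.sqInt_predErr_path hΔ S0 r t) fun ω w => ?_
    exact R.predErr_update_noise Δ le_rfl (ω, r) w
  · refine crossMoment_noise_eq_zero S0 t ((R.measurable_qerrAt t).comp (by fun_prop))
      (R.sqInt_qerrAt_path hΔ S0 r t) fun ω w => ?_
    have h := R.predErr_update_noise Δ (le_refl t) (ω, r) w
    simp only [qerrAt]
    rw [← h]

lemma integral_dither_joint (S0 : Matrix (Fin p) (Fin p) ℝ) (t : ℕ)
    {α : Type*} [MeasurableSpace α] {H : (Vec p × (ℕ → Vec q)) × (ℕ → Vec p) → α}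
    (hH : Measurable H) (hHt : ∀ a r, H (a.1, Function.update a.2 t r) = H a)
    {f : α → Vec p → ℝ} (hf : Measurable (Function.uncurry f))
    (hi : Integrable (fun a => f (H a) (a.2 t)) (driveDitherLaw q S0 Δ)) :
    ∫ a, f (H a) (a.2 t) ∂(driveDitherLaw q S0 Δ)
      = ∫ a, ∫ r, f (H a) r ∂(ditherStep Δ) ∂(driveDitherLaw q S0 Δ) :=
  integral_of_resample (resample_dither_joint S0 Δ t) (W := fun a => a.2 t) hH (by fun_prop)
    (fun a r => hHt a r) (fun a r => by simp) hf hi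

/-- The prediction error at time `t` does not involve the dither at time `t`. Integrating that
dither first leaves a centred quantization error. -/
lemma crossMoment_qerr_joint (hΔ : ∀ i, 0 < Δ i) (S0 : Matrix (Fin p) (Fin p) ℝ) (t : ℕ) :
    crossMoment (driveDitherLaw q S0 Δ) (R.predErr Δ t) (R.qerrAt Δ t) = 0 := by
  ext i j
  simp only [crossMoment, Matrix.of_apply, qerrAt]
  have hm : Measurable fun b : Vec p × Vec p => R.qerr Δ b.1 b.2 j :=
    (measurable_pi_apply j).comp (R.measurable_qerr Δ measurable_fst measurable_snd)
  have hm2 : Measurable fun b : Vec p × Vec p => b.1 i := by fun_prop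
  rw [integral_dither_joint (f := fun k r => k i * R.qerr Δ k r j) S0 t (R.measurable_predErr Δ t)
    (fun a r => R.predErr_update_dither Δ le_rfl a r) (hm2.mul hm)]
  · simp only [integral_const_mul, R.integral_qerr hΔ]; simp
  · exact (R.sqInt_predErr_joint hΔ S0 t).integrable_mul (R.sqInt_qerrAt_joint hΔ S0 t) i j

lemma crossMoment_qerr_qerr_joint (hΔ : ∀ i, 0 < Δ i) (S0 : Matrix (Fin p) (Fin p) ℝ) (t : ℕ) :
    crossMoment (driveDitherLaw q S0 Δ) (R.qerrAt Δ t) (R.qerrAt Δ t)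
      = diagonal (fun i => Δ i ^ 2 / 12) := by
  ext i j
  simp only [crossMoment, Matrix.of_apply, qerrAt]
  have hm : ∀ j, Measurable fun b : Vec p × Vec p => R.qerr Δ b.1 b.2 j := fun j =>
    (measurable_pi_apply j).comp (R.measurable_qerr Δ measurable_fst measurable_snd)
  rw [integral_dither_joint (f := fun k r => R.qerr Δ k r i * R.qerr Δ k r j) S0 t
    (R.measurable_predErr Δ t) (fun a r => R.predErr_update_dither Δ le_rfl a r) ((hm i).mul (hm j))]
  · simp only [R.integral_qerr_mul hΔ]; simp
  · exact (R.sqInt_qerrAt_joint hΔ S0 t).integrable_mul (R.sqInt_qerrAt_joint hΔ S0 t) i j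

/-- By `Θ_sq_mul`, quantization noise enters the loop with the covariance of the Gaussian channel
noise, so the realization's own prior covariance is a fixed point for the quantized loop as well. -/
lemma steady_state (hΔ : ∀ i, 0 < Δ i) :
    let L := A * R.filt
    let G := -(A * R.E⁻¹ * diagonal (R.Θ Δ))
    R.prior = L * R.prior * Lᵀ + (G * diagonal (fun i => Δ i ^ 2 / 12) * Gᵀ + B * Bᵀ) := by
  intro L G
  have h : G * diagonal (fun i => Δ i ^ 2 / 12) * Gᵀ
      = A * R.E⁻¹ * diagonal (fun i => R.gain i * R.δ i) * (A * R.E⁻¹)ᵀ := by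
    have h2 : diagonal (fun i => R.gain i * R.δ i)
        = diagonal (R.Θ Δ) * diagonal (fun i => Δ i ^ 2 / 12) * diagonal (R.Θ Δ) := by
      rw [diagonal_mul_diagonal, diagonal_mul_diagonal]
      congr 1; ext i; rw [← R.Θ_sq_mul hΔ]; ring
    rw [h2]
    simp only [G, Matrix.transpose_neg, Matrix.neg_mul, Matrix.mul_neg, neg_neg,
      Matrix.transpose_mul, diagonal_transpose, Matrix.mul_assoc]
  rw [h]
  exact R.prior_eq_closedLoop

lemma crossMoment_predErr_joint (hΔ : ∀ i, 0 < Δ i) (S0 : Matrix (Fin p) (Fin p) ℝ) (t : ℕ) :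
    let L := A * R.filt
    let G := -(A * R.E⁻¹ * diagonal (R.Θ Δ))
    crossMoment (driveDitherLaw q S0 Δ) (R.predErr Δ (t + 1)) (R.predErr Δ (t + 1))
      = L * crossMoment (driveDitherLaw q S0 Δ) (R.predErr Δ t) (R.predErr Δ t) * Lᵀ
        + (G * diagonal (fun i => Δ i ^ 2 / 12) * Gᵀ + B * Bᵀ) := by
  intro L G
  have hI : ∀ {u : (Vec p × (ℕ → Vec q)) × (ℕ → Vec p) → Vec p}, Measurable u →
      SqInt (driveDitherLaw q S0 Δ) u →
      (∀ a w, u ((a.1.1, Function.update a.1.2 t w), a.2) = u a) →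
      crossMoment (driveDitherLaw q S0 Δ) u (fun a => a.1.2 t) = 0 := by
    intro u hum hu h
    refine crossMoment_eq_zero_of_indepFun
      (indepFun_of_resample (resample_noise_joint S0 Δ t) (W := fun a => a.1.2 t) hum
        (by fun_prop) (fun a w => h a w) (fun ω x => by simp)) hu (sqInt_noise' S0 Δ t) fun j => ?_
    rw [← integral_noise S0 t j, ← (measurePreserving_fst (μ := driveLaw q S0)
      (ν := ditherLaw Δ)).map_eq, integral_map (by fun_prop)
      (Measurable.aestronglyMeasurable (by fun_prop))]
    rfl
  have hww : crossMoment (driveDitherLaw q S0 Δ) (fun a => a.1.2 t) (fun a => a.1.2 t) = 1 := by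
    rw [← crossMoment_noise S0 t, ← (measurePreserving_fst (μ := driveLaw q S0)
      (ν := ditherLaw Δ)).map_eq, crossMoment_map (by fun_prop) (by fun_prop) (by fun_prop)]
    rfl
  have h := crossMoment_step (R.sqInt_predErr_joint hΔ S0 t) (R.sqInt_qerrAt_joint hΔ S0 t)
    (sqInt_noise' S0 Δ t)
    (hI (R.measurable_predErr Δ t) (R.sqInt_predErr_joint hΔ S0 t)
      fun a w => R.predErr_update_noise Δ le_rfl a w)
    (hI (R.measurable_qerrAt t) (R.sqInt_qerrAt_joint hΔ S0 t) fun a w => by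
      simp only [qerrAt]; rw [R.predErr_update_noise Δ le_rfl a w]) hww L G B
  rw [R.crossMoment_qerr_joint hΔ, R.crossMoment_qerr_qerr_joint hΔ] at h
  have h2 : R.predErr Δ (t + 1) = fun ω => L *ᵥ R.predErr Δ t ω + G *ᵥ R.qerrAt Δ t ω
      + B *ᵥ ω.1.2 t := funext fun a => R.predErr_succ hΔ t a
  rw [h2, h]
  simp [add_assoc]

/-- The steady-state value of the quadratic cost `‖C k + H v‖²`. -/
def steadyCost (Δ : Vec p) {m : ℕ} (C H : Matrix (Fin m) (Fin p) ℝ) : ℝ :=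
  (C * R.prior * Cᵀ).trace + (H * diagonal (fun i => Δ i ^ 2 / 12) * Hᵀ).trace

/-- The accumulated expected cost of the scheme exceeds the steady-state value by a constant. -/
lemma exists_sum_cost_joint_le (hAB : IsStabilizable A B) (hΔ : ∀ i, 0 < Δ i)
    (S0 : Matrix (Fin p) (Fin p) ℝ) {m : ℕ} (C H : Matrix (Fin m) (Fin p) ℝ) :
    ∃ J : ℝ, 0 ≤ J ∧ ∀ n : ℕ, ∑ t ∈ Finset.range n,
      (crossMoment (driveDitherLaw q S0 Δ) (fun a => C *ᵥ R.predErr Δ t a + H *ᵥ R.qerrAt Δ t a)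
        (fun a => C *ᵥ R.predErr Δ t a + H *ᵥ R.qerrAt Δ t a)).trace
      ≤ J + n * R.steadyCost Δ C H := by
  have hM : (Cᵀ * C).PosSemidef := by
    have := Matrix.posSemidef_conjTranspose_mul_self C
    rwa [Matrix.conjTranspose_eq_transpose_of_trivial] at this
  -- The weight `CᵀC` expresses the state part of the cost; the constant `J` is the initial
  -- potential `tr (N Q₀)`.
  obtain ⟨N, hN, hNM⟩ := (R.isStable_closedLoop hAB).exists_lyapunov hM
  have hQ := fun t => posSemidef_crossMoment (R.sqInt_predErr_joint hΔ S0 t)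
  refine ⟨_, trace_mul_nonneg hN (hQ 0), fun n => ?_⟩
  have h := sum_trace_le_of_lyapunov hN hNM (R.steady_state hΔ) (Z := fun _ => 0) hQ
    (fun t => by rw [R.crossMoment_predErr_joint hΔ, add_zero]) n
  have hterm : ∀ t, (crossMoment (driveDitherLaw q S0 Δ)
      (fun a => C *ᵥ R.predErr Δ t a + H *ᵥ R.qerrAt Δ t a)
      (fun a => C *ᵥ R.predErr Δ t a + H *ᵥ R.qerrAt Δ t a)).trace
      = (Cᵀ * C * crossMoment (driveDitherLaw q S0 Δ) (R.predErr Δ t) (R.predErr Δ t)).trace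
        + (H * diagonal (fun i => Δ i ^ 2 / 12) * Hᵀ).trace := by
    intro t
    rw [crossMoment_lin (R.sqInt_predErr_joint hΔ S0 t) (R.sqInt_qerrAt_joint hΔ S0 t),
      R.crossMoment_qerr_joint hΔ, R.crossMoment_qerr_qerr_joint hΔ]
    simp only [Matrix.mul_zero, Matrix.zero_mul, Matrix.transpose_zero, add_zero, zero_add,
      Matrix.trace_add]
    rw [Matrix.trace_mul_comm, ← Matrix.mul_assoc]
  simp only [hterm, Finset.sum_add_distrib, Finset.sum_const, Finset.card_range, nsmul_eq_mul]
  have h3 : (Cᵀ * C * R.prior).trace = (C * R.prior * Cᵀ).trace := by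
    rw [Matrix.trace_mul_comm (C * R.prior), ← Matrix.mul_assoc]
  simp only [Finset.sum_const_zero, Matrix.mul_zero, Matrix.trace_zero, add_zero, h3] at h
  rw [steadyCost, mul_add]
  linarith

end Realization

/-! ### Time averages -/

lemma limsupAvg_ofReal_le {b : ℕ → ℝ} (hb : ∀ t, 0 ≤ b t) {c : ℝ}
    (h : ∀ ε > 0, ∀ᶠ n : ℕ in atTop, ∑ t ∈ Finset.range n, b t ≤ n * (c + ε)) :
    limsupAvg (fun t => ENNReal.ofReal (b t)) ≤ ENNReal.ofReal c := by
  refine ENNReal.le_of_forall_pos_le_add fun ε hε _ => ?_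
  have h1 : limsupAvg (fun t => ENNReal.ofReal (b t)) ≤ ENNReal.ofReal (c + ε) := by
    refine limsup_le_of_le (by isBoundedDefault) ?_
    have h2 := (tendsto_add_atTop_nat 1).eventually (h ε hε)
    filter_upwards [h2] with n hn
    rw [← ENNReal.ofReal_sum_of_nonneg fun t _ => hb t]
    refine ENNReal.div_le_of_le_mul ?_
    have h3 : ((n : ℝ≥0∞) + 1) = ENNReal.ofReal ((n + 1 : ℕ) : ℝ) := by
      rw [ENNReal.ofReal_natCast]; push_cast; rfl
    rw [h3, mul_comm, ← ENNReal.ofReal_mul (by positivity)]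
    exact ENNReal.ofReal_le_ofReal hn
  refine h1.trans (ENNReal.ofReal_add_le.trans ?_)
  simp

lemma limsupAvg_mono {a b : ℕ → ℝ≥0∞} (h : ∀ t, a t ≤ b t) : limsupAvg a ≤ limsupAvg b := by
  refine limsup_le_limsup (Eventually.of_forall fun n => ?_)
  exact ENNReal.div_le_div_right (Finset.sum_le_sum fun t _ => h t) _

lemma eventually_sum_le_of_le {b : ℕ → ℝ} {J c : ℝ}
    (h : ∀ n : ℕ, ∑ t ∈ Finset.range n, b t ≤ J + n * c) :
    ∀ ε > 0, ∀ᶠ n : ℕ in atTop, ∑ t ∈ Finset.range n, b t ≤ n * (c + ε) := by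
  intro ε hε
  obtain ⟨n0, hn0⟩ := exists_nat_gt (J / ε)
  filter_upwards [eventually_ge_atTop n0] with n hn
  have h1 : J < n * ε := by
    rw [div_lt_iff₀ hε] at hn0
    have : (n0 : ℝ) ≤ n := by exact_mod_cast hn
    nlinarith
  have := h n
  rw [mul_add]; linarith

/-- For nonnegative terms, averages along the squares control all averages. -/
lemma eventually_sum_le_of_squares {b : ℕ → ℝ} (hb : ∀ t, 0 ≤ b t) {c : ℝ}
    (h : ∀ ε > 0, ∀ᶠ m : ℕ in atTop, ∑ t ∈ Finset.range (m ^ 2), b t ≤ (m : ℝ) ^ 2 * (c + ε)) :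
    ∀ ε > 0, ∀ᶠ n : ℕ in atTop, ∑ t ∈ Finset.range n, b t ≤ n * (c + ε) := by
  intro ε hε
  obtain ⟨m0, hm0⟩ := eventually_atTop.1 (h (ε / 2) (half_pos hε))
  set c' := c + ε / 2 with hc'
  -- Rounding `n` up from about `s²` to `(s+1)²` costs `(2s+1) c' ≤ 3 s c'`, which is at most `s²
  -- ε/2` as soon as `6 c' ≤ s ε`.
  obtain ⟨s0, hs0⟩ := exists_nat_gt (6 * c' / ε)
  have hsum : ∀ n, 0 ≤ ∑ t ∈ Finset.range n, b t := fun n => Finset.sum_nonneg fun t _ => hb t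
  have hc0 : 0 ≤ c' := by
    have h1 := (hsum ((m0 + 1) ^ 2)).trans (hm0 (m0 + 1) (by omega))
    have : (0 : ℝ) < ((m0 + 1 : ℕ) : ℝ) ^ 2 := by positivity
    exact nonneg_of_mul_nonneg_right h1 this
  filter_upwards [eventually_ge_atTop ((max m0 (max s0 1)) ^ 2)] with n hn
  set s := Nat.sqrt n with hs
  have hsm : max m0 (max s0 1) ≤ s := Nat.le_sqrt'.2 hn
  -- Nonnegative terms make the partial sums monotone, so the next square controls the sum up to
  -- `n`.
  have h1 : ∑ t ∈ Finset.range n, b t ≤ ∑ t ∈ Finset.range ((s + 1) ^ 2), b t := by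
    refine Finset.sum_le_sum_of_subset_of_nonneg ?_ fun t _ _ => hb t
    exact Finset.range_subset_range.2 (Nat.lt_succ_sqrt' n).le
  have h2 := hm0 (s + 1) (by have := le_max_left m0 (max s0 1); omega)
  have h3 : (s : ℝ) ^ 2 ≤ n := by exact_mod_cast Nat.sqrt_le' n
  have h4 : (s0 : ℝ) ≤ s := by
    have := (le_max_left s0 1).trans (le_max_right m0 (max s0 1)); exact_mod_cast this.trans hsm
  have h5 : (1 : ℝ) ≤ s := by
    have := (le_max_right s0 1).trans (le_max_right m0 (max s0 1)); exact_mod_cast this.trans hsm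
  refine (h1.trans h2).trans ?_
  push_cast
  rw [div_lt_iff₀ hε] at hs0
  have h6 : 6 * c' ≤ s * ε := by nlinarith
  have h7 : (2 * (s : ℝ) + 1) * c' ≤ s ^ 2 * (ε / 2) := by nlinarith
  have h8 : c + ε = c' + ε / 2 := by rw [hc']; ring
  rw [h8]
  nlinarith [mul_nonneg (sub_nonneg.2 h3) (add_nonneg hc0 (half_pos hε).le)]

lemma sq_integral_le {Ω : Type*} [MeasurableSpace Ω] {μ : Measure Ω} [IsProbabilityMeasure μ]
    {f : Ω → ℝ} (hf : MemLp f 2 μ) : (∫ ω, f ω ∂μ) ^ 2 ≤ ∫ ω, f ω ^ 2 ∂μ := by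
  have h := variance_nonneg f μ
  rw [variance_eq_sub hf] at h
  simp only [Pi.pow_apply] at h
  linarith

/-! ### Distortion of the scheme, on average and along dither paths -/

namespace Realization

variable {p q : ℕ} {A : Matrix (Fin p) (Fin p) ℝ} {B : Matrix (Fin p) (Fin q) ℝ} {D : ℝ}
  (R : Realization A B D) {Δ : Vec p}

/-- The error covariance of the reproduction, as a map of prediction error and
quantization error. -/
lemma sub_recon (hΔ : ∀ i, 0 < Δ i) (t : ℕ) (a : (Vec p × (ℕ → Vec q)) × (ℕ → Vec p)) :
    sourcePath A B a.1.1 a.1.2 t - R.recon Δ (sourcePath A B a.1.1 a.1.2) a.2 t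
      = R.filt *ᵥ R.predErr Δ t a + (-(R.E⁻¹ * diagonal (R.Θ Δ))) *ᵥ R.qerrAt Δ t a := by
  rw [qerrAt, ← R.sub_innov hΔ, recon, predErr]
  abel

/-- The filtering error is `filt` applied to the prediction error plus scaled quantization noise;
its steady covariance is the decomposition of `post` in `post_eq_filt`. -/
lemma steadyCost_recon (hΔ : ∀ i, 0 < Δ i) :
    R.steadyCost Δ R.filt (-(R.E⁻¹ * diagonal (R.Θ Δ))) = R.post.trace := by
  have h2 : diagonal (fun i => R.gain i * R.δ i)
      = diagonal (R.Θ Δ) * diagonal (fun i => Δ i ^ 2 / 12) * diagonal (R.Θ Δ) := by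
    rw [diagonal_mul_diagonal, diagonal_mul_diagonal]
    congr 1; ext i; rw [← R.Θ_sq_mul hΔ]; ring
  conv_rhs => rw [R.post_eq_filt, Matrix.trace_add, h2]
  rw [steadyCost]
  simp only [Matrix.transpose_neg, Matrix.neg_mul, Matrix.mul_neg, neg_neg,
      Matrix.transpose_mul, diagonal_transpose, Matrix.mul_assoc]

lemma schemeLaw_eq_map (S0 : Matrix (Fin p) (Fin p) ℝ) (Δ : Vec p) :
    schemeLaw A B S0 Δ = (driveDitherLaw q S0 Δ).map
      fun a => (sourcePath A B a.1.1 a.1.2, a.2) := by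
  have h := Measure.map_prod_map (driveLaw q S0) (ditherLaw Δ) (measurable_sourcePath A B)
    measurable_id
  rw [Measure.map_id] at h
  rw [schemeLaw, sourceLaw_eq_map, h]
  rfl

lemma measurable_pathDither : Measurable fun a : (Vec p × (ℕ → Vec q)) × (ℕ → Vec p) =>
    (sourcePath A B a.1.1 a.1.2, a.2) :=
  ((measurable_sourcePath A B).comp measurable_fst).prodMk measurable_snd

lemma measurable_recon (t : ℕ) :
    Measurable (fun a : (ℕ → Vec p) × (ℕ → Vec p) => R.recon Δ a.1 a.2 t) := by
  have h1 : Measurable fun a : (ℕ → Vec p) × (ℕ → Vec p) => a.1 t - R.pred Δ a.1 a.2 t :=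
    Measurable.sub (by fun_prop) (R.measurable_pred Δ t)
  have h2 : Measurable fun a : (ℕ → Vec p) × (ℕ → Vec p) => a.2 t := by fun_prop
  exact (R.measurable_pred Δ t).add (R.measurable_innov Δ h1 h2)

lemma measurable_sqErr {α : Type*} [MeasurableSpace α] {f g : α → Vec p} (hf : Measurable f)
    (hg : Measurable g) : Measurable fun a => sqErr (f a) (g a) := by
  unfold sqErr
  refine ENNReal.measurable_ofReal.comp (Finset.measurable_sum _ fun i _ => ?_)
  exact (((measurable_pi_apply i).comp hf).sub ((measurable_pi_apply i).comp hg)).pow_const 2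

lemma expDistortion_eq (hΔ : ∀ i, 0 < Δ i) (S0 : Matrix (Fin p) (Fin p) ℝ) (t : ℕ) :
    R.expDistortion S0 Δ t = ENNReal.ofReal (crossMoment (driveDitherLaw q S0 Δ)
      (fun a => R.filt *ᵥ R.predErr Δ t a + (-(R.E⁻¹ * diagonal (R.Θ Δ))) *ᵥ R.qerrAt Δ t a)
      (fun a => R.filt *ᵥ R.predErr Δ t a
        + (-(R.E⁻¹ * diagonal (R.Θ Δ))) *ᵥ R.qerrAt Δ t a)).trace := by
  rw [← SqInt.lintegral_sum_sq (((R.sqInt_predErr_joint hΔ S0 t).mulVec _).add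
    ((R.sqInt_qerrAt_joint hΔ S0 t).mulVec _)), expDistortion, schemeLaw_eq_map, lintegral_map]
  · refine lintegral_congr fun a => ?_
    rw [← R.sub_recon hΔ]
    rfl
  · have h2 : Measurable fun a : (ℕ → Vec p) × (ℕ → Vec p) => a.1 t := by fun_prop
    exact measurable_sqErr h2 (R.measurable_recon t)
  · exact measurable_pathDither

/-- The dithered scheme meets the distortion constraint. -/
theorem limsupAvg_expDistortion_le (hAB : IsStabilizable A B) (hΔ : ∀ i, 0 < Δ i)
    (S0 : Matrix (Fin p) (Fin p) ℝ) :
    limsupAvg (R.expDistortion S0 Δ) ≤ ENNReal.ofReal D := by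
  obtain ⟨J, -, hJ⟩ := R.exists_sum_cost_joint_le hAB hΔ S0 R.filt (-(R.E⁻¹ * diagonal (R.Θ Δ)))
  have h : R.expDistortion S0 Δ = fun t => ENNReal.ofReal _ :=
    funext fun t => R.expDistortion_eq hΔ S0 t
  rw [h]
  refine (limsupAvg_ofReal_le (fun t => ?_) (eventually_sum_le_of_le hJ)).trans ?_
  · exact (posSemidef_crossMoment (((R.sqInt_predErr_joint hΔ S0 t).mulVec _).add
      ((R.sqInt_qerrAt_joint hΔ S0 t).mulVec _))).trace_nonneg
  · rw [R.steadyCost_recon hΔ]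
    exact ENNReal.ofReal_le_ofReal R.trace_le

/-! ### Almost every dither path is good -/

/-- Averages of functions of prediction error and dither that are centred given the prediction
error vanish for almost every dither path, even after averaging over the source. -/
lemma ae_tendsto_average_zero (hAB : IsStabilizable A B) (hΔ : ∀ i, 0 < Δ i)
    (S0 : Matrix (Fin p) (Fin p) ℝ) {f : Vec p → Vec p → ℝ}
    (hf : Measurable (Function.uncurry f)) {c : ℝ} (hc : 0 ≤ c)
    (hfc : ∀ k r, f k r ^ 2 ≤ c * (1 + ∑ i, k i ^ 2))
    (hf0 : ∀ k, ∫ r, f k r ∂(ditherStep Δ) = 0) :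
    ∀ᵐ r ∂(ditherLaw Δ), Tendsto (fun m : ℕ => (∑ t ∈ Finset.range (m ^ 2),
      ∫ ω, f (R.predErr Δ t (ω, r)) (r t) ∂(driveLaw q S0)) / (m : ℝ) ^ 2) atTop (nhds 0) := by
  set P := driveDitherLaw q S0 Δ with hP
  set d : ℕ → (Vec p × (ℕ → Vec q)) × (ℕ → Vec p) → ℝ := fun t a => f (R.predErr Δ t a) (a.2 t)
    with hd
  have hdm : ∀ t, Measurable (d t) := fun t => by
    have h : Measurable fun a : (Vec p × (ℕ → Vec q)) × (ℕ → Vec p) => a.2 t := by fun_prop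
    exact hf.comp ((R.measurable_predErr Δ t).prodMk h)
  have hbd : ∀ {Ω : Type} [MeasurableSpace Ω] {μ : Measure Ω} [IsProbabilityMeasure μ]
      {k : Ω → Vec p}, SqInt μ k → Integrable (fun ω => c * (1 + ∑ i, k ω i ^ 2)) μ := by
    intro Ω _ μ _ k hk
    exact ((integrable_const 1).add
      (integrable_finsetSum _ fun i _ => (hk i).integrable_sq)).const_mul c
  have hdL : ∀ t, MemLp (d t) 2 P := fun t => by
    rw [memLp_two_iff_integrable_sq (hdm t).aestronglyMeasurable]
    refine (hbd (R.sqInt_predErr_joint hΔ S0 t)).mono' ((hdm t).pow_const 2).aestronglyMeasurable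
      (ae_of_all _ fun a => ?_)
    rw [Real.norm_of_nonneg (sq_nonneg _)]
    exact hfc _ _
  have hdr : ∀ t r, MemLp (fun ω => d t (ω, r)) 2 (driveLaw q S0) := fun t r => by
    have hm : Measurable fun ω => d t (ω, r) := (hdm t).comp (by fun_prop)
    rw [memLp_two_iff_integrable_sq hm.aestronglyMeasurable]
    refine (hbd (R.sqInt_predErr_path hΔ S0 r t)).mono' (hm.pow_const 2).aestronglyMeasurable
      (ae_of_all _ fun a => ?_)
    rw [Real.norm_of_nonneg (sq_nonneg _)]
    exact hfc _ _
  set T : ℕ → (Vec p × (ℕ → Vec q)) × (ℕ → Vec p) → ℝ := fun n a => ∑ t ∈ Finset.range n, d t a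
    with hT
  have hTm : ∀ n, Measurable (T n) := fun n => Finset.measurable_sum _ fun t _ => hdm t
  have hTL : ∀ n, MemLp (T n) 2 P := fun n => memLp_finsetSum _ fun t _ => hdL t
  have hTr : ∀ n r, MemLp (fun ω => T n (ω, r)) 2 (driveLaw q S0) := fun n r =>
    memLp_finsetSum _ fun t _ => hdr t r
  have hTu : ∀ n a r, T n (a.1, Function.update a.2 n r) = T n a := by
    intro n a r
    simp only [hT]
    refine Finset.sum_congr rfl fun t ht => ?_
    have htn : t < n := Finset.mem_range.1 ht
    simp only [hd]
    rw [R.predErr_update_dither Δ htn.le a r, Function.update_of_ne htn.ne]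
  -- The terms are martingale differences: neither `T n` nor the prediction error at time `n`
  -- involves the dither at time `n`, over which `f` averages to zero.
  have horth : ∀ n, ∫ a, T n a * d n a ∂P = 0 := by
    intro n
    have hm2 : Measurable fun b : (ℝ × Vec p) × Vec p => f b.1.2 b.2 :=
      hf.comp (show Measurable fun b : (ℝ × Vec p) × Vec p => (b.1.2, b.2) by fun_prop)
    have hm3 : Measurable fun b : (ℝ × Vec p) × Vec p => b.1.1 := by fun_prop
    have h := integral_dither_joint (q := q) (Δ := Δ) S0 n (H := fun a => (T n a, R.predErr Δ n a))
      ((hTm n).prodMk (R.measurable_predErr Δ n)) (fun a r =>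
        Prod.ext (hTu n a r) (R.predErr_update_dither Δ le_rfl a r))
      (f := fun b r => b.1 * f b.2 r) (hm3.mul hm2) ((hTL n).integrable_mul (hdL n))
    rw [h]
    simp only [integral_const_mul, hf0]; simp
  -- With `C = 1` and `H = 0` the cost is the second moment of the prediction error, which bounds
  -- the second moment of `d t` through `hfc`. Hence these grow at most linearly in sum.
  obtain ⟨J, hJ0, hJ⟩ := R.exists_sum_cost_joint_le hAB hΔ S0 (1 : Matrix (Fin p) (Fin p) ℝ) 0
  set s := R.steadyCost Δ (1 : Matrix (Fin p) (Fin p) ℝ) 0 with hs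
  have htr : ∀ t, ∫ a, d t a ^ 2 ∂P ≤ c * (1 + (crossMoment P
      (fun a => (1 : Matrix (Fin p) (Fin p) ℝ) *ᵥ R.predErr Δ t a
        + (0 : Matrix (Fin p) (Fin p) ℝ) *ᵥ R.qerrAt Δ t a)
      (fun a => (1 : Matrix (Fin p) (Fin p) ℝ) *ᵥ R.predErr Δ t a
        + (0 : Matrix (Fin p) (Fin p) ℝ) *ᵥ R.qerrAt Δ t a)).trace) := by
    intro t
    simp only [Matrix.one_mulVec, Matrix.zero_mulVec, add_zero]
    have hk := R.sqInt_predErr_joint hΔ S0 t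
    rw [trace_crossMoment hk]
    refine (integral_mono (hdL t).integrable_sq (hbd hk) fun a => hfc _ _).trans_eq ?_
    rw [integral_const_mul, integral_add (integrable_const 1)
      (integrable_finsetSum _ fun i _ => (hk i).integrable_sq)]
    simp
  -- Pythagoras for orthogonal increments.
  have hvar : ∀ n, ∫ a, T n a ^ 2 ∂P ≤ ∑ t ∈ Finset.range n, ∫ a, d t a ^ 2 ∂P := by
    intro n
    induction n with
    | zero => simp [hT]
    | succ n ih =>
      have h1 : ∀ a, T (n + 1) a ^ 2 = T n a ^ 2 + 2 * (T n a * d n a) + d n a ^ 2 := fun a => by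
        simp only [hT, Finset.sum_range_succ]; ring
      have i1 : Integrable (fun a => 2 * (T n a * d n a)) P :=
        ((hTL n).integrable_mul (hdL n)).const_mul 2
      simp only [h1]
      have i2 : Integrable (fun a => T n a ^ 2 + 2 * (T n a * d n a)) P :=
        (hTL n).integrable_sq.add i1
      rw [integral_add i2 (hdL n).integrable_sq, integral_add (hTL n).integrable_sq i1, integral_const_mul, horth, Finset.sum_range_succ]
      linarith
  set c2 := c * (1 + J + |s|) with hc2
  have hc20 : 0 ≤ c2 := mul_nonneg hc (by positivity)
  have hvar2 : ∀ m : ℕ, ∫ a, T (m ^ 2) a ^ 2 ∂P ≤ c2 * (m : ℝ) ^ 2 := by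
    intro m
    rcases Nat.eq_zero_or_pos m with rfl | hm
    · simp [hT]
    have h1 : (1 : ℝ) ≤ (m : ℝ) ^ 2 := by
      have : (1 : ℝ) ≤ m := by exact_mod_cast hm
      nlinarith
    refine (hvar _).trans ((Finset.sum_le_sum fun t _ => htr t).trans ?_)
    rw [← Finset.mul_sum, Finset.sum_add_distrib, hc2, mul_assoc]
    refine mul_le_mul_of_nonneg_left ?_ hc
    have h2 := hJ (m ^ 2)
    push_cast at h2
    simp only [Finset.sum_const, Finset.card_range, nsmul_eq_mul, mul_one]
    push_cast
    nlinarith [le_abs_self s]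
  set g : ℕ → (ℕ → Vec p) → ℝ := fun n r => ∫ ω, T n (ω, r) ∂(driveLaw q S0) with hg
  have hgm : ∀ n, Measurable (g n) := fun n =>
    ((hTm n).stronglyMeasurable.integral_prod_left' (μ := driveLaw q S0)).measurable
  have hgs : ∀ n r, g n r = ∑ t ∈ Finset.range n, ∫ ω, d t (ω, r) ∂(driveLaw q S0) := fun n r =>
    integral_finsetSum _ fun t _ => (hdr t r).integrable (by norm_num)
  -- Averaging over the source for a fixed dither path can only decrease second moments, by Jensen's
  -- inequality.
  have hgl : ∀ n, ∫⁻ r, ENNReal.ofReal (g n r ^ 2) ∂(ditherLaw Δ)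
      ≤ ENNReal.ofReal (∫ a, T n a ^ 2 ∂P) := by
    intro n
    have h1 : ∀ r, ENNReal.ofReal (g n r ^ 2)
        ≤ ∫⁻ ω, ENNReal.ofReal (T n (ω, r) ^ 2) ∂(driveLaw q S0) := fun r => by
      rw [← ofReal_integral_eq_lintegral_ofReal (hTr n r).integrable_sq
        (ae_of_all _ fun ω => sq_nonneg _)]
      exact ENNReal.ofReal_le_ofReal (sq_integral_le (hTr n r))
    refine (lintegral_mono h1).trans_eq ?_
    rw [ofReal_integral_eq_lintegral_ofReal (hTL n).integrable_sq
      (ae_of_all _ fun ω => sq_nonneg _), hP, driveDitherLaw, lintegral_prod_symm]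
    exact (ENNReal.measurable_ofReal.comp ((hTm n).pow_const 2)).aemeasurable
  -- At time `m²` the average has second moment at most `c2 m² / m⁴ = c2 / m²`. This is summable
  -- over `m`, the reason for passing to squares; so for almost every path the squared averages are
  -- summable and tend to zero.
  have hsum : ∑' m : ℕ, ∫⁻ r, ENNReal.ofReal ((g (m ^ 2) r / (m : ℝ) ^ 2) ^ 2) ∂(ditherLaw Δ)
      ≠ ∞ := by
    have h1 : ∀ m : ℕ, ∫⁻ r, ENNReal.ofReal ((g (m ^ 2) r / (m : ℝ) ^ 2) ^ 2) ∂(ditherLaw Δ)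
        ≤ ENNReal.ofReal (c2 * (1 / (m : ℝ) ^ 2)) := by
      intro m
      have h2 : ∀ r, ENNReal.ofReal ((g (m ^ 2) r / (m : ℝ) ^ 2) ^ 2)
          = ENNReal.ofReal ((1 / (m : ℝ) ^ 2) ^ 2) * ENNReal.ofReal (g (m ^ 2) r ^ 2) := fun r => by
        rw [← ENNReal.ofReal_mul (by positivity)]; congr 1; ring
      simp only [h2]
      have h3 : Measurable fun r => ENNReal.ofReal (g (m ^ 2) r ^ 2) :=
        ENNReal.measurable_ofReal.comp ((hgm _).pow_const 2)
      rw [lintegral_const_mul _ h3]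
      refine (mul_le_mul_right ((hgl _).trans (ENNReal.ofReal_le_ofReal (hvar2 m))) _).trans ?_
      rw [← ENNReal.ofReal_mul (by positivity)]
      refine ENNReal.ofReal_le_ofReal ?_
      rcases Nat.eq_zero_or_pos m with rfl | hm
      · simp
      have : (0 : ℝ) < m := by exact_mod_cast hm
      apply le_of_eq; field_simp
    refine ne_top_of_le_ne_top ?_ (ENNReal.tsum_le_tsum h1)
    have h3 : Summable fun m : ℕ => c2 * (1 / (m : ℝ) ^ 2) :=
      (Real.summable_one_div_nat_pow.2 one_lt_two).mul_left c2
    rw [← ENNReal.ofReal_tsum_of_nonneg (fun m => by positivity) h3]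
    exact ENNReal.ofReal_ne_top
  have hmeas : ∀ m : ℕ, Measurable fun r => ENNReal.ofReal ((g (m ^ 2) r / (m : ℝ) ^ 2) ^ 2) :=
    fun m => ENNReal.measurable_ofReal.comp (((hgm _).div_const _).pow_const 2)
  rw [← lintegral_tsum fun m => (hmeas m).aemeasurable] at hsum
  filter_upwards [ae_lt_top (Measurable.tsum hmeas) hsum] with r hr
  have h1 := ENNReal.tendsto_atTop_zero_of_tsum_ne_top hr.ne
  have h2 : Tendsto (fun m : ℕ => (g (m ^ 2) r / (m : ℝ) ^ 2) ^ 2) atTop (nhds 0) := by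
    have h3 := (ENNReal.tendsto_toReal ENNReal.zero_ne_top).comp h1
    simp only [ENNReal.toReal_zero] at h3
    refine h3.congr fun m => ?_
    rw [Function.comp_apply, ENNReal.toReal_ofReal (sq_nonneg _)]
  have h4 : Tendsto (fun m : ℕ => |g (m ^ 2) r / (m : ℝ) ^ 2|) atTop (nhds 0) := by
    have h5 := (Real.continuous_sqrt.tendsto 0).comp h2
    simp only [Real.sqrt_zero] at h5
    refine h5.congr fun m => ?_
    rw [Function.comp_apply, Real.sqrt_sq_eq_abs]
  have h6 := (tendsto_zero_iff_abs_tendsto_zero _).2 h4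
  refine h6.congr fun m => ?_
  rw [hgs]

/-- For almost every dither path, the expected cost given the path averages to at most the
steady-state value. -/
theorem ae_eventually_sum_cost_le (hAB : IsStabilizable A B) (hΔ : ∀ i, 0 < Δ i)
    (S0 : Matrix (Fin p) (Fin p) ℝ) {m : ℕ} (C H : Matrix (Fin m) (Fin p) ℝ) :
    ∀ᵐ r ∂(ditherLaw Δ), ∀ ε > 0, ∀ᶠ n : ℕ in atTop, ∑ t ∈ Finset.range n,
      (crossMoment (driveLaw q S0)
        (fun ω => C *ᵥ R.predErr Δ t (ω, r) + H *ᵥ R.qerrAt Δ t (ω, r))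
        (fun ω => C *ᵥ R.predErr Δ t (ω, r) + H *ᵥ R.qerrAt Δ t (ω, r))).trace
      ≤ n * (R.steadyCost Δ C H + ε) := by
  set V : Matrix (Fin p) (Fin p) ℝ := diagonal (fun i => Δ i ^ 2 / 12) with hV
  have hqm : ∀ j, Measurable fun b : Vec p × Vec p => R.qerr Δ b.1 b.2 j := fun j =>
    (measurable_pi_apply j).comp (R.measurable_qerr Δ measurable_fst measurable_snd)
  have hqb : ∀ k r i, R.qerr Δ k r i ^ 2 ≤ (Δ i / 2) ^ 2 := fun k r i => by
    rw [← sq_abs]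
    exact pow_le_pow_left₀ (abs_nonneg _) (R.abs_qerr_le hΔ k r i) 2
  have hCae : ∀ i j, ∀ᵐ r ∂(ditherLaw Δ), Tendsto (fun m : ℕ => (∑ t ∈ Finset.range (m ^ 2),
      ∫ ω, R.predErr Δ t (ω, r) i * R.qerr Δ (R.predErr Δ t (ω, r)) (r t) j ∂(driveLaw q S0))
        / (m : ℝ) ^ 2) atTop (nhds 0) := by
    intro i j
    refine R.ae_tendsto_average_zero hAB hΔ S0 (f := fun k r => k i * R.qerr Δ k r j)
      (c := (Δ j / 2) ^ 2) ?_ (sq_nonneg _) (fun k r => ?_) fun k => ?_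
    · have : Measurable fun b : Vec p × Vec p => b.1 i := by fun_prop
      exact this.mul (hqm j)
    · rw [mul_pow, mul_comm]
      have h1 : k i ^ 2 ≤ 1 + ∑ i, k i ^ 2 := by
        have := Finset.single_le_sum (f := fun i => k i ^ 2) (fun i _ => sq_nonneg _)
          (Finset.mem_univ i)
        linarith
      exact mul_le_mul (hqb k r j) h1 (sq_nonneg _) (sq_nonneg _)
    · rw [integral_const_mul, R.integral_qerr hΔ, mul_zero]
  have hSae : ∀ i j, ∀ᵐ r ∂(ditherLaw Δ), Tendsto (fun m : ℕ => (∑ t ∈ Finset.range (m ^ 2),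
      ∫ ω, (R.qerr Δ (R.predErr Δ t (ω, r)) (r t) i * R.qerr Δ (R.predErr Δ t (ω, r)) (r t) j
        - V i j) ∂(driveLaw q S0)) / (m : ℝ) ^ 2) atTop (nhds 0) := by
    intro i j
    have hint : ∀ k, Integrable (fun r => R.qerr Δ k r i * R.qerr Δ k r j) (ditherStep Δ) := by
      intro k
      have h1 : ∀ i, MemLp (fun r => R.qerr Δ k r i) 2 (ditherStep Δ) := fun i =>
        MemLp.of_bound ((hqm i).comp (show Measurable fun r : Vec p => (k, r) by
          fun_prop)).aestronglyMeasurable (Δ i / 2) (ae_of_all _ fun r => R.abs_qerr_le hΔ k r i)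
      exact (h1 i).integrable_mul (h1 j)
    refine R.ae_tendsto_average_zero hAB hΔ S0
      (f := fun k r => R.qerr Δ k r i * R.qerr Δ k r j - V i j)
      -- From `(x - V)² ≤ 2x² + 2V²` and the bound `Δ/2` on each quantization error.
      (c := 2 * ((Δ i / 2) ^ 2 * (Δ j / 2) ^ 2) + 2 * V i j ^ 2) ?_ (by positivity)
      (fun k r => ?_) fun k => ?_
    · exact ((hqm i).mul (hqm j)).sub_const _
    · have h0 : 0 ≤ ∑ i, k i ^ 2 := Finset.sum_nonneg fun i _ => sq_nonneg _
      have h1 : (R.qerr Δ k r i * R.qerr Δ k r j) ^ 2 ≤ (Δ i / 2) ^ 2 * (Δ j / 2) ^ 2 := by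
        rw [mul_pow]
        exact mul_le_mul (hqb k r i) (hqb k r j) (sq_nonneg _) (sq_nonneg _)
      have h2 : (R.qerr Δ k r i * R.qerr Δ k r j - V i j) ^ 2
          ≤ 2 * ((Δ i / 2) ^ 2 * (Δ j / 2) ^ 2) + 2 * V i j ^ 2 := by
        nlinarith [sq_nonneg (R.qerr Δ k r i * R.qerr Δ k r j + V i j)]
      refine h2.trans (le_mul_of_one_le_right (by positivity) (by linarith))
    · rw [integral_sub (hint k) (integrable_const _), R.integral_qerr_mul hΔ]
      simp [hV]
  have hM : (Cᵀ * C).PosSemidef := by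
    have := Matrix.posSemidef_conjTranspose_mul_self C
    rwa [Matrix.conjTranspose_eq_transpose_of_trivial] at this
  obtain ⟨N, hN, hNM⟩ := (R.isStable_closedLoop hAB).exists_lyapunov hM
  filter_upwards [ae_all_iff.2 fun i => ae_all_iff.2 (hCae i),
    ae_all_iff.2 fun i => ae_all_iff.2 (hSae i)] with r hCr hSr
  set L := A * R.filt with hL
  set G := -(A * R.E⁻¹ * diagonal (R.Θ Δ)) with hG
  set Qt : ℕ → Matrix (Fin p) (Fin p) ℝ := fun t =>
    crossMoment (driveLaw q S0) (fun ω => R.predErr Δ t (ω, r)) (fun ω => R.predErr Δ t (ω, r))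
  set Ct : ℕ → Matrix (Fin p) (Fin p) ℝ := fun t =>
    crossMoment (driveLaw q S0) (fun ω => R.predErr Δ t (ω, r)) (fun ω => R.qerrAt Δ t (ω, r))
  set St : ℕ → Matrix (Fin p) (Fin p) ℝ := fun t =>
    crossMoment (driveLaw q S0) (fun ω => R.qerrAt Δ t (ω, r)) (fun ω => R.qerrAt Δ t (ω, r)) - V
    with hSt
  have hk := R.sqInt_predErr_path hΔ S0 r
  have hv := R.sqInt_qerrAt_path hΔ S0 r
  -- This linear functional collects the total effect of the deviations `Ct` and `St`: the first
  -- trace is their effect through the covariance recursion, weighted by the potential `N`, the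
  -- second their direct effect on the cost.
  set ψ : Matrix (Fin p) (Fin p) ℝ → Matrix (Fin p) (Fin p) ℝ → ℝ := fun X Y =>
    (N * (L * X * Gᵀ + (G * Xᵀ * Lᵀ + G * Y * Gᵀ))).trace
      + (C * X * Hᵀ + (H * Xᵀ * Cᵀ + H * Y * Hᵀ)).trace with hψ
  have hstep : ∀ t, Qt (t + 1) = L * Qt t * Lᵀ + (G * V * Gᵀ + B * Bᵀ)
      + (L * Ct t * Gᵀ + (G * (Ct t)ᵀ * Lᵀ + G * St t * Gᵀ)) := by
    intro t
    have h := R.crossMoment_predErr_path hΔ S0 r t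
    simp only at h
    refine h.trans ?_
    have hs : crossMoment (driveLaw q S0) (fun ω => R.qerrAt Δ t (ω, r))
      (fun ω => R.qerrAt Δ t (ω, r)) = St t + V := by simp [hSt]
    rw [hs, Matrix.mul_add, Matrix.add_mul]
    abel
  have hcost : ∀ t, (crossMoment (driveLaw q S0)
        (fun ω => C *ᵥ R.predErr Δ t (ω, r) + H *ᵥ R.qerrAt Δ t (ω, r))
        (fun ω => C *ᵥ R.predErr Δ t (ω, r) + H *ᵥ R.qerrAt Δ t (ω, r))).trace
      = (Cᵀ * C * Qt t).trace + (H * V * Hᵀ).trace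
        + (C * Ct t * Hᵀ + (H * (Ct t)ᵀ * Cᵀ + H * St t * Hᵀ)).trace := by
    intro t
    rw [crossMoment_lin (hk t) (hv t)]
    have hs : crossMoment (driveLaw q S0) (fun ω => R.qerrAt Δ t (ω, r))
      (fun ω => R.qerrAt Δ t (ω, r)) = St t + V := by simp [hSt]
    rw [hs, Matrix.mul_add, Matrix.add_mul]
    simp only [Matrix.trace_add]
    have h3 : (C * crossMoment (driveLaw q S0) (fun ω => R.predErr Δ t (ω, r))
        (fun ω => R.predErr Δ t (ω, r)) * Cᵀ).trace = (Cᵀ * C * Qt t).trace := by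
      rw [Matrix.trace_mul_comm, ← Matrix.mul_assoc]
    rw [h3]
    ring
  have hbound : ∀ n : ℕ, ∑ t ∈ Finset.range n, (crossMoment (driveLaw q S0)
        (fun ω => C *ᵥ R.predErr Δ t (ω, r) + H *ᵥ R.qerrAt Δ t (ω, r))
        (fun ω => C *ᵥ R.predErr Δ t (ω, r) + H *ᵥ R.qerrAt Δ t (ω, r))).trace
      ≤ (N * Qt 0).trace + n * R.steadyCost Δ C H
        + ψ (∑ t ∈ Finset.range n, Ct t) (∑ t ∈ Finset.range n, St t) := by
    intro n
    have h := sum_trace_le_of_lyapunov hN hNM (R.steady_state hΔ)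
      (fun t => posSemidef_crossMoment (hk t)) hstep n
    have h3 : (Cᵀ * C * R.prior).trace = (C * R.prior * Cᵀ).trace := by
      rw [Matrix.trace_mul_comm (C * R.prior), ← Matrix.mul_assoc]
    simp only [hcost, Finset.sum_add_distrib, Finset.sum_const, Finset.card_range, nsmul_eq_mul,
      ← Matrix.trace_sum, ← Matrix.mul_sum, ← Matrix.sum_mul, ← Matrix.transpose_sum] at h ⊢
    rw [h3] at h
    simp only [steadyCost, hψ]
    linarith
  have hlimC : Tendsto (fun m : ℕ => ((m : ℝ) ^ 2)⁻¹ • ∑ t ∈ Finset.range (m ^ 2), Ct t)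
      atTop (nhds 0) := by
    refine tendsto_pi_nhds.2 fun i => tendsto_pi_nhds.2 fun j => ?_
    refine (hCr i j).congr fun m => ?_
    rw [Matrix.smul_apply, Matrix.sum_apply, smul_eq_mul, div_eq_inv_mul]
    rfl
  have hlimS : Tendsto (fun m : ℕ => ((m : ℝ) ^ 2)⁻¹ • ∑ t ∈ Finset.range (m ^ 2), St t)
      atTop (nhds 0) := by
    refine tendsto_pi_nhds.2 fun i => tendsto_pi_nhds.2 fun j => ?_
    refine (hSr i j).congr fun m => ?_
    rw [Matrix.smul_apply, Matrix.sum_apply, smul_eq_mul, div_eq_inv_mul]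
    congr 1
    refine Finset.sum_congr rfl fun t _ => ?_
    refine (integral_sub ((hv t).integrable_mul (hv t) i j) (integrable_const (V i j))).trans ?_
    simp [hSt, crossMoment, qerrAt]
  -- Continuity and linearity of `ψ` turn the vanishing averages of `Ct` and `St` along squares into
  -- a vanishing average contribution.
  have hψc : Continuous fun X : Matrix (Fin p) (Fin p) ℝ × Matrix (Fin p) (Fin p) ℝ =>
      ψ X.1 X.2 := by
    simp only [hψ]; fun_prop
  have hlim : Tendsto (fun m : ℕ => ((m : ℝ) ^ 2)⁻¹ *
      ψ (∑ t ∈ Finset.range (m ^ 2), Ct t) (∑ t ∈ Finset.range (m ^ 2), St t))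
      atTop (nhds 0) := by
    have h := (hψc.tendsto (0, 0)).comp (hlimC.prodMk_nhds hlimS)
    have h0 : ψ 0 0 = 0 := by simp [hψ]
    simp only [h0] at h
    refine h.congr fun m => ?_
    simp only [Function.comp_apply, hψ, Matrix.mul_smul, Matrix.smul_mul, Matrix.transpose_smul,
      ← smul_add, Matrix.trace_smul, smul_eq_mul, mul_add]
  -- The costs are nonnegative, so bounds along squares extend to all times.
  refine eventually_sum_le_of_squares (fun t => ?_) fun ε hε => ?_
  · exact (posSemidef_crossMoment (((hk t).mulVec C).add ((hv t).mulVec H))).trace_nonneg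
  · obtain ⟨m0, hm0⟩ := exists_nat_gt ((N * Qt 0).trace / (ε / 2))
    filter_upwards [hlim.eventually (gt_mem_nhds (half_pos hε)), eventually_ge_atTop m0,
      eventually_ge_atTop 1] with m h1 h2 h3
    have h4 := hbound (m ^ 2)
    have hm1 : (1 : ℝ) ≤ m := by exact_mod_cast h3
    have hmm : (m0 : ℝ) ≤ m := by exact_mod_cast h2
    rw [div_lt_iff₀ (half_pos hε)] at hm0
    have hm2 : (0 : ℝ) < (m : ℝ) ^ 2 := by positivity
    rw [inv_mul_lt_iff₀ hm2] at h1
    push_cast at h4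
    have h5 : (N * Qt 0).trace ≤ (m : ℝ) ^ 2 * (ε / 2) := by
      have h6 : (m0 : ℝ) ≤ (m : ℝ) ^ 2 := by nlinarith
      have := mul_le_mul_of_nonneg_right h6 (half_pos hε).le
      linarith
    linarith

end Realization

/-! ### Shannon codes -/

/-- The first `l` binary digits of `x`. -/
def binaryDigits (l : ℕ) (x : ℝ) : Word :=
  (List.range l).map fun j => decide (⌊2 ^ (j + 1) * x⌋₊ % 2 = 1)

lemma length_binaryDigits (l : ℕ) (x : ℝ) : (binaryDigits l x).length = l := by
  simp [binaryDigits]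

lemma measurable_binaryDigits : Measurable fun a : ℕ × ℝ => binaryDigits a.1 a.2 := by
  refine measurable_from_prod_countable_right fun l => ?_
  have h1 : Measurable fun x : ℝ => fun j : Fin l => ⌊2 ^ ((j : ℕ) + 1) * x⌋₊ :=
    measurable_pi_lambda _ fun j => Nat.measurable_floor.comp (measurable_id.const_mul _)
  have h2 : (fun x : ℝ => binaryDigits l x)
      = (fun f : Fin l → ℕ => List.ofFn fun j => decide (f j % 2 = 1))
        ∘ fun x : ℝ => fun j : Fin l => ⌊2 ^ ((j : ℕ) + 1) * x⌋₊ := by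
    funext x
    simp only [binaryDigits, Function.comp_apply]
    refine List.ext_getElem (by simp) fun i h1 h2 => ?_
    simp
  show Measurable (fun x : ℝ => binaryDigits l x)
  rw [h2]
  exact (measurable_of_countable _).comp h1

/-- The integer `⌊2^(l+1) x⌋` is twice `⌊2^l x⌋` plus its last binary digit, so the digits determine
it by induction. -/
lemma floor_eq_of_binaryDigits {x y : ℝ} (hx1 : x < 1) (hy1 : y < 1)
    (l : ℕ) (h : ∀ j < l, (⌊2 ^ (j + 1) * x⌋₊ % 2 = 1 ↔ ⌊2 ^ (j + 1) * y⌋₊ % 2 = 1)) :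
    ⌊2 ^ l * x⌋₊ = ⌊2 ^ l * y⌋₊ := by
  induction l with
  | zero => simp [Nat.floor_eq_zero.2 hx1, Nat.floor_eq_zero.2 hy1]
  | succ l ih =>
    have ih' := ih fun j hj => h j (by omega)
    have hd : ∀ z : ℝ, ⌊2 ^ (l + 1) * z⌋₊ / 2 = ⌊2 ^ l * z⌋₊ := fun z => by
      rw [← Nat.floor_div_ofNat]
      congr 1
      rw [pow_succ]; ring
    have h1 := h l (by omega)
    have h2 := hd x
    have h3 := hd y
    omega

/-- Points at distance at least `2⁻ˡ` have different binary expansions of length `l`. -/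
lemma not_binaryDigits_prefix {x y : ℝ} (hx : 0 ≤ x) (hy1 : y < 1) {l l' : ℕ}
    (hxy : x + 2⁻¹ ^ l ≤ y) (hl : l ≤ l') :
    ¬ binaryDigits l x <+: binaryDigits l' y ∧ ¬ binaryDigits l' y <+: binaryDigits l x := by
  have hpos : (0 : ℝ) < 2⁻¹ ^ l := by positivity
  -- After scaling by `2^l` the points differ by at least one, so their integer parts differ.
  have hne : ⌊2 ^ l * x⌋₊ ≠ ⌊2 ^ l * y⌋₊ := by
    have h1 : (2 : ℝ) ^ l * x + 1 ≤ 2 ^ l * y := by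
      have := mul_le_mul_of_nonneg_left hxy (show (0 : ℝ) ≤ 2 ^ l by positivity)
      rwa [mul_add, ← mul_pow, mul_inv_cancel₀ two_ne_zero, one_pow] at this
    have h2 := Nat.floor_le_floor h1
    rw [Nat.floor_add_one (by positivity)] at h2
    omega
  have key : ¬ binaryDigits l x <+: binaryDigits l' y := by
    intro h
    apply hne
    refine floor_eq_of_binaryDigits (by linarith) hy1 l fun j hj => ?_
    have h1 := h.getElem (i := j) (by rw [length_binaryDigits]; exact hj)
    simp only [binaryDigits, List.getElem_map, List.getElem_range] at h1
    simpa using h1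
  refine ⟨key, fun h => ?_⟩
  have h1 := h.length_le
  rw [length_binaryDigits, length_binaryDigits] at h1
  exact key (h.eq_of_length (by rw [length_binaryDigits, length_binaryDigits]; omega) ▸ List.prefix_rfl)

section Shannon

variable {R S : Type*} [MeasurableSpace R] [MeasurableSpace S] [Countable S]
  [MeasurableSingletonClass S]

/-- Every conditional distribution on a countable alphabet has a Shannon code. -/
theorem exists_isShannonCode (κ : Kernel R S) [IsMarkovKernel κ] :
    ∃ code : R → S → Word, IsShannonCode κ code := by
  classical
  obtain ⟨e, he⟩ := exists_injective_nat S
  set l : R → S → ℕ := fun r b => ⌈-Real.logb 2 ((κ r).real {b})⌉₊ with hl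
  -- Shannon's construction: symbols are ordered by codeword length, ties being broken by an
  -- enumeration `e`. The word of `b` is the first `l` binary digits of the total weight `c` of its
  -- predecessors. Defining `c` as a sum over all predecessors avoids sorting the alphabet and keeps
  -- it measurable in `r`.
  set prec : R → S → S → Prop := fun r b b' => l r b < l r b' ∨ (l r b = l r b' ∧ e b < e b')
    with hprec
  -- Dyadic weights in place of the probabilities; null symbols get no weight, since their nominal
  -- length is zero and would spoil the Kraft sum.
  set w : R → S → ℝ≥0∞ := fun r b => if κ r {b} = 0 then 0 else 2⁻¹ ^ l r b with hw
  set c : R → S → ℝ≥0∞ := fun r b => ∑' b', if prec r b' b then w r b' else 0 with hc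
  have hwle : ∀ r b, w r b ≤ κ r {b} := by
    intro r b
    simp only [hw]
    split_ifs with h
    · exact zero_le
    · have hp : 0 < (κ r).real {b} := ENNReal.toReal_pos h (measure_ne_top _ _)
      have h1 : -Real.logb 2 ((κ r).real {b}) ≤ (l r b : ℝ) := Nat.le_ceil _
      have h2 : (2⁻¹ : ℝ) ^ l r b ≤ (κ r).real {b} := by
        rw [← Real.rpow_natCast, Real.inv_rpow two_pos.le, ← Real.rpow_neg two_pos.le,
          ← Real.le_logb_iff_rpow_le one_lt_two hp]
        linarith
      have h3 : (2⁻¹ : ℝ≥0∞) ^ l r b = ENNReal.ofReal ((2⁻¹ : ℝ) ^ l r b) := by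
        rw [ENNReal.ofReal_pow (by norm_num), ENNReal.ofReal_inv_of_pos two_pos]; simp
      rw [h3]
      exact (ENNReal.ofReal_le_ofReal h2).trans_eq (ofReal_measureReal (measure_ne_top _ _))
  have htot : ∀ r, ∑' b, w r b ≤ 1 := by
    intro r
    refine (ENNReal.tsum_le_tsum (hwle r)).trans ?_
    have h := lintegral_countable' (μ := κ r) (fun _ : S => (1 : ℝ≥0∞))
    simp only [lintegral_const, measure_univ, one_mul] at h
    exact h.ge
  have hlm : ∀ b, Measurable fun r => l r b := fun b =>
    Nat.measurable_ceil.comp (((Real.measurable_log.comp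
      (κ.measurable_coe (measurableSet_singleton b)).ennreal_toReal).div_const (Real.log 2)).neg)
  have hset : ∀ b, MeasurableSet {r | κ r {b} = 0} := fun b =>
    (κ.measurable_coe (measurableSet_singleton b)) (measurableSet_singleton 0)
  have hwm : ∀ b, Measurable fun r => w r b := fun b =>
    Measurable.ite (hset b) measurable_const
      ((measurable_of_countable fun n : ℕ => (2⁻¹ : ℝ≥0∞) ^ n).comp (hlm b))
  have hcm : ∀ b, Measurable fun r => c r b := fun b => by
    refine Measurable.tsum fun b' => Measurable.ite ?_ (hwm b') measurable_const
    simp only [hprec]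
    exact (measurableSet_lt (hlm b') (hlm b)).union
      ((measurableSet_eq_fun (hlm b') (hlm b)).inter (MeasurableSet.const _))
  have hcle : ∀ r b, c r b ≤ 1 := fun r b =>
    (ENNReal.tsum_le_tsum fun b' => by split_ifs <;> simp).trans (htot r)
  have hirr : ∀ r b, ¬ prec r b b := fun r b h => by simp [hprec] at h
  have htrans : ∀ r b b' b'', prec r b b' → prec r b' b'' → prec r b b'' := by
    intro r b b' b'' h1 h2
    simp only [hprec] at h1 h2 ⊢
    omega
  -- The predecessors of `b`, together with `b` itself, precede `b'`, so the intervals `[c, c + w)`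
  -- do not overlap.
  have hstep : ∀ r b b', prec r b b' → c r b + w r b ≤ c r b' := by
    intro r b b' h
    have h1 : w r b = ∑' b'', if b'' = b then w r b'' else 0 := by
      rw [tsum_eq_single b fun b'' hb => if_neg hb, if_pos rfl]
    rw [h1, hc]
    simp only
    rw [← ENNReal.tsum_add]
    refine ENNReal.tsum_le_tsum fun b'' => ?_
    by_cases h2 : b'' = b
    · subst h2; simp [hirr, h]
    · by_cases h3 : prec r b'' b
      · simp [h2, h3, htrans r _ _ _ h3 h]
      · simp [h2, h3]
  have hlast : ∀ r b, c r b + w r b ≤ 1 := by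
    intro r b
    have h1 : w r b = ∑' b'', if b'' = b then w r b'' else 0 := by
      rw [tsum_eq_single b fun b'' hb => if_neg hb, if_pos rfl]
    refine le_trans ?_ (htot r)
    rw [h1, hc]
    simp only
    rw [← ENNReal.tsum_add]
    refine ENNReal.tsum_le_tsum fun b'' => ?_
    by_cases h2 : b'' = b
    · subst h2; simp [hirr]
    · simp only [h2, if_false, add_zero]; split_ifs <;> simp
  have hwR : ∀ r b, κ r {b} ≠ 0 → (w r b).toReal = 2⁻¹ ^ l r b := fun r b h => by
    simp [hw, h]
  have hwfin : ∀ r b, w r b ≠ ∞ := fun r b =>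
    ne_top_of_le_ne_top ENNReal.one_ne_top (le_add_self.trans (hlast r b))
  have hcfin : ∀ r b, c r b ≠ ∞ := fun r b => ne_top_of_le_ne_top ENNReal.one_ne_top (hcle r b)
  have hlt1 : ∀ r b, κ r {b} ≠ 0 → (c r b).toReal < 1 := by
    intro r b h
    have h1 := ENNReal.toReal_mono ENNReal.one_ne_top (hlast r b)
    rw [ENNReal.toReal_add (hcfin r b) (hwfin r b), hwR r b h, ENNReal.toReal_one] at h1
    have : (0 : ℝ) < 2⁻¹ ^ l r b := by positivity
    linarith
  have hsep : ∀ r b b', κ r {b} ≠ 0 → prec r b b' →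
      (c r b).toReal + 2⁻¹ ^ l r b ≤ (c r b').toReal := by
    intro r b b' h hp
    rw [← hwR r b h, ← ENNReal.toReal_add (hcfin r b) (hwfin r b)]
    exact ENNReal.toReal_mono (hcfin r b') (hstep r b b' hp)
  have hple : ∀ r b b', prec r b b' → l r b ≤ l r b' := by
    intro r b b' h
    simp only [hprec] at h
    omega
  refine ⟨fun r b => binaryDigits (l r b) (c r b).toReal, ?_, ?_, ?_⟩
  · refine measurable_from_prod_countable_left fun b => ?_
    exact measurable_binaryDigits.comp ((hlm b).prodMk (hcm b).ennreal_toReal)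
  · intro r b b' hb hb' hpre
    by_contra hne
    have h0 : e b ≠ e b' := fun h => hne (he h)
    have h1 : prec r b b' ∨ prec r b' b := by
      simp only [hprec]; omega
    rcases h1 with h1 | h1
    · exact (not_binaryDigits_prefix ENNReal.toReal_nonneg (hlt1 r b' hb') (hsep r b b' hb h1)
        (hple r b b' h1)).1 hpre
    · exact (not_binaryDigits_prefix ENNReal.toReal_nonneg (hlt1 r b hb) (hsep r b' b hb' h1)
        (hple r b' b h1)).2 hpre
  · intro r b _
    exact length_binaryDigits _ _

end Shannon

/-! ### Lengths of Shannon codes designed for a mismatched distribution -/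

section Mismatch

variable {R S : Type*} [MeasurableSpace R] [MeasurableSpace S]

lemma IsShannonCode.length_le {κ : Kernel R S} [IsMarkovKernel κ] {code : R → S → Word}
    (h : IsShannonCode κ code) {r : R} {b : S} (hb : κ r {b} ≠ 0) :
    ((code r b).length : ℝ) ≤ 1 - Real.logb 2 ((κ r).real {b}) := by
  rw [h.length_eq r b hb]
  have h1 : 0 ≤ -Real.logb 2 ((κ r).real {b}) := by
    rw [neg_nonneg]
    exact Real.logb_nonpos one_lt_two measureReal_nonneg measureReal_le_one
  have := (Nat.ceil_lt_add_one h1).le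
  linarith

/-- The tangent bound `log z ≤ z - 1`. Its remainder is linear in `y/x`, so that in expectation only
the total mass of the mismatched distribution enters. -/
lemma neg_logb_le {x y : ℝ} (hx : 0 < x) (hy : 0 < y) :
    -Real.logb 2 x ≤ -Real.logb 2 y + (y / x - 1) / Real.log 2 := by
  have h2 : 0 < Real.log 2 := Real.log_pos one_lt_two
  have h := Real.log_le_sub_one_of_pos (div_pos hy hx)
  rw [Real.log_div hy.ne' hx.ne'] at h
  simp only [Real.logb]
  rw [← neg_div, ← neg_div, ← add_div]
  gcongr
  linarith

variable [Countable S] [MeasurableSingletonClass S] [StandardBorelSpace S] [Nonempty S]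
  {Ω : Type*} [MeasurableSpace Ω] {P : Measure Ω} [IsProbabilityMeasure P]

/-- The expected length of a Shannon code is at most one bit more than the expected logarithmic
loss of any other family of subprobability mass functions. -/
lemma lintegral_length_le {b : Ω → S} {r : Ω → R} (hb : Measurable b) (hr : Measurable r)
    {code : R → S → Word} (hcode : IsShannonCode (condDistrib b r P) code)
    {g : S → R → ℝ} (hg0 : ∀ s x, 0 < g s x) (hgm : ∀ s, Measurable (g s))
    (hg1 : ∫⁻ x, ∑' s, ENNReal.ofReal (g s x) ∂(P.map r) ≤ 1)
    (hi : Integrable (fun ω => -Real.logb 2 (g (b ω) (r ω))) P) :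
    0 ≤ 1 + ∫ ω, -Real.logb 2 (g (b ω) (r ω)) ∂P ∧
      ∫⁻ ω, ((code (r ω) (b ω)).length : ℝ≥0∞) ∂P
        ≤ ENNReal.ofReal (1 + ∫ ω, -Real.logb 2 (g (b ω) (r ω)) ∂P) := by
  set κ := condDistrib b r P with hκ
  have hl2 : 0 < Real.log 2 := Real.log_pos one_lt_two
  have hpm : IsProbabilityMeasure (P.map r) := Measure.isProbabilityMeasure_map hr.aemeasurable
  have hjoint : P.map (fun ω => (r ω, b ω)) = P.map r ⊗ₘ κ :=
    (compProd_map_condDistrib hb.aemeasurable).symm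
  have hκm : Measurable fun a : R × S => κ a.1 {a.2} :=
    measurable_from_prod_countable_left fun s => κ.measurable_coe (measurableSet_singleton s)
  have hgm' : Measurable fun a : R × S => g a.2 a.1 :=
    measurable_from_prod_countable_left fun s => hgm s
  -- On a countable alphabet, symbols of conditional probability zero almost surely never occur; no
  -- property of their codewords is needed.
  have hpos : ∀ᵐ ω ∂P, κ (r ω) {b ω} ≠ 0 := by
    have hset : MeasurableSet {a : R × S | κ a.1 {a.2} ≠ 0} :=
      (hκm (measurableSet_singleton 0)).compl
    have h1 : ∀ᵐ a ∂(P.map r ⊗ₘ κ), κ a.1 {a.2} ≠ 0 := by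
      refine Measure.ae_compProd_of_ae_ae hset (ae_of_all _ fun x => ?_)
      rw [ae_iff]
      simp only [ne_eq, not_not]
      rw [← Set.biUnion_of_singleton {a | κ x {a} = 0}]
      exact (measure_biUnion_null_iff (Set.to_countable _)).2 fun s hs => hs
    rw [← hjoint, ae_map_iff (hr.prodMk hb).aemeasurable hset] at h1
    exact h1
  set h : R × S → ℝ≥0∞ := fun a => if κ a.1 {a.2} = 0 then 0 else
    ENNReal.ofReal (g a.2 a.1) / κ a.1 {a.2} with hh
  have hhm : Measurable h := Measurable.ite (hκm (measurableSet_singleton 0)) measurable_const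
    ((ENNReal.measurable_ofReal.comp hgm').div hκm)
  -- The conditional probabilities cancel and leave the mean total mass of `g`. Only this mean over
  -- `r` has to be at most one, not the mass for each `r`.
  have hh1 : ∫⁻ ω, h (r ω, b ω) ∂P ≤ 1 := by
    rw [← lintegral_map (μ := P) hhm (hr.prodMk hb), hjoint, Measure.lintegral_compProd hhm]
    refine (lintegral_mono fun x => ?_).trans hg1
    rw [lintegral_countable']
    refine ENNReal.tsum_le_tsum fun s => ?_
    simp only [hh]
    split_ifs with h0
    · simp
    · exact (ENNReal.div_mul_cancel h0 (measure_ne_top _ _)).le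
  have hhm2 : Measurable fun ω => h (r ω, b ω) := hhm.comp (hr.prodMk hb)
  have hGi : Integrable (fun ω => (h (r ω, b ω)).toReal) P :=
    integrable_toReal_of_lintegral_ne_top hhm2.aemeasurable
      (ne_top_of_le_ne_top ENNReal.one_ne_top hh1)
  have hG1 : ∫ ω, (h (r ω, b ω)).toReal ∂P ≤ 1 := by
    rw [integral_toReal hhm2.aemeasurable (ae_lt_top hhm2
      (ne_top_of_le_ne_top ENNReal.one_ne_top hh1))]
    exact ENNReal.toReal_mono ENNReal.one_ne_top hh1
  set U : Ω → ℝ := fun ω => 1 + (-Real.logb 2 (g (b ω) (r ω))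
    + ((h (r ω, b ω)).toReal - 1) / Real.log 2) with hU
  have hU1 : ∀ᵐ ω ∂P, ((code (r ω) (b ω)).length : ℝ) ≤ U ω := by
    filter_upwards [hpos] with ω hω
    have h1 := hcode.length_le hω
    have hp : 0 < (κ (r ω)).real {b ω} := ENNReal.toReal_pos hω (measure_ne_top _ _)
    have h2 := neg_logb_le hp (hg0 (b ω) (r ω))
    have h3 : (h (r ω, b ω)).toReal = g (b ω) (r ω) / (κ (r ω)).real {b ω} := by
      simp only [hh, if_neg hω, ENNReal.toReal_div, ENNReal.toReal_ofReal (hg0 _ _).le]; rfl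
    simp only [hU, h3]
    linarith
  have i1 : Integrable (fun ω => ((h (r ω, b ω)).toReal - 1) / Real.log 2) P :=
    (hGi.sub (integrable_const 1)).div_const _
  have i2 : Integrable (fun ω => -Real.logb 2 (g (b ω) (r ω))
      + ((h (r ω, b ω)).toReal - 1) / Real.log 2) P := hi.add i1
  have hUi : Integrable U P := (integrable_const 1).add i2
  have hUle : ∫ ω, U ω ∂P ≤ 1 + ∫ ω, -Real.logb 2 (g (b ω) (r ω)) ∂P := by
    simp only [hU]
    rw [integral_add (integrable_const 1) i2, integral_add hi i1, integral_div,
      integral_sub hGi (integrable_const 1)]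
    simp only [integral_const, probReal_univ, one_smul]
    have : (∫ ω, (h (r ω, b ω)).toReal ∂P - 1) / Real.log 2 ≤ 0 :=
      div_nonpos_of_nonpos_of_nonneg (by linarith) hl2.le
    linarith
  have hU0 : 0 ≤ᵐ[P] U := by
    filter_upwards [hU1] with ω hω
    exact (Nat.cast_nonneg _).trans hω
  refine ⟨(integral_nonneg_of_ae hU0).trans hUle, ?_⟩
  refine le_trans (lintegral_mono_ae (g := fun ω => ENNReal.ofReal (U ω)) ?_) ?_
  · filter_upwards [hU1] with ω hω
    rw [← ENNReal.ofReal_natCast]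
    exact ENNReal.ofReal_le_ofReal hω
  · rw [← ofReal_integral_eq_lintegral_ofReal hUi hU0]
    exact ENNReal.ofReal_le_ofReal hUle

end Mismatch

/-! ### The Gaussian reference distribution of the quantizer output -/

lemma ditherMarginal_eq {s : ℝ} (hs : 0 < s) :
    ditherMarginal s = ENNReal.ofReal s⁻¹ • volume.restrict (Set.Ioo (-s / 2) (s / 2)) := by
  have h1 : Set.Ioo (-1 / 2 : ℝ) (1 / 2) = (fun u => s * u) ⁻¹' Set.Ioo (-s / 2) (s / 2) := by
    ext u
    simp only [Set.mem_Ioo, Set.mem_preimage]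
    constructor
    · rintro ⟨h1, h2⟩; constructor <;> nlinarith
    · rintro ⟨h1, h2⟩; constructor <;> by_contra! h3 <;> nlinarith
  rw [ditherMarginal, h1, ← Measure.restrict_map (by fun_prop) measurableSet_Ioo,
    ← Measure.restrict_smul]
  congr 1
  rw [Real.map_volume_mul_left hs.ne', abs_of_pos (inv_pos.2 hs)]

/-- The density on the grid `s ℤ - r` induced by a centred Gaussian. -/
def gridDensity (s v : ℝ) (b : ℤ) (r : ℝ) : ℝ := s * gaussianPDFReal 0 v.toNNReal (s * b - r)

lemma gridDensity_pos {s v : ℝ} (hs : 0 < s) (hv : 0 < v) (b : ℤ) (r : ℝ) :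
    0 < gridDensity s v b r :=
  mul_pos hs (gaussianPDFReal_pos _ _ _ (by simpa using hv))

lemma measurable_gridDensity (s v : ℝ) (b : ℤ) : Measurable (gridDensity s v b) :=
  ((measurable_gaussianPDFReal 0 v.toNNReal).comp (measurable_const.sub measurable_id)).const_mul s

/-- While the dither runs uniformly over a cell, `s b - r` sweeps the cell around `s b`, so the mean
of `s` times the density is the Gaussian mass of that cell. The open cell lies in the preimage of
`b` under rounding, hence the inequality. -/
lemma lintegral_gridDensity_le {s v : ℝ} (hs : 0 < s) (hv : 0 < v) (b : ℤ) :
    ∫⁻ r, ENNReal.ofReal (gridDensity s v b r) ∂(ditherMarginal s)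
      ≤ ((gaussianReal 0 v.toNNReal).map fun x => quantIndex s x) {b} := by
  have hqm : Measurable fun x => quantIndex s x :=
    measurable_round_real.comp (measurable_id.div_const s)
  set T := Set.Ioo (s * b - s / 2) (s * b + s / 2) with hT
  have h1 : Set.Ioo (-s / 2) (s / 2) = (fun r => s * b - r) ⁻¹' T := by
    ext r
    simp only [hT, Set.mem_Ioo, Set.mem_preimage]
    constructor <;> rintro ⟨h1, h2⟩ <;> constructor <;> linarith
  have h2 : ∀ r, ENNReal.ofReal (gridDensity s v b r)
      = ENNReal.ofReal s * gaussianPDF 0 v.toNNReal (s * b - r) := fun r => by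
    rw [gridDensity, ENNReal.ofReal_mul hs.le]; rfl
  simp only [h2]
  have hpm : Measurable fun r : ℝ => gaussianPDF 0 v.toNNReal (s * b - r) :=
    (measurable_gaussianPDF _ _).comp (measurable_const.sub measurable_id)
  rw [lintegral_const_mul _ hpm, ditherMarginal_eq hs, lintegral_smul_measure, smul_eq_mul,
    ← mul_assoc, ← ENNReal.ofReal_mul hs.le, mul_inv_cancel₀ hs.ne', ENNReal.ofReal_one, one_mul,
    h1, (Measure.measurePreserving_sub_left volume (s * b)).setLIntegral_comp_preimage
      measurableSet_Ioo (measurable_gaussianPDF _ _), ← gaussianReal_apply 0 (by simpa using hv),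
    Measure.map_apply hqm (measurableSet_singleton b)]
  refine measure_mono fun x hx => ?_
  simp only [Set.mem_preimage, Set.mem_singleton_iff, quantIndex]
  rw [round_eq, Int.floor_eq_iff]
  obtain ⟨h3, h4⟩ := hx
  constructor
  · rw [← sub_le_iff_le_add, le_div_iff₀ hs]; linarith
  · rw [← lt_sub_iff_add_lt, div_lt_iff₀ hs]; linarith

lemma lintegral_prod_pi {n : ℕ} {μ : Fin n → Measure ℝ}
    [∀ i, SigmaFinite (μ i)] {f : Fin n → ℝ → ℝ≥0∞} (hf : ∀ i, Measurable (f i)) :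
    ∫⁻ x, ∏ i, f i (x i) ∂(Measure.pi μ) = ∏ i, ∫⁻ x, f i x ∂(μ i) := by
  induction n with
  | zero => simp
  | succ n ih =>
    have hm : ∀ i, Measurable fun x : Fin n → ℝ => f (Fin.succ i) (x i) := fun i =>
      (hf _).comp (measurable_pi_apply i)
    rw [← (measurePreserving_piFinSuccAbove μ 0).symm.lintegral_comp_emb
      (MeasurableEquiv.measurableEmbedding _)]
    simp only [Fin.prod_univ_succ]
    have h := lintegral_prod_mul (μ := μ 0) (ν := Measure.pi fun i : Fin n => μ (Fin.succ i))
      (f := f 0) (g := fun x => ∏ i : Fin n, f (Fin.succ i) (x i)) (hf 0).aemeasurable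
      (Finset.measurable_prod _ fun i _ => hm i).aemeasurable
    rw [ih fun i => hf _] at h
    exact h

/-- Averaged over the dither, the grid masses are dominated by the law of a quantized Gaussian
vector, whose total mass is one. -/
lemma lintegral_tsum_gridDensity_le {p : ℕ} {Δ v : Vec p} (hΔ : ∀ i, 0 < Δ i)
    (hv : ∀ i, 0 < v i) :
    ∫⁻ r, ∑' b : Fin p → ℤ, ENNReal.ofReal (∏ i, gridDensity (Δ i) (v i) (b i) (r i))
      ∂(ditherStep Δ) ≤ 1 := by
  set ν : Fin p → Measure ℤ := fun i =>
    (gaussianReal 0 (v i).toNNReal).map fun x => quantIndex (Δ i) x with hν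
  have hνp : ∀ i, IsProbabilityMeasure (ν i) := fun i =>
    Measure.isProbabilityMeasure_map
      (measurable_round_real.comp (measurable_id.div_const (Δ i))).aemeasurable
  have hm : ∀ b : Fin p → ℤ, ∀ i, Measurable fun r : ℝ =>
      ENNReal.ofReal (gridDensity (Δ i) (v i) (b i) r) := fun b i =>
    ENNReal.measurable_ofReal.comp (measurable_gridDensity _ _ _)
  have h0 : ∀ (b : Fin p → ℤ) (r : Vec p),
      ENNReal.ofReal (∏ i, gridDensity (Δ i) (v i) (b i) (r i))
      = ∏ i, ENNReal.ofReal (gridDensity (Δ i) (v i) (b i) (r i)) := fun b r =>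
    ENNReal.ofReal_prod_of_nonneg fun i _ => (gridDensity_pos (hΔ i) (hv i) _ _).le
  simp only [h0]
  have hm2 : ∀ b : Fin p → ℤ, Measurable fun r : Vec p =>
      ∏ i, ENNReal.ofReal (gridDensity (Δ i) (v i) (b i) (r i)) := fun b =>
    Finset.measurable_prod _ fun i _ => (hm b i).comp (measurable_pi_apply i)
  rw [lintegral_tsum fun b => (hm2 b).aemeasurable]
  have h1 := lintegral_countable' (μ := Measure.pi ν) (fun _ : Fin p → ℤ => (1 : ℝ≥0∞))
  simp only [lintegral_const, measure_univ, one_mul] at h1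
  rw [h1]
  refine ENNReal.tsum_le_tsum fun b => ?_
  rw [Measure.pi_singleton, ditherStep, lintegral_prod_pi (hm b)]
  exact Finset.prod_le_prod' fun i _ => lintegral_gridDensity_le (hΔ i) (hv i) (b i)

/-- Measuring the variance in units of `s²/12` removes the step size from the constant: `2π (s²/12)
ρ / s² = πρ/6`. -/
lemma neg_logb_gridDensity {s ρ : ℝ} (hs : 0 < s) (hρ : 0 < ρ) (b : ℤ) (r : ℝ) :
    -Real.logb 2 (gridDensity s (s ^ 2 / 12 * ρ) b r)
      = 1 / 2 * Real.logb 2 (Real.pi * ρ / 6)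
        + (s * b - r) ^ 2 / (2 * (s ^ 2 / 12 * ρ) * Real.log 2) := by
  have hl2 : 0 < Real.log 2 := Real.log_pos one_lt_two
  have hv : 0 < s ^ 2 / 12 * ρ := by positivity
  have hpi := Real.pi_pos
  have h1 : Real.log (gridDensity s (s ^ 2 / 12 * ρ) b r)
      = Real.log s + (-(1 / 2) * Real.log (2 * Real.pi * (s ^ 2 / 12 * ρ))
        - (s * b - r) ^ 2 / (2 * (s ^ 2 / 12 * ρ))) := by
    rw [gridDensity, gaussianPDFReal, Real.log_mul hs.ne' (by positivity),
      Real.log_mul (by positivity) (Real.exp_pos _).ne', Real.log_exp, Real.log_inv,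
      Real.log_sqrt (by positivity), Real.coe_toNNReal _ hv.le]
    ring
  have h2 : Real.log (2 * Real.pi * (s ^ 2 / 12 * ρ))
      = 2 * Real.log s + Real.log (Real.pi * ρ / 6) := by
    rw [show 2 * Real.pi * (s ^ 2 / 12 * ρ) = s ^ 2 * (Real.pi * ρ / 6) by ring,
      Real.log_mul (by positivity) (by positivity), Real.log_pow]
    norm_num
  simp only [Real.logb]
  rw [h1, h2]
  field_simp
  ring

/-! ### The logarithmic loss of the quantizer output -/

namespace Realization

variable {p q : ℕ} {A : Matrix (Fin p) (Fin p) ℝ} {B : Matrix (Fin p) (Fin q) ℝ} {D : ℝ}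
  (R : Realization A B D) {Δ : Vec p}

/-- The ratio of prior and posterior variance; one in the degenerate coordinates. -/
def ratio (i : Fin p) : ℝ := if R.lam i = 0 then 1 else R.lam i / R.δ i

lemma δ_pos {i : Fin p} (h : R.lam i ≠ 0) : 0 < R.δ i :=
  lt_of_le_of_ne (R.δ_nonneg i) fun h0 => h (R.lam_eq_zero i h0.symm)

lemma one_le_ratio (i : Fin p) : 1 ≤ R.ratio i := by
  unfold ratio
  split_ifs with h
  · exact le_rfl
  · rw [le_div_iff₀ (R.δ_pos h), one_mul]; exact R.δ_le_lam i

lemma logb_ratio (i : Fin p) : Real.logb 2 (R.ratio i) = Real.logb 2 (R.lam i / R.δ i) := by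
  unfold ratio
  split_ifs with h
  · simp [h]
  · rfl

/-- The variance of the quantizer output in the steady state. -/
def outVar (Δ : Vec p) (i : Fin p) : ℝ := Δ i ^ 2 / 12 * R.ratio i

lemma outVar_pos (hΔ : ∀ i, 0 < Δ i) (i : Fin p) : 0 < R.outVar Δ i := by
  have h1 := hΔ i
  have h2 := R.one_le_ratio i
  unfold outVar
  positivity

/-- The steady variance of the quantizer output is signal plus noise. With `V = Δ²/12`, `Φ² = H V /
δ` and `H λ = λ - δ` they add up to `V λ / δ`. If `Θ = 0`, only the noise remains, and the ratio is
at least one. -/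
lemma Φ_sq_mul_add_le (hΔ : ∀ i, 0 < Δ i) (i : Fin p) :
    R.Φ Δ i ^ 2 * R.lam i + Δ i ^ 2 / 12 ≤ R.outVar Δ i := by
  have hV : 0 < Δ i ^ 2 / 12 := by have := hΔ i; positivity
  have h1 := R.one_le_ratio i
  by_cases h : R.Θ Δ i = 0
  · simp only [Φ, h, _root_.inv_zero, zero_mul, outVar]
    nlinarith
  · have h0 : 0 ≤ R.H i * R.δ i * (Δ i ^ 2 / 12)⁻¹ :=
      mul_nonneg (mul_nonneg (R.H_nonneg i) (R.δ_nonneg i)) (inv_nonneg.2 hV.le)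
    have h2 : R.Θ Δ i ^ 2 = R.H i * R.δ i * (Δ i ^ 2 / 12)⁻¹ := by rw [Θ, Real.sq_sqrt h0]
    have h3 : R.H i * R.δ i * (Δ i ^ 2 / 12)⁻¹ ≠ 0 := by
      rw [← h2]; exact pow_ne_zero 2 h
    have hH : R.H i ≠ 0 := fun h4 => h3 (by simp [h4])
    have hδ : R.δ i ≠ 0 := fun h4 => h3 (by simp [h4])
    have hl : R.lam i ≠ 0 := fun h4 => hδ (le_antisymm (h4 ▸ R.δ_le_lam i) (R.δ_nonneg i))
    have h5 : R.Φ Δ i ^ 2 = R.H i * (Δ i ^ 2 / 12) / R.δ i := by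
      rw [Φ, mul_pow, inv_pow, h2]
      field_simp
    have h6 : R.H i * R.lam i = R.lam i - R.δ i := by
      rw [H, sub_mul, div_mul_cancel₀ _ hl, one_mul]
    rw [h5, outVar, ratio, if_neg hl]
    apply le_of_eq
    field_simp
    linear_combination (Δ i ^ 2) * h6

/-- The Gaussian reference probability mass function of the quantizer output, given the
dither. -/
def refMass (Δ : Vec p) (b : Fin p → ℤ) (r : Vec p) : ℝ :=
  ∏ i, gridDensity (Δ i) (R.outVar Δ i) (b i) (r i)

lemma refMass_pos (hΔ : ∀ i, 0 < Δ i) (b : Fin p → ℤ) (r : Vec p) : 0 < R.refMass Δ b r :=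
  Finset.prod_pos fun i _ => gridDensity_pos (hΔ i) (R.outVar_pos hΔ i) _ _

lemma measurable_refMass (b : Fin p → ℤ) : Measurable (R.refMass Δ b) :=
  Finset.measurable_prod _ fun i _ =>
    (measurable_gridDensity _ _ _).comp (measurable_pi_apply i)

/-- The normalization of the quantizer output in the logarithmic loss. -/
def lossScale (Δ : Vec p) : Matrix (Fin p) (Fin p) ℝ :=
  diagonal fun i => (Real.sqrt (2 * R.outVar Δ i * Real.log 2))⁻¹

/-- The constant part of the logarithmic loss. -/
def lossConst : ℝ := ∑ i, 1 / 2 * Real.logb 2 (Real.pi * R.ratio i / 6)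

lemma lossScale_sq (hΔ : ∀ i, 0 < Δ i) (i : Fin p) :
    ((Real.sqrt (2 * R.outVar Δ i * Real.log 2))⁻¹) ^ 2
      = (2 * R.outVar Δ i * Real.log 2)⁻¹ := by
  have hl2 : 0 < Real.log 2 := Real.log_pos one_lt_two
  have := R.outVar_pos hΔ i
  rw [inv_pow, Real.sq_sqrt (by positivity)]

/-- Gaussianity of the reference makes the loss a constant plus a squared norm that is linear in
prediction and quantization error, so codeword lengths fall under the same cost estimates as the
distortion. -/
lemma neg_logb_refMass (hΔ : ∀ i, 0 < Δ i) (k r : Vec p) :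
    -Real.logb 2 (R.refMass Δ (R.index Δ k r) r) = R.lossConst
      + ∑ i, ((R.lossScale Δ * diagonal (R.Φ Δ) * R.E) *ᵥ k
        + R.lossScale Δ *ᵥ R.qerr Δ k r) i ^ 2 := by
  rw [refMass, Real.logb_prod _ _ fun i _ => (gridDensity_pos (hΔ i) (R.outVar_pos hΔ i) _ _).ne',
    ← Finset.sum_neg_distrib, lossConst, ← Finset.sum_add_distrib]
  refine Finset.sum_congr rfl fun i _ => ?_
  rw [outVar, neg_logb_gridDensity (hΔ i) (zero_lt_one.trans_le (R.one_le_ratio i))]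
  congr 1
  have h1 : ((R.lossScale Δ * diagonal (R.Φ Δ) * R.E) *ᵥ k + R.lossScale Δ *ᵥ R.qerr Δ k r) i
      = (Real.sqrt (2 * R.outVar Δ i * Real.log 2))⁻¹ * R.β Δ k r i := by
    rw [Pi.add_apply, ← Matrix.mulVec_mulVec, ← Matrix.mulVec_mulVec, lossScale, mulVec_diagonal,
      mulVec_diagonal, mulVec_diagonal, R.β_eq, quantInput]
    ring
  rw [h1, mul_pow, R.lossScale_sq hΔ, outVar, β, div_eq_inv_mul]

/-- Each coordinate contributes output variance divided by `2 · outVar · ln 2`, at most `1 / (2 ln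
2) = ½ log₂ e`: this is the `e` in `πe/6`. -/
lemma steadyCost_loss_le (hΔ : ∀ i, 0 < Δ i) :
    R.steadyCost Δ (R.lossScale Δ * diagonal (R.Φ Δ) * R.E) (R.lossScale Δ)
      ≤ p * (1 / (2 * Real.log 2)) := by
  have hl2 : 0 < Real.log 2 := Real.log_pos one_lt_two
  have h1 : R.lossScale Δ * diagonal (R.Φ Δ) * R.E * R.prior
        * (R.lossScale Δ * diagonal (R.Φ Δ) * R.E)ᵀ
      = diagonal fun i => (2 * R.outVar Δ i * Real.log 2)⁻¹ * (R.Φ Δ i ^ 2 * R.lam i) := by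
    have h2 : R.E * R.prior * R.Eᵀ = diagonal R.lam := R.prior_eq
    have h3 : R.lossScale Δ * diagonal (R.Φ Δ) * R.E * R.prior
        * (R.lossScale Δ * diagonal (R.Φ Δ) * R.E)ᵀ
        = R.lossScale Δ * diagonal (R.Φ Δ) * (R.E * R.prior * R.Eᵀ)
          * (diagonal (R.Φ Δ) * (R.lossScale Δ)ᵀ) := by
      simp only [Matrix.transpose_mul, diagonal_transpose, Matrix.mul_assoc]
    rw [h3, h2, lossScale, diagonal_transpose, diagonal_mul_diagonal, diagonal_mul_diagonal,
      diagonal_mul_diagonal, diagonal_mul_diagonal]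
    congr 1
    funext i
    rw [← R.lossScale_sq hΔ]; ring
  have h2 : R.lossScale Δ * diagonal (fun i => Δ i ^ 2 / 12) * (R.lossScale Δ)ᵀ
      = diagonal fun i => (2 * R.outVar Δ i * Real.log 2)⁻¹ * (Δ i ^ 2 / 12) := by
    rw [lossScale, diagonal_transpose, diagonal_mul_diagonal, diagonal_mul_diagonal]
    congr 1
    funext i
    rw [← R.lossScale_sq hΔ]; ring
  rw [steadyCost, h1, h2, trace_diagonal, trace_diagonal, ← Finset.sum_add_distrib]
  have h3 : ∀ i, (2 * R.outVar Δ i * Real.log 2)⁻¹ * (R.Φ Δ i ^ 2 * R.lam i)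
      + (2 * R.outVar Δ i * Real.log 2)⁻¹ * (Δ i ^ 2 / 12) ≤ 1 / (2 * Real.log 2) := by
    intro i
    have hv := R.outVar_pos hΔ i
    rw [← mul_add]
    refine (mul_le_mul_of_nonneg_left (R.Φ_sq_mul_add_le hΔ i) (by positivity)).trans_eq ?_
    field_simp
  refine (Finset.sum_le_sum fun i _ => h3 i).trans_eq ?_
  simp

lemma lossConst_add : R.lossConst + p * (1 / (2 * Real.log 2))
    = R.rate + (p : ℝ) / 2 * Real.logb 2 (Real.pi * Real.exp 1 / 6) := by
  have hpi := Real.pi_pos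
  have hl2 : 0 < Real.log 2 := Real.log_pos one_lt_two
  have h1 : ∀ i, 1 / 2 * Real.logb 2 (Real.pi * R.ratio i / 6)
      = 1 / 2 * Real.logb 2 (R.lam i / R.δ i) + 1 / 2 * Real.logb 2 (Real.pi / 6) := fun i => by
    have := R.one_le_ratio i
    rw [← R.logb_ratio, show Real.pi * R.ratio i / 6 = R.ratio i * (Real.pi / 6) by ring,
      Real.logb_mul (by positivity) (by positivity)]
    ring
  have h2 : Real.logb 2 (Real.pi * Real.exp 1 / 6)
      = Real.logb 2 (Real.pi / 6) + 1 / Real.log 2 := by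
    rw [show Real.pi * Real.exp 1 / 6 = Real.pi / 6 * Real.exp 1 by ring,
      Real.logb_mul (by positivity) (Real.exp_pos _).ne']
    simp [Real.logb]
  rw [lossConst, rate, h2]
  simp only [h1, Finset.sum_add_distrib, Finset.sum_const, Finset.card_univ, Fintype.card_fin,
    nsmul_eq_mul]
  field_simp
  ring

lemma integrable_loss (hΔ : ∀ i, 0 < Δ i) {Ω : Type*} [MeasurableSpace Ω] {μ : Measure Ω}
    [IsProbabilityMeasure μ] {k r : Ω → Vec p} (hk : SqInt μ k)
    (hv : SqInt μ fun ω => R.qerr Δ (k ω) (r ω)) :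
    Integrable (fun ω => -Real.logb 2 (R.refMass Δ (R.index Δ (k ω) (r ω)) (r ω))) μ := by
  simp only [R.neg_logb_refMass hΔ]
  have h := (hk.mulVec (R.lossScale Δ * diagonal (R.Φ Δ) * R.E)).add (hv.mulVec (R.lossScale Δ))
  exact (integrable_const _).add (integrable_finsetSum _ fun i _ => (h i).integrable_sq)

lemma integral_loss (hΔ : ∀ i, 0 < Δ i) {Ω : Type*} [MeasurableSpace Ω] {μ : Measure Ω}
    [IsProbabilityMeasure μ] {k r : Ω → Vec p} (hk : SqInt μ k)
    (hv : SqInt μ fun ω => R.qerr Δ (k ω) (r ω)) :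
    ∫ ω, -Real.logb 2 (R.refMass Δ (R.index Δ (k ω) (r ω)) (r ω)) ∂μ
      = R.lossConst + (crossMoment μ
        (fun ω => (R.lossScale Δ * diagonal (R.Φ Δ) * R.E) *ᵥ k ω
          + R.lossScale Δ *ᵥ R.qerr Δ (k ω) (r ω))
        (fun ω => (R.lossScale Δ * diagonal (R.Φ Δ) * R.E) *ᵥ k ω
          + R.lossScale Δ *ᵥ R.qerr Δ (k ω) (r ω))).trace := by
  simp only [R.neg_logb_refMass hΔ]
  have h := (hk.mulVec (R.lossScale Δ * diagonal (R.Φ Δ) * R.E)).add (hv.mulVec (R.lossScale Δ))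
  rw [integral_add (integrable_const _)
    (integrable_finsetSum _ fun i _ => (h i).integrable_sq), trace_crossMoment h]
  simp

lemma map_dither (S0 : Matrix (Fin p) (Fin p) ℝ) (t : ℕ) :
    (schemeLaw A B S0 Δ).map (fun ω => ω.2 t) = ditherStep Δ := by
  have h1 : MeasurePreserving (fun ω : (ℕ → Vec p) × (ℕ → Vec p) => ω.2)
    (schemeLaw A B S0 Δ) (ditherLaw Δ) := measurePreserving_snd
  have h2 : MeasurePreserving (Function.eval t) (ditherLaw Δ) (ditherStep Δ) :=
    measurePreserving_eval_infinitePi (fun _ : ℕ => ditherStep Δ) t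
  exact (h2.comp h1).map_eq

lemma measurable_output (t : ℕ) :
    Measurable fun a : (ℕ → Vec p) × (ℕ → Vec p) => R.output Δ a.1 a.2 t := by
  have h1 : Measurable fun a : (ℕ → Vec p) × (ℕ → Vec p) => a.1 t - R.pred Δ a.1 a.2 t :=
    Measurable.sub (by fun_prop) (R.measurable_pred Δ t)
  have h2 : Measurable fun a : (ℕ → Vec p) × (ℕ → Vec p) => a.2 t := by fun_prop
  exact R.measurable_index Δ h1 h2

lemma measurable_refMass_comp {α : Type*} [MeasurableSpace α] {f : α → Fin p → ℤ}
    {g : α → Vec p} (hf : Measurable f) (hg : Measurable g) :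
    Measurable fun a => R.refMass Δ (f a) (g a) := by
  unfold refMass gridDensity
  refine Finset.measurable_prod _ fun i _ => ?_
  have h1 : Measurable fun a => ((f a i : ℤ) : ℝ) :=
    (measurable_from_top (f := fun z : ℤ => (z : ℝ))).comp ((measurable_pi_apply i).comp hf)
  have h2 : Measurable fun a => g a i := (measurable_pi_apply i).comp hg
  exact ((measurable_gaussianPDFReal 0 _).comp ((h1.const_mul _).sub h2)).const_mul _

lemma measurable_logMass {α : Type*} [MeasurableSpace α] {f : α → Fin p → ℤ} {g : α → Vec p}
    (hf : Measurable f) (hg : Measurable g) :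
    Measurable fun a => -Real.logb 2 (R.refMass Δ (f a) (g a)) := by
  have h2 : Measurable fun a => R.refMass Δ (f a) (g a) := R.measurable_refMass_comp hf hg
  simp only [Real.logb]
  exact (h2.log.div_const _).neg

/-- The logarithmic loss of the reference distribution at time `t`. -/
def outputLoss (Δ : Vec p) (t : ℕ) (ω : (ℕ → Vec p) × (ℕ → Vec p)) : ℝ :=
  -Real.logb 2 (R.refMass Δ (R.output Δ ω.1 ω.2 t) (ω.2 t))

lemma measurable_outputLoss (t : ℕ) : Measurable (R.outputLoss Δ t) := by
  have h2 : Measurable fun a : (ℕ → Vec p) × (ℕ → Vec p) => a.2 t := by fun_prop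
  exact R.measurable_logMass (R.measurable_output t) h2

lemma outputLoss_path (t : ℕ) (a : (Vec p × (ℕ → Vec q)) × (ℕ → Vec p)) :
    R.outputLoss Δ t (sourcePath A B a.1.1 a.1.2, a.2)
      = -Real.logb 2 (R.refMass Δ (R.index Δ (R.predErr Δ t a) (a.2 t)) (a.2 t)) := rfl

/-- The part of the logarithmic loss that is quadratic in prediction and quantization error. -/
def quadLoss (Δ : Vec p) (t : ℕ) (a : (Vec p × (ℕ → Vec q)) × (ℕ → Vec p)) : Vec p :=
  (R.lossScale Δ * diagonal (R.Φ Δ) * R.E) *ᵥ R.predErr Δ t a + R.lossScale Δ *ᵥ R.qerrAt Δ t a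

lemma integrable_outputLoss (hΔ : ∀ i, 0 < Δ i) (S0 : Matrix (Fin p) (Fin p) ℝ) (t : ℕ) :
    Integrable (R.outputLoss Δ t) (schemeLaw A B S0 Δ) := by
  rw [schemeLaw_eq_map, integrable_map_measure (R.measurable_outputLoss t).aestronglyMeasurable
    measurable_pathDither.aemeasurable]
  refine (R.integrable_loss hΔ (k := R.predErr Δ t) (r := fun a => a.2 t)
    (R.sqInt_predErr_joint hΔ S0 t) (R.sqInt_qerrAt_joint hΔ S0 t)).congr (ae_of_all _ fun a => ?_)
  exact (R.outputLoss_path t a).symm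

lemma integral_outputLoss (hΔ : ∀ i, 0 < Δ i) (S0 : Matrix (Fin p) (Fin p) ℝ) (t : ℕ) :
    ∫ ω, R.outputLoss Δ t ω ∂(schemeLaw A B S0 Δ) = R.lossConst
      + (crossMoment (driveDitherLaw q S0 Δ) (R.quadLoss Δ t) (R.quadLoss Δ t)).trace := by
  rw [schemeLaw_eq_map, integral_map measurable_pathDither.aemeasurable
    (R.measurable_outputLoss t).aestronglyMeasurable]
  simp only [outputLoss_path]
  exact R.integral_loss hΔ (k := R.predErr Δ t) (r := fun a => a.2 t)
      (R.sqInt_predErr_joint hΔ S0 t) (R.sqInt_qerrAt_joint hΔ S0 t)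

lemma exists_isShannonCode_output (S0 : Matrix (Fin p) (Fin p) ℝ) (t : ℕ) :
    ∃ code : Vec p → (Fin p → ℤ) → Word, IsShannonCode (R.outputGivenDither S0 Δ t) code := by
  unfold outputGivenDither
  exact exists_isShannonCode _

lemma expLength_le (hΔ : ∀ i, 0 < Δ i) (S0 : Matrix (Fin p) (Fin p) ℝ) (t : ℕ)
    {code : Vec p → (Fin p → ℤ) → Word} (hcode : IsShannonCode (R.outputGivenDither S0 Δ t) code) :
    0 ≤ 1 + ∫ ω, R.outputLoss Δ t ω ∂(schemeLaw A B S0 Δ) ∧ R.expLength S0 Δ t code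
      ≤ ENNReal.ofReal (1 + ∫ ω, R.outputLoss Δ t ω ∂(schemeLaw A B S0 Δ)) := by
  refine lintegral_length_le (R.measurable_output t) (by fun_prop) hcode
    (R.refMass_pos hΔ) (fun b => R.measurable_refMass b) ?_ (R.integrable_outputLoss hΔ S0 t)
  rw [map_dither]
  exact lintegral_tsum_gridDensity_le hΔ (R.outVar_pos hΔ)

/-- The rate of the dithered scheme with Shannon codes. -/
theorem exists_shannonCode_limsupAvg_le (hAB : IsStabilizable A B) (hΔ : ∀ i, 0 < Δ i)
    (S0 : Matrix (Fin p) (Fin p) ℝ) :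
    ∃ code : ℕ → Vec p → (Fin p → ℤ) → Word,
      (∀ t, IsShannonCode (R.outputGivenDither S0 Δ t) (code t)) ∧
      limsupAvg (fun t => R.expLength S0 Δ t (code t)) ≤ ENNReal.ofReal
        (R.rate + ((p : ℝ) / 2 * Real.logb 2 (Real.pi * Real.exp 1 / 6) + 1)) := by
  choose code hcode using R.exists_isShannonCode_output (Δ := Δ) S0
  refine ⟨code, hcode, ?_⟩
  obtain ⟨J, -, hJ⟩ := R.exists_sum_cost_joint_le hAB hΔ S0
    (R.lossScale Δ * diagonal (R.Φ Δ) * R.E) (R.lossScale Δ)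
  -- The additional bit comes from rounding the lengths up; the remainder is a quadratic cost with
  -- known steady value.
  refine (limsupAvg_mono fun t => (R.expLength_le hΔ S0 t (hcode t)).2).trans ?_
  refine limsupAvg_ofReal_le (fun t => (R.expLength_le hΔ S0 t (hcode t)).1)
    (eventually_sum_le_of_le (J := J) fun n => ?_)
  simp only [R.integral_outputLoss hΔ, Finset.sum_add_distrib, Finset.sum_const, Finset.card_range,
    nsmul_eq_mul]
  have h1 := hJ n
  have h2 := mul_le_mul_of_nonneg_left (R.steadyCost_loss_le hΔ) (Nat.cast_nonneg (α := ℝ) n)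
  rw [show R.rate + ((p : ℝ) / 2 * Real.logb 2 (Real.pi * Real.exp 1 / 6) + 1)
    = R.lossConst + p * (1 / (2 * Real.log 2)) + 1 by rw [R.lossConst_add]; ring]
  unfold quadLoss
  nlinarith

end Realization

/-! ### Deterministic zero-delay codes -/

instance : DiscreteMeasurableSpace Word := ⟨fun _ => trivial⟩

lemma compProd_eq_dirac {α β γ : Type*} [MeasurableSpace α] [MeasurableSpace β]
    [MeasurableSpace γ] [MeasurableSingletonClass β] {K : Kernel α β} [IsSFiniteKernel K]
    {η : Kernel (α × β) γ} [IsSFiniteKernel η] {a : α} {b : β} {c : γ}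
    (hK : K a = Measure.dirac b) (hη : η (a, b) = Measure.dirac c) :
    (K ⊗ₖ η) a = Measure.dirac (b, c) := by
  ext s hs
  rw [Kernel.compProd_apply hs, hK, lintegral_dirac, hη, Measure.dirac_apply' _ hs,
    Measure.dirac_apply' _ (measurable_prodMk_left hs)]
  rfl

/-- It is enough that the policies are deterministic along the actual trajectory; expectations over
a code then reduce to integrals over the source. -/
lemma ZeroDelayCode.hist_eq_dirac {p : ℕ} (c : ZeroDelayCode p) {x : ℕ → Vec p} {Z : ℕ → Word}
    {Y : ℕ → Vec p}
    (henc : ∀ t, c.enc t (fun s => Z s, fun s => x s) = Measure.dirac (Z t))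
    (hdec : ∀ t, c.dec t (fun s => Y s, fun s => Z s) = Measure.dirac (Y t)) (t : ℕ) :
    c.hist t x = Measure.dirac (fun s : Fin t => Z s, fun s : Fin t => Y s) := by
  have hsn : ∀ {X : Type} (f : ℕ → X) (t : ℕ),
      (Fin.snoc (fun s : Fin t => f s) (f t) : Fin (t + 1) → X) = fun s : Fin (t + 1) => f s := by
    intro X f t
    ext s
    refine Fin.lastCases ?_ (fun j => ?_) s
    · simp
    · simp
  induction t with
  | zero =>
    simp only [ZeroDelayCode.hist, Kernel.const_apply]
    congr 1
    exact Prod.ext (Subsingleton.elim _ _) (Subsingleton.elim _ _)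
  | succ t ih =>
    have hstep : c.stepKernel t (x, (fun s : Fin t => Z s, fun s : Fin t => Y s)) = Measure.dirac (Z t, Y t) := by
      unfold ZeroDelayCode.stepKernel
      refine compProd_eq_dirac ?_ ?_
      · rw [Kernel.comap_apply]; exact henc t
      · rw [Kernel.comap_apply]
        have h := hdec t
        rw [← hsn Z t] at h
        exact h
    have hm : Measurable (fun a : ((Fin t → Word) × (Fin t → Vec p)) × (Word × Vec p) =>
        ((Fin.snoc a.1.1 a.2.1 : Fin (t + 1) → Word),
        (Fin.snoc a.1.2 a.2.2 : Fin (t + 1) → Vec p))) := by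
      refine Measurable.prodMk ?_ ?_
      · exact (measurable_snoc t).comp (Measurable.prodMk (by fun_prop) (by fun_prop))
      · exact (measurable_snoc t).comp (Measurable.prodMk (by fun_prop) (by fun_prop))
    refine (Kernel.map_apply _ hm x).trans ?_
    rw [compProd_eq_dirac ih hstep, Measure.map_dirac' hm]
    simp only [hsn Z t, hsn Y t]

lemma lintegral_compProd_dirac {α β : Type*} [MeasurableSpace α] [MeasurableSpace β]
    [MeasurableSingletonClass β] {μ : Measure α} [SFinite μ] {K : Kernel α β} [IsSFiniteKernel K]
    {g : α → β} (hK : ∀ a, K a = Measure.dirac (g a)) {f : α × β → ℝ≥0∞} (hf : Measurable f) :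
    ∫⁻ a, f a ∂(μ ⊗ₘ K) = ∫⁻ a, f (a, g a) ∂μ := by
  rw [Measure.lintegral_compProd hf]
  simp only [hK, lintegral_dirac]

lemma ZeroDelayCode.expLength_eq {p : ℕ} (c : ZeroDelayCode p) (src : Measure (ℕ → Vec p))
    [SFinite src] {Z : ℕ → (ℕ → Vec p) → Word} {Y : ℕ → (ℕ → Vec p) → Vec p}
    (h : ∀ t x, c.hist t x = Measure.dirac (fun s : Fin t => Z s x, fun s : Fin t => Y s x)) (t : ℕ) :
    c.expLength src t = ∫⁻ x, ((Z t x).length : ℝ≥0∞) ∂src := by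
  have hm : Measurable fun a : (ℕ → Vec p) × ((Fin (t + 1) → Word) × (Fin (t + 1) → Vec p)) =>
      ((a.2.1 (Fin.last t)).length : ℝ≥0∞) :=
    (measurable_of_countable (fun z : Word => (z.length : ℝ≥0∞))).comp (by fun_prop)
  rw [ZeroDelayCode.expLength, lintegral_compProd_dirac (h (t + 1)) hm]
  rfl

lemma ZeroDelayCode.expDistortion_eq {p : ℕ} (c : ZeroDelayCode p) (src : Measure (ℕ → Vec p))
    [SFinite src] {Z : ℕ → (ℕ → Vec p) → Word} {Y : ℕ → (ℕ → Vec p) → Vec p}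
    (h : ∀ t x, c.hist t x = Measure.dirac (fun s : Fin t => Z s x, fun s : Fin t => Y s x)) (t : ℕ) :
    c.expDistortion src t = ∫⁻ x, sqErr (x t) (Y t x) ∂src := by
  have hm : Measurable fun a : (ℕ → Vec p) × ((Fin (t + 1) → Word) × (Fin (t + 1) → Vec p)) =>
      sqErr (a.1 t) (a.2.2 (Fin.last t)) :=
    Realization.measurable_sqErr (by fun_prop) (by fun_prop)
  rw [ZeroDelayCode.expDistortion, lintegral_compProd_dirac (h (t + 1)) hm]
  rfl

/-- A prefix code for symbols with positive masses `f` of finite sum. -/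
lemma exists_prefixCode {S : Type*} [MeasurableSpace S] [Countable S]
    [MeasurableSingletonClass S] {f : S → ℝ} (hf : ∀ s, 0 < f s)
    (hfin : ∑' s, ENNReal.ofReal (f s) ≠ ∞) [Nonempty S] :
    ∃ code : S → Word, (∀ s s', code s <+: code s' → s = s') ∧
      ∀ s, ((code s).length : ℝ) ≤ 1 - Real.logb 2 (f s)
        + ((∑' s, ENNReal.ofReal (f s)).toReal - 1) / Real.log 2 := by
  set Z := ∑' s, ENNReal.ofReal (f s) with hZ
  have hf0 : ∀ s, ENNReal.ofReal (f s) ≠ 0 := fun s => by simpa using hf s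
  have hZ0 : Z ≠ 0 := fun h => by
    obtain ⟨s⟩ := ‹Nonempty S›
    exact hf0 s (ENNReal.tsum_eq_zero.1 h s)
  have hZR : 0 < Z.toReal := ENNReal.toReal_pos hZ0 hfin
  -- A Shannon code for the normalized masses pays an extra `log₂ Z`, which `log Z ≤ Z - 1` makes
  -- linear in the total mass.
  set μ := (PMF.normalize (fun s => ENNReal.ofReal (f s)) hZ0 hfin).toMeasure with hμ
  have hμs : ∀ s, μ {s} = ENNReal.ofReal (f s) * Z⁻¹ := fun s => by
    rw [hμ, PMF.toMeasure_apply_singleton _ _ (measurableSet_singleton s), PMF.normalize_apply]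
  have hμ0 : ∀ s, μ {s} ≠ 0 := fun s => by
    rw [hμs]; exact mul_ne_zero (hf0 s) (ENNReal.inv_ne_zero.2 hfin)
  have hμr : ∀ s, μ.real {s} = f s / Z.toReal := fun s => by
    rw [measureReal_def, hμs, ENNReal.toReal_mul, ENNReal.toReal_ofReal (hf s).le,
      ENNReal.toReal_inv, div_eq_mul_inv]
  obtain ⟨code, hcode⟩ := exists_isShannonCode (Kernel.const Unit μ)
  refine ⟨code (), fun s s' h => hcode.prefixFree () s s' (hμ0 s) (hμ0 s') h, fun s => ?_⟩
  have h1 := hcode.length_le (r := ()) (hμ0 s)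
  simp only [Kernel.const_apply, hμr] at h1
  rw [Real.logb_div (hf s).ne' hZR.ne'] at h1
  have h2 : Real.logb 2 Z.toReal ≤ (Z.toReal - 1) / Real.log 2 := by
    rw [Real.logb]
    exact div_le_div_of_nonneg_right (Real.log_le_sub_one_of_pos hZR)
      (Real.log_pos one_lt_two).le
  linarith

namespace Realization

variable {p q : ℕ} {A : Matrix (Fin p) (Fin p) ℝ} {B : Matrix (Fin p) (Fin q) ℝ} {D : ℝ}
  (R : Realization A B D) {Δ : Vec p}

/-! ### The code with a fixed dither path -/

/-- The Kalman prediction, as a function of the preceding reproductions. -/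
def predOf (A : Matrix (Fin p) (Fin p) ℝ) : (t : ℕ) → (Fin t → Vec p) → Vec p
  | 0, _ => 0
  | t + 1, y => A *ᵥ y (Fin.last t)

lemma measurable_predOf (t : ℕ) : Measurable (predOf A t) := by
  cases t with
  | zero => exact measurable_const
  | succ t => exact measurable_mulVec A (measurable_pi_apply _)

lemma pred_eq_predOf (x r : ℕ → Vec p) (t : ℕ) :
    R.pred Δ x r t = predOf A t fun s => R.recon Δ x r s := by
  cases t <;> rfl

/-- A path with prescribed beginning. -/
def extendPath {t : ℕ} (x : Fin t → Vec p) (s : ℕ) : Vec p := if h : s < t then x ⟨s, h⟩ else 0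

lemma measurable_extendPath (t : ℕ) :
    Measurable (extendPath : (Fin t → Vec p) → ℕ → Vec p) := by
  refine measurable_pi_lambda _ fun s => ?_
  unfold extendPath
  split_ifs
  · exact measurable_pi_apply _
  · exact measurable_const

lemma output_extendPath (x r : ℕ → Vec p) (t : ℕ) :
    R.output Δ (extendPath fun s : Fin (t + 1) => x s) r t = R.output Δ x r t := by
  have h : ∀ s < t + 1, extendPath (fun s : Fin (t + 1) => x s) s = x s := fun s hs => by
    simp [extendPath, hs]
  unfold output
  rw [R.pred_congr Δ (fun s hs => h s (by omega)) fun _ _ => rfl, h t (by omega)]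

lemma measurable_output_comp (r : ℕ → Vec p) (t : ℕ) {α : Type*} [MeasurableSpace α]
    {f : α → ℕ → Vec p} (hf : Measurable f) : Measurable fun a => R.output Δ (f a) r t := by
  have h1 : Measurable fun a => R.pred Δ (f a) r t :=
    (R.measurable_pred Δ t).comp (hf.prodMk measurable_const)
  have h2 : Measurable fun a => f a t := (measurable_pi_apply t).comp hf
  exact R.measurable_index Δ (h2.sub h1) measurable_const

/-- The zero-delay code in which the dithered quantizers use a fixed dither path `r`, and the
quantizer outputs at time `t` are encoded with `code t`. -/
def pathCode (Δ : Vec p) (r : ℕ → Vec p) (code : ℕ → (Fin p → ℤ) → Word)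
    (hcode : ∀ t s s', code t s <+: code t s' → s = s') : ZeroDelayCode p where
  codebook t := Set.range (code t)
  prefixFree t := by
    rintro _ ⟨s, rfl⟩ _ ⟨s', rfl⟩ h
    rw [hcode t s s' h]
  -- The output at time `t` is a function of the source up to `t` and of the fixed dither path, so
  -- the encoder can recompute the whole loop; the zeros appended by `extendPath` are never read.
  enc t := Kernel.deterministic (fun a => code t (R.output Δ (extendPath a.2) r t)) (by
    have h1 : Measurable fun a : (Fin t → Word) × (Fin (t + 1) → Vec p) =>
      R.output Δ (extendPath a.2) r t :=
        R.measurable_output_comp r t ((measurable_extendPath (t + 1)).comp measurable_snd)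
    exact (measurable_of_countable (code t)).comp h1)
  -- The decoder needs only its previous reproduction for the prediction, and the current word for
  -- the innovation; the code is injective, so `Function.invFun` recovers the symbol.
  dec t := Kernel.deterministic (fun a => predOf A t a.1 + R.E⁻¹ *ᵥ fun i => R.Θ Δ i *
      (Δ i * ((Function.invFun (code t) (a.2 (Fin.last t)) i : ℤ) : ℝ) - r t i)) (by
    refine ((measurable_predOf t).comp measurable_fst).add ?_
    refine (measurable_of_countable fun z : Word => R.E⁻¹ *ᵥ fun i => R.Θ Δ i *
      (Δ i * ((Function.invFun (code t) z i : ℤ) : ℝ) - r t i)).comp ?_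
    fun_prop)
  enc_markov t := inferInstance
  dec_markov t := inferInstance
  enc_mem t h := by
    rw [Kernel.deterministic_apply' _ _ (MeasurableSet.of_discrete)]
    simp

lemma pathCode_hist (r : ℕ → Vec p) (code : ℕ → (Fin p → ℤ) → Word)
    (hcode : ∀ t s s', code t s <+: code t s' → s = s') (t : ℕ) (x : ℕ → Vec p) :
    (R.pathCode Δ r code hcode).hist t x = Measure.dirac
      (fun s : Fin t => code s (R.output Δ x r s), fun s : Fin t => R.recon Δ x r s) := by
  refine ZeroDelayCode.hist_eq_dirac (Z := fun s => code s (R.output Δ x r s))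
    (Y := R.recon Δ x r) _ (fun t => ?_) (fun t => ?_) t
  · simp only [pathCode, Kernel.deterministic_apply, R.output_extendPath]
  · have hinj : Function.Injective (code t) := fun s s' h => hcode t s s' (h ▸ List.prefix_rfl)
    simp only [pathCode, Kernel.deterministic_apply, Fin.val_last,
      Function.leftInverse_invFun hinj _, ← R.pred_eq_predOf]
    rfl

/-- The total reference mass for a given dither value. -/
def totalMass (Δ : Vec p) (r : Vec p) : ℝ≥0∞ := ∑' b, ENNReal.ofReal (R.refMass Δ b r)

lemma measurable_totalMass : Measurable (R.totalMass Δ) :=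
  Measurable.tsum fun b => ENNReal.measurable_ofReal.comp (R.measurable_refMass b)

lemma lintegral_totalMass_le (hΔ : ∀ i, 0 < Δ i) : ∫⁻ r, R.totalMass Δ r ∂(ditherStep Δ) ≤ 1 :=
  lintegral_tsum_gridDensity_le hΔ (R.outVar_pos hΔ)

lemma ae_totalMass_ne_top (hΔ : ∀ i, 0 < Δ i) :
    ∀ᵐ r ∂(ditherLaw Δ), ∀ t, R.totalMass Δ (r t) ≠ ∞ := by
  refine ae_all_iff.2 fun t => ?_
  have h := ae_lt_top (R.measurable_totalMass (Δ := Δ))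
    (ne_top_of_le_ne_top ENNReal.one_ne_top (R.lintegral_totalMass_le hΔ))
  have h2 : MeasurePreserving (Function.eval t) (ditherLaw Δ) (ditherStep Δ) :=
    measurePreserving_eval_infinitePi (fun _ : ℕ => ditherStep Δ) t
  filter_upwards [h2.quasiMeasurePreserving.ae h] with r hr
  exact hr.ne

/-- The total masses at different times are i.i.d. with mean at most one, so by the strong law the
price of normalizing averages to at most zero. -/
lemma ae_eventually_sum_totalMass_le (hΔ : ∀ i, 0 < Δ i) :
    ∀ᵐ r ∂(ditherLaw Δ), ∀ ε > 0, ∀ᶠ n : ℕ in atTop,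
      ∑ t ∈ Finset.range n, ((R.totalMass Δ (r t)).toReal - 1) ≤ n * ε := by
  set X : ℕ → (ℕ → Vec p) → ℝ := fun t r => (R.totalMass Δ (r t)).toReal with hX
  have hm : Measurable fun r : Vec p => (R.totalMass Δ r).toReal :=
    (R.measurable_totalMass (Δ := Δ)).ennreal_toReal
  have hev : ∀ t, MeasurePreserving (Function.eval t) (ditherLaw Δ) (ditherStep Δ) := fun t =>
    measurePreserving_eval_infinitePi (fun _ : ℕ => ditherStep Δ) t
  have hfin := ne_top_of_le_ne_top ENNReal.one_ne_top (R.lintegral_totalMass_le hΔ)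
  have hi : Integrable (fun r : Vec p => (R.totalMass Δ r).toReal) (ditherStep Δ) :=
    integrable_toReal_of_lintegral_ne_top (R.measurable_totalMass (Δ := Δ)).aemeasurable hfin
  have hX0 : Integrable (X 0) (ditherLaw Δ) := (hev 0).integrable_comp_of_integrable hi
  have hind : iIndepFun X (ditherLaw Δ) :=
    iIndepFun_infinitePi (P := fun _ : ℕ => ditherStep Δ)
      (X := fun _ r => (R.totalMass Δ r).toReal) fun _ => hm
  have hid : ∀ t, IdentDistrib (X t) (X 0) (ditherLaw Δ) (ditherLaw Δ) := fun t => by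
    have h1 : IdentDistrib (Function.eval t) (Function.eval 0) (ditherLaw Δ) (ditherLaw Δ) :=
      ⟨(hev t).measurable.aemeasurable, (hev 0).measurable.aemeasurable,
        (hev t).map_eq.trans (hev 0).map_eq.symm⟩
    exact h1.comp hm
  have hmean : ∫ r, X 0 r ∂(ditherLaw Δ) ≤ 1 := by
    have h1 : ∫ r, X 0 r ∂(ditherLaw Δ) = ∫ r, (R.totalMass Δ r).toReal ∂(ditherStep Δ) := by
      rw [← (hev 0).map_eq, integral_map (hev 0).measurable.aemeasurable hm.aestronglyMeasurable]
    rw [h1, integral_toReal (R.measurable_totalMass (Δ := Δ)).aemeasurable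
      (ae_lt_top (R.measurable_totalMass (Δ := Δ)) hfin)]
    exact ENNReal.toReal_mono ENNReal.one_ne_top (R.lintegral_totalMass_le hΔ)
  filter_upwards [strong_law_ae_real X hX0 (fun i j hij => hind.indepFun hij) hid] with r hr
  intro ε hε
  filter_upwards [hr.eventually (gt_mem_nhds (lt_of_le_of_lt hmean (lt_add_of_pos_right 1 hε))),
    eventually_gt_atTop 0] with n hn h0
  have hn0 : (0 : ℝ) < n := by exact_mod_cast h0
  rw [div_lt_iff₀ hn0] at hn
  simp only [Finset.sum_sub_distrib, Finset.sum_const, Finset.card_range, nsmul_eq_mul, mul_one]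
  simp only [hX] at hn
  linarith

lemma pathCode_expDistortion (hΔ : ∀ i, 0 < Δ i) (S0 : Matrix (Fin p) (Fin p) ℝ)
    (r : ℕ → Vec p) (code : ℕ → (Fin p → ℤ) → Word)
    (hpre : ∀ t s s', code t s <+: code t s' → s = s') (t : ℕ) :
    (R.pathCode Δ r code hpre).expDistortion (sourceLaw A B S0) t
        = ENNReal.ofReal (crossMoment (driveLaw q S0)
          (fun ω => R.filt *ᵥ R.predErr Δ t (ω, r)
            + (-(R.E⁻¹ * diagonal (R.Θ Δ))) *ᵥ R.qerrAt Δ t (ω, r))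
          (fun ω => R.filt *ᵥ R.predErr Δ t (ω, r)
            + (-(R.E⁻¹ * diagonal (R.Θ Δ))) *ᵥ R.qerrAt Δ t (ω, r))).trace := by
  have hk := R.sqInt_predErr_path hΔ S0 r
  have hv := R.sqInt_qerrAt_path hΔ S0 r
  rw [ZeroDelayCode.expDistortion_eq _ _ (Z := fun s x => code s (R.output Δ x r s))
    (Y := fun s x => R.recon Δ x r s) (R.pathCode_hist r code hpre),
    ← SqInt.lintegral_sum_sq (((hk t).mulVec _).add ((hv t).mulVec _)), sourceLaw_eq_map,
    lintegral_map _ (measurable_sourcePath A B)]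
  · refine lintegral_congr fun ω => ?_
    rw [← R.sub_recon hΔ]
    rfl
  · have h2 : Measurable fun x : ℕ → Vec p => x t := by fun_prop
    have h3 : Measurable fun x : ℕ → Vec p => (x, r) := by fun_prop
    exact measurable_sqErr h2 ((R.measurable_recon t).comp h3)

/-- The loss bound on the expected codeword length for a fixed dither path. -/
def pathLoss (S0 : Matrix (Fin p) (Fin p) ℝ) (Δ : Vec p) (r : ℕ → Vec p) (t : ℕ) : ℝ :=
  1 + (R.lossConst + (crossMoment (driveLaw q S0)
        (fun ω => R.quadLoss Δ t (ω, r)) (fun ω => R.quadLoss Δ t (ω, r))).trace)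
        + ((R.totalMass Δ (r t)).toReal - 1) / Real.log 2

lemma pathCode_expLength_le (hΔ : ∀ i, 0 < Δ i) (S0 : Matrix (Fin p) (Fin p) ℝ)
    (r : ℕ → Vec p) (code : ℕ → (Fin p → ℤ) → Word)
    (hpre : ∀ t s s', code t s <+: code t s' → s = s') (t : ℕ)
    (hlen : ∀ s, ((code t s).length : ℝ) ≤ 1 - Real.logb 2 (R.refMass Δ s (r t))
        + ((R.totalMass Δ (r t)).toReal - 1) / Real.log 2) :
    0 ≤ R.pathLoss S0 Δ r t ∧ (R.pathCode Δ r code hpre).expLength (sourceLaw A B S0) t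
        ≤ ENNReal.ofReal (R.pathLoss S0 Δ r t) := by
  have hk := R.sqInt_predErr_path hΔ S0 r
  have hv := R.sqInt_qerrAt_path hΔ S0 r
  set b := R.pathLoss S0 Δ r t with hb
  have hU : ∃ U : Vec p × (ℕ → Vec q) → ℝ, Integrable U (driveLaw q S0) ∧
      ∫ ω, U ω ∂(driveLaw q S0) = b ∧ ∀ ω,
        ((code t (R.output Δ (sourcePath A B ω.1 ω.2) r t)).length : ℝ) ≤ U ω := by
    refine ⟨fun ω => 1 + R.outputLoss Δ t (sourcePath A B ω.1 ω.2, r)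
      + ((R.totalMass Δ (r t)).toReal - 1) / Real.log 2, ?_, ?_, fun ω => ?_⟩
    · have h1 := R.integrable_loss hΔ (k := fun ω => R.predErr Δ t (ω, r)) (r := fun ω => r t)
        (hk t) (hv t)
      exact ((integrable_const 1).add h1).add (integrable_const _)
    · have h1 := R.integrable_loss hΔ (k := fun ω => R.predErr Δ t (ω, r)) (r := fun ω => r t)
        (hk t) (hv t)
      have h2 := R.integral_loss hΔ (k := fun ω => R.predErr Δ t (ω, r)) (r := fun ω => r t)
        (hk t) (hv t)
      have h3 : Integrable (fun ω => R.outputLoss Δ t (sourcePath A B ω.1 ω.2, r))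
        (driveLaw q S0) := h1
      have h4 : ∫ ω, R.outputLoss Δ t (sourcePath A B ω.1 ω.2, r) ∂(driveLaw q S0)
        = R.lossConst + (crossMoment (driveLaw q S0)
        (fun ω => R.quadLoss Δ t (ω, r)) (fun ω => R.quadLoss Δ t (ω, r))).trace := h2
      have h5 : Integrable (fun ω => 1 + R.outputLoss Δ t (sourcePath A B ω.1 ω.2, r))
        (driveLaw q S0) := (integrable_const 1).add h3
      rw [integral_add h5 (integrable_const _), integral_add (integrable_const 1) h3, h4]
      simp [hb, pathLoss]
    · have h1 := hlen (R.output Δ (sourcePath A B ω.1 ω.2) r t)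
      simp only [outputLoss]
      linarith
  obtain ⟨U, hUi, hUb, hUl⟩ := hU
  have hU0 : ∀ ω, 0 ≤ U ω := fun ω => (Nat.cast_nonneg _).trans (hUl ω)
  refine ⟨hUb ▸ integral_nonneg hU0, ?_⟩
  rw [← hUb, ofReal_integral_eq_lintegral_ofReal hUi (ae_of_all _ hU0),
    ZeroDelayCode.expLength_eq _ _ (Z := fun s x => code s (R.output Δ x r s))
    (Y := fun s x => R.recon Δ x r s) (R.pathCode_hist r code hpre), sourceLaw_eq_map,
    lintegral_map _ (measurable_sourcePath A B)]
  · refine lintegral_mono fun ω => ?_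
    rw [← ENNReal.ofReal_natCast]
    exact ENNReal.ofReal_le_ofReal (hUl ω)
  · have h4 : Measurable fun x : ℕ → Vec p => R.output Δ x r t :=
      R.measurable_output_comp r t measurable_id
    exact (measurable_of_countable fun s : Fin p → ℤ => ((code t s).length : ℝ≥0∞)).comp h4

/-- A fixed dither path gives a zero-delay code with the performance of the realization. -/
theorem opta_le (hAB : IsStabilizable A B) (S0 : Matrix (Fin p) (Fin p) ℝ) :
    opta (sourceLaw A B S0) D ≤ ENNReal.ofReal
      (R.rate + ((p : ℝ) / 2 * Real.logb 2 (Real.pi * Real.exp 1 / 6) + 1)) := by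
  -- The bound does not depend on the step sizes, so any choice will do.
  set Δ : Vec p := fun _ => 1 with hΔdef
  have hΔ : ∀ i, 0 < Δ i := fun i => one_pos
  have hl2 : 0 < Real.log 2 := Real.log_pos one_lt_two
  -- One dither path that is simultaneously good for the distortion, for the quadratic loss, for
  -- finiteness of the total masses and for their averages.
  obtain ⟨r, hr1, hr2, hr3, hr4⟩ := ((R.ae_eventually_sum_cost_le hAB hΔ S0 R.filt
    (-(R.E⁻¹ * diagonal (R.Θ Δ)))).and ((R.ae_eventually_sum_cost_le hAB hΔ S0
    (R.lossScale Δ * diagonal (R.Φ Δ) * R.E) (R.lossScale Δ)).and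
    ((R.ae_totalMass_ne_top hΔ).and (R.ae_eventually_sum_totalMass_le hΔ)))).exists
  choose code hpre hlen using fun t => exists_prefixCode (f := fun b => R.refMass Δ b (r t))
    (fun b => R.refMass_pos hΔ b (r t)) (hr3 t)
  have hk := R.sqInt_predErr_path hΔ S0 r
  have hv := R.sqInt_qerrAt_path hΔ S0 r
  refine iInf₂_le_of_le (R.pathCode Δ r code hpre) ?_ ?_
  · rw [funext (R.pathCode_expDistortion hΔ S0 r code hpre)]
    refine (limsupAvg_ofReal_le (fun t => ?_) hr1).trans ?_
    · exact (posSemidef_crossMoment (((hk t).mulVec _).add ((hv t).mulVec _))).trace_nonneg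
    · rw [R.steadyCost_recon hΔ]
      exact ENNReal.ofReal_le_ofReal R.trace_le
  · have hb0 := fun t => R.pathCode_expLength_le hΔ S0 r code hpre t (hlen t)
    refine (limsupAvg_mono fun t => (hb0 t).2).trans
      (limsupAvg_ofReal_le (fun t => (hb0 t).1) fun ε hε => ?_)
    filter_upwards [hr2 (ε / 2) (half_pos hε), hr4 (ε / 2 * Real.log 2)
      (mul_pos (half_pos hε) hl2)] with n h1 h2
    rw [← mul_assoc, ← div_le_iff₀ hl2, Finset.sum_div] at h2
    simp only [pathLoss, Finset.sum_add_distrib, Finset.sum_const, Finset.card_range, nsmul_eq_mul]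
    have h3 := mul_le_mul_of_nonneg_left (R.steadyCost_loss_le hΔ) (Nat.cast_nonneg (α := ℝ) n)
    rw [show R.rate + ((p : ℝ) / 2 * Real.logb 2 (Real.pi * Real.exp 1 / 6) + 1)
      = R.lossConst + p * (1 / (2 * Real.log 2)) + 1 by rw [R.lossConst_add]; ring]
    unfold quadLoss
    nlinarith

end Realization

/-! ### Gaussian laws -/

/-- The law of `m + C z` for a standard Gaussian vector `z`. -/
def gaussLaw {d : ℕ} {κ : Type*} [Fintype κ] (m : Vec d) (C : Matrix (Fin d) κ ℝ) :
    Measure (Vec d) :=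
  (Measure.pi fun _ : κ => gaussianReal 0 1).map fun z => m + C *ᵥ z

section GaussLaw

variable {d : ℕ} {κ η : Type*} [Fintype κ] [Fintype η]

lemma measurable_affine (m : Vec d) (C : Matrix (Fin d) κ ℝ) :
    Measurable fun z : κ → ℝ => m + C *ᵥ z :=
  (continuous_const.add (Continuous.matrix_mulVec continuous_const continuous_id)).measurable

instance (m : Vec d) (C : Matrix (Fin d) κ ℝ) : IsProbabilityMeasure (gaussLaw m C) :=
  Measure.isProbabilityMeasure_map (measurable_affine m C).aemeasurable

lemma charFunDual_gaussLaw (m : Vec d) (C : Matrix (Fin d) κ ℝ) (L : StrongDual ℝ (Vec d)) :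
    charFunDual (gaussLaw m C) L = Complex.exp (L m * Complex.I)
      * Complex.exp (-(((fun i => L (Pi.single i 1)) ⬝ᵥ (C * Cᵀ) *ᵥ
        (fun i => L (Pi.single i 1)) : ℝ) : ℂ) / 2) := by
  set l : Vec d := fun i => L (Pi.single i 1) with hl
  have hL : ∀ x : Vec d, L x = l ⬝ᵥ x := fun x => by
    conv_lhs => rw [← Finset.univ_sum_single x]
    rw [map_sum, dotProduct]
    refine Finset.sum_congr rfl fun i _ => ?_
    have : (Pi.single i (x i) : Vec d) = x i • Pi.single i 1 := by
      rw [← Pi.single_smul]; simp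
    rw [this, map_smul, smul_eq_mul, mul_comm]
  have h1 : ∀ z : κ → ℝ, Complex.exp (L (m + C *ᵥ z) * Complex.I)
      = Complex.exp (L m * Complex.I) * ∏ j, Complex.exp (((l ᵥ* C) j : ℂ) * z j * Complex.I) := by
    intro z
    rw [← Complex.exp_sum, ← Complex.exp_add, map_add, hL (C *ᵥ z), dotProduct_mulVec]
    congr 1
    rw [dotProduct]
    push_cast
    rw [add_mul, Finset.sum_mul]
  rw [charFunDual_apply, gaussLaw, integral_map (measurable_affine m C).aemeasurable
    (by fun_prop)]
  simp only [h1]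
  rw [integral_const_mul, integral_fintype_prod_eq_prod
    (f := fun j (x : ℝ) => Complex.exp (((l ᵥ* C) j : ℂ) * x * Complex.I))]
  congr 1
  simp only [← charFun_apply_real, charFun_gaussianReal]
  rw [← Complex.exp_sum]
  congr 1
  have h2 : l ⬝ᵥ (C * Cᵀ) *ᵥ l = ∑ j, (l ᵥ* C) j ^ 2 := by
    rw [← Matrix.mulVec_mulVec, dotProduct_mulVec, mulVec_transpose, dotProduct]
    simp only [sq]
  rw [h2]
  push_cast
  rw [← Finset.sum_neg_distrib, Finset.sum_div]
  refine Finset.sum_congr rfl fun j _ => ?_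
  simp [neg_div]

/-- A Gaussian law depends on the factor of its covariance only through the covariance. -/
lemma gaussLaw_congr (m : Vec d) {C : Matrix (Fin d) κ ℝ} {C' : Matrix (Fin d) η ℝ}
    (h : C * Cᵀ = C' * C'ᵀ) : gaussLaw m C = gaussLaw m C' := by
  refine Measure.ext_of_charFunDual ?_
  ext L
  rw [charFunDual_gaussLaw, charFunDual_gaussLaw, h]

open scoped MatrixOrder in
/-- The Gaussian law with mean `m` and covariance `S`. -/
def gauss (m : Vec d) (S : Matrix (Fin d) (Fin d) ℝ) : Measure (Vec d) := gaussLaw m (CFC.sqrt S)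

instance (m : Vec d) (S : Matrix (Fin d) (Fin d) ℝ) : IsProbabilityMeasure (gauss m S) := by
  unfold gauss; infer_instance

open scoped MatrixOrder in
lemma gaussLaw_eq_gauss (m : Vec d) (C : Matrix (Fin d) κ ℝ) :
    gaussLaw m C = gauss m (C * Cᵀ) := by
  have hS : (C * Cᵀ).PosSemidef := by
    have := Matrix.posSemidef_self_mul_conjTranspose C
    rwa [Matrix.conjTranspose_eq_transpose_of_trivial] at this
  refine gaussLaw_congr m ?_
  have h := (CFC.sqrt_nonneg (C * Cᵀ)).posSemidef.isHermitian.eq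
  rw [Matrix.conjTranspose_eq_transpose_of_trivial] at h
  rw [h, CFC.sqrt_mul_sqrt_self _ hS.nonneg]

lemma exists_gauss_eq (m : Vec d) {S : Matrix (Fin d) (Fin d) ℝ} (hS : S.PosSemidef) :
    ∃ C : Matrix (Fin d) (Fin d) ℝ, C * Cᵀ = S ∧ gauss m S = gaussLaw m C := by
  obtain ⟨C, -, h1, h2⟩ := exists_posSemidef_sqrt hS
  exact ⟨C, by rw [h1, h2], by rw [gaussLaw_eq_gauss, h1, h2]⟩

/-- The image of a Gaussian law under a linear map with additive Gaussian noise. -/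
lemma lintegral_gauss_step {q : ℕ} (m : Vec d) {S : Matrix (Fin d) (Fin d) ℝ} (hS : S.PosSemidef)
    (A : Matrix (Fin d) (Fin d) ℝ) (B : Matrix (Fin d) (Fin q) ℝ) {g : Vec d → ℝ≥0∞}
    (hg : Measurable g) :
    ∫⁻ z, ∫⁻ w, g (A *ᵥ z + B *ᵥ w) ∂(noiseStep q) ∂(gauss m S)
      = ∫⁻ z, g z ∂(gauss (A *ᵥ m) (A * S * Aᵀ + B * Bᵀ)) := by
  obtain ⟨C, hC, h⟩ := exists_gauss_eq m hS
  -- The sum is the image of one longer standard Gaussian vector under the block matrix `[AC B]`,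
  -- and a Gaussian law depends only on the product of the factor with its transpose.
  have h2 : A * S * Aᵀ + B * Bᵀ = fromCols (A * C) B * (fromCols (A * C) B)ᵀ := by
    rw [transpose_fromCols, fromCols_mul_fromRows, Matrix.transpose_mul, ← hC]
    simp only [Matrix.mul_assoc]
  have hm : Measurable fun a : (Fin d → ℝ) × (Fin q → ℝ) => g (A *ᵥ (m + C *ᵥ a.1) + B *ᵥ a.2) := by
    refine hg.comp (Continuous.measurable ?_)
    exact (Continuous.matrix_mulVec continuous_const (continuous_const.add
      (Continuous.matrix_mulVec continuous_const continuous_fst))).add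
      (Continuous.matrix_mulVec continuous_const continuous_snd)
  have hm2 : Measurable fun a : Vec d × Vec q => g (A *ᵥ a.1 + B *ᵥ a.2) := by
    refine hg.comp (Continuous.measurable ?_)
    exact (Continuous.matrix_mulVec continuous_const continuous_fst).add
      (Continuous.matrix_mulVec continuous_const continuous_snd)
  rw [h2, ← gaussLaw_eq_gauss, h, gaussLaw, gaussLaw,
    lintegral_map (Measurable.lintegral_prod_right' hm2) (measurable_affine _ _),
    lintegral_map hg (measurable_affine _ _)]
  have h3 := (measurePreserving_sumPiEquivProdPi
    (fun _ : Fin d ⊕ Fin q => gaussianReal 0 1)).lintegral_comp hm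
  rw [lintegral_prod _ hm.aemeasurable] at h3
  refine h3.symm.trans (lintegral_congr fun z => ?_)
  congr 1
  rw [Matrix.mulVec_add, Matrix.mulVec_mulVec, add_assoc]
  congr 1
  rw [fromCols_mulVec]
  rfl

end GaussLaw

/-! ### Densities -/

/-- The logarithm of the centred Gaussian density, up to a constant. -/
def logDens {d : ℕ} (S : Matrix (Fin d) (Fin d) ℝ) (z : Vec d) : ℝ :=
  -(1 / 2) * Real.log S.det - 1 / 2 * (z ⬝ᵥ S⁻¹ *ᵥ z)

lemma measurable_logDens {d : ℕ} (S : Matrix (Fin d) (Fin d) ℝ) : Measurable (logDens S) := by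
  refine Continuous.measurable ?_
  unfold logDens
  exact continuous_const.sub (continuous_const.mul (continuous_id.dotProduct
    (Continuous.matrix_mulVec continuous_const continuous_id)))

lemma lintegral_noiseStep {d : ℕ} {g : Vec d → ℝ≥0∞} (hg : Measurable g) :
    ∫⁻ z, g z ∂(noiseStep d) = ∫⁻ z, g z * ENNReal.ofReal
      ((Real.sqrt (2 * Real.pi))⁻¹ ^ d * Real.exp (-(1 / 2) * (z ⬝ᵥ z))) := by
  have h1 : ∀ z : Vec d, ENNReal.ofReal
      ((Real.sqrt (2 * Real.pi))⁻¹ ^ d * Real.exp (-(1 / 2) * (z ⬝ᵥ z)))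
      = ∏ i, gaussianPDF 0 1 (z i) := by
    intro z
    simp only [gaussianPDF]
    rw [← ENNReal.ofReal_prod_of_nonneg fun i _ => gaussianPDFReal_nonneg _ _ _]
    congr 1
    simp only [gaussianPDFReal, NNReal.coe_one, mul_one, sub_zero, Finset.prod_mul_distrib,
      Finset.prod_const, Finset.card_univ, Fintype.card_fin, ← Real.exp_sum, dotProduct]
    congr 2
    rw [Finset.mul_sum]
    refine Finset.sum_congr rfl fun i _ => ?_
    ring
  have hm : Measurable fun z : Vec d => ∏ i, gaussianPDF 0 1 (z i) :=
    Finset.measurable_prod _ fun i _ => (measurable_gaussianPDF 0 1).comp (measurable_pi_apply i)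
  have h2 : noiseStep d = (volume : Measure (Vec d)).withDensity
      fun z => ∏ i, gaussianPDF 0 1 (z i) := by
    refine Measure.pi_eq fun s hs => ?_
    rw [withDensity_apply _ (MeasurableSet.univ_pi hs), volume_pi, Measure.restrict_pi_pi,
      lintegral_prod_pi fun i => measurable_gaussianPDF 0 1]
    refine Finset.prod_congr rfl fun i _ => ?_
    rw [gaussianReal_apply 0 one_ne_zero]
  simp only [h1]
  rw [h2, lintegral_withDensity_eq_lintegral_mul _ hm hg]
  simp only [Pi.mul_apply, mul_comm]

/-- The density of a nonsingular Gaussian law. -/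
lemma lintegral_gauss {d : ℕ} (m : Vec d) {S : Matrix (Fin d) (Fin d) ℝ} (hS : S.PosDef)
    {g : Vec d → ℝ≥0∞} (hg : Measurable g) :
    ∫⁻ z, g z ∂(gauss m S) = ∫⁻ z, g z * ENNReal.ofReal
      ((Real.sqrt (2 * Real.pi))⁻¹ ^ d * Real.exp (logDens S (z - m))) := by
  obtain ⟨C, hC, h⟩ := exists_gauss_eq m hS.posSemidef
  have hdet : C.det * C.det = S.det := by rw [← hC, det_mul, det_transpose]
  have hSpos : 0 < S.det := hS.det_pos
  have hC0 : C.det ≠ 0 := fun h0 => by rw [h0, mul_zero] at hdet; exact hSpos.ne hdet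
  have hunit : IsUnit C.det := hC0.isUnit
  set G : Vec d → ℝ≥0∞ := fun x => g x * ENNReal.ofReal
      ((Real.sqrt (2 * Real.pi))⁻¹ ^ d
        * Real.exp (-(1 / 2) * ((C⁻¹ *ᵥ (x - m)) ⬝ᵥ (C⁻¹ *ᵥ (x - m))))) with hG
  have hcont : Continuous fun x : Vec d => C⁻¹ *ᵥ (x - m) :=
    Continuous.matrix_mulVec continuous_const (continuous_id.sub continuous_const)
  have hGm : Measurable G := by
    refine hg.mul (ENNReal.measurable_ofReal.comp (Continuous.measurable ?_))
    exact continuous_const.mul (Real.continuous_exp.comp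
      (continuous_const.mul (hcont.dotProduct hcont)))
  have h1 : ∫⁻ z, g z ∂(gauss m S) = ∫⁻ z, G (m + C *ᵥ z) := by
    rw [h, gaussLaw, lintegral_map hg (measurable_affine m C)]
    have := lintegral_noiseStep (hg.comp (measurable_affine m C))
    refine this.trans (lintegral_congr fun z => ?_)
    simp only [hG, Function.comp_apply, add_sub_cancel_left, Matrix.mulVec_mulVec,
      nonsing_inv_mul C hunit, Matrix.one_mulVec]
  have h2 : ∫⁻ z, G (m + C *ᵥ z) = ENNReal.ofReal |C.det⁻¹| * ∫⁻ x, G x := by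
    have h3 := Real.map_matrix_volume_pi_eq_smul_volume_pi hC0
    have h4 : Measurable fun x => G (m + x) := hGm.comp (measurable_const_add m)
    have h5 : Measurable (toLin' C) := (LinearMap.continuous_of_finiteDimensional _).measurable
    have h6 : ∫⁻ z, G (m + C *ᵥ z) = ∫⁻ x, G (m + x) ∂(Measure.map (toLin' C) volume) := by
      rw [lintegral_map h4 h5]; rfl
    rw [h6, h3, lintegral_smul_measure, lintegral_add_left_eq_self G m]; rfl
  rw [h1, h2, ← lintegral_const_mul _ hGm]
  refine lintegral_congr fun x => ?_
  have h3 : (C⁻¹ *ᵥ (x - m)) ⬝ᵥ (C⁻¹ *ᵥ (x - m)) = (x - m) ⬝ᵥ S⁻¹ *ᵥ (x - m) := by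
    rw [← hC, Matrix.mul_inv_rev, ← Matrix.mulVec_mulVec, ← transpose_nonsing_inv,
      dotProduct_mulVec (x - m), vecMul_transpose]
  -- The Jacobian of `z ↦ m + C z` supplies the determinant term of `logDens`.
  have h4 : |C.det⁻¹| = Real.exp (-(1 / 2) * Real.log S.det) := by
    rw [← hdet, Real.log_mul hC0 hC0, abs_inv, ← Real.exp_log (abs_pos.2 hC0), Real.log_abs,
      ← Real.exp_neg]
    congr 1
    ring
  simp only [hG, h3]
  rw [mul_left_comm, ← ENNReal.ofReal_mul (abs_nonneg _), h4, mul_left_comm, ← Real.exp_add]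
  congr 4
  rw [logDens]
  ring

/-- Change of measure between nonsingular Gaussian laws. -/
lemma lintegral_gauss_reweight {d : ℕ} (m a : Vec d) {S S' : Matrix (Fin d) (Fin d) ℝ}
    (hS : S.PosDef) (hS' : S'.PosDef) {g : Vec d → ℝ≥0∞} (hg : Measurable g) :
    ∫⁻ z, ENNReal.ofReal (Real.exp (logDens S' (z - a) - logDens S (z - m))) * g z ∂(gauss m S)
      = ∫⁻ z, g z ∂(gauss a S') := by
  have hm1 : Measurable fun z => logDens S' (z - a) :=
    (measurable_logDens S').comp (measurable_id.sub_const a)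
  have hm2 : Measurable fun z => logDens S (z - m) :=
    (measurable_logDens S).comp (measurable_id.sub_const m)
  have hm3 : Measurable fun z =>
      ENNReal.ofReal (Real.exp (logDens S' (z - a) - logDens S (z - m))) * g z :=
    ((hm1.sub hm2).exp.ennreal_ofReal).mul hg
  rw [lintegral_gauss m hS hm3, lintegral_gauss a hS' hg]
  refine lintegral_congr fun z => ?_
  rw [mul_right_comm, ← ENNReal.ofReal_mul (Real.exp_pos _).le, mul_comm]
  congr 2
  rw [mul_left_comm, ← Real.exp_add]
  congr 2
  ring

/-! ### A variational lower bound for the relative entropy -/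

/-- The Donsker–Varadhan bound: pointwise `f ≤ llr + (exp (f - llr) - 1)`, and the exponential has
`μ`-mean at most `∫ exp f dν ≤ 1`. Without absolute continuity or integrability the divergence is
infinite. -/
lemma ofReal_integral_le_klDiv {α : Type*} [MeasurableSpace α] {μ ν : Measure α}
    [IsProbabilityMeasure μ] [IsProbabilityMeasure ν] {f : α → ℝ} (hfm : Measurable f)
    (hfi : Integrable f μ) (h : ∫⁻ a, ENNReal.ofReal (Real.exp (f a)) ∂ν ≤ 1) :
    ENNReal.ofReal (∫ a, f a ∂μ) ≤ InformationTheory.klDiv μ ν := by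
  by_cases hac : μ ≪ ν ∧ Integrable (llr μ ν) μ
  swap
  · rw [InformationTheory.klDiv_def, if_neg hac]; exact le_top
  obtain ⟨hac, hli⟩ := hac
  rw [InformationTheory.klDiv_of_ac_of_integrable hac hli]
  refine ENNReal.ofReal_le_ofReal ?_
  simp only [probReal_univ, add_sub_cancel_right]
  set r := μ.rnDeriv ν with hr
  have hrm : Measurable r := Measure.measurable_rnDeriv μ ν
  set g : α → ℝ≥0∞ := fun a => ENNReal.ofReal (Real.exp (f a)) * (r a)⁻¹ with hg
  have hgm : Measurable g := hfm.exp.ennreal_ofReal.mul hrm.inv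
  have hg1 : ∫⁻ a, g a ∂μ ≤ 1 := by
    rw [← lintegral_rnDeriv_mul hac hgm.aemeasurable]
    refine (lintegral_mono fun a => ?_).trans h
    simp only [hg]
    rw [mul_left_comm]
    exact mul_le_of_le_one_right' (ENNReal.mul_inv_le_one _)
  have hgi : Integrable (fun a => (g a).toReal) μ :=
    integrable_toReal_of_lintegral_ne_top hgm.aemeasurable
      (ne_top_of_le_ne_top ENNReal.one_ne_top hg1)
  have hgI : ∫ a, (g a).toReal ∂μ ≤ 1 := by
    rw [integral_toReal hgm.aemeasurable (ae_lt_top hgm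
      (ne_top_of_le_ne_top ENNReal.one_ne_top hg1))]
    exact ENNReal.toReal_mono ENNReal.one_ne_top hg1
  have hle : ∀ᵐ a ∂μ, f a ≤ llr μ ν a + ((g a).toReal - 1) := by
    filter_upwards [Measure.rnDeriv_pos hac, hac.ae_le (Measure.rnDeriv_lt_top μ ν)] with a h1 h2
    have h3 : 0 < (r a).toReal := ENNReal.toReal_pos h1.ne' h2.ne
    have h4 : (g a).toReal = Real.exp (f a - Real.log (r a).toReal) := by
      simp only [hg]
      rw [ENNReal.toReal_mul, ENNReal.toReal_ofReal (Real.exp_pos _).le, ENNReal.toReal_inv,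
        Real.exp_sub, Real.exp_log h3, div_eq_mul_inv]
    have h5 := Real.add_one_le_exp (f a - Real.log (r a).toReal)
    rw [h4, llr]
    linarith
  have i1 : Integrable (fun a => (g a).toReal - 1) μ := hgi.sub (integrable_const 1)
  refine (integral_mono_ae hfi (hli.add i1) hle).trans ?_
  simp only [Pi.add_apply]
  rw [integral_add hli i1, integral_sub hgi (integrable_const 1)]
  simp only [integral_const, probReal_univ, one_smul]
  linarith

/-! ### Exponential moments of a Gaussian state under reweighting -/

section Reweight

variable {d q : ℕ} (A : Matrix (Fin d) (Fin d) ℝ) (B : Matrix (Fin d) (Fin q) ℝ)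

/-- The covariances `A S Aᵀ + B Bᵀ` of the uncontrolled state started at zero. -/
def stateCov : ℕ → Matrix (Fin d) (Fin d) ℝ
  | 0 => 0
  | t + 1 => A * stateCov t * Aᵀ + B * Bᵀ

lemma posSemidef_mul_transpose {m n : Type*} [Fintype m] [Fintype n] (C : Matrix m n ℝ) :
    (C * Cᵀ).PosSemidef := by
  have := Matrix.posSemidef_self_mul_conjTranspose C
  rwa [Matrix.conjTranspose_eq_transpose_of_trivial] at this

lemma posSemidef_conj {m n : Type*} [Fintype m] [Fintype n] {S : Matrix n n ℝ}
    (hS : S.PosSemidef) (C : Matrix m n ℝ) : (C * S * Cᵀ).PosSemidef := by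
  have := hS.mul_mul_conjTranspose_same C
  rwa [Matrix.conjTranspose_eq_transpose_of_trivial] at this

lemma posSemidef_stateCov (t : ℕ) : (stateCov A B t).PosSemidef := by
  induction t with
  | zero => exact Matrix.PosSemidef.zero
  | succ t ih => exact (posSemidef_conj ih A).add (posSemidef_mul_transpose B)

/-- The law of the process noise. -/
def noiseLaw (q : ℕ) : Measure (ℕ → Vec q) := Measure.infinitePi fun _ : ℕ => noiseStep q

instance : IsProbabilityMeasure (noiseLaw q) := by unfold noiseLaw; infer_instance

lemma measurable_state (t : ℕ) : Measurable fun w : ℕ → Vec q => sourcePath A B 0 w t :=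
  (measurable_pi_apply t).comp ((measurable_sourcePath A B).comp measurable_prodMk_left)

/-- The weight `F` does not involve the noise at time `t`, which can therefore be integrated out,
leaving a function of the state at time `t`. -/
lemma lintegral_state_succ {t : ℕ} {F : (ℕ → Vec q) → ℝ≥0∞} (hF : Measurable F)
    (hFt : ∀ w w', F (Function.update w t w') = F w) {g : Vec d → ℝ≥0∞} (hg : Measurable g) :
    ∫⁻ w, F w * g (sourcePath A B 0 w (t + 1)) ∂(noiseLaw q)
      = ∫⁻ w, F w * ∫⁻ v, g (A *ᵥ sourcePath A B 0 w t + B *ᵥ v) ∂(noiseStep q) ∂(noiseLaw q) := by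
  have hm : Measurable (Function.uncurry fun (b : ℝ≥0∞ × Vec d) (v : Vec q) =>
      b.1 * g (A *ᵥ b.2 + B *ᵥ v)) := by
    have h1 : Continuous fun a : (ℝ≥0∞ × Vec d) × Vec q => A *ᵥ a.1.2 + B *ᵥ a.2 :=
      (Continuous.matrix_mulVec continuous_const (continuous_snd.comp continuous_fst)).add
        (Continuous.matrix_mulVec continuous_const continuous_snd)
    have h2 : Measurable fun a : (ℝ≥0∞ × Vec d) × Vec q => a.1.1 := by fun_prop
    exact h2.mul (hg.comp h1.measurable)
  have h := lintegral_of_resample (measurePreserving_update (noiseStep q) t)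
    (H := fun w => (F w, sourcePath A B 0 w t)) (W := fun w => w t)
    (hF.prodMk (measurable_state A B t)) (measurable_pi_apply t)
    (fun w v => Prod.ext (hFt w v) (sourcePath_update A B 0 w le_rfl v)) (fun w v => by simp) hm
  refine h.trans (lintegral_congr fun w => ?_)
  have h1 : Continuous fun v : Vec q => A *ᵥ sourcePath A B 0 w t + B *ᵥ v :=
    continuous_const.add (Continuous.matrix_mulVec continuous_const continuous_id)
  exact lintegral_const_mul _ (hg.comp h1.measurable)

lemma measurable_step_lintegral {g : Vec d → ℝ≥0∞} (hg : Measurable g) :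
    Measurable fun z : Vec d => ∫⁻ v, g (A *ᵥ z + B *ᵥ v) ∂(noiseStep q) := by
  have h1 : Continuous fun a : Vec d × Vec q => A *ᵥ a.1 + B *ᵥ a.2 :=
      (Continuous.matrix_mulVec continuous_const continuous_fst).add
        (Continuous.matrix_mulVec continuous_const continuous_snd)
  exact Measurable.lintegral_prod_right' (hg.comp h1.measurable)

lemma lintegral_state (t : ℕ) {g : Vec d → ℝ≥0∞} (hg : Measurable g) :
    ∫⁻ w, g (sourcePath A B 0 w t) ∂(noiseLaw q) = ∫⁻ z, g z ∂(gauss 0 (stateCov A B t)) := by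
  induction t generalizing g with
  | zero =>
    have h : gauss (0 : Vec d) 0 = gaussLaw 0 (0 : Matrix (Fin d) (Fin d) ℝ) := by
      rw [gaussLaw_eq_gauss]; simp
    simp [sourcePath, stateCov, h, gaussLaw, Measure.map_const, lintegral_dirac' _ hg]
  | succ t ih =>
    have h := lintegral_state_succ A B (t := t) (F := fun _ => 1) measurable_const (fun _ _ => rfl) hg
    simp only [one_mul] at h
    rw [h, ih (measurable_step_lintegral A B hg),
      lintegral_gauss_step 0 (posSemidef_stateCov A B t) A B hg, Matrix.mulVec_zero, stateCov]

/-- The a priori means of a linear filter with gains `K` and observations `η`. -/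
def priorMean (K : ℕ → Matrix (Fin d) (Fin d) ℝ) (η : ℕ → Vec d) : ℕ → Vec d
  | 0 => 0
  | k + 1 => A *ᵥ (priorMean K η k + K k *ᵥ (η k - priorMean K η k))

/-- The a posteriori means of a linear filter with gains `K` and observations `η`. -/
def postMean (K : ℕ → Matrix (Fin d) (Fin d) ℝ) (η : ℕ → Vec d) (k : ℕ) : Vec d :=
  priorMean A K η k + K k *ᵥ (η k - priorMean A K η k)

lemma priorMean_succ (K : ℕ → Matrix (Fin d) (Fin d) ℝ) (η : ℕ → Vec d) (k : ℕ) :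
    priorMean A K η (k + 1) = A *ᵥ postMean A K η k := rfl

/-- The model covariances of the filter: `G` at first, later `A P Aᵀ + B Bᵀ`. -/
def modelCov (G P : Matrix (Fin d) (Fin d) ℝ) : ℕ → Matrix (Fin d) (Fin d) ℝ
  | 0 => G
  | _ + 1 => A * P * Aᵀ + B * Bᵀ

/-- The increments of the information density of the model. -/
def infoIncr (G P : Matrix (Fin d) (Fin d) ℝ) (K : ℕ → Matrix (Fin d) (Fin d) ℝ)
    (ξ η : ℕ → Vec d) (k : ℕ) : ℝ :=
  logDens P (ξ k - postMean A K η k) - logDens (modelCov A B G P k) (ξ k - priorMean A K η k)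

/-- The information density of the model, with a wide Gaussian `N(m, S)` as the last
posterior. -/
def infoDens (G P S : Matrix (Fin d) (Fin d) ℝ) (K : ℕ → Matrix (Fin d) (Fin d) ℝ)
    (N : ℕ) (ξ η : ℕ → Vec d) : ℝ :=
  ∑ k ∈ Finset.range N, infoIncr A B G P K ξ η k
    + (logDens S (ξ N - priorMean A K η N)
      - logDens (modelCov A B G P N) (ξ N - priorMean A K η N))

variable {A B} {G P S : Matrix (Fin d) (Fin d) ℝ}

lemma posDef_modelCov (hG : G.PosDef) (hP : (A * P * Aᵀ + B * Bᵀ).PosDef) (k : ℕ) :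
    (modelCov A B G P k).PosDef := by
  cases k with
  | zero => exact hG
  | succ k => exact hP

lemma measurable_state_infoIncr (K : ℕ → Matrix (Fin d) (Fin d) ℝ) (T : ℕ) (η : ℕ → Vec d)
    (k : ℕ) : Measurable fun w : ℕ → Vec q =>
      infoIncr A B G P K (fun j => sourcePath A B 0 w (T + j)) η k := by
  unfold infoIncr
  exact ((measurable_logDens _).comp ((measurable_state A B (T + k)).sub_const _)).sub
    ((measurable_logDens _).comp ((measurable_state A B (T + k)).sub_const _))

/-- The reweighted law of the state is Gaussian. -/
lemma lintegral_reweighted {T : ℕ} (hG : (stateCov A B T).PosDef) (hP0 : P.PosDef)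
    (hP : (A * P * Aᵀ + B * Bᵀ).PosDef) (K : ℕ → Matrix (Fin d) (Fin d) ℝ) (η : ℕ → Vec d)
    (N : ℕ) {g : Vec d → ℝ≥0∞} (hg : Measurable g) :
    ∫⁻ w, ENNReal.ofReal (Real.exp (∑ k ∈ Finset.range N,
        infoIncr A B (stateCov A B T) P K (fun j => sourcePath A B 0 w (T + j)) η k))
        * g (sourcePath A B 0 w (T + N)) ∂(noiseLaw q)
      = ∫⁻ z, g z ∂(gauss (priorMean A K η N) (modelCov A B (stateCov A B T) P N)) := by
  induction N generalizing g with
  | zero => simpa [priorMean, modelCov] using lintegral_state A B T hg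
  | succ N ih =>
    have hFm : Measurable fun w : ℕ → Vec q => ENNReal.ofReal (Real.exp
        (∑ k ∈ Finset.range (N + 1),
        infoIncr A B (stateCov A B T) P K (fun j => sourcePath A B 0 w (T + j)) η k)) :=
      (Finset.measurable_sum _ fun k _ => measurable_state_infoIncr K T η k).exp.ennreal_ofReal
    have hFt : ∀ (w : ℕ → Vec q) w', ENNReal.ofReal (Real.exp (∑ k ∈ Finset.range (N + 1),
        infoIncr A B (stateCov A B T) P K
          (fun j => sourcePath A B 0 (Function.update w (T + N) w') (T + j)) η k))
        = ENNReal.ofReal (Real.exp (∑ k ∈ Finset.range (N + 1),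
        infoIncr A B (stateCov A B T) P K (fun j => sourcePath A B 0 w (T + j)) η k)) := by
      intro w w'
      congr 2
      refine Finset.sum_congr rfl fun k hk => ?_
      have hk' : T + k ≤ T + N := by have := Finset.mem_range.1 hk; omega
      simp only [infoIncr, sourcePath_update A B 0 w hk']
    -- One filter cycle for fixed observations `η`: the new increment replaces the Gaussian prior by
    -- `N(a, P)`, and the dynamics carry this to the next prior. The gains enter only through the
    -- means.
    have h1 := lintegral_state_succ A B (t := T + N) hFm hFt hg
    set h : Vec d → ℝ≥0∞ := fun z => ∫⁻ v, g (A *ᵥ z + B *ᵥ v) ∂(noiseStep q) with hh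
    have hhm : Measurable h := measurable_step_lintegral A B hg
    set a := postMean A K η N with ha
    set m := priorMean A K η N with hm
    set S := modelCov A B (stateCov A B T) P N with hS
    have hm1 : Measurable fun z => logDens P (z - a) :=
      (measurable_logDens P).comp (measurable_id.sub_const a)
    have hm2 : Measurable fun z => logDens S (z - m) :=
      (measurable_logDens S).comp (measurable_id.sub_const m)
    have hm3 : Measurable fun z =>
        ENNReal.ofReal (Real.exp (logDens P (z - a) - logDens S (z - m))) * h z :=
      ((hm1.sub hm2).exp.ennreal_ofReal).mul hhm
    have h2 := ih hm3
    rw [lintegral_gauss_reweight m a (posDef_modelCov hG hP N) hP0 hhm,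
      lintegral_gauss_step a hP0.posSemidef A B hg] at h2
    rw [← add_assoc, h1]
    refine Eq.trans (lintegral_congr fun w => ?_) h2
    rw [← mul_assoc, ← ENNReal.ofReal_mul (Real.exp_pos _).le, ← Real.exp_add,
      Finset.sum_range_succ]
    rfl

/-- The last factor exchanges the final prior for another probability law, so the total mass stays
one. This holds for every observation sequence and all gains, whether or not the model describes the
channel; only the state has to be Gaussian. -/
lemma lintegral_exp_infoDens {T : ℕ} (hG : (stateCov A B T).PosDef) (hP0 : P.PosDef)
    (hP : (A * P * Aᵀ + B * Bᵀ).PosDef) (hS : S.PosDef) (K : ℕ → Matrix (Fin d) (Fin d) ℝ)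
    (η : ℕ → Vec d) (N : ℕ) :
    ∫⁻ w, ENNReal.ofReal (Real.exp (infoDens A B (stateCov A B T) P S K N
        (fun j => sourcePath A B 0 w (T + j)) η)) ∂(noiseLaw q) = 1 := by
  set m := priorMean A K η N with hm
  set S' := modelCov A B (stateCov A B T) P N with hS'
  have hm1 : Measurable fun z => logDens S (z - m) :=
    (measurable_logDens S).comp (measurable_id.sub_const m)
  have hm2 : Measurable fun z => logDens S' (z - m) :=
    (measurable_logDens S').comp (measurable_id.sub_const m)
  have h := lintegral_reweighted hG hP0 hP K η N
    (g := fun z => ENNReal.ofReal (Real.exp (logDens S (z - m) - logDens S' (z - m))))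
    ((hm1.sub hm2).exp.ennreal_ofReal)
  have h2 := lintegral_gauss_reweight m m (posDef_modelCov hG hP N) hS (g := fun _ => 1)
    measurable_const
  simp only [mul_one, lintegral_one, measure_univ] at h2
  rw [h2] at h
  refine Eq.trans (lintegral_congr fun w => ?_) h
  rw [← ENNReal.ofReal_mul (Real.exp_pos _).le, ← Real.exp_add]
  rfl

end Reweight

open Realization (extendPath measurable_extendPath measurable_mulVec measurable_sqErr)

/-! ### Test channels driven by the noise -/

namespace TestChannel

variable {p : ℕ} (κ : TestChannel p)

lemma causal_congr {x x' : ℕ → Vec p} {t : ℕ} (h : ∀ s < t, x s = x' s) :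
    κ.causal t x = κ.causal t x' := by
  induction t with
  | zero => rfl
  | succ t ih =>
    have h1 := ih fun s hs => h s (hs.trans (Nat.lt_succ_self t))
    simp only [causal]
    rw [Kernel.map_apply _ (measurable_snoc t), Kernel.map_apply _ (measurable_snoc t)]
    congr 1
    -- The kernel at time `t` reads the source only up to time `t`, where the two paths agree.
    ext s hs
    rw [Kernel.compProd_apply hs, Kernel.compProd_apply hs, h1]
    refine lintegral_congr fun y => ?_
    simp only [Kernel.comap_apply]
    have h2 : (fun i : Fin (t + 1) => x i) = fun i : Fin (t + 1) => x' i :=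
      funext fun i => h i i.2
    rw [h2]

lemma causal_map_init (x : ℕ → Vec p) (t : ℕ) :
    (κ.causal (t + 1) x).map (Fin.init : (Fin (t + 1) → Vec p) → Fin t → Vec p)
      = κ.causal t x := by
  have hm : Measurable (Fin.init : (Fin (t + 1) → Vec p) → Fin t → Vec p) :=
    measurable_pi_lambda _ fun i => measurable_pi_apply _
  simp only [causal]
  rw [Kernel.map_apply _ (measurable_snoc t), Measure.map_map hm (measurable_snoc t)]
  have h : (Fin.init : (Fin (t + 1) → Vec p) → Fin t → Vec p)
      ∘ (fun a : (Fin t → Vec p) × Vec p => (Fin.snoc a.1 a.2 : Fin (t + 1) → Vec p))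
      = Prod.fst := by
    ext1 a; simp
  rw [h, ← Kernel.fst_apply, Kernel.fst_compProd]

lemma causal_map_restrict (x : ℕ → Vec p) {m n : ℕ} (hmn : m ≤ n) :
    (κ.causal n x).map (fun y => fun i : Fin m => extendPath y i) = κ.causal m x := by
  induction n, hmn using Nat.le_induction with
  | base =>
    have h : (fun y : Fin m → Vec p => fun i : Fin m => extendPath y i) = id := by
      ext y i; simp [extendPath]
    rw [h, Measure.map_id]
  | succ n hmn ih =>
    have hm : Measurable (Fin.init : (Fin (n + 1) → Vec p) → Fin n → Vec p) :=
      measurable_pi_lambda _ fun i => measurable_pi_apply _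
    have hm2 : Measurable (fun y : Fin n → Vec p => fun i : Fin m => extendPath y i) :=
      measurable_pi_lambda _ fun i => (measurable_pi_apply (i : ℕ)).comp (measurable_extendPath n)
    have h : (fun y : Fin (n + 1) → Vec p => fun i : Fin m => extendPath y i)
        = (fun y : Fin n → Vec p => fun i : Fin m => extendPath y i) ∘ Fin.init := by
      funext y i
      have h1 : (i : ℕ) < n := i.2.trans_le hmn
      simp only [extendPath, Function.comp_apply, dif_pos h1, dif_pos (h1.trans (Nat.lt_succ_self n))]
      rfl
    rw [h, ← Measure.map_map hm2 hm, causal_map_init, ih]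

variable {q : ℕ} (A : Matrix (Fin p) (Fin p) ℝ) (B : Matrix (Fin p) (Fin q) ℝ)
  (S0 : Matrix (Fin p) (Fin p) ℝ)

/-- The channel, as a kernel from the driving randomness. -/
def driven (n : ℕ) : Kernel (Vec p × (ℕ → Vec q)) (Fin n → Vec p) :=
  (κ.causal n).comap (fun ω => sourcePath A B ω.1 ω.2) (measurable_sourcePath A B)

instance (n : ℕ) : IsMarkovKernel (κ.driven A B n) := by unfold driven; infer_instance

/-- The joint law of the driving randomness and the first `n` reproductions. -/
def drivenLaw (n : ℕ) : Measure ((Vec p × (ℕ → Vec q)) × (Fin n → Vec p)) :=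
  driveLaw q S0 ⊗ₘ κ.driven A B n

instance (n : ℕ) : IsProbabilityMeasure (κ.drivenLaw A B S0 n) := by
  unfold drivenLaw; infer_instance

lemma measurePreserving_fst_drivenLaw (n : ℕ) :
    MeasurePreserving Prod.fst (κ.drivenLaw A B S0 n) (driveLaw q S0) :=
  ⟨measurable_fst, Measure.fst_compProd _ _⟩

lemma measurable_path_fst (n : ℕ) :
    Measurable fun a : (Vec p × (ℕ → Vec q)) × (Fin n → Vec p) =>
      ((fun i : Fin n => sourcePath A B a.1.1 a.1.2 i), a.2) :=
  Measurable.prodMk (measurable_pi_lambda _ fun i => (measurable_pi_apply (i : ℕ)).comp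
    ((measurable_sourcePath A B).comp measurable_fst)) measurable_snd

lemma jointLaw_eq_map (n : ℕ) : κ.jointLaw (sourceLaw A B S0) n
    = (κ.drivenLaw A B S0 (n + 1)).map fun a =>
      ((fun i : Fin (n + 1) => sourcePath A B a.1.1 a.1.2 i), a.2) := by
  have hm : Measurable fun a : (ℕ → Vec p) × (Fin (n + 1) → Vec p) =>
      ((fun i : Fin (n + 1) => a.1 i), a.2) := by fun_prop
  refine Measure.ext_of_lintegral _ fun f hf => ?_
  have h1 : Measurable fun a : (ℕ → Vec p) × (Fin (n + 1) → Vec p) =>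
      f ((fun i : Fin (n + 1) => a.1 i), a.2) := hf.comp hm
  have h2 : Measurable fun a : (Vec p × (ℕ → Vec q)) × (Fin (n + 1) → Vec p) =>
      f ((fun i : Fin (n + 1) => sourcePath A B a.1.1 a.1.2 i), a.2) :=
    hf.comp (measurable_path_fst A B (n + 1))
  have h3 : Measurable fun x : ℕ → Vec p =>
      ∫⁻ y, f ((fun i : Fin (n + 1) => x i), y) ∂(κ.causal (n + 1) x) :=
    Measurable.lintegral_kernel_prod_right' h1
  rw [jointLaw, lintegral_map hf hm, lintegral_map hf (measurable_path_fst A B (n + 1)),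
    Measure.lintegral_compProd h1, drivenLaw, Measure.lintegral_compProd h2, sourceLaw_eq_map,
    lintegral_map h3 (measurable_sourcePath A B)]
  rfl

lemma fst_jointLaw (n : ℕ) : (κ.jointLaw (sourceLaw A B S0) n).fst
    = (driveLaw q S0).map fun ω => fun i : Fin (n + 1) => sourcePath A B ω.1 ω.2 i := by
  have hm : Measurable fun ω : Vec p × (ℕ → Vec q) =>
      fun i : Fin (n + 1) => sourcePath A B ω.1 ω.2 i :=
    measurable_pi_lambda _ fun i => (measurable_pi_apply (i : ℕ)).comp (measurable_sourcePath A B)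
  rw [jointLaw_eq_map, Measure.fst, Measure.map_map measurable_fst (measurable_path_fst A B _),
    ← (κ.measurePreserving_fst_drivenLaw A B S0 (n + 1)).map_eq, Measure.map_map hm measurable_fst]
  rfl

instance (src : Measure (ℕ → Vec p)) [IsProbabilityMeasure src] (n : ℕ) :
    IsProbabilityMeasure (κ.jointLaw src n) := by
  unfold jointLaw
  exact Measure.isProbabilityMeasure_map (by fun_prop)

lemma drivenLaw_map_restrict {m n : ℕ} (hmn : m ≤ n) :
    (κ.drivenLaw A B S0 n).map (fun a => (a.1, fun i : Fin m => extendPath a.2 i))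
      = κ.drivenLaw A B S0 m := by
  have hm2 : Measurable (fun y : Fin n → Vec p => fun i : Fin m => extendPath y i) :=
    measurable_pi_lambda _ fun i => (measurable_pi_apply (i : ℕ)).comp (measurable_extendPath n)
  have hm : Measurable fun a : (Vec p × (ℕ → Vec q)) × (Fin n → Vec p) =>
      (a.1, fun i : Fin m => extendPath a.2 i) := measurable_fst.prodMk (hm2.comp measurable_snd)
  refine Measure.ext_of_lintegral _ fun f hf => ?_
  have h1 : Measurable fun a : (Vec p × (ℕ → Vec q)) × (Fin n → Vec p) =>
      f (a.1, fun i : Fin m => extendPath a.2 i) := hf.comp hm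
  rw [lintegral_map hf hm, drivenLaw, drivenLaw, Measure.lintegral_compProd h1,
    Measure.lintegral_compProd hf]
  refine lintegral_congr fun ω => ?_
  simp only [driven, Kernel.comap_apply]
  have h2 : Measurable fun b : Fin m → Vec p => f (ω, b) := hf.comp measurable_prodMk_left
  rw [← κ.causal_map_restrict _ hmn, lintegral_map h2 hm2]

/-- Causality of the channel: reproductions up to time `t` depend on the path up to `t`, which does
not contain the noise at time `t`. That noise therefore remains fresh given these reproductions. -/
lemma resample_drivenLaw (t : ℕ) : MeasurePreserving
    (fun b : ((Vec p × (ℕ → Vec q)) × (Fin (t + 1) → Vec p)) × Vec q =>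
      ((b.1.1.1, Function.update b.1.1.2 t b.2), b.1.2))
    ((κ.drivenLaw A B S0 (t + 1)).prod (noiseStep q)) (κ.drivenLaw A B S0 (t + 1)) :=
  resample_compProd (resample_noise q S0 t) (κ.driven A B (t + 1)) fun ω v => by
    simp only [driven, Kernel.comap_apply]
    exact κ.causal_congr fun s hs => sourcePath_update A B _ _ (by omega) _

lemma sqInt_noise_drivenLaw (n t : ℕ) :
    SqInt (κ.drivenLaw A B S0 n) (fun a => a.1.2 t) := fun i =>
  (Realization.sqInt_noise S0 t i).comp_measurePreserving (κ.measurePreserving_fst_drivenLaw A B S0 n)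

lemma crossMoment_fst_drivenLaw (n : ℕ) {η η' : Type*} {u : Vec p × (ℕ → Vec q) → η → ℝ}
    {v : Vec p × (ℕ → Vec q) → η' → ℝ} (hu : Measurable u) (hv : Measurable v) :
    crossMoment (κ.drivenLaw A B S0 n) (fun a => u a.1) (fun a => v a.1)
      = crossMoment (driveLaw q S0) u v := by
  rw [← (κ.measurePreserving_fst_drivenLaw A B S0 n).map_eq, crossMoment_map measurable_fst hu hv]

/-- Functions of the past are uncorrelated with the noise. -/
lemma crossMoment_noise_drivenLaw {n t : ℕ} (htn : t + 1 ≤ n) {η : Type*}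
    {u : (Vec p × (ℕ → Vec q)) × (ℕ → Vec p) → η → ℝ} (hum : Measurable u)
    (hu : SqInt (κ.drivenLaw A B S0 n) fun a => u (a.1, extendPath a.2))
    (huy : ∀ ω y y', (∀ s ≤ t, y s = y' s) → u (ω, y) = u (ω, y'))
    (huw : ∀ ω y v, u ((ω.1, Function.update ω.2 t v), y) = u (ω, y)) :
    crossMoment (κ.drivenLaw A B S0 n) (fun a => u (a.1, extendPath a.2)) (fun a => a.1.2 t)
      = 0 := by
  have hm2 : Measurable (fun y : Fin n → Vec p => fun i : Fin (t + 1) => extendPath y i) :=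
    measurable_pi_lambda _ fun i => (measurable_pi_apply (i : ℕ)).comp (measurable_extendPath n)
  have hm : Measurable fun a : (Vec p × (ℕ → Vec q)) × (Fin n → Vec p) =>
      (a.1, fun i : Fin (t + 1) => extendPath a.2 i) :=
    measurable_fst.prodMk (hm2.comp measurable_snd)
  have hv : Measurable fun a : (Vec p × (ℕ → Vec q)) × (Fin (t + 1) → Vec p) =>
      u (a.1, extendPath a.2) :=
    hum.comp (measurable_fst.prodMk ((measurable_extendPath (t + 1)).comp measurable_snd))
  have hw : Measurable fun a : (Vec p × (ℕ → Vec q)) × (Fin (t + 1) → Vec p) => a.1.2 t := by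
    fun_prop
  -- Later reproductions may depend on the noise at time `t`; as `u` does not read them, they can be
  -- marginalized before resampling.
  have huv : ∀ a : (Vec p × (ℕ → Vec q)) × (Fin n → Vec p), u (a.1, extendPath a.2)
      = u (a.1, extendPath fun i : Fin (t + 1) => extendPath a.2 i) := fun a =>
    huy _ _ _ fun s hs => by simp [extendPath, Nat.lt_succ_of_le hs]
  have hu2 : SqInt (κ.drivenLaw A B S0 (t + 1)) fun a => u (a.1, extendPath a.2) := by
    rw [← κ.drivenLaw_map_restrict A B S0 htn, sqInt_map hm hv]
    simpa only [← huv] using hu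
  have h0 : ∀ j, ∫ a, a.1.2 t j ∂(κ.drivenLaw A B S0 (t + 1)) = 0 := fun j => by
    have hmj : Measurable fun ω : Vec p × (ℕ → Vec q) => ω.2 t j := by fun_prop
    rw [← Realization.integral_noise (p := p) S0 t j,
      ← (κ.measurePreserving_fst_drivenLaw A B S0 (t + 1)).map_eq,
      integral_map measurable_fst.aemeasurable hmj.aestronglyMeasurable]
  have key := crossMoment_eq_zero_of_indepFun (indepFun_of_resample
    (κ.resample_drivenLaw A B S0 t) (W := fun a => a.1.2 t) hv hw (fun a v => huw _ _ v)
    (fun a v => by simp)) hu2 (κ.sqInt_noise_drivenLaw A B S0 (t + 1) t) h0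
  rw [← κ.drivenLaw_map_restrict A B S0 htn, crossMoment_map hm hv hw] at key
  simpa only [← huv] using key

end TestChannel

/-! ### Ridge regression -/

section Ridge

variable {Ω : Type*} [MeasurableSpace Ω] {μ : Measure Ω} {d : ℕ}

/-- The gain of the regularized linear regression of `z` on `h`. -/
def ridgeGain (μ : Measure Ω) (ε : ℝ) (z h : Ω → Vec d) : Matrix (Fin d) (Fin d) ℝ :=
  crossMoment μ z h * (crossMoment μ h h + ε • 1)⁻¹

/-- The gain minimizes the second moment matrix of `z - L h` plus `ε L Lᵀ` over all `L`. Comparison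
with `L = 0` gives the first claim, comparison with `L = 1` the second, at the price `ε d`. The
regularization makes the moment matrix of `h` invertible. -/
lemma ridge_bounds {ε : ℝ} (hε : 0 < ε) {z h : Ω → Vec d} (hz : SqInt μ z) (hh : SqInt μ h) :
    (crossMoment μ z z - crossMoment μ (fun ω => z ω - ridgeGain μ ε z h *ᵥ h ω)
      (fun ω => z ω - ridgeGain μ ε z h *ᵥ h ω)).PosSemidef ∧
    (crossMoment μ (fun ω => z ω - ridgeGain μ ε z h *ᵥ h ω)
      (fun ω => z ω - ridgeGain μ ε z h *ᵥ h ω)).trace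
      ≤ (crossMoment μ (fun ω => z ω - h ω) (fun ω => z ω - h ω)).trace + ε * d := by
  set K := ridgeGain μ ε z h with hK
  set W := crossMoment μ h h + ε • (1 : Matrix (Fin d) (Fin d) ℝ) with hW
  have hWp : W.PosDef := Matrix.PosDef.posSemidef_add (posSemidef_crossMoment hh) (Matrix.PosDef.one.smul hε)
  have hWt : Wᵀ = W := by
    have := hWp.isHermitian.eq
    rwa [Matrix.conjTranspose_eq_transpose_of_trivial] at this
  have hM : crossMoment μ z h = K * W := by
    rw [hK, ridgeGain, Matrix.mul_assoc, nonsing_inv_mul _ hWp.det_pos.ne'.isUnit, Matrix.mul_one]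
  have hcov : crossMoment μ h h = W - ε • 1 := by rw [hW]; simp
  have hgen : ∀ L : Matrix (Fin d) (Fin d) ℝ,
      crossMoment μ (fun ω => z ω - L *ᵥ h ω) (fun ω => z ω - L *ᵥ h ω)
      = crossMoment μ z z - K * W * Lᵀ - L * W * Kᵀ + L * W * Lᵀ - ε • (L * Lᵀ) := by
    intro L
    have h1 := crossMoment_lin hz hh (1 : Matrix (Fin d) (Fin d) ℝ) (-L)
    simp only [Matrix.one_mulVec, Matrix.neg_mulVec, ← sub_eq_add_neg] at h1
    rw [h1, hcov, hM]
    simp only [Matrix.one_mul, Matrix.transpose_one, Matrix.mul_one, Matrix.transpose_neg,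
      Matrix.mul_neg, Matrix.neg_mul, smul_neg, Matrix.transpose_mul, hWt, Matrix.mul_sub,
      Matrix.sub_mul, Matrix.mul_smul, Matrix.smul_mul, Matrix.mul_assoc]
    abel
  have hKW : (K * W * Kᵀ).PosSemidef := posSemidef_conj hWp.posSemidef K
  have hKK : (ε • (K * Kᵀ)).PosSemidef := (posSemidef_mul_transpose K).smul hε.le
  have h2 := hgen K
  have h3 := hgen 1
  simp only [Matrix.one_mulVec, Matrix.transpose_one, Matrix.mul_one, Matrix.one_mul] at h3
  constructor
  · rw [h2]
    have : crossMoment μ z z - (crossMoment μ z z - K * W * Kᵀ - K * W * Kᵀ + K * W * Kᵀ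
        - ε • (K * Kᵀ)) = K * W * Kᵀ + ε • (K * Kᵀ) := by abel
    rw [this]
    exact hKW.add hKK
  · have h4 : ((1 - K) * W * (1 - K)ᵀ).PosSemidef := posSemidef_conj hWp.posSemidef _
    have h5 : (1 - K) * W * (1 - K)ᵀ = W - W * Kᵀ - K * W + K * W * Kᵀ := by
      simp only [Matrix.transpose_sub, Matrix.transpose_one, Matrix.sub_mul, Matrix.mul_sub,
        Matrix.one_mul, Matrix.mul_one]
      abel
    have h6 := h4.trace_nonneg
    have h7 := hKK.trace_nonneg
    rw [h5] at h6
    rw [h2, h3]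
    simp only [Matrix.trace_sub, Matrix.trace_add, Matrix.trace_smul, Matrix.trace_one,
      Fintype.card_fin, smul_eq_mul] at h6 h7 ⊢
    linarith

end Ridge

/-! ### Linear filtering with regularized gains -/

section Filter

variable {Ω : Type*} [MeasurableSpace Ω] {μ : Measure Ω} {d q : ℕ}

lemma SqInt.integral_logDens [IsProbabilityMeasure μ] {z : Ω → Vec d} (hz : SqInt μ z)
    (S : Matrix (Fin d) (Fin d) ℝ) :
    Integrable (fun ω => logDens S (z ω)) μ ∧ ∫ ω, logDens S (z ω) ∂μ
      = -(1 / 2) * Real.log S.det - 1 / 2 * (S⁻¹ * crossMoment μ z z).trace := by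
  have h := (hz.integrable_quad S⁻¹).const_mul (1 / 2)
  refine ⟨(integrable_const _).sub h, ?_⟩
  simp only [logDens]
  rw [integral_sub (integrable_const _) h, integral_const_mul (1 / 2 : ℝ)
    fun ω => z ω ⬝ᵥ S⁻¹ *ᵥ z ω, integral_quad hz, integral_const, probReal_univ, one_smul]

/-- The a priori estimates of the filter that regresses on `η` with regularization `ε`. -/
def ridgePrior (μ : Measure Ω) (ε : ℝ) (A : Matrix (Fin d) (Fin d) ℝ) (ξ η : ℕ → Ω → Vec d) :
    ℕ → Ω → Vec d
  | 0 => fun _ => 0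
  | k + 1 => fun ω => A *ᵥ (ridgePrior μ ε A ξ η k ω
      + ridgeGain μ ε (fun ω => ξ k ω - ridgePrior μ ε A ξ η k ω)
          (fun ω => η k ω - ridgePrior μ ε A ξ η k ω)
        *ᵥ (η k ω - ridgePrior μ ε A ξ η k ω))

/-- The gains of the filter that regresses on `η` with regularization `ε`. -/
def ridgeGains (μ : Measure Ω) (ε : ℝ) (A : Matrix (Fin d) (Fin d) ℝ) (ξ η : ℕ → Ω → Vec d)
    (k : ℕ) : Matrix (Fin d) (Fin d) ℝ :=
  ridgeGain μ ε (fun ω => ξ k ω - ridgePrior μ ε A ξ η k ω)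
    (fun ω => η k ω - ridgePrior μ ε A ξ η k ω)

lemma priorMean_ridgeGains (ε : ℝ) (A : Matrix (Fin d) (Fin d) ℝ) (ξ η : ℕ → Ω → Vec d) (k : ℕ)
    (ω : Ω) : priorMean A (ridgeGains μ ε A ξ η) (fun j => η j ω) k
      = ridgePrior μ ε A ξ η k ω := by
  induction k with
  | zero => rfl
  | succ k ih => rw [priorMean_succ, postMean, ih]; rfl

variable {A : Matrix (Fin d) (Fin d) ℝ} {B : Matrix (Fin d) (Fin q) ℝ} {N : ℕ}
  {ξ η : ℕ → Ω → Vec d} {w : ℕ → Ω → Vec q}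

lemma sqInt_priorMean (K : ℕ → Matrix (Fin d) (Fin d) ℝ) {k : ℕ} [IsFiniteMeasure μ]
    (hη : ∀ j < k, SqInt μ (η j)) : SqInt μ fun ω => priorMean A K (fun j => η j ω) k := by
  induction k with
  | zero => exact fun i => MemLp.zero' 
  | succ k ih =>
    have h := ih fun j hj => hη j (hj.trans (Nat.lt_succ_self k))
    exact (h.add (((hη k (Nat.lt_succ_self k)).sub h).mulVec (K k))).mulVec A

lemma crossMoment_priorMean (K : ℕ → Matrix (Fin d) (Fin d) ℝ) {k : ℕ} [IsFiniteMeasure μ]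
    (hη : ∀ j < k, SqInt μ (η j)) {v : Ω → Vec q} (hv : SqInt μ v)
    (hηv : ∀ j < k, crossMoment μ (η j) v = 0) :
    crossMoment μ (fun ω => priorMean A K (fun j => η j ω) k) v = 0 := by
  induction k with
  | zero => ext i j; simp [crossMoment, priorMean]
  | succ k ih =>
    have hη' : ∀ j < k, SqInt μ (η j) := fun j hj => hη j (hj.trans (Nat.lt_succ_self k))
    have h := ih hη' fun j hj => hηv j (hj.trans (Nat.lt_succ_self k))
    have hp := sqInt_priorMean (A := A) K hη'
    have hk := (hη k (Nat.lt_succ_self k)).sub hp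
    have h2 : crossMoment μ (fun ω => η k ω - priorMean A K (fun j => η j ω) k) v = 0 := by
      rw [crossMoment_sub_left (hη k (Nat.lt_succ_self k)) hp hv, h, hηv k (Nat.lt_succ_self k),
        sub_zero]
    simp only [priorMean]
    rw [crossMoment_mulVec_left A (hp.add (hk.mulVec (K k))) hv,
      crossMoment_add_left hp (hk.mulVec (K k)) hv, crossMoment_mulVec_left (K k) hk hv, h2, h]
    simp

/-- The error covariances of the filter with regularized gains. -/
lemma exists_filter [IsProbabilityMeasure μ] {ε : ℝ} (hε : 0 < ε) (hξ : ∀ k ≤ N, SqInt μ (ξ k))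
    (hη : ∀ k < N, SqInt μ (η k)) (hw : ∀ k < N, SqInt μ (w k))
    (hstep : ∀ k < N, ∀ ω, ξ (k + 1) ω = A *ᵥ ξ k ω + B *ᵥ w k ω)
    (hww : ∀ k < N, crossMoment μ (w k) (w k) = 1)
    (hξw : ∀ k < N, crossMoment μ (ξ k) (w k) = 0)
    (hηw : ∀ k < N, ∀ j ≤ k, crossMoment μ (η j) (w k) = 0) :
    ∃ (K P Q : ℕ → Matrix (Fin d) (Fin d) ℝ),
      (∀ k ≤ N, SqInt μ fun ω => ξ k ω - priorMean A K (fun j => η j ω) k) ∧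
      (∀ k < N, SqInt μ fun ω => ξ k ω - postMean A K (fun j => η j ω) k) ∧
      (∀ k ≤ N, Q k = crossMoment μ (fun ω => ξ k ω - priorMean A K (fun j => η j ω) k)
        (fun ω => ξ k ω - priorMean A K (fun j => η j ω) k)) ∧
      (∀ k < N, P k = crossMoment μ (fun ω => ξ k ω - postMean A K (fun j => η j ω) k)
        (fun ω => ξ k ω - postMean A K (fun j => η j ω) k)) ∧
      Q 0 = crossMoment μ (ξ 0) (ξ 0) ∧
      (∀ k < N, Q (k + 1) = A * P k * Aᵀ + B * Bᵀ) ∧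
      (∀ k < N, (Q k - P k).PosSemidef) ∧
      (∀ k < N, (P k).trace
        ≤ (crossMoment μ (fun ω => ξ k ω - η k ω) (fun ω => ξ k ω - η k ω)).trace + ε * d) := by
  set K := ridgeGains μ ε A ξ η with hK
  have hprior : ∀ k ≤ N, SqInt μ fun ω => priorMean A K (fun j => η j ω) k := fun k hk =>
    sqInt_priorMean K fun j hj => hη j (hj.trans_le hk)
  have h1 : ∀ k ≤ N, SqInt μ fun ω => ξ k ω - priorMean A K (fun j => η j ω) k := fun k hk =>
    (hξ k hk).sub (hprior k hk)
  have h1' : ∀ k < N, SqInt μ fun ω => η k ω - priorMean A K (fun j => η j ω) k := fun k hk =>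
    (hη k hk).sub (hprior k hk.le)
  have hpost : ∀ k ω, ξ k ω - postMean A K (fun j => η j ω) k
      = ξ k ω - priorMean A K (fun j => η j ω) k
        - K k *ᵥ (η k ω - priorMean A K (fun j => η j ω) k) := fun k ω => by
    rw [postMean]; abel
  have h2 : ∀ k < N, SqInt μ fun ω => ξ k ω - postMean A K (fun j => η j ω) k := fun k hk => by
    simp only [hpost]
    exact (h1 k hk.le).sub ((h1' k hk).mulVec (K k))
  have hKk : ∀ k, K k = ridgeGain μ ε (fun ω => ξ k ω - priorMean A K (fun j => η j ω) k)
      (fun ω => η k ω - priorMean A K (fun j => η j ω) k) := fun k => by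
    simp only [hK, priorMean_ridgeGains]; rfl
  refine ⟨K, fun k => crossMoment μ (fun ω => ξ k ω - postMean A K (fun j => η j ω) k)
        (fun ω => ξ k ω - postMean A K (fun j => η j ω) k),
    fun k => crossMoment μ (fun ω => ξ k ω - priorMean A K (fun j => η j ω) k)
        (fun ω => ξ k ω - priorMean A K (fun j => η j ω) k), h1, h2, fun _ _ => rfl, fun _ _ => rfl,
    by simp [priorMean], fun k hk => ?_, fun k hk => ?_, fun k hk => ?_⟩
  -- The noise at time `k` is uncorrelated with the state and with all observations up to `k`, hence
  -- with the linear estimation error. Second moments suffice: the reproductions need not be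
  -- Gaussian.
  · have hp0 := crossMoment_priorMean (A := A) K (fun j hj => hη j (hj.trans hk)) (hw k hk)
      fun j (hj : j < k) => hηw k hk j hj.le
    have e1 : crossMoment μ (fun ω => ξ k ω - priorMean A K (fun j => η j ω) k) (w k) = 0 := by
      rw [crossMoment_sub_left (hξ k hk.le) (hprior k hk.le) (hw k hk), hξw k hk, hp0, sub_zero]
    have e2 : crossMoment μ (fun ω => η k ω - priorMean A K (fun j => η j ω) k) (w k) = 0 := by
      rw [crossMoment_sub_left (hη k hk) (hprior k hk.le) (hw k hk), hηw k hk k le_rfl, hp0,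
        sub_zero]
    have e3 : crossMoment μ (fun ω => ξ k ω - postMean A K (fun j => η j ω) k) (w k) = 0 := by
      simp only [hpost]
      rw [crossMoment_sub_left (h1 k hk.le) ((h1' k hk).mulVec (K k)) (hw k hk),
        crossMoment_mulVec_left (K k) (h1' k hk) (hw k hk), e1, e2]
      simp
    have e4 : ∀ ω, ξ (k + 1) ω - priorMean A K (fun j => η j ω) (k + 1)
        = A *ᵥ (ξ k ω - postMean A K (fun j => η j ω) k) + B *ᵥ w k ω := fun ω => by
      rw [hstep k hk, priorMean_succ, Matrix.mulVec_sub]; abel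
    simp only [e4]
    rw [crossMoment_lin (h2 k hk) (hw k hk), e3, hww k hk]
    simp
  · have h := (ridge_bounds hε (h1 k hk.le) (h1' k hk)).1
    rw [← hKk] at h
    simpa only [hpost] using h
  · have h := (ridge_bounds hε (h1 k hk.le) (h1' k hk)).2
    rw [← hKk] at h
    simpa only [hpost, sub_sub_sub_cancel_right] using h

lemma posSemidef_finsetSum {m ι : Type*} [Fintype m] {s : Finset ι} {f : ι → Matrix m m ℝ}
    (h : ∀ i ∈ s, (f i).PosSemidef) : (∑ i ∈ s, f i).PosSemidef := by
  classical
  induction s using Finset.induction_on with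
  | empty => simpa using Matrix.PosSemidef.zero
  | insert a s ha ih =>
    rw [Finset.sum_insert ha]
    exact (h a (Finset.mem_insert_self a s)).add
      (ih fun i hi => h i (Finset.mem_insert_of_mem hi))

/-- The rate increment of the model `P` against the covariance `P'`, in nats. -/
def modelRate (A : Matrix (Fin d) (Fin d) ℝ) (B : Matrix (Fin d) (Fin q) ℝ)
    (P P' : Matrix (Fin d) (Fin d) ℝ) : ℝ :=
  1 / 2 * (Real.log (A * P * Aᵀ + B * Bᵀ).det - Real.log P.det)
    + 1 / 2 * (((A * P * Aᵀ + B * Bᵀ)⁻¹ * (A * P' * Aᵀ + B * Bᵀ)).trace - (P⁻¹ * P').trace)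

/-- The density is quadratic in the filter errors, so its mean is affine in their covariances; this
permits time averaging later. -/
lemma integral_infoDens [IsProbabilityMeasure μ] {K P Q : ℕ → Matrix (Fin d) (Fin d) ℝ}
    (h1 : ∀ k ≤ N, SqInt μ fun ω => ξ k ω - priorMean A K (fun j => η j ω) k)
    (h2 : ∀ k < N, SqInt μ fun ω => ξ k ω - postMean A K (fun j => η j ω) k)
    (hQ : ∀ k ≤ N, Q k = crossMoment μ (fun ω => ξ k ω - priorMean A K (fun j => η j ω) k)
        (fun ω => ξ k ω - priorMean A K (fun j => η j ω) k))
    (hP : ∀ k < N, P k = crossMoment μ (fun ω => ξ k ω - postMean A K (fun j => η j ω) k)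
        (fun ω => ξ k ω - postMean A K (fun j => η j ω) k))
    (G M S : Matrix (Fin d) (Fin d) ℝ) :
    Integrable (fun ω => infoDens A B G M S K N (fun j => ξ j ω) (fun j => η j ω)) μ ∧
    ∫ ω, infoDens A B G M S K N (fun j => ξ j ω) (fun j => η j ω) ∂μ
      = ∑ k ∈ Finset.range N, (-(1 / 2) * Real.log M.det - 1 / 2 * (M⁻¹ * P k).trace)
        + ∑ k ∈ Finset.range (N + 1), (1 / 2 * Real.log (modelCov A B G M k).det
          + 1 / 2 * ((modelCov A B G M k)⁻¹ * Q k).trace)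
        + (-(1 / 2) * Real.log S.det - 1 / 2 * (S⁻¹ * Q N).trace) := by
  have i1 : ∀ k < N, Integrable
      (fun ω => infoIncr A B G M K (fun j => ξ j ω) (fun j => η j ω) k) μ := fun k hk =>
    ((h2 k hk).integral_logDens M).1.sub ((h1 k hk.le).integral_logDens (modelCov A B G M k)).1
  have e1 : ∀ k < N, ∫ ω, infoIncr A B G M K (fun j => ξ j ω) (fun j => η j ω) k ∂μ
      = (-(1 / 2) * Real.log M.det - 1 / 2 * (M⁻¹ * P k).trace)
        + (1 / 2 * Real.log (modelCov A B G M k).det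
          + 1 / 2 * ((modelCov A B G M k)⁻¹ * Q k).trace) := fun k hk => by
    have ha := (h2 k hk).integral_logDens M
    have hb := (h1 k hk.le).integral_logDens (modelCov A B G M k)
    simp only [infoIncr]
    rw [integral_sub ha.1 hb.1, ha.2, hb.2, ← hQ k hk.le, ← hP k hk]
    ring
  have hS := (h1 N le_rfl).integral_logDens S
  have hM := (h1 N le_rfl).integral_logDens (modelCov A B G M N)
  have i2 : Integrable (fun ω => ∑ k ∈ Finset.range N,
      infoIncr A B G M K (fun j => ξ j ω) (fun j => η j ω) k) μ :=
    integrable_finsetSum _ fun k hk => i1 k (Finset.mem_range.1 hk)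
  refine ⟨i2.add (hS.1.sub hM.1), ?_⟩
  have i3 : Integrable (fun ω => logDens S (ξ N ω - priorMean A K (fun j => η j ω) N)
      - logDens (modelCov A B G M N) (ξ N ω - priorMean A K (fun j => η j ω) N)) μ :=
    hS.1.sub hM.1
  simp only [infoDens]
  rw [integral_add i2 i3, integral_sub hS.1 hM.1,
    integral_finsetSum _ fun k hk => i1 k (Finset.mem_range.1 hk), hS.2, hM.2, ← hQ N le_rfl,
    Finset.sum_congr rfl fun k hk => e1 k (Finset.mem_range.1 hk), Finset.sum_add_distrib,
    Finset.sum_range_succ (n := N)]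
  ring

/-- The matrix `P` is the time average of the posterior covariances. Its counterpart for the priors
is the average over times `1, …, N`, one step later, which is why the density carries an additional
prior term at time `N`. The wide law with covariance `N • 1` that balances this term costs only
`(d/2) log N` and a bounded trace. -/
lemma exists_filter_bound [IsProbabilityMeasure μ] {ε : ℝ} (hε : 0 < ε) (hN : 0 < N)
    (hξ : ∀ k ≤ N, SqInt μ (ξ k))
    (hη : ∀ k < N, SqInt μ (η k)) (hw : ∀ k < N, SqInt μ (w k))
    (hstep : ∀ k < N, ∀ ω, ξ (k + 1) ω = A *ᵥ ξ k ω + B *ᵥ w k ω)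
    (hww : ∀ k < N, crossMoment μ (w k) (w k) = 1)
    (hξw : ∀ k < N, crossMoment μ (ξ k) (w k) = 0)
    (hηw : ∀ k < N, ∀ j ≤ k, crossMoment μ (η j) (w k) = 0) :
    ∃ (K : ℕ → Matrix (Fin d) (Fin d) ℝ) (P : Matrix (Fin d) (Fin d) ℝ), P.PosSemidef ∧
      N * P.trace ≤ ∑ k ∈ Finset.range N,
        (crossMoment μ (fun ω => ξ k ω - η k ω) (fun ω => ξ k ω - η k ω)).trace + N * (ε * d) ∧
      (A * P * Aᵀ + B * Bᵀ + (N : ℝ)⁻¹ • crossMoment μ (ξ 0) (ξ 0) - P).PosSemidef ∧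
      ∀ G M : Matrix (Fin d) (Fin d) ℝ, G.PosDef →
        Integrable (fun ω => infoDens A B G M ((N : ℝ) • 1) K N (fun j => ξ j ω)
          (fun j => η j ω)) μ ∧
        N * modelRate A B M P + (1 / 2 * Real.log G.det - d / 2 * Real.log N
            - 1 / 2 * (A * P * Aᵀ + B * Bᵀ).trace)
          ≤ ∫ ω, infoDens A B G M ((N : ℝ) • 1) K N (fun j => ξ j ω) (fun j => η j ω) ∂μ := by
  obtain ⟨K, P, Q, h1, h2, hQ, hP, hQ0, hQs, hQP, htr⟩ :=
    exists_filter (A := A) (B := B) hε hξ hη hw hstep hww hξw hηw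
  have hN0 : (0 : ℝ) < N := by exact_mod_cast hN
  have hQp : ∀ k ≤ N, (Q k).PosSemidef := fun k hk => by
    rw [hQ k hk]; exact posSemidef_crossMoment (h1 k hk)
  have hPp : ∀ k < N, (P k).PosSemidef := fun k hk => by
    rw [hP k hk]; exact posSemidef_crossMoment (h2 k hk)
  set R := ∑ k ∈ Finset.range N, P k with hR
  have hRp : R.PosSemidef := posSemidef_finsetSum fun k hk => hPp k (Finset.mem_range.1 hk)
  set P' := (N : ℝ)⁻¹ • R with hP'
  have hNP : (N : ℝ) • P' = R := by rw [hP', smul_smul, mul_inv_cancel₀ hN0.ne', one_smul]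
  have hsumQ : ∑ k ∈ Finset.range N, Q (k + 1) = (N : ℝ) • (A * P' * Aᵀ + B * Bᵀ) := by
    have e : (N : ℝ) • (A * P' * Aᵀ) = A * R * Aᵀ := by
      rw [hP', Matrix.mul_smul, Matrix.smul_mul, smul_smul, mul_inv_cancel₀ hN0.ne', one_smul]
    rw [Finset.sum_congr rfl fun k hk => hQs k (Finset.mem_range.1 hk), Finset.sum_add_distrib,
      Finset.sum_const, Finset.card_range, smul_add, e, hR,
      Matrix.mul_sum, Matrix.sum_mul, Nat.cast_smul_eq_nsmul]
  -- A single term is at most the sum. This crude bound is enough because the trace of `Q N` is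
  -- divided by `N` in the wide terminal law.
  have hQN : (Q N).trace ≤ N * (A * P' * Aᵀ + B * Bᵀ).trace := by
    have e : (N : ℝ) * (A * P' * Aᵀ + B * Bᵀ).trace = ∑ k ∈ Finset.range N, (Q (k + 1)).trace := by
      rw [← Matrix.trace_sum, hsumQ, Matrix.trace_smul, smul_eq_mul]
    rw [e]
    have : (Q (N - 1 + 1)).trace ≤ _ :=
      Finset.single_le_sum (f := fun k => (Q (k + 1)).trace) (s := Finset.range N)
      (fun k hk => (hQp (k + 1) (Finset.mem_range.1 hk)).trace_nonneg)
      (Finset.mem_range.2 (Nat.sub_lt hN one_pos))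
    rwa [Nat.sub_add_cancel hN] at this
  refine ⟨K, P', hRp.smul (by positivity), ?_, ?_, fun G M hG => ?_⟩
  · rw [← smul_eq_mul, ← Matrix.trace_smul, hNP, hR, Matrix.trace_sum]
    refine (Finset.sum_le_sum fun k hk => htr k (Finset.mem_range.1 hk)).trans ?_
    rw [Finset.sum_add_distrib, Finset.sum_const, Finset.card_range, nsmul_eq_mul]
  -- Summing `P k ≤ Q k` and shifting the index by one leaves the boundary terms `Q 0` and `Q N`;
  -- the first is kept as a correction of order `1/N`.
  · have e : A * P' * Aᵀ + B * Bᵀ + (N : ℝ)⁻¹ • crossMoment μ (ξ 0) (ξ 0) - P'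
        = (N : ℝ)⁻¹ • (∑ k ∈ Finset.range N, (Q k - P k) + Q N) := by
      have e1 : ∑ k ∈ Finset.range N, Q k + Q N = Q 0 + ∑ k ∈ Finset.range N, Q (k + 1) := by
        rw [← Finset.sum_range_succ, Finset.sum_range_succ', add_comm]
      rw [Finset.sum_sub_distrib, sub_add_eq_add_sub, e1, hsumQ, ← hR, ← hNP, ← hQ0]
      rw [smul_sub, smul_add, smul_smul, smul_smul, inv_mul_cancel₀ hN0.ne', one_smul, one_smul]
      abel
    rw [e]
    exact ((posSemidef_finsetSum fun k hk => hQP k (Finset.mem_range.1 hk)).add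
      (hQp N le_rfl)).smul (by positivity)
  · obtain ⟨hi, he⟩ := integral_infoDens (A := A) (B := B) h1 h2 hQ hP G M ((N : ℝ) • 1)
    refine ⟨hi, ?_⟩
    rw [he, Finset.sum_range_succ']
    simp only [modelCov]
    have e1 : ∑ k ∈ Finset.range N, (-(1 / 2) * Real.log M.det - 1 / 2 * (M⁻¹ * P k).trace)
        = N * (-(1 / 2) * Real.log M.det - 1 / 2 * (M⁻¹ * P').trace) := by
      rw [Finset.sum_sub_distrib, Finset.sum_const, Finset.card_range, nsmul_eq_mul,
        ← Finset.mul_sum, ← Matrix.trace_sum, ← Matrix.mul_sum, ← hR, ← hNP, Matrix.mul_smul,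
        Matrix.trace_smul, smul_eq_mul]
      ring
    have e2 : ∑ k ∈ Finset.range N, (1 / 2 * Real.log (A * M * Aᵀ + B * Bᵀ).det
          + 1 / 2 * ((A * M * Aᵀ + B * Bᵀ)⁻¹ * Q (k + 1)).trace)
        = N * (1 / 2 * Real.log (A * M * Aᵀ + B * Bᵀ).det
          + 1 / 2 * ((A * M * Aᵀ + B * Bᵀ)⁻¹ * (A * P' * Aᵀ + B * Bᵀ)).trace) := by
      rw [Finset.sum_add_distrib, Finset.sum_const, Finset.card_range, nsmul_eq_mul,
        ← Finset.mul_sum, ← Matrix.trace_sum, ← Matrix.mul_sum, hsumQ, Matrix.mul_smul,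
        Matrix.trace_smul, smul_eq_mul]
      ring
    have e3 : 0 ≤ (G⁻¹ * Q 0).trace := trace_mul_nonneg hG.inv.posSemidef (hQp 0 (Nat.zero_le N))
    have e4 : Real.log ((N : ℝ) • (1 : Matrix (Fin d) (Fin d) ℝ)).det = d * Real.log N := by
      rw [Matrix.det_smul, Matrix.det_one, mul_one, Fintype.card_fin, Real.log_pow]
    have e5 : (((N : ℝ) • (1 : Matrix (Fin d) (Fin d) ℝ))⁻¹ * Q N).trace
        ≤ (A * P' * Aᵀ + B * Bᵀ).trace := by
      have : ((N : ℝ) • (1 : Matrix (Fin d) (Fin d) ℝ))⁻¹ = (N : ℝ)⁻¹ • 1 :=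
        Matrix.inv_eq_right_inv (by
          rw [Matrix.smul_mul, Matrix.mul_smul, Matrix.one_mul, smul_smul, mul_inv_cancel₀ hN0.ne',
            one_smul])
      rw [this, Matrix.smul_mul, Matrix.one_mul, Matrix.trace_smul, smul_eq_mul,
        inv_mul_le_iff₀ hN0]
      exact hQN
    rw [e1, e2, e4, modelRate]
    nlinarith [e3, e5]

end Filter

/-! ### A lower bound for the information through a test channel -/

section InfoDens

variable {α : Type*} [MeasurableSpace α] {d q : ℕ} {A : Matrix (Fin d) (Fin d) ℝ}
  {B : Matrix (Fin d) (Fin q) ℝ}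

lemma measurable_priorMean (K : ℕ → Matrix (Fin d) (Fin d) ℝ) {v : ℕ → α → Vec d}
    (hv : ∀ k, Measurable (v k)) (k : ℕ) :
    Measurable fun a => priorMean A K (fun j => v j a) k := by
  induction k with
  | zero => exact measurable_const
  | succ k ih =>
    simp only [priorMean]
    exact measurable_mulVec A (ih.add (measurable_mulVec (K k) ((hv k).sub ih)))

lemma measurable_infoDens (G P S : Matrix (Fin d) (Fin d) ℝ) (K : ℕ → Matrix (Fin d) (Fin d) ℝ)
    (N : ℕ) {u v : ℕ → α → Vec d} (hu : ∀ k, Measurable (u k)) (hv : ∀ k, Measurable (v k)) :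
    Measurable fun a => infoDens A B G P S K N (fun j => u j a) (fun j => v j a) := by
  have h1 : ∀ k, Measurable fun a => u k a - priorMean A K (fun j => v j a) k := fun k =>
    (hu k).sub (measurable_priorMean K hv k)
  have h2 : ∀ k, Measurable fun a => u k a - postMean A K (fun j => v j a) k := fun k =>
    (hu k).sub ((measurable_priorMean K hv k).add
      (measurable_mulVec (K k) ((hv k).sub (measurable_priorMean K hv k))))
  simp only [infoDens, infoIncr]
  exact (Finset.measurable_sum _ fun k _ => ((measurable_logDens _).comp (h2 k)).sub
    ((measurable_logDens _).comp (h1 k))).add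
    (((measurable_logDens _).comp (h1 N)).sub ((measurable_logDens _).comp (h1 N)))

lemma infoDens_congr (G P S : Matrix (Fin d) (Fin d) ℝ) (K : ℕ → Matrix (Fin d) (Fin d) ℝ)
    {N : ℕ} {u u' : ℕ → Vec d} (v : ℕ → Vec d) (h : ∀ k ≤ N, u k = u' k) :
    infoDens A B G P S K N u v = infoDens A B G P S K N u' v := by
  simp only [infoDens, infoIncr]
  rw [h N le_rfl, Finset.sum_congr rfl fun k hk => by rw [h k (Finset.mem_range.1 hk).le]]

end InfoDens

variable {p q d : ℕ} {A : Matrix (Fin p) (Fin p) ℝ} {B : Matrix (Fin p) (Fin q) ℝ}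
  {A₁ : Matrix (Fin d) (Fin d) ℝ} {B₁ : Matrix (Fin d) (Fin q) ℝ} {U : Matrix (Fin p) (Fin d) ℝ}

lemma sourcePath_eq_add (hA : A * U = U * A₁) (hB : B = U * B₁) (x0 : Vec p) (w : ℕ → Vec q)
    (t : ℕ) : sourcePath A B x0 w t = A ^ t *ᵥ x0 + U *ᵥ sourcePath A₁ B₁ 0 w t := by
  induction t with
  | zero => simp [sourcePath]
  | succ t ih =>
    simp only [sourcePath]
    rw [ih, Matrix.mulVec_add, Matrix.mulVec_add, Matrix.mulVec_mulVec, Matrix.mulVec_mulVec,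
      Matrix.mulVec_mulVec, Matrix.mulVec_mulVec, hA, ← hB, ← pow_succ', add_assoc]

/-- Once the response to the initial state is subtracted, the path lives in the range of `U` and is
the reduced system started at zero. So the converse uses nothing about the law of the initial state.
-/
lemma transpose_mulVec_sourcePath (hU : Uᵀ * U = 1) (hA : A * U = U * A₁) (hB : B = U * B₁)
    (x0 : Vec p) (w : ℕ → Vec q) (t : ℕ) :
    Uᵀ *ᵥ (sourcePath A B x0 w t - A ^ t *ᵥ x0) = sourcePath A₁ B₁ 0 w t := by
  rw [sourcePath_eq_add hA hB, add_sub_cancel_left, Matrix.mulVec_mulVec, hU, Matrix.one_mulVec]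

lemma sum_sq_transpose_mulVec_le (hU : Uᵀ * U = 1) (v : Vec p) :
    ∑ i, (Uᵀ *ᵥ v) i ^ 2 ≤ ∑ i, v i ^ 2 := by
  have e : ∀ {m : ℕ} (z : Vec m), ∑ i, z i ^ 2 = z ⬝ᵥ z := fun z => by
    simp only [dotProduct, sq]
  have h : 0 ≤ ∑ i, (v - U *ᵥ (Uᵀ *ᵥ v)) i ^ 2 := Finset.sum_nonneg fun i _ => sq_nonneg _
  rw [e] at h
  rw [e, e]
  have h1 : (U *ᵥ (Uᵀ *ᵥ v)) ⬝ᵥ (U *ᵥ (Uᵀ *ᵥ v)) = (Uᵀ *ᵥ v) ⬝ᵥ (Uᵀ *ᵥ v) := by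
    rw [Matrix.dotProduct_mulVec, Matrix.vecMul_mulVec, hU, Matrix.vecMul_one]
  have h2 : v ⬝ᵥ (U *ᵥ (Uᵀ *ᵥ v)) = (Uᵀ *ᵥ v) ⬝ᵥ (Uᵀ *ᵥ v) := by
    rw [Matrix.dotProduct_mulVec, ← Matrix.mulVec_transpose]
  rw [sub_dotProduct, dotProduct_sub, dotProduct_sub, h1, h2, dotProduct_comm (U *ᵥ Uᵀ *ᵥ v) v, h2] at h
  linarith

lemma sqInt_state (S0 : Matrix (Fin p) (Fin p) ℝ) (t : ℕ) :
    SqInt (driveLaw q S0) fun ω => sourcePath A₁ B₁ 0 ω.2 t := by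
  induction t with
  | zero => exact fun i => MemLp.zero'
  | succ t ih => exact (ih.mulVec A₁).add ((Realization.sqInt_noise S0 t).mulVec B₁)

namespace TestChannel

variable (κ : TestChannel p) (S0 : Matrix (Fin p) (Fin p) ℝ)

lemma measurable_drivenState (n t : ℕ) :
    Measurable fun a : (Vec p × (ℕ → Vec q)) × (Fin n → Vec p) => sourcePath A₁ B₁ 0 a.1.2 t :=
  (measurable_state A₁ B₁ t).comp (measurable_snd.comp measurable_fst)

lemma measurable_reduced (n t : ℕ) :
    Measurable fun a : (Vec p × (ℕ → Vec q)) × (Fin n → Vec p) =>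
      Uᵀ *ᵥ (extendPath a.2 t - A ^ t *ᵥ a.1.1) :=
  measurable_mulVec _ (((measurable_pi_apply t).comp ((measurable_extendPath n).comp
    measurable_snd)).sub (measurable_mulVec _ (measurable_fst.comp measurable_fst)))

/-- The sum of the distortions after time `T`, in reduced coordinates. -/
lemma lintegral_reduced_le (hU : Uᵀ * U = 1) (hA : A * U = U * A₁) (hB : B = U * B₁)
    {T N n : ℕ} (hn : n = T + N) {D : ℝ}
    (hκ : κ.avgDistortion (sourceLaw A B S0) n ≤ ENNReal.ofReal D) :
    ∑ k ∈ Finset.range N, ∫⁻ a, ENNReal.ofReal (∑ i, (sourcePath A₁ B₁ 0 a.1.2 (T + k)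
        - Uᵀ *ᵥ (extendPath a.2 (T + k) - A ^ (T + k) *ᵥ a.1.1)) i ^ 2)
        ∂(κ.drivenLaw A B S0 (n + 1))
      ≤ ENNReal.ofReal ((n + 1) * D) := by
  have h1 : ∫⁻ a, ∑ t : Fin (n + 1), sqErr (sourcePath A B a.1.1 a.1.2 t) (a.2 t)
      ∂(κ.drivenLaw A B S0 (n + 1)) ≤ ENNReal.ofReal ((n + 1) * D) := by
    have hm : Measurable fun b : (Fin (n + 1) → Vec p) × (Fin (n + 1) → Vec p) =>
        ∑ t, sqErr (b.1 t) (b.2 t) := Finset.measurable_sum _ fun t _ =>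
      measurable_sqErr (by fun_prop) (by fun_prop)
    rw [avgDistortion, jointLaw_eq_map, lintegral_map hm (measurable_path_fst A B (n + 1)),
      ENNReal.div_le_iff (by simp) (by simp)] at hκ
    refine hκ.trans_eq ?_
    rw [mul_comm, ENNReal.ofReal_mul (by positivity)]
    congr 1
    rw [ENNReal.ofReal_add (by positivity) zero_le_one]
    simp
  refine le_trans ?_ h1
  have hmk : ∀ k, Measurable fun a : (Vec p × (ℕ → Vec q)) × (Fin (n + 1) → Vec p) =>
      ENNReal.ofReal (∑ i, (sourcePath A₁ B₁ 0 a.1.2 (T + k)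
        - Uᵀ *ᵥ (extendPath a.2 (T + k) - A ^ (T + k) *ᵥ a.1.1)) i ^ 2) := fun k =>
    (Finset.measurable_sum _ fun i _ => ((measurable_pi_apply i).comp
      ((measurable_drivenState (n + 1) (T + k)).sub
        (measurable_reduced (n + 1) (T + k)))).pow_const 2).ennreal_ofReal
  rw [← lintegral_finsetSum _ fun k _ => hmk k]
  refine lintegral_mono fun a => ?_
  have h2 : ∑ t : Fin (n + 1), sqErr (sourcePath A B a.1.1 a.1.2 t) (a.2 t)
      = ∑ t ∈ Finset.range (n + 1), sqErr (sourcePath A B a.1.1 a.1.2 t) (extendPath a.2 t) := by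
    rw [Finset.sum_range]
    refine Finset.sum_congr rfl fun t _ => ?_
    simp [extendPath, t.is_le]
  simp only [h2]
  have h3 : ∀ f : ℕ → ℝ≥0∞, ∑ t ∈ Finset.range n, f t
      = ∑ t ∈ Finset.range T, f t + ∑ k ∈ Finset.range N, f (T + k) := fun f => by
    rw [hn, Finset.sum_range_add]
  rw [Finset.sum_range_succ, h3]
  -- The distortion before time `T` and at time `n` is discarded. In the rest, the response to the
  -- initial state cancels from the error, and `Uᵀ` does not increase norms.
  refine le_trans (Finset.sum_le_sum fun k _ => ?_) (le_trans le_add_self le_self_add)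
  refine ENNReal.ofReal_le_ofReal ?_
  rw [← transpose_mulVec_sourcePath hU hA hB a.1.1, ← Matrix.mulVec_sub, sub_sub_sub_cancel_right]
  exact sum_sq_transpose_mulVec_le hU _

/-- Under the product law the reproductions are independent of the path. For fixed reproductions and
initial state, the observations are constants and `lintegral_exp_infoDens` applies to the remaining
noise. The initial state is read off the path at time zero, so the test function depends only on the
path and the reproductions. -/
lemma lintegral_exp_infoDens_prod (hU : Uᵀ * U = 1) (hA : A * U = U * A₁) (hB : B = U * B₁)
    {T N n : ℕ} (hn : n = T + N) (hG : (stateCov A₁ B₁ T).PosDef)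
    {M S : Matrix (Fin d) (Fin d) ℝ} (hM : M.PosDef) (hM' : (A₁ * M * A₁ᵀ + B₁ * B₁ᵀ).PosDef)
    (hS : S.PosDef) (K : ℕ → Matrix (Fin d) (Fin d) ℝ)
    {f : (Fin (n + 1) → Vec p) × (Fin (n + 1) → Vec p) → ℝ} (hfm : Measurable f)
    (hf : f = fun b => infoDens A₁ B₁ (stateCov A₁ B₁ T) M S K N
      (fun k => Uᵀ *ᵥ (extendPath b.1 (T + k) - A ^ (T + k) *ᵥ extendPath b.1 0))
      (fun k => Uᵀ *ᵥ (extendPath b.2 (T + k) - A ^ (T + k) *ᵥ extendPath b.1 0))) :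
    ∫⁻ b, ENNReal.ofReal (Real.exp (f b)) ∂((κ.jointLaw (sourceLaw A B S0) n).fst.prod
      (κ.jointLaw (sourceLaw A B S0) n).snd) = 1 := by
  have hfm' : Measurable fun b => ENNReal.ofReal (Real.exp (f b)) := hfm.exp.ennreal_ofReal
  have hpath : Measurable fun ω : Vec p × (ℕ → Vec q) =>
      fun i : Fin (n + 1) => sourcePath A B ω.1 ω.2 i :=
    measurable_pi_lambda _ fun i => (measurable_pi_apply (i : ℕ)).comp (measurable_sourcePath A B)
  rw [lintegral_prod_symm' _ hfm', fst_jointLaw]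
  have key : ∀ y, ∫⁻ x, ENNReal.ofReal (Real.exp (f (x, y))) ∂((driveLaw q S0).map
      fun ω : Vec p × (ℕ → Vec q) => fun i : Fin (n + 1) => sourcePath A B ω.1 ω.2 i) = 1 := by
    intro y
    have hm : Measurable fun x => ENNReal.ofReal (Real.exp (f (x, y))) :=
      hfm'.comp measurable_prodMk_right
    rw [lintegral_map hm hpath]
    have hm2 : Measurable fun ω : Vec p × (ℕ → Vec q) => ENNReal.ofReal (Real.exp
      (f ((fun i : Fin (n + 1) => sourcePath A B ω.1 ω.2 i), y))) := hm.comp hpath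
    rw [driveLaw, lintegral_prod _ hm2.aemeasurable]
    have : ∀ x0 : Vec p, ∫⁻ w, ENNReal.ofReal (Real.exp
        (f ((fun i : Fin (n + 1) => sourcePath A B x0 w i), y))) ∂(noiseLaw q) = 1 := by
      intro x0
      rw [← lintegral_exp_infoDens hG hM hM' hS K
        (fun k => Uᵀ *ᵥ (extendPath y (T + k) - A ^ (T + k) *ᵥ x0)) N]
      refine lintegral_congr fun w => ?_
      have e : ∀ t ≤ n, extendPath (fun i : Fin (n + 1) => sourcePath A B x0 w i) t
          = sourcePath A B x0 w t := fun t ht => by simp [extendPath, ht]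
      simp only [hf, e 0 (Nat.zero_le n)]
      congr 2
      refine infoDens_congr _ _ _ _ _ fun k hk => ?_
      rw [e (T + k) (by omega)]
      exact transpose_mulVec_sourcePath hU hA hB x0 w (T + k)
    have h1 : IsProbabilityMeasure
        ((multivariateGaussian (0 : EuclideanSpace ℝ (Fin p)) S0).map WithLp.ofLp) :=
      Measure.isProbabilityMeasure_map (by fun_prop)
    exact (lintegral_congr this).trans (by simp)
  simp only [key, lintegral_one, measure_univ]

lemma ofReal_integral_infoDens_le_klDiv (hU : Uᵀ * U = 1) (hA : A * U = U * A₁)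
    (hB : B = U * B₁) {T N n : ℕ} (hn : n = T + N) (hN : 0 < N) (hG : (stateCov A₁ B₁ T).PosDef)
    {M : Matrix (Fin d) (Fin d) ℝ} (hM : M.PosDef) (hM' : (A₁ * M * A₁ᵀ + B₁ * B₁ᵀ).PosDef)
    (K : ℕ → Matrix (Fin d) (Fin d) ℝ)
    (hi : Integrable (fun a => infoDens A₁ B₁ (stateCov A₁ B₁ T) M ((N : ℝ) • 1) K N
      (fun k => sourcePath A₁ B₁ 0 a.1.2 (T + k))
      (fun k => Uᵀ *ᵥ (extendPath a.2 (T + k) - A ^ (T + k) *ᵥ a.1.1)))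
      (κ.drivenLaw A B S0 (n + 1))) :
    ENNReal.ofReal (∫ a, infoDens A₁ B₁ (stateCov A₁ B₁ T) M ((N : ℝ) • 1) K N
      (fun k => sourcePath A₁ B₁ 0 a.1.2 (T + k))
      (fun k => Uᵀ *ᵥ (extendPath a.2 (T + k) - A ^ (T + k) *ᵥ a.1.1))
      ∂(κ.drivenLaw A B S0 (n + 1)))
      ≤ InformationTheory.klDiv (κ.jointLaw (sourceLaw A B S0) n)
        ((κ.jointLaw (sourceLaw A B S0) n).fst.prod (κ.jointLaw (sourceLaw A B S0) n).snd) := by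
  have hext : ∀ t, Measurable fun b : (Fin (n + 1) → Vec p) × (Fin (n + 1) → Vec p) =>
      extendPath b.1 t := fun t =>
    (measurable_pi_apply t).comp ((measurable_extendPath (n + 1)).comp measurable_fst)
  have hext2 : ∀ t, Measurable fun b : (Fin (n + 1) → Vec p) × (Fin (n + 1) → Vec p) =>
      extendPath b.2 t := fun t =>
    (measurable_pi_apply t).comp ((measurable_extendPath (n + 1)).comp measurable_snd)
  have hu : ∀ k, Measurable fun b : (Fin (n + 1) → Vec p) × (Fin (n + 1) → Vec p) =>
      Uᵀ *ᵥ (extendPath b.1 (T + k) - A ^ (T + k) *ᵥ extendPath b.1 0) := fun k =>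
    measurable_mulVec _ ((hext _).sub (measurable_mulVec _ (hext 0)))
  have hv : ∀ k, Measurable fun b : (Fin (n + 1) → Vec p) × (Fin (n + 1) → Vec p) =>
      Uᵀ *ᵥ (extendPath b.2 (T + k) - A ^ (T + k) *ᵥ extendPath b.1 0) := fun k =>
    measurable_mulVec _ ((hext2 _).sub (measurable_mulVec _ (hext 0)))
  obtain ⟨f, hf⟩ : ∃ f : (Fin (n + 1) → Vec p) × (Fin (n + 1) → Vec p) → ℝ, f = fun b =>
      infoDens A₁ B₁ (stateCov A₁ B₁ T) M ((N : ℝ) • 1) K N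
      (fun k => Uᵀ *ᵥ (extendPath b.1 (T + k) - A ^ (T + k) *ᵥ extendPath b.1 0))
      (fun k => Uᵀ *ᵥ (extendPath b.2 (T + k) - A ^ (T + k) *ᵥ extendPath b.1 0)) := ⟨_, rfl⟩
  have hfm : Measurable f := by
    rw [hf]
    exact measurable_infoDens (stateCov A₁ B₁ T) M ((N : ℝ) • 1) K N hu hv
  have hNS : ((N : ℝ) • (1 : Matrix (Fin d) (Fin d) ℝ)).PosDef :=
    Matrix.PosDef.one.smul (by exact_mod_cast hN)
  have hfe : ∀ a : (Vec p × (ℕ → Vec q)) × (Fin (n + 1) → Vec p),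
      infoDens A₁ B₁ (stateCov A₁ B₁ T) M ((N : ℝ) • 1) K N
          (fun k => sourcePath A₁ B₁ 0 a.1.2 (T + k))
          (fun k => Uᵀ *ᵥ (extendPath a.2 (T + k) - A ^ (T + k) *ᵥ a.1.1))
        = f ((fun i : Fin (n + 1) => sourcePath A B a.1.1 a.1.2 i), a.2) := fun a => by
    have e : ∀ t ≤ n, extendPath (fun i : Fin (n + 1) => sourcePath A B a.1.1 a.1.2 i) t
        = sourcePath A B a.1.1 a.1.2 t := fun t ht => by simp [extendPath, ht]
    simp only [hf, e 0 (Nat.zero_le n)]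
    refine infoDens_congr _ _ _ _ _ fun k hk => ?_
    rw [e (T + k) (by omega)]
    exact (transpose_mulVec_sourcePath hU hA hB _ _ (T + k)).symm
  simp only [hfe] at hi ⊢
  have hfi : Integrable f (κ.jointLaw (sourceLaw A B S0) n) := by
    rw [jointLaw_eq_map, integrable_map_measure hfm.aestronglyMeasurable
      (measurable_path_fst A B (n + 1)).aemeasurable]
    exact hi
  refine le_trans (le_of_eq ?_) (ofReal_integral_le_klDiv hfm hfi
    (κ.lintegral_exp_infoDens_prod S0 hU hA hB hn hG hM hM' hNS K hfm hf).le)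
  rw [jointLaw_eq_map, integral_map (measurable_path_fst A B (n + 1)).aemeasurable
    hfm.aestronglyMeasurable]

/-- The covariance of the reduced state at time `T`. -/
def reducedCov (q : ℕ) (S0 : Matrix (Fin p) (Fin p) ℝ) (A₁ : Matrix (Fin d) (Fin d) ℝ)
    (B₁ : Matrix (Fin d) (Fin q) ℝ) (T : ℕ) : Matrix (Fin d) (Fin d) ℝ :=
  crossMoment (driveLaw q S0) (fun ω => sourcePath A₁ B₁ 0 ω.2 T)
    (fun ω => sourcePath A₁ B₁ 0 ω.2 T)

/-- The information through a test channel, compared with the information densities of linear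
Gaussian models. -/
theorem exists_cov_klDiv (hU : Uᵀ * U = 1) (hA : A * U = U * A₁) (hB : B = U * B₁)
    {T N n : ℕ} (hn : n = T + N) (hN : 0 < N) (hG : (stateCov A₁ B₁ T).PosDef) {D : ℝ}
    (hD : 0 ≤ D) (hκ : κ.avgDistortion (sourceLaw A B S0) n ≤ ENNReal.ofReal D)
    {ε : ℝ} (hε : 0 < ε) :
    ∃ P : Matrix (Fin d) (Fin d) ℝ, P.PosSemidef ∧
      N * P.trace ≤ (n + 1) * D + N * (ε * d) ∧
      (A₁ * P * A₁ᵀ + B₁ * B₁ᵀ + (N : ℝ)⁻¹ • reducedCov q S0 A₁ B₁ T - P).PosSemidef ∧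
      ∀ M : Matrix (Fin d) (Fin d) ℝ, M.PosDef → (A₁ * M * A₁ᵀ + B₁ * B₁ᵀ).PosDef →
        ENNReal.ofReal (N * modelRate A₁ B₁ M P + (1 / 2 * Real.log (stateCov A₁ B₁ T).det
            - d / 2 * Real.log N - 1 / 2 * (A₁ * P * A₁ᵀ + B₁ * B₁ᵀ).trace))
          ≤ InformationTheory.klDiv (κ.jointLaw (sourceLaw A B S0) n)
            ((κ.jointLaw (sourceLaw A B S0) n).fst.prod (κ.jointLaw (sourceLaw A B S0) n).snd) := by
  set μ := κ.drivenLaw A B S0 (n + 1) with hμ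
  set ξ : ℕ → (Vec p × (ℕ → Vec q)) × (Fin (n + 1) → Vec p) → Vec d :=
    fun k a => sourcePath A₁ B₁ 0 a.1.2 (T + k) with hξdef
  set η : ℕ → (Vec p × (ℕ → Vec q)) × (Fin (n + 1) → Vec p) → Vec d :=
    fun k a => Uᵀ *ᵥ (extendPath a.2 (T + k) - A ^ (T + k) *ᵥ a.1.1) with hηdef
  set w : ℕ → (Vec p × (ℕ → Vec q)) × (Fin (n + 1) → Vec p) → Vec q :=
    fun k a => a.1.2 (T + k) with hwdef
  have hξm : ∀ k, Measurable (ξ k) := fun k => measurable_drivenState (n + 1) (T + k)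
  have hηm : ∀ k, Measurable (η k) := fun k => measurable_reduced (n + 1) (T + k)
  have hξ : ∀ k, SqInt μ (ξ k) := fun k i => (sqInt_state S0 (T + k) i).comp_measurePreserving
    (κ.measurePreserving_fst_drivenLaw A B S0 (n + 1))
  have hdist := κ.lintegral_reduced_le S0 hU hA hB hn hκ
  have hd : ∀ k < N, SqInt μ fun a => ξ k a - η k a := fun k hk =>
    SqInt.of_lintegral ((hξm k).sub (hηm k)) (ne_top_of_le_ne_top ENNReal.ofReal_ne_top
      ((Finset.single_le_sum (f := fun k => ∫⁻ a, ENNReal.ofReal (∑ i, (ξ k a - η k a) i ^ 2) ∂μ)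
        (fun _ _ => zero_le) (Finset.mem_range.2 hk)).trans hdist))
  -- Reproductions are not assumed square integrable; finite distortion gives it, as the state is
  -- square integrable.
  have hη : ∀ k < N, SqInt μ (η k) := fun k hk => by
    have := (hξ k).sub (hd k hk)
    simpa only [sub_sub_cancel] using this
  have hw : ∀ k, SqInt μ (w k) := fun k => κ.sqInt_noise_drivenLaw A B S0 (n + 1) (T + k)
  have hwm : ∀ t, Measurable fun ω : Vec p × (ℕ → Vec q) => ω.2 t := fun t => by fun_prop
  have hww : ∀ k, crossMoment μ (w k) (w k) = 1 := fun k =>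
    (κ.crossMoment_fst_drivenLaw A B S0 (n + 1) (hwm (T + k)) (hwm (T + k))).trans
      (Realization.crossMoment_noise S0 (T + k))
  have hξw : ∀ k < N, crossMoment μ (ξ k) (w k) = 0 := fun k hk =>
    κ.crossMoment_noise_drivenLaw A B S0 (t := T + k) (by omega)
      (u := fun b => sourcePath A₁ B₁ 0 b.1.2 (T + k))
      ((measurable_state A₁ B₁ (T + k)).comp (measurable_snd.comp measurable_fst)) (hξ k)
      (fun _ _ _ _ => rfl) (fun ω _ v => sourcePath_update A₁ B₁ 0 ω.2 le_rfl v)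
  have hηw : ∀ k < N, ∀ j ≤ k, crossMoment μ (η j) (w k) = 0 := fun k hk j hj =>
    κ.crossMoment_noise_drivenLaw A B S0 (t := T + k) (by omega)
      (u := fun b => Uᵀ *ᵥ (b.2 (T + j) - A ^ (T + j) *ᵥ b.1.1))
      (measurable_mulVec _ (((measurable_pi_apply (T + j)).comp measurable_snd).sub
        (measurable_mulVec _ (measurable_fst.comp measurable_fst)))) (hη j (hj.trans_lt hk))
      (fun ω y y' h => by simp only [h (T + j) (by omega)]) (fun _ _ _ => rfl)
  obtain ⟨K, P, hP, htr, hcov, hK⟩ := exists_filter_bound (A := A₁) (B := B₁) hε hN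
    (fun k _ => hξ k) hη (fun k _ => hw k) (fun k _ ω => rfl) (fun k _ => hww k) hξw hηw
  have hC0 : crossMoment μ (ξ 0) (ξ 0) = reducedCov q S0 A₁ B₁ T :=
    κ.crossMoment_fst_drivenLaw A B S0 (n + 1) (u := fun ω => sourcePath A₁ B₁ 0 ω.2 T)
      (v := fun ω => sourcePath A₁ B₁ 0 ω.2 T) ((measurable_state A₁ B₁ T).comp measurable_snd)
      ((measurable_state A₁ B₁ T).comp measurable_snd)
  refine ⟨P, hP, htr.trans (add_le_add_left ?_ _), hC0 ▸ hcov, fun M hM hM' => ?_⟩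
  · rw [← ENNReal.ofReal_le_ofReal_iff (by positivity), ENNReal.ofReal_sum_of_nonneg
      fun k hk => (posSemidef_crossMoment (hd k (Finset.mem_range.1 hk))).trace_nonneg]
    refine le_trans (le_of_eq (Finset.sum_congr rfl fun k hk => ?_)) hdist
    exact ((hd k (Finset.mem_range.1 hk)).lintegral_sum_sq).symm
  · obtain ⟨hi, hle⟩ := hK _ M hG
    exact (ENNReal.ofReal_le_ofReal hle).trans
      (κ.ofReal_integral_infoDens_le_klDiv S0 hU hA hB hn hN hG hM hM' K hi)

end TestChannel

/-! ### Positive semidefinite matrices -/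

section Linear

lemma transpose_eq_of_posSemidef {n : Type*} {S : Matrix n n ℝ} (hS : S.PosSemidef) : Sᵀ = S := by
  have := hS.isHermitian.eq
  rwa [Matrix.conjTranspose_eq_transpose_of_trivial] at this

variable {n : Type*} [Fintype n]

lemma quad_nonneg {S : Matrix n n ℝ} (hS : S.PosSemidef) (v : n → ℝ) : 0 ≤ v ⬝ᵥ S *ᵥ v := by
  simpa using hS.dotProduct_mulVec_nonneg v

lemma mulVec_eq_zero_of_quad {S : Matrix n n ℝ} (hS : S.PosSemidef) {v : n → ℝ}
    (h : v ⬝ᵥ S *ᵥ v = 0) : S *ᵥ v = 0 :=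
  (hS.dotProduct_mulVec_zero_iff v).1 (by simpa using h)

lemma mulVec_eq_zero_of_le {S R : Matrix n n ℝ} (hS : S.PosSemidef) (hSR : (R - S).PosSemidef)
    {v : n → ℝ} (h : R *ᵥ v = 0) : S *ᵥ v = 0 := by
  refine mulVec_eq_zero_of_quad hS (le_antisymm ?_ (quad_nonneg hS v))
  have := quad_nonneg hSR v
  rw [Matrix.sub_mulVec, dotProduct_sub, h, dotProduct_zero] at this
  linarith

lemma posDef_of_ker {S : Matrix n n ℝ} (hS : S.PosSemidef) (h : ∀ v, S *ᵥ v = 0 → v = 0) :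
    S.PosDef :=
  Matrix.PosDef.of_dotProduct_mulVec_pos hS.isHermitian fun v hv => by
    have h1 : v ⬝ᵥ S *ᵥ v ≠ 0 := fun h0 => hv (h v (mulVec_eq_zero_of_quad hS h0))
    simpa using (quad_nonneg hS v).lt_of_ne' h1

lemma eq_zero_of_posDef {S : Matrix n n ℝ} (hS : S.PosDef) {v : n → ℝ} (h : S *ᵥ v = 0) :
    v = 0 := by
  by_contra hv
  have := hS.dotProduct_mulVec_pos hv
  rw [h] at this
  simp at this

lemma quad_conj' {m : Type*} [Fintype m] (C : Matrix m n ℝ) (S : Matrix n n ℝ) (v : m → ℝ) :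
    v ⬝ᵥ (C * S * Cᵀ) *ᵥ v = (Cᵀ *ᵥ v) ⬝ᵥ S *ᵥ (Cᵀ *ᵥ v) := by
  rw [← Matrix.mulVec_mulVec, ← Matrix.mulVec_mulVec, Matrix.dotProduct_mulVec v,
    ← Matrix.mulVec_transpose]

lemma exists_orthogonal_diagonal [DecidableEq n] {S : Matrix n n ℝ} (hS : Sᵀ = S) :
    ∃ (W : Matrix n n ℝ) (g : n → ℝ), Wᵀ * W = 1 ∧ W * Wᵀ = 1 ∧ Wᵀ * S * W = diagonal g := by
  have hH : S.IsHermitian := by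
    rw [Matrix.IsHermitian, Matrix.conjTranspose_eq_transpose_of_trivial, hS]
  set W : Matrix n n ℝ := hH.eigenvectorUnitary.1 with hW
  have hst : star W = Wᵀ := by
    rw [Matrix.star_eq_conjTranspose, Matrix.conjTranspose_eq_transpose_of_trivial]
  have h1 : Wᵀ * W = 1 := by
    rw [← hst]; exact Unitary.coe_star_mul_self hH.eigenvectorUnitary
  have h2 : W * Wᵀ = 1 := by
    rw [← hst]; exact Unitary.coe_mul_star_self hH.eigenvectorUnitary
  refine ⟨W, hH.eigenvalues, h1, h2, ?_⟩
  have h3 := hH.spectral_theorem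
  rw [Unitary.conjStarAlgAut_apply, ← hW] at h3
  have h4 : S = W * diagonal hH.eigenvalues * Wᵀ := by
    rw [← hst]; exact h3
  conv_lhs => rw [h4]
  rw [Matrix.mul_assoc, Matrix.mul_assoc, Matrix.mul_assoc, h1, Matrix.mul_one, ← Matrix.mul_assoc,
    h1, Matrix.one_mul]

/-- Simultaneous diagonalization. -/
lemma exists_simultaneous_diagonal [DecidableEq n] {M Q : Matrix n n ℝ} (hM : M.PosDef) (hQ : Qᵀ = Q) :
    ∃ (E : Matrix n n ℝ) (z : n → ℝ), IsUnit E.det ∧ E * M * Eᵀ = 1 ∧ E * Q * Eᵀ = diagonal z := by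
  -- Whiten with `C = M^(-1/2)`, then rotate by the eigenvectors of `C Q C`.
  obtain ⟨C, -, hC, hCC⟩ := exists_posSemidef_sqrt hM.inv.posSemidef
  have hMu : IsUnit M.det := hM.det_pos.ne'.isUnit
  have hCu : IsUnit C.det := by
    have : IsUnit (C * C).det := by rw [hCC]; exact hM.inv.det_pos.ne'.isUnit
    rw [Matrix.det_mul] at this
    exact isUnit_of_mul_isUnit_left this
  have h1 : C * M * C = 1 := by
    have h2 : C * (C * M * C) = C * 1 := by
      rw [← Matrix.mul_assoc, ← Matrix.mul_assoc, hCC, Matrix.nonsing_inv_mul _ hMu, Matrix.one_mul,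
        Matrix.mul_one]
    have h3 := congrArg (fun X => C⁻¹ * X) h2
    simpa only [← Matrix.mul_assoc, Matrix.nonsing_inv_mul _ hCu, Matrix.one_mul] using h3
  obtain ⟨W, z, hW1, hW2, hWz⟩ := exists_orthogonal_diagonal (S := C * Q * C) (by
    rw [Matrix.transpose_mul, Matrix.transpose_mul, hC, hQ, Matrix.mul_assoc])
  refine ⟨Wᵀ * C, z, ?_, ?_, ?_⟩
  · rw [Matrix.det_mul]
    refine IsUnit.mul ?_ hCu
    rw [Matrix.isUnit_iff_isUnit_det Wᵀ |>.symm]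
    exact ⟨⟨Wᵀ, W, hW1, hW2⟩, rfl⟩
  · rw [Matrix.transpose_mul, Matrix.transpose_transpose, hC,
      show Wᵀ * C * M * (C * W) = Wᵀ * (C * M * C) * W by simp only [Matrix.mul_assoc], h1,
      Matrix.mul_one, hW1]
  · rw [Matrix.transpose_mul, Matrix.transpose_transpose, hC, ← hWz]
    simp only [Matrix.mul_assoc]

end Linear

/-! ### The controllable part of the source -/

section Controllable

variable {p q : ℕ} (A : Matrix (Fin p) (Fin p) ℝ) (B : Matrix (Fin p) (Fin q) ℝ)

lemma posSemidef_stateCov_succ_sub (t : ℕ) :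
    (stateCov A B (t + 1) - stateCov A B t).PosSemidef := by
  induction t with
  | zero => simpa [stateCov] using posSemidef_mul_transpose B
  | succ t ih =>
    have : stateCov A B (t + 1 + 1) - stateCov A B (t + 1)
        = A * (stateCov A B (t + 1) - stateCov A B t) * Aᵀ := by
      rw [stateCov.eq_2 A B (t + 1), stateCov.eq_2 A B t, Matrix.mul_sub, Matrix.sub_mul]
      abel
    rw [this]
    exact posSemidef_conj ih A

variable {A B} in
lemma mulVec_step_eq_zero {P : Matrix (Fin p) (Fin p) ℝ} (hP : P.PosSemidef) {v : Vec p}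
    (h : v ⬝ᵥ (A * P * Aᵀ + B * Bᵀ) *ᵥ v = 0) : P *ᵥ (Aᵀ *ᵥ v) = 0 ∧ Bᵀ *ᵥ v = 0 := by
  have h1 : v ⬝ᵥ (B * Bᵀ) *ᵥ v = (Bᵀ *ᵥ v) ⬝ᵥ (Bᵀ *ᵥ v) := by
    have := quad_conj' B (1 : Matrix (Fin q) (Fin q) ℝ) v
    rwa [Matrix.mul_one, Matrix.one_mulVec] at this
  rw [Matrix.add_mulVec, dotProduct_add, quad_conj', h1] at h
  have h2 := quad_nonneg hP (Aᵀ *ᵥ v)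
  have h3 : 0 ≤ (Bᵀ *ᵥ v) ⬝ᵥ (Bᵀ *ᵥ v) := by
    simp only [dotProduct]
    exact Finset.sum_nonneg fun i _ => mul_self_nonneg _
  exact ⟨mulVec_eq_zero_of_quad hP (by linarith), dotProduct_self_eq_zero.1 (by linarith)⟩

/-- The state covariances increase, so their kernels decrease and stabilize in finite dimension.
From then on a kernel vector stays in the kernel for one more step, which gives invariance under
`Aᵀ` and annihilation by `Bᵀ`. -/
lemma exists_invariant_ker : ∃ T, ∀ v : Vec p, stateCov A B T *ᵥ v = 0 →
    stateCov A B T *ᵥ (Aᵀ *ᵥ v) = 0 ∧ Bᵀ *ᵥ v = 0 := by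
  have hmono : Antitone fun t => LinearMap.ker (stateCov A B t).mulVecLin :=
    antitone_nat_of_succ_le fun t v hv => by
      rw [LinearMap.mem_ker, Matrix.mulVecLin_apply] at hv ⊢
      exact mulVec_eq_zero_of_le (posSemidef_stateCov A B t) (posSemidef_stateCov_succ_sub A B t) hv
  obtain ⟨T, hT⟩ := IsArtinian.monotone_stabilizes
    (⟨fun t => OrderDual.toDual (LinearMap.ker (stateCov A B t).mulVecLin), hmono⟩ :
      ℕ →o (Submodule ℝ (Vec p))ᵒᵈ)
  refine ⟨T, fun v hv => mulVec_step_eq_zero (posSemidef_stateCov A B T) ?_⟩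
  have h : LinearMap.ker (stateCov A B T).mulVecLin
      = LinearMap.ker (stateCov A B (T + 1)).mulVecLin := hT (T + 1) (Nat.le_succ T)
  have h1 : v ∈ LinearMap.ker (stateCov A B (T + 1)).mulVecLin := by
    rw [← h, LinearMap.mem_ker, Matrix.mulVecLin_apply, hv]
  rw [LinearMap.mem_ker, Matrix.mulVecLin_apply, stateCov] at h1
  rw [h1, dotProduct_zero]

variable {A B} in
lemma conj_stateCov {d : ℕ} {A₁ : Matrix (Fin d) (Fin d) ℝ} {B₁ : Matrix (Fin d) (Fin q) ℝ}
    {U : Matrix (Fin p) (Fin d) ℝ} (hA : A * U = U * A₁) (hB : B = U * B₁) (t : ℕ) :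
    U * stateCov A₁ B₁ t * Uᵀ = stateCov A B t := by
  induction t with
  | zero => simp [stateCov]
  | succ t ih =>
    have hA' : Uᵀ * Aᵀ = A₁ᵀ * Uᵀ := by rw [← Matrix.transpose_mul, hA, Matrix.transpose_mul]
    have hB' : Bᵀ = B₁ᵀ * Uᵀ := by rw [← Matrix.transpose_mul, ← hB]
    rw [stateCov, stateCov, ← ih,
      show A * (U * stateCov A₁ B₁ t * Uᵀ) * Aᵀ = (A * U) * stateCov A₁ B₁ t * (Uᵀ * Aᵀ) by
        simp only [Matrix.mul_assoc], hA, hA', hB']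
    conv_rhs => rw [hB]
    simp only [Matrix.mul_add, Matrix.add_mul, Matrix.mul_assoc]

/-- Orthonormal coordinates in which the noise drives exactly the first `d` components. -/
lemma exists_controllable_part : ∃ (d : ℕ) (m : Type) (_ : Fintype m) (_ : DecidableEq m)
    (_ : Fin d ⊕ m ≃ Fin p) (V : Matrix (Fin p) (Fin d ⊕ m) ℝ) (A₁ : Matrix (Fin d) (Fin d) ℝ)
    (B₁ : Matrix (Fin d) (Fin q) ℝ) (T : ℕ), Vᵀ * V = 1 ∧ V * Vᵀ = 1 ∧
      A * V.toCols₁ = V.toCols₁ * A₁ ∧ B = V.toCols₁ * B₁ ∧ (stateCov A₁ B₁ T).PosDef := by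
  obtain ⟨T, hT⟩ := exists_invariant_ker A B
  set G := stateCov A B T with hG
  have hGp : G.PosSemidef := posSemidef_stateCov A B T
  obtain ⟨W, g, hW1, hW2, hWg⟩ := exists_orthogonal_diagonal (transpose_eq_of_posSemidef hGp)
  set e₁ := Fintype.equivFin {i // ¬ g i = 0} with he₁
  -- Eigenvectors of the state covariance are sorted so that the nonzero eigenvalues, the directions
  -- reached by the noise, come first.
  set e : Fin (Fintype.card {i // ¬ g i = 0}) ⊕ {i // g i = 0} ≃ Fin p :=
    (Equiv.sumCongr e₁.symm (Equiv.refl _)).trans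
      ((Equiv.sumComm _ _).trans (Equiv.sumCompl fun i => g i = 0)) with he
  have he0 : ∀ k, g (e (Sum.inl k)) ≠ 0 := fun k => (e₁.symm k).2
  have he1 : ∀ i, g (e (Sum.inr i)) = 0 := fun i => i.2
  set V := W.submatrix id e with hV
  have hV1 : Vᵀ * V = 1 := by
    rw [hV, Matrix.transpose_submatrix, Matrix.submatrix_mul _ _ e id e Function.bijective_id |>.symm, hW1,
      Matrix.submatrix_one_equiv]
  have hV2 : V * Vᵀ = 1 := by
    rw [hV, Matrix.transpose_submatrix, Matrix.submatrix_mul_equiv, hW2, Matrix.submatrix_id_id]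
  have hVG : Vᵀ * G * V = diagonal fun i => g (e i) := by
    have : Vᵀ * G * V = (Wᵀ * G * W).submatrix e e := by
      ext i j; simp [hV, Matrix.mul_apply]
    rw [this, hWg, Matrix.submatrix_diagonal_equiv]
    rfl
  have hGV : G * V = V * diagonal fun i => g (e i) := by
    rw [← hVG, ← Matrix.mul_assoc, ← Matrix.mul_assoc, hV2, Matrix.one_mul]
  set U := V.toCols₁ with hU
  set U₂ := V.toCols₂ with hU₂
  have hsum : U * Uᵀ + U₂ * U₂ᵀ = 1 := by
    rw [← hV2]
    ext i j
    simp [Matrix.mul_apply, hU, hU₂]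
  have hUU : Uᵀ * U = 1 := by
    ext i j
    have := congrFun (congrFun hV1 (Sum.inl i)) (Sum.inl j)
    simpa [Matrix.mul_apply, Matrix.one_apply, hU] using this
  have hker : ∀ z, G *ᵥ z = 0 → Uᵀ *ᵥ z = 0 := fun z hz => by
    have h1 : (diagonal fun i => g (e i)) *ᵥ (Vᵀ *ᵥ z) = 0 := by
      rw [← hVG, Matrix.mulVec_mulVec, Matrix.mul_assoc, hV2, Matrix.mul_one, ← Matrix.mulVec_mulVec,
        hz, Matrix.mulVec_zero]
    ext k
    have h2 := congrFun h1 (Sum.inl k)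
    rw [Matrix.mulVec_diagonal] at h2
    exact (mul_eq_zero.1 h2).resolve_left (he0 k)
  have hcol : ∀ i, G *ᵥ (fun a => V a (Sum.inr i)) = 0 := fun i => by
    ext a
    have h1 := congrFun (congrFun hGV a) (Sum.inr i)
    rw [Matrix.mul_diagonal, he1, mul_zero] at h1
    exact h1
  -- The columns of `U₂` span the invariant kernel: `B` does not act on them, and `A` maps the range
  -- of `U` to itself.
  have hBU : U₂ᵀ * B = 0 := by
    ext i j
    have h1 := congrFun (hT _ (hcol i)).2 j
    refine Eq.trans ?_ h1
    rw [Matrix.mul_apply]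
    exact Finset.sum_congr rfl fun a _ => mul_comm _ _
  have hAU : U₂ᵀ * (A * U) = 0 := by
    ext i k
    have h1 := congrFun (hker _ (hT _ (hcol i)).1) k
    rw [Matrix.mulVec_mulVec, ← Matrix.transpose_mul] at h1
    refine Eq.trans ?_ h1
    rw [Matrix.mul_apply]
    exact Finset.sum_congr rfl fun a _ => mul_comm _ _
  have hA : A * U = U * (Uᵀ * A * U) := by
    have h1 : A * U = (U * Uᵀ + U₂ * U₂ᵀ) * (A * U) := by rw [hsum, Matrix.one_mul]
    rw [h1, Matrix.add_mul, Matrix.mul_assoc U₂, hAU, Matrix.mul_zero, add_zero]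
    simp only [Matrix.mul_assoc]
  have hB : B = U * (Uᵀ * B) := by
    have h1 : B = (U * Uᵀ + U₂ * U₂ᵀ) * B := by rw [hsum, Matrix.one_mul]
    conv_lhs => rw [h1, Matrix.add_mul, Matrix.mul_assoc U₂, hBU, Matrix.mul_zero, add_zero]
    rw [Matrix.mul_assoc]
  refine ⟨_, {i // g i = 0}, inferInstance, inferInstance, e, V, Uᵀ * A * U, Uᵀ * B, T, hV1, hV2,
    hA, hB, ?_⟩
  have h1 : stateCov (Uᵀ * A * U) (Uᵀ * B) T = diagonal fun k => g (e (Sum.inl k)) := by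
    have h2 := conj_stateCov hA hB T
    have h3 : stateCov (Uᵀ * A * U) (Uᵀ * B) T = Uᵀ * G * U := by
      rw [hG, ← h2,
        show ∀ X : Matrix _ _ ℝ, Uᵀ * (U * X * Uᵀ) * U = (Uᵀ * U) * X * (Uᵀ * U) from fun X => by
          simp only [Matrix.mul_assoc], hUU, Matrix.one_mul, Matrix.mul_one]
    rw [h3]
    ext k l
    have h4 := congrFun (congrFun hVG (Sum.inl k)) (Sum.inl l)
    simp only [Matrix.diagonal_apply, Sum.inl.injEq] at h4 ⊢
    rw [← h4]
    simp [Matrix.mul_apply, hU]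
  refine posDef_of_ker (posSemidef_stateCov _ _ T) fun v hv => ?_
  rw [h1] at hv
  ext k
  have h2 := congrFun hv k
  rw [Matrix.mulVec_diagonal] at h2
  exact (mul_eq_zero.1 h2).resolve_left (he0 k)

end Controllable

/-! ### Limits of covariances -/

section Limit

open scoped Topology

variable {d q : ℕ} {A : Matrix (Fin d) (Fin d) ℝ} {B : Matrix (Fin d) (Fin q) ℝ}

lemma posSemidef_of_tendsto {S : ℕ → Matrix (Fin d) (Fin d) ℝ} {S' : Matrix (Fin d) (Fin d) ℝ}
    (h : Tendsto S atTop (𝓝 S')) (hS : ∀ j, (S j).PosSemidef) : S'.PosSemidef := by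
  refine Matrix.PosSemidef.of_dotProduct_mulVec_nonneg ?_ fun v => ?_
  · rw [Matrix.IsHermitian, Matrix.conjTranspose_eq_transpose_of_trivial]
    have h1 : Tendsto (fun j => (S j)ᵀ) atTop (𝓝 S'ᵀ) :=
      (continuous_id.matrix_transpose.tendsto S').comp h
    simp only [fun j => transpose_eq_of_posSemidef (hS j)] at h1
    exact tendsto_nhds_unique h1 h
  · have hc : Continuous fun X : Matrix (Fin d) (Fin d) ℝ => v ⬝ᵥ X *ᵥ v :=
      continuous_const.dotProduct (continuous_id.matrix_mulVec continuous_const)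
    simpa using ge_of_tendsto' ((hc.tendsto S').comp h) fun j => quad_nonneg (hS j) v

lemma abs_apply_le_trace {S : Matrix (Fin d) (Fin d) ℝ} (hS : S.PosSemidef) (i k : Fin d) :
    |S i k| ≤ S.trace := by
  have hsym : S k i = S i k := congrFun (congrFun (transpose_eq_of_posSemidef hS) i) k
  have hdiag : ∀ i, 0 ≤ S i i := fun i => by
    have := quad_nonneg hS (Pi.single i 1)
    simpa using this
  have htr : ∀ i, S i i ≤ S.trace := fun i =>
    Finset.single_le_sum (f := fun i => S i i) (fun i _ => hdiag i) (Finset.mem_univ i)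
  have hq : ∀ s : ℝ, s * s = 1 → 0 ≤ S i i + S k k + 2 * s * S i k := fun s hs => by
    have h1 := quad_nonneg hS (Pi.single i 1 + s • Pi.single k 1)
    simp only [Matrix.mulVec_add, Matrix.mulVec_smul, dotProduct_add, add_dotProduct,
      smul_dotProduct, dotProduct_smul, Matrix.mulVec_single_one, single_one_dotProduct,
      Matrix.col_apply, smul_eq_mul] at h1
    rw [hsym] at h1
    have h2 : s * (S i k + s * S k k) = s * S i k + s * s * S k k := by ring
    rw [h2, hs] at h1
    linarith
  have h1 := hq 1 (by norm_num)
  have h2 := hq (-1) (by norm_num)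
  rw [abs_le]
  constructor <;> linarith [htr i, htr k]

lemma continuous_prior : Continuous fun P : Matrix (Fin d) (Fin d) ℝ => A * P * Aᵀ + B * Bᵀ :=
  ((continuous_const.matrix_mul continuous_id).matrix_mul continuous_const).add continuous_const

lemma continuous_modelRate (M : Matrix (Fin d) (Fin d) ℝ) : Continuous (modelRate A B M) := by
  unfold modelRate
  exact continuous_const.add (continuous_const.mul
    ((continuous_const.matrix_mul continuous_prior).matrix_trace.sub
      (continuous_const.matrix_mul continuous_id).matrix_trace))

/-- Bounded traces keep the covariances in a compact set, and after division by `N` all corrections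
vanish. The model `M` is kept apart from `P` because `modelRate` is continuous in `P` for fixed `M`
even where the limit might be singular and its determinant of no use. -/
lemma exists_limit_cov {C : Matrix (Fin d) (Fin d) ℝ} {D L g : ℝ} {T : ℕ} (hD : 0 ≤ D)
    (h : ∀ j : ℕ, ∃ (N : ℕ) (P : Matrix (Fin d) (Fin d) ℝ), j < N ∧ P.PosSemidef ∧
      N * P.trace ≤ ((T + N : ℕ) + 1) * D + N * (((j : ℝ) + 1)⁻¹ * d) ∧
      (A * P * Aᵀ + B * Bᵀ + (N : ℝ)⁻¹ • C - P).PosSemidef ∧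
      ∀ M : Matrix (Fin d) (Fin d) ℝ, M.PosDef → (A * M * Aᵀ + B * Bᵀ).PosDef →
        N * modelRate A B M P + (1 / 2 * g - d / 2 * Real.log N
          - 1 / 2 * (A * P * Aᵀ + B * Bᵀ).trace) ≤ ((T + N : ℕ) + 1) * (L + ((j : ℝ) + 1)⁻¹)) :
    ∃ P : Matrix (Fin d) (Fin d) ℝ, P.PosSemidef ∧ P.trace ≤ D ∧
      (A * P * Aᵀ + B * Bᵀ - P).PosSemidef ∧
      ∀ M : Matrix (Fin d) (Fin d) ℝ, M.PosDef → (A * M * Aᵀ + B * Bᵀ).PosDef →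
        modelRate A B M P ≤ L := by
  choose N P hN hP htr hcov hM using h
  have hN0 : ∀ j, (0 : ℝ) < N j := fun j => by exact_mod_cast (Nat.zero_le j).trans_lt (hN j)
  have hNtop : Tendsto (fun j => (N j : ℝ)) atTop atTop :=
    tendsto_natCast_atTop_atTop.comp (tendsto_atTop_mono (fun j => (hN j).le) tendsto_id)
  have hNinv : Tendsto (fun j => (N j : ℝ)⁻¹) atTop (𝓝 0) := tendsto_inv_atTop_zero.comp hNtop
  have hlog : Tendsto (fun j => Real.log (N j) / N j) atTop (𝓝 0) := by
    have h1 := (Real.tendsto_pow_log_div_mul_add_atTop 1 0 1 one_ne_zero).comp hNtop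
    simpa [Function.comp_def] using h1
  have hj : Tendsto (fun j : ℕ => ((j : ℝ) + 1)⁻¹) atTop (𝓝 0) :=
    tendsto_inv_atTop_zero.comp (tendsto_atTop_add_const_right _ _ tendsto_natCast_atTop_atTop)
  have ha : ∀ j, (((T + N j : ℕ) : ℝ) + 1) / N j = 1 + (T + 1) * (N j : ℝ)⁻¹ := fun j => by
    have := (hN0 j).ne'
    push_cast
    field_simp
    ring
  have hatend : Tendsto (fun j => 1 + ((T : ℝ) + 1) * (N j : ℝ)⁻¹) atTop (𝓝 1) := by
    simpa using (hNinv.const_mul ((T : ℝ) + 1)).const_add 1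
  have htr' : ∀ j, (P j).trace ≤ (1 + (T + 1) * (N j : ℝ)⁻¹) * D + ((j : ℝ) + 1)⁻¹ * d :=
    fun j => by
      rw [← ha, div_mul_eq_mul_div, ← sub_le_iff_le_add, le_div_iff₀ (hN0 j)]
      nlinarith [htr j]
  have hNinv1 : ∀ j, (N j : ℝ)⁻¹ ≤ 1 := fun j => by
    refine inv_le_one_of_one_le₀ ?_
    exact_mod_cast (Nat.succ_le_of_lt ((Nat.zero_le j).trans_lt (hN j)))
  have hbound : ∀ j, (P j).trace ≤ (1 + (T + 1)) * D + d := fun j => by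
    refine (htr' j).trans (add_le_add (mul_le_mul_of_nonneg_right ?_ hD) ?_)
    · have : ((T : ℝ) + 1) * (N j : ℝ)⁻¹ ≤ (T + 1) * 1 :=
        mul_le_mul_of_nonneg_left (hNinv1 j) (by positivity)
      linarith
    · have : ((j : ℝ) + 1)⁻¹ ≤ 1 := inv_le_one_of_one_le₀ (by linarith [(j.cast_nonneg : (0 : ℝ) ≤ j)])
      exact mul_le_of_le_one_left (by positivity) this
  set R := (1 + ((T : ℝ) + 1)) * D + d with hR
  have hcompact : IsCompact (Set.pi Set.univ fun _ : Fin d => Set.pi Set.univ fun _ : Fin d =>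
      Set.Icc (-R) R) := isCompact_univ_pi fun _ => isCompact_univ_pi fun _ => isCompact_Icc
  obtain ⟨P', φ, hφ, hlim⟩ : ∃ (P' : Matrix (Fin d) (Fin d) ℝ) (φ : ℕ → ℕ), StrictMono φ ∧
      Tendsto (fun j => P (φ j)) atTop (𝓝 P') := by
    obtain ⟨P', -, φ, hφ, hlim⟩ := hcompact.tendsto_subseq (x := fun j i k => P j i k)
      fun j i _ k _ => abs_le.1 ((abs_apply_le_trace (hP j) i k).trans (hbound j))
    exact ⟨P', φ, hφ, hlim⟩
  have hφt := hφ.tendsto_atTop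
  have hprior : Tendsto (fun j => A * P (φ j) * Aᵀ + B * Bᵀ) atTop
      (𝓝 (A * P' * Aᵀ + B * Bᵀ)) :=
    (continuous_prior.tendsto _).comp hlim
  have htrace : Continuous fun X : Matrix (Fin d) (Fin d) ℝ => X.trace := continuous_id.matrix_trace
  refine ⟨P', posSemidef_of_tendsto hlim fun j => hP (φ j), ?_, ?_, fun M hM1 hM2 => ?_⟩
  · refine le_of_tendsto_of_tendsto' ((htrace.tendsto _).comp hlim) ?_ fun j => htr' (φ j)
    have := ((hatend.mul_const D).add (hj.mul_const (d : ℝ))).comp hφt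
    simpa [Function.comp_def] using this
  · refine posSemidef_of_tendsto ?_ fun j => hcov (φ j)
    have := (hprior.add ((hNinv.comp hφt).smul_const C)).sub hlim
    simpa [Function.comp_def] using this
  · refine le_of_tendsto_of_tendsto' (((continuous_modelRate M).tendsto _).comp hlim)
      (g := fun j => (1 + (T + 1) * (N (φ j) : ℝ)⁻¹) * (L + (((φ j : ℕ) : ℝ) + 1)⁻¹)
        + d / 2 * (Real.log (N (φ j)) / N (φ j))
        + (1 / 2 * (A * P (φ j) * Aᵀ + B * Bᵀ).trace - 1 / 2 * g) * (N (φ j) : ℝ)⁻¹) ?_ fun j => ?_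
    · have h1 := (hatend.mul (hj.const_add L)).comp hφt
      have h2 := (hlog.const_mul ((d : ℝ) / 2)).comp hφt
      have h3 := ((((htrace.tendsto _).comp hprior).const_mul (1 / 2)).sub_const (1 / 2 * g)).mul
        (hNinv.comp hφt)
      simpa [Function.comp_def] using (h1.add h2).add h3
    · have h1 := hM (φ j) M hM1 hM2
      have h0 := hN0 (φ j)
      simp only [Function.comp_apply]
      rw [← ha, ← sub_nonneg]
      have h2 : 0 ≤ (N (φ j) : ℝ)⁻¹ * (((T + N (φ j) : ℕ) + 1) * (L + ((φ j : ℝ) + 1)⁻¹)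
          - (N (φ j) * modelRate A B M (P (φ j)) + (1 / 2 * g - d / 2 * Real.log (N (φ j))
          - 1 / 2 * (A * P (φ j) * Aᵀ + B * Bᵀ).trace))) :=
        mul_nonneg (inv_nonneg.2 h0.le) (sub_nonneg.2 h1)
      refine h2.trans_eq ?_
      field_simp
      ring

end Limit

/-! ### An optimal error covariance -/

section OptimalCov

open scoped Topology

variable {p d q : ℕ} {A : Matrix (Fin d) (Fin d) ℝ} {B : Matrix (Fin d) (Fin q) ℝ} {T : ℕ}

lemma posSemidef_priorCov {M : Matrix (Fin d) (Fin d) ℝ} (hM : M.PosSemidef) :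
    (A * M * Aᵀ + B * Bᵀ).PosSemidef :=
  (posSemidef_conj hM A).add (posSemidef_mul_transpose B)

lemma stateCov_mulVec_eq_zero {P : Matrix (Fin d) (Fin d) ℝ} (h : ∀ v : Vec d, P *ᵥ v = 0 →
    P *ᵥ (Aᵀ *ᵥ v) = 0 ∧ Bᵀ *ᵥ v = 0) (t : ℕ) {v : Vec d} (hv : P *ᵥ v = 0) :
    stateCov A B t *ᵥ v = 0 := by
  induction t generalizing v with
  | zero => simp [stateCov]
  | succ t ih =>
    rw [stateCov, Matrix.add_mulVec, ← Matrix.mulVec_mulVec, ← Matrix.mulVec_mulVec,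
      ← Matrix.mulVec_mulVec, ih (h v hv).1, (h v hv).2]
    simp

/-- A kernel vector is annihilated by `Aᵀ` and `Bᵀ`, hence by the state covariance at time `T + 1`,
which dominates the nonsingular one at time `T`. -/
lemma posDef_priorCov (hG : (stateCov A B T).PosDef) {M : Matrix (Fin d) (Fin d) ℝ}
    (hM : M.PosDef) : (A * M * Aᵀ + B * Bᵀ).PosDef := by
  refine posDef_of_ker (posSemidef_priorCov hM.posSemidef) fun v hv => ?_
  obtain ⟨h1, h2⟩ := mulVec_step_eq_zero hM.posSemidef (A := A) (B := B) (v := v)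
    (by rw [hv, dotProduct_zero])
  have h3 : Aᵀ *ᵥ v = 0 := eq_zero_of_posDef hM h1
  refine eq_zero_of_posDef hG (mulVec_eq_zero_of_le hG.posSemidef
    (posSemidef_stateCov_succ_sub A B T) ?_)
  rw [stateCov, Matrix.add_mulVec, ← Matrix.mulVec_mulVec, ← Matrix.mulVec_mulVec,
    ← Matrix.mulVec_mulVec, h2, h3]
  simp

lemma log_det_sub_log_det {M Q E : Matrix (Fin d) (Fin d) ℝ} {z : Vec d} (hM : M.PosDef)
    (hE : IsUnit E.det) (hEM : E * M * Eᵀ = 1) (hEQ : E * Q * Eᵀ = diagonal z) (hz : ∀ i, z i ≠ 0) :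
    Real.log Q.det - Real.log M.det = ∑ i, Real.log (z i) := by
  have hdM : E.det * M.det * E.det = 1 := by
    have := congrArg Matrix.det hEM
    rwa [Matrix.det_mul, Matrix.det_mul, Matrix.det_transpose, Matrix.det_one] at this
  have hdQ : E.det * Q.det * E.det = ∏ i, z i := by
    have := congrArg Matrix.det hEQ
    rwa [Matrix.det_mul, Matrix.det_mul, Matrix.det_transpose, Matrix.det_diagonal] at this
  have hQM : Q.det = M.det * ∏ i, z i := by
    have hE2 : E.det * E.det ≠ 0 := mul_ne_zero hE.ne_zero hE.ne_zero
    have : E.det * E.det * Q.det = E.det * E.det * (M.det * ∏ i, z i) := by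
      rw [← hdQ]; linear_combination -(E.det * Q.det * E.det) * hdM
    exact mul_left_cancel₀ hE2 this
  rw [hQM, Real.log_mul hM.det_pos.ne' (Finset.prod_ne_zero_iff.2 fun i _ => hz i),
    add_sub_cancel_left, Real.log_prod fun i _ => hz i]

/-- A relative determinant bound for ordered matrices bounds the larger one. -/
lemma posSemidef_exp_smul_sub {M Q : Matrix (Fin d) (Fin d) ℝ} (hM : M.PosDef) (hQ : Qᵀ = Q)
    -- After whitening `M`, the eigenvalues of `Q` are all at least one, so the logarithm of each is
    -- bounded by their sum.
    (hMQ : (Q - M).PosSemidef) {c : ℝ} (h : Real.log Q.det - Real.log M.det ≤ c) :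
    (Real.exp c • M - Q).PosSemidef := by
  obtain ⟨E, z, hE, hEM, hEQ⟩ := exists_simultaneous_diagonal hM hQ
  have hz : ∀ i, 1 ≤ z i := fun i => by
    have h1 := posSemidef_conj hMQ E
    rw [Matrix.mul_sub, Matrix.sub_mul, hEM, hEQ, ← Matrix.diagonal_one, Matrix.diagonal_sub,
      Matrix.posSemidef_diagonal_iff] at h1
    linarith [h1 i]
  rw [log_det_sub_log_det hM hE hEM hEQ fun i => by linarith [hz i]] at h
  have hzi : ∀ i, z i ≤ Real.exp c := fun i => by
    rw [← Real.log_le_iff_le_exp (by linarith [hz i])]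
    exact (Finset.single_le_sum (f := fun i => Real.log (z i))
      (fun i _ => Real.log_nonneg (hz i)) (Finset.mem_univ i)).trans h
  have h1 : (E * (Real.exp c • M - Q) * Eᵀ).PosSemidef := by
    rw [Matrix.mul_sub, Matrix.sub_mul, Matrix.mul_smul, Matrix.smul_mul, hEM, hEQ,
      ← Matrix.diagonal_one, ← Matrix.diagonal_smul, Matrix.diagonal_sub,
      Matrix.posSemidef_diagonal_iff]
    intro i
    simpa using hzi i
  have h2 := posSemidef_conj h1 E⁻¹
  have h3 : E⁻¹ * E = 1 := Matrix.nonsing_inv_mul _ hE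
  have h4 : Eᵀ * E⁻¹ᵀ = 1 := by rw [← Matrix.transpose_mul, h3, Matrix.transpose_one]
  rwa [show E⁻¹ * (E * (Real.exp c • M - Q) * Eᵀ) * E⁻¹ᵀ
      = (E⁻¹ * E) * (Real.exp c • M - Q) * (Eᵀ * E⁻¹ᵀ) by simp only [Matrix.mul_assoc], h3, h4,
    Matrix.one_mul, Matrix.mul_one] at h2

lemma priorCov_mix (P G : Matrix (Fin d) (Fin d) ℝ) (ε : ℝ) :
    A * ((1 - ε) • P + ε • G) * Aᵀ + B * Bᵀ
      = (1 - ε) • (A * P * Aᵀ + B * Bᵀ) + ε • (A * G * Aᵀ + B * Bᵀ) := by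
  simp only [Matrix.mul_add, Matrix.add_mul, Matrix.mul_sub, Matrix.sub_mul, Matrix.mul_smul,
    Matrix.smul_mul, smul_add, sub_smul, one_smul]
  abel

/-- Testing with models `M` that approach `P` from the nonsingular side bounds the determinant ratio
of prior and posterior uniformly, so in the limit the prior of `P` is at most a multiple of `P`.
Then the kernel of `P` is invariant under `Aᵀ` and annihilated by `Bᵀ`; the noise never reaches such
directions, so there are none. -/
lemma posDef_of_modelRate_le (hG : (stateCov A B T).PosDef) {P : Matrix (Fin d) (Fin d) ℝ} {L : ℝ}
    (hP : P.PosSemidef) (hcov : (A * P * Aᵀ + B * Bᵀ - P).PosSemidef)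
    (hM : ∀ M : Matrix (Fin d) (Fin d) ℝ, M.PosDef → (A * M * Aᵀ + B * Bᵀ).PosDef →
      modelRate A B M P ≤ L) : P.PosDef := by
  set Q := A * P * Aᵀ + B * Bᵀ with hQ
  set G := stateCov A B T with hGdef
  have hQp : Q.PosSemidef := posSemidef_priorCov hP
  have hmix : ∀ j : ℕ, (Real.exp (2 * L + 2 * d) • ((1 - ((j : ℝ) + 2)⁻¹) • P + ((j : ℝ) + 2)⁻¹ • G)
      - ((1 - ((j : ℝ) + 2)⁻¹) • Q + ((j : ℝ) + 2)⁻¹ • (A * G * Aᵀ + B * Bᵀ))).PosSemidef := by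
    intro j
    set ε := ((j : ℝ) + 2)⁻¹ with hε
    have hε0 : 0 < ε := by positivity
    have hε1 : ε ≤ 1 / 2 := by
      rw [hε, one_div]
      exact inv_anti₀ (by norm_num) (by linarith [(j.cast_nonneg : (0 : ℝ) ≤ j)])
    set M := (1 - ε) • P + ε • G with hMdef
    have hMp : M.PosDef := Matrix.PosDef.posSemidef_add (hP.smul (by linarith)) (hG.smul hε0)
    have hM' : (A * M * Aᵀ + B * Bᵀ).PosDef := posDef_priorCov hG hMp
    have hMe : A * M * Aᵀ + B * Bᵀ = (1 - ε) • Q + ε • (A * G * Aᵀ + B * Bᵀ) := priorCov_mix P G ε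
    have hsub : (A * M * Aᵀ + B * Bᵀ - M).PosSemidef := by
      have : A * M * Aᵀ + B * Bᵀ - M = (1 - ε) • (Q - P) + ε • (A * G * Aᵀ + B * Bᵀ - G) := by
        rw [hMe, hMdef, smul_sub, smul_sub]; abel
      rw [this]
      exact (hcov.smul (by linarith)).add
        ((posSemidef_stateCov_succ_sub A B T).smul hε0.le)
    rw [← hMe]
    refine posSemidef_exp_smul_sub hMp (transpose_eq_of_posSemidef hM'.posSemidef) hsub ?_
    have h1 := hM M hMp hM'
    have h2 : 0 ≤ ((A * M * Aᵀ + B * Bᵀ)⁻¹ * Q).trace :=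
      trace_mul_nonneg hM'.inv.posSemidef hQp
    have h3 : 0 ≤ (M⁻¹ * G).trace := trace_mul_nonneg hMp.inv.posSemidef hG.posSemidef
    have h3' : 0 ≤ (M⁻¹ * P).trace := trace_mul_nonneg hMp.inv.posSemidef hP
    -- Since `tr (M⁻¹ M) = d` and `ε ≤ 1/2`, the trace of `M⁻¹ P` is at most `2d`. The rate bound
    -- then gives a logarithmic determinant ratio of at most `2L + 2d`.
    have h4 : (1 - ε) * (M⁻¹ * P).trace + ε * (M⁻¹ * G).trace = d := by
      have h5 : (M⁻¹ * M).trace = d := by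
        rw [Matrix.nonsing_inv_mul _ hMp.det_pos.ne'.isUnit, Matrix.trace_one, Fintype.card_fin]
      conv at h5 => lhs; rw [hMdef]
      rw [← hMdef, Matrix.mul_add, Matrix.mul_smul, Matrix.mul_smul, Matrix.trace_add,
        Matrix.trace_smul, Matrix.trace_smul, smul_eq_mul, smul_eq_mul] at h5
      exact h5
    have h6 : (M⁻¹ * P).trace ≤ 2 * d := by
      have := mul_nonneg hε0.le h3
      nlinarith
    rw [modelRate, ← hQ] at h1
    linarith
  have hj : Tendsto (fun j : ℕ => ((j : ℝ) + 2)⁻¹) atTop (𝓝 0) :=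
    tendsto_inv_atTop_zero.comp (tendsto_atTop_add_const_right _ _ tendsto_natCast_atTop_atTop)
  have hlim : (Real.exp (2 * L + 2 * d) • P - Q).PosSemidef := by
    refine posSemidef_of_tendsto ?_ hmix
    have h1 := (((hj.const_sub 1).smul_const P).add (hj.smul_const G)).const_smul
      (Real.exp (2 * L + 2 * d))
    have h2 := ((hj.const_sub 1).smul_const Q).add (hj.smul_const (A * G * Aᵀ + B * Bᵀ))
    simpa using h1.sub h2
  refine posDef_of_ker hP fun v hv => eq_zero_of_posDef hG (stateCov_mulVec_eq_zero (P := P)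
    (fun v hv => mulVec_step_eq_zero hP ?_) T hv)
  have : Q *ᵥ v = 0 := mulVec_eq_zero_of_le hQp hlim (by rw [Matrix.smul_mulVec, hv, smul_zero])
  rw [this, dotProduct_zero]

lemma modelRate_self {P : Matrix (Fin d) (Fin d) ℝ} (hP : P.PosDef)
    (hP' : (A * P * Aᵀ + B * Bᵀ).PosDef) : modelRate A B P P
      = 1 / 2 * (Real.log (A * P * Aᵀ + B * Bᵀ).det - Real.log P.det) := by
  rw [modelRate, Matrix.nonsing_inv_mul _ hP.det_pos.ne'.isUnit,
    Matrix.nonsing_inv_mul _ hP'.det_pos.ne'.isUnit, sub_self, mul_zero, add_zero]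

variable {A' : Matrix (Fin p) (Fin p) ℝ} {B' : Matrix (Fin p) (Fin q) ℝ}
  {U : Matrix (Fin p) (Fin d) ℝ}

/-- Values near a lower limit are taken at arbitrarily large horizons, and there a nearly optimal
channel exists. The bound is in nats; `log 2 ≤ 1` absorbs the conversion of the slack. -/
lemma exists_klDiv_le {src : Measure (ℕ → Vec p)} {D : ℝ} (hR : nrdf src D ≠ ∞) {ε : ℝ}
    (hε : 0 < ε) (m : ℕ) : ∃ n ≥ m, ∃ κ : TestChannel p,
      κ.avgDistortion src n ≤ ENNReal.ofReal D ∧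
      InformationTheory.klDiv (κ.jointLaw src n)
        ((κ.jointLaw src n).fst.prod (κ.jointLaw src n).snd)
        ≤ ENNReal.ofReal ((n + 1) * ((nrdf src D).toReal * Real.log 2 + ε)) := by
  have hlt : liminf (fun n => finiteNRDF src n D) atTop
      < ENNReal.ofReal ((nrdf src D).toReal + ε) := by
    rw [ENNReal.ofReal_add ENNReal.toReal_nonneg hε.le, ENNReal.ofReal_toReal hR]
    exact ENNReal.lt_add_right hR (by simpa using hε)
  obtain ⟨n, h1, h2⟩ := ((frequently_lt_of_liminf_lt (by isBoundedDefault) hlt).and_eventually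
    (eventually_ge_atTop m)).exists
  simp only [finiteNRDF, iInf_lt_iff] at h1
  obtain ⟨κ, hκ, h1⟩ := h1
  have hl : 0 < Real.log 2 := Real.log_pos one_lt_two
  have hl1 : Real.log 2 ≤ 1 := by linarith [Real.log_two_lt_d9]
  refine ⟨n, h2, κ, hκ, ?_⟩
  have h3 := h1.le
  rw [ENNReal.div_le_iff (by simp) (by simp), TestChannel.mutualInfo,
    ENNReal.div_le_iff (by simpa using hl) ENNReal.ofReal_ne_top] at h3
  refine h3.trans ?_
  have h4 : ((n : ℝ≥0∞) + 1) = ENNReal.ofReal ((n : ℝ) + 1) := by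
    rw [ENNReal.ofReal_add (by positivity) zero_le_one]; simp
  have h5 : 0 ≤ (nrdf src D).toReal := ENNReal.toReal_nonneg
  rw [h4, ← ENNReal.ofReal_mul (by positivity), ← ENNReal.ofReal_mul (by positivity)]
  refine ENNReal.ofReal_le_ofReal ?_
  have h6 : ((n : ℝ) + 1) * (ε * Real.log 2) ≤ (n + 1) * (ε * 1) := by gcongr
  nlinarith [h6]

/-- An error covariance whose stationary rate does not exceed the nonanticipative rate distortion
function. -/
theorem exists_cov_rate_le (hU : Uᵀ * U = 1) (hA : A' * U = U * A) (hB : B' = U * B)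
    (hG : (stateCov A B T).PosDef) (S0 : Matrix (Fin p) (Fin p) ℝ) {D : ℝ} (hD : 0 < D) :
    ∃ P : Matrix (Fin d) (Fin d) ℝ, P.PosDef ∧ P.trace ≤ D ∧
      (A * P * Aᵀ + B * Bᵀ - P).PosSemidef ∧
      ENNReal.ofReal (1 / 2 * (Real.log (A * P * Aᵀ + B * Bᵀ).det - Real.log P.det) / Real.log 2)
        ≤ nrdf (sourceLaw A' B' S0) D := by
  by_cases hR : nrdf (sourceLaw A' B' S0) D = ∞
  -- If the rate distortion function is infinite, any admissible covariance will do: a small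
  -- multiple of the state covariance meets the trace constraint and stays below its own prior.
  · have htr : 0 ≤ (stateCov A B T).trace := hG.posSemidef.trace_nonneg
    set c := min 1 (D / (1 + (stateCov A B T).trace)) with hc
    have hc0 : 0 < c := lt_min one_pos (by positivity)
    have hc1 : c ≤ 1 := min_le_left _ _
    refine ⟨c • stateCov A B T, hG.smul hc0, ?_, ?_, by rw [hR]; exact le_top⟩
    · rw [Matrix.trace_smul, smul_eq_mul]
      have h1 : c ≤ D / (1 + (stateCov A B T).trace) := min_le_right _ _
      rw [le_div_iff₀ (by positivity)] at h1
      nlinarith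
    · have h1 := priorCov_mix (A := A) (B := B) 0 (stateCov A B T) c
      rw [smul_zero, zero_add] at h1
      have h2 : A * (c • stateCov A B T) * Aᵀ + B * Bᵀ - c • stateCov A B T
          = (1 - c) • (A * 0 * Aᵀ + B * Bᵀ) + c • (stateCov A B (T + 1) - stateCov A B T) := by
        rw [h1, smul_sub, stateCov, add_sub_assoc]
      rw [h2]
      exact ((posSemidef_priorCov Matrix.PosSemidef.zero).smul (by linarith)).add
        ((posSemidef_stateCov_succ_sub A B T).smul hc0.le)
  · set L := (nrdf (sourceLaw A' B' S0) D).toReal with hL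
    have hL0 : 0 ≤ L := ENNReal.toReal_nonneg
    have hl : 0 < Real.log 2 := Real.log_pos one_lt_two
    obtain ⟨P, hP, htr, hcov, hM⟩ := exists_limit_cov (A := A) (B := B)
        (C := TestChannel.reducedCov q S0 A B T) (D := D) (L := L * Real.log 2)
        -- The parameter `1/(j+1)` serves both as slack in the rate and as regularization of the
        -- filter, while the horizon exceeds `T + j`.
        (g := Real.log (stateCov A B T).det) (T := T) hD.le fun j => by
      have hε : 0 < ((j : ℝ) + 1)⁻¹ := by positivity
      obtain ⟨n, hn, κ, hκ, hkl⟩ := exists_klDiv_le hR hε (T + (j + 1))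
      obtain ⟨N, rfl⟩ := Nat.exists_eq_add_of_le ((Nat.le_add_right T (j + 1)).trans hn)
      obtain ⟨P, h1, h2, h3, h4⟩ := κ.exists_cov_klDiv S0 hU hA hB rfl (by omega) hG hD.le hκ hε
      refine ⟨N, P, by omega, h1, h2, h3, fun M hM1 hM2 => ?_⟩
      have h5 := (h4 M hM1 hM2).trans hkl
      rwa [ENNReal.ofReal_le_ofReal_iff (by positivity)] at h5
    have hPd := posDef_of_modelRate_le hG hP hcov hM
    have hPd' := posDef_priorCov hG hPd
    refine ⟨P, hPd, htr, hcov, ?_⟩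
    -- For the model `M = P` the trace terms cancel and only the determinant ratio remains.
    have h1 := hM P hPd hPd'
    rw [modelRate_self hPd hPd'] at h1
    rw [← ENNReal.ofReal_toReal hR]
    exact ENNReal.ofReal_le_ofReal (by rwa [div_le_iff₀ hl])

end OptimalCov

/-! ### Existence of an optimal realization -/

variable {p d q : ℕ} {A : Matrix (Fin p) (Fin p) ℝ} {B : Matrix (Fin p) (Fin q) ℝ}
  {A₁ : Matrix (Fin d) (Fin d) ℝ} {B₁ : Matrix (Fin d) (Fin q) ℝ}

/-- On the part reached by the noise, `E` whitens the posterior and diagonalizes the prior, so `δ =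
1` and `λ ≥ 1`. On the complement both covariances are zero, so `δ = λ = 0` and these coordinates
contribute nothing to the rate. -/
lemma exists_realization_of_cov {m : Type} [Fintype m] [DecidableEq m] (e : Fin d ⊕ m ≃ Fin p)
    {V : Matrix (Fin p) (Fin d ⊕ m) ℝ} (hV : Vᵀ * V = 1) (hA : A * V.toCols₁ = V.toCols₁ * A₁)
    (hB : B = V.toCols₁ * B₁) {P : Matrix (Fin d) (Fin d) ℝ} (hP : P.PosDef) {D : ℝ}
    (htr : P.trace ≤ D) (hcov : (A₁ * P * A₁ᵀ + B₁ * B₁ᵀ - P).PosSemidef) :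
    ∃ R : Realization A B D, R.rate
      = 1 / 2 * (Real.log (A₁ * P * A₁ᵀ + B₁ * B₁ᵀ).det - Real.log P.det) / Real.log 2 := by
  set Q := A₁ * P * A₁ᵀ + B₁ * B₁ᵀ with hQ
  obtain ⟨E₁, z, hE, hEP, hEQ⟩ := exists_simultaneous_diagonal hP
    (transpose_eq_of_posSemidef (posSemidef_priorCov hP.posSemidef : Q.PosSemidef))
  have hz : ∀ i, 1 ≤ z i := fun i => by
    have h1 := posSemidef_conj hcov E₁
    rw [Matrix.mul_sub, Matrix.sub_mul, hEP, hEQ, ← Matrix.diagonal_one, Matrix.diagonal_sub,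
      Matrix.posSemidef_diagonal_iff] at h1
    linarith [h1 i]
  set U := V.toCols₁ with hU
  have hVU : Vᵀ * U = fromRows 1 0 := by
    ext i j
    have := congrFun (congrFun hV i) (Sum.inl j)
    rcases i with i | i <;> simpa [Matrix.mul_apply, Matrix.one_apply, hU] using this
  have hUU : Uᵀ * U = 1 := by
    ext i j
    have := congrFun (congrFun hVU (Sum.inl i)) j
    simpa [Matrix.mul_apply, hU] using this
  -- Rotate into the adapted basis, then apply `E₁` to its first block; the identity on the second
  -- block only keeps the matrix invertible.
  set F : Matrix (Fin d ⊕ m) (Fin p) ℝ := fromBlocks E₁ 0 0 (1 : Matrix m m ℝ) * Vᵀ with hF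
  have hFU : F * U = fromRows E₁ 0 := by
    rw [hF, Matrix.mul_assoc, hVU, ← Matrix.fromCols_fromRows_eq_fromBlocks E₁ 0 0 (1 : Matrix m m ℝ),
      Matrix.fromCols_mul_fromRows]
    ext i j
    rcases i with i | i <;> simp
  have hconj : ∀ X : Matrix (Fin d) (Fin d) ℝ,
      F * (U * X * Uᵀ) * Fᵀ = fromBlocks (E₁ * X * E₁ᵀ) 0 0 0 := fun X => by
    rw [show F * (U * X * Uᵀ) * Fᵀ = (F * U) * X * (F * U)ᵀ by
      rw [Matrix.transpose_mul F U]; simp only [Matrix.mul_assoc], hFU, Matrix.fromRows_mul,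
      Matrix.transpose_fromRows, Matrix.fromRows_mul_fromCols]
    simp
  have hdiag : ∀ (X : Matrix (Fin d) (Fin d) ℝ) (y : Vec d), E₁ * X * E₁ᵀ = diagonal y →
      F.submatrix e.symm id * (U * X * Uᵀ) * (F.submatrix e.symm id)ᵀ
        = diagonal fun i => Sum.elim y (fun _ : m => (0 : ℝ)) (e.symm i) := fun X y h => by
    have h1 : F.submatrix e.symm id * (U * X * Uᵀ) * (F.submatrix e.symm id)ᵀ
        = (F * (U * X * Uᵀ) * Fᵀ).submatrix e.symm e.symm := by
      ext i j; simp [Matrix.mul_apply]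
    rw [h1, hconj, h, ← Matrix.diagonal_zero, Matrix.fromBlocks_diagonal,
      Matrix.submatrix_diagonal_equiv]
    rfl
  have hprior : A * (U * P * Uᵀ) * Aᵀ + B * Bᵀ = U * Q * Uᵀ := by
    have hA' : Uᵀ * Aᵀ = A₁ᵀ * Uᵀ := by rw [← Matrix.transpose_mul, hA, Matrix.transpose_mul]
    have hB' : Bᵀ = B₁ᵀ * Uᵀ := by rw [← Matrix.transpose_mul, ← hB]
    rw [show A * (U * P * Uᵀ) * Aᵀ = (A * U) * P * (Uᵀ * Aᵀ) by simp only [Matrix.mul_assoc], hA,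
      hA', hB']
    conv_lhs => rw [hB]
    simp only [hQ, Matrix.mul_add, Matrix.add_mul, Matrix.mul_assoc]
  have hdet : IsUnit (F.submatrix e.symm id).det := by
    have h1 : F * (V * fromBlocks E₁⁻¹ 0 0 (1 : Matrix m m ℝ)) = 1 := by
      rw [hF, Matrix.mul_assoc, ← Matrix.mul_assoc Vᵀ, hV, Matrix.one_mul,
        Matrix.fromBlocks_multiply]
      simp [Matrix.mul_nonsing_inv _ hE]
    refine Matrix.isUnit_det_of_right_inverse
      (B := (V * fromBlocks E₁⁻¹ 0 0 (1 : Matrix m m ℝ)).submatrix id e.symm) ?_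
    rw [← Matrix.submatrix_mul _ _ _ id _ Function.bijective_id, h1, Matrix.submatrix_one_equiv]
  let R : Realization A B D :=
    { post := U * P * Uᵀ
      E := F.submatrix e.symm id
      δ := fun i => Sum.elim (fun _ => 1) (fun _ : m => (0 : ℝ)) (e.symm i)
      lam := fun i => Sum.elim z (fun _ : m => (0 : ℝ)) (e.symm i)
      isUnit_E := hdet
      post_eq := hdiag P _ (by rw [hEP, Matrix.diagonal_one])
      prior_eq := by rw [hprior]; exact hdiag Q z hEQ
      δ_nonneg := fun i => by rcases e.symm i with k | k <;> simp
      δ_le_lam := fun i => by rcases e.symm i with k | k <;> simp [hz]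
      lam_eq_zero := fun i => by rcases e.symm i with k | k <;> simp
      trace_le := by
        rwa [Matrix.trace_mul_comm, ← Matrix.mul_assoc, hUU, Matrix.one_mul] }
  refine ⟨R, ?_⟩
  have h1 : R.rate = ∑ i, 1 / 2 * Real.logb 2 (Sum.elim z (fun _ : m => (0 : ℝ)) i
      / Sum.elim (fun _ => 1) (fun _ : m => (0 : ℝ)) i) :=
    Equiv.sum_comp e.symm fun i => 1 / 2 * Real.logb 2 (Sum.elim z (fun _ : m => (0 : ℝ)) i
      / Sum.elim (fun _ => 1) (fun _ : m => (0 : ℝ)) i)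
  rw [h1, log_det_sub_log_det hP hE hEP hEQ fun i => by linarith [hz i], Fintype.sum_sum_type]
  simp [Real.logb, Finset.mul_sum, Finset.sum_div, mul_div_assoc]

theorem exists_isOptimal (A : Matrix (Fin p) (Fin p) ℝ) (B : Matrix (Fin p) (Fin q) ℝ)
    (S0 : Matrix (Fin p) (Fin p) ℝ) {D : ℝ} (hD : 0 < D) :
    ∃ R : Realization A B D, R.IsOptimal S0 := by
  obtain ⟨d, m, _, _, e, V, A₁, B₁, T, hV, -, hA, hB, hG⟩ := exists_controllable_part A B
  have hUU : V.toCols₁ᵀ * V.toCols₁ = 1 := by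
    ext i j
    have := congrFun (congrFun hV (Sum.inl i)) (Sum.inl j)
    simpa [Matrix.mul_apply, Matrix.one_apply] using this
  obtain ⟨P, hP, htr, hcov, hrate⟩ := exists_cov_rate_le hUU hA hB hG S0 hD
  obtain ⟨R, hR⟩ := exists_realization_of_cov e hV hA hB hP htr hcov
  exact ⟨R, by rw [Realization.IsOptimal, hR]; exact hrate⟩

end ZeroDelay

end

/-- Upper bound on the zero-delay rate of a Gaussian AR(1) source, and its achievability by
subtractively dithered scalar quantization of the innovations. -/
theorem theorem1 {p q : ℕ} (A : Matrix (Fin p) (Fin p) ℝ) (B : Matrix (Fin p) (Fin q) ℝ)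
    (S0 : Matrix (Fin p) (Fin p) ℝ) (hS0 : S0.PosSemidef)
    (hAB : ZeroDelay.IsStable A ∨ ZeroDelay.IsStabilizable A B) (D : ℝ) (hD : 0 < D) :
    -- the operational bound
    ZeroDelay.opta (ZeroDelay.sourceLaw A B S0) D ≤
        ZeroDelay.nrdf (ZeroDelay.sourceLaw A B S0) D +
          ENNReal.ofReal ((p : ℝ) / 2 * Real.logb 2 (Real.pi * Real.exp 1 / 6) + 1) ∧
    -- there is a feedback realization of an optimal test channel
    (∃ R : ZeroDelay.Realization A B D, R.IsOptimal S0) ∧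
    -- with dithered quantizers in place of the channels, each of them meets the distortion
    -- and, with memoryless Shannon coding conditioned on the dither, the rate
    ∀ R : ZeroDelay.Realization A B D, R.IsOptimal S0 →
      ∀ Δ : ZeroDelay.Vec p, (∀ i, 0 < Δ i) →
        ZeroDelay.limsupAvg (R.expDistortion S0 Δ) ≤ ENNReal.ofReal D ∧
        ∃ code : ℕ → ZeroDelay.Vec p → (Fin p → ℤ) → ZeroDelay.Word,
          (∀ t, ZeroDelay.IsShannonCode (R.outputGivenDither S0 Δ t) (code t)) ∧
          ZeroDelay.limsupAvg (fun t => R.expLength S0 Δ t (code t)) ≤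
            ZeroDelay.nrdf (ZeroDelay.sourceLaw A B S0) D +
              ENNReal.ofReal ((p : ℝ) / 2 * Real.logb 2 (Real.pi * Real.exp 1 / 6) + 1) := by
  have hAB' : ZeroDelay.IsStabilizable A B := hAB.elim (fun h => h.isStabilizable) id
  have hle : ∀ R : ZeroDelay.Realization A B D, R.IsOptimal S0 →
      ENNReal.ofReal (R.rate + ((p : ℝ) / 2 * Real.logb 2 (Real.pi * Real.exp 1 / 6) + 1))
        ≤ ZeroDelay.nrdf (ZeroDelay.sourceLaw A B S0) D +
          ENNReal.ofReal ((p : ℝ) / 2 * Real.logb 2 (Real.pi * Real.exp 1 / 6) + 1) :=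
    fun R hR => ENNReal.ofReal_add_le.trans (add_le_add_left hR _)
  obtain ⟨R₀, hR₀⟩ := ZeroDelay.exists_isOptimal A B S0 hD
  refine ⟨(R₀.opta_le hAB' S0).trans (hle R₀ hR₀), ⟨R₀, hR₀⟩, fun R hR Δ hΔ =>
    ⟨R.limsupAvg_expDistortion_le hAB' hΔ S0, ?_⟩⟩
  obtain ⟨code, h1, h2⟩ := R.exists_shannonCode_limsupAvg_le hAB' hΔ S0
  exact ⟨code, h1, h2.trans (hle R hR)⟩
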